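/- Let $X$ be a complex manifold of dimension $n=\ell+1$ with a Kähler metric $g_{i\bar j}$, and let $W$ be a holomorphic function on $X$. In local holomorphic coordinates put $\Gamma^i_{jk}=g^{i\bar m}\partial_jg_{k\bar m}$, $R_{i\bar jk\bar l}=g_{m\bar j}\partial_{\bar l}\Gamma^m_{ik}$, $R^i{}_{jk\bar l}=g^{i\bar m}R_{\bar mjk\bar l}$ with $R_{\bar mjk\bar l}=-R_{j\bar mk\bar l}$, and $\Gamma^{\bar i}_{\bar j\bar k}=\overline{\Gamma^i_{jk}}$. Let $D=\{|z|\le1\}$, $z=x^1+\imath x^2$, with the flat metric and area measure $d^2z\sqrt h$, let $v_0=\partial_\sigma$ be the generator of the rotations of $D$, let $*dz=\imath\,dz$, $*d\bar z=-\imath\,d\bar z$, and let $\hbar\in\mathbb C\setminus\{0\}$. The fields on $D$ take values in a finite-dimensional complex Grassmann algebra $\Lambda$ (an arbitrary $\mathbb Z/2$-graded, graded commutative algebra with nilpotent augmentation ideal): an even map $\Phi=(\phi^i,\bar\phi^{\bar i})$ to $X$ (with an ordinary map $D\to X$ as its body), odd sections $\bar\eta,\theta$ of $\Phi^*T^{0,1}X$,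 an odd one-form $\rho$ with values in $\Phi^*T^{1,0}X$, an even two-form $G$ with values in $\Phi^*T^{1,0}X$ and an even section $\bar G$ of $\Phi^*T^{0,1}X$, all smooth on the closed disk. Functions of $(\phi,\bar\phi)$ are understood by Taylor expansion around the body. Signs follow the total parity (form degree plus Grassmann parity), so that $d$, $\iota_{v_0}$ and $\delta_{S^1}$ are odd and anticommute with odd constants of $\Lambda$. The $S^1$-equivariant BRST differential is $$\delta_{S^1}\phi^i=\hbar\iota_{v_0}\rho^i,\qquad \delta_{S^1}\bar\phi^{\bar i}=\bar\eta^{\bar i},\qquad \delta_{S^1}\bar\eta^{\bar i}=\hbar\iota_{v_0}d\bar\phi^{\bar i},\qquad \delta_{S^1}\theta^{\bar i}=\bar G^{\bar i}-\Gamma^{\bar i}_{\bar j\bar k}\bar\eta^{\bar j}\theta^{\bar k},$$ $$\delta_{S^1}\bar G^{\bar i}=-\Gamma^{\bar i}_{\bar j\bar k}\bar\eta^{\bar j}\bar G^{\bar k}+\hbar\iota_{v_0}(D\theta^{\bar i})+\hbar\,\partial_l\Gamma^{\bar i}_{\bar j\bar k}(\iota_{v_0}\rho^l)\bar\eta^{\bar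 j}\theta^{\bar k},\qquad \delta_{S^1}\rho^i=-d\phi^i-\hbar\iota_{v_0}G^i-\hbar\Gamma^i_{jk}(\iota_{v_0}\rho^j)\rho^k,$$ $$\delta_{S^1}G^i=d\rho^i+\Gamma^i_{jk}d\phi^j\wedge\rho^k+\tfrac12R^i{}_{jk\bar l}\bar\eta^{\bar l}\rho^j\wedge\rho^k+\hbar\Gamma^i_{jk}(\iota_{v_0}G^j)\wedge\rho^k,$$ where $D\rho^i=d\rho^i+\Gamma^i_{jk}d\phi^j\wedge\rho^k$, $D\bar\eta^{\bar i}=d\bar\eta^{\bar i}+\Gamma^{\bar i}_{\bar j\bar k}d\bar\phi^{\bar j}\bar\eta^{\bar k}$ and $D\theta^{\bar i}=d\theta^{\bar i}+\Gamma^{\bar i}_{\bar j\bar k}d\bar\phi^{\bar j}\theta^{\bar k}$. For an odd parameter $\varepsilon\in\Lambda$ and a functional $\mathcal F$ of the fields $\Psi$, the variation $\delta_{S^1}\mathcal F$ is defined by $\mathcal F[\Psi+\varepsilon\,\delta_{S^1}\Psi]=\mathcal F[\Psi]+\varepsilon\,\delta_{S^1}\mathcal F[\Psi]$. Let $$S_D=\int_D\Bigl(g_{i\bar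 j}(d\phi^i+\hbar\iota_{v_0}G^i)\wedge*d\bar\phi^{\bar j}+g_{i\bar j}\rho^i\wedge*D\bar\eta^{\bar j}-g_{i\bar j}\theta^{\bar j}D\rho^i+g_{i\bar j}G^i\bar G^{\bar j}-\tfrac12R_{i\bar lk\bar j}\bar\eta^{\bar l}\theta^{\bar j}\rho^i\wedge\rho^k\Bigr)$$ $$+\int_Dd^2z\sqrt h\,\bigl(D_{\bar i}\partial_{\bar j}\bar W(\bar\phi)\,\bar\eta^{\bar i}\theta^{\bar j}+\partial_{\bar i}\bar W(\bar\phi)\,\bar G^{\bar i}\bigr)+\int_D\bigl(-\tfrac12D_i\partial_jW(\phi)\,\rho^i\wedge\rho^j+\partial_iW(\phi)\,G^i\bigr),$$ where $D_i\partial_jW=\partial_i\partial_jW-\Gamma^k_{ij}\partial_kW$ and $D_{\bar i}\partial_{\bar j}\bar W$ is its complex conjugate, and put $$S=S_D-\frac1\hbar\int_{\partial D}d\sigma\,W(\phi).$$ Then $\delta_{S^1}^2=\hbar\mathcal L_{v_0}$ on all fields, where $\mathcal L_{v_0}=d\,\iota_{v_0}+\iota_{v_0}d$; $$\delta_{S^1}S_D=\int_{\partial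 D}\rho^i\partial_iW(\phi),\qquad \delta_{S^1}\Bigl(-\frac1\hbar\int_{\partial D}d\sigma\,W(\phi)\Bigr)=-\int_{\partial D}\rho^i\partial_iW(\phi);$$ and $\delta_{S^1}S=0$, i.e. $S[\Psi+\varepsilon\,\delta_{S^1}\Psi]=S[\Psi]$, without any boundary condition on the fields. -/

import Mathlib

open scoped ContDiff Manifold

noncomputable section

namespace TypeBModel

/-! ### Grassmann algebras -/

/-- A complex (normed) Grassmann algebra: a `ℤ/2`-graded, graded commutative complex algebra whose
augmentation ideal (the "soul") is nilpotent.  The grading is recorded by the parity automorphism: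
an element is even if `parity` fixes it and odd if `parity` negates it.  `body` is the augmentation,
and `order` bounds the length of nonvanishing products of elements without body. -/
class GrassmannAlgebra (Λ : Type*) [NormedRing Λ] [NormedAlgebra ℂ Λ] where
  parity : Λ →ₐ[ℂ] Λ
  parity_parity : ∀ a, parity (parity a) = a
  even_comm : ∀ a b, parity a = a → a * b = b * a
  odd_anticomm : ∀ a b, parity a = -a → parity b = -b → a * b = -(b * a)
  body : Λ →ₐ[ℂ] ℂ
  order : ℕ
  nilpotent : ∀ l : List Λ, (∀ a ∈ l, body a = 0) → order ≤ l.length → l.prod = 0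

/-- Even elements. -/
def IsEven {Λ : Type*} [NormedRing Λ] [NormedAlgebra ℂ Λ] [GrassmannAlgebra Λ] (a : Λ) : Prop :=
  GrassmannAlgebra.parity a = a

/-- Odd elements. -/
def IsOdd {Λ : Type*} [NormedRing Λ] [NormedAlgebra ℂ Λ] [GrassmannAlgebra Λ] (a : Λ) : Prop :=
  GrassmannAlgebra.parity a = -a

/-! ### Differential forms on the plane with Grassmann coefficients, at a point -/

/-- The quadruple `(a, b, c, e)` stands for `a + dx¹ b + dx² c + dx¹ dx² e`. -/
def SForm (Λ : Type*) : Type _ := Λ × Λ × Λ × Λ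

namespace SForm

variable {Λ : Type*} [NormedRing Λ] [NormedAlgebra ℂ Λ]

instance : NormedAddCommGroup (SForm Λ) := inferInstanceAs (NormedAddCommGroup (Λ × Λ × Λ × Λ))

instance : NormedSpace ℂ (SForm Λ) := inferInstanceAs (NormedSpace ℂ (Λ × Λ × Λ × Λ))

/-- The form `a + dx¹ b + dx² c + dx¹ dx² e`. -/
def mk (a b c e : Λ) : SForm Λ := (a, b, c, e)

/-- The component of degree zero. -/
def c0 (w : SForm Λ) : Λ := w.1

/-- The coefficient of `dx¹`. -/
def c1 (w : SForm Λ) : Λ := w.2.1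

/-- The coefficient of `dx²`. -/
def c2 (w : SForm Λ) : Λ := w.2.2.1

/-- The coefficient of `dx¹ dx²`. -/
def c12 (w : SForm Λ) : Λ := w.2.2.2

/-- Elements of `Λ` as forms of degree zero. -/
def of (a : Λ) : SForm Λ := mk a 0 0 0

/-- Complex numbers as forms of degree zero. -/
def const (z : ℂ) : SForm Λ := of (algebraMap ℂ Λ z)

/-- The wedge product, with the sign rule for the total parity (form degree plus Grassmann parity):
`dx¹`, `dx²` anticommute with each other and with the odd elements of `Λ`, that is
`a dxⁱ = dxⁱ (parity a)`. -/
instance [GrassmannAlgebra Λ] : Mul (SForm Λ) where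
  mul v w := mk
    (v.c0 * w.c0)
    (GrassmannAlgebra.parity v.c0 * w.c1 + v.c1 * w.c0)
    (GrassmannAlgebra.parity v.c0 * w.c2 + v.c2 * w.c0)
    (v.c0 * w.c12 + GrassmannAlgebra.parity v.c1 * w.c2 - GrassmannAlgebra.parity v.c2 * w.c1
      + v.c12 * w.c0)

/-- The one-form `dx¹`. -/
def dx1 : SForm Λ := mk 0 1 0 0

/-- The one-form `dx²`. -/
def dx2 : SForm Λ := mk 0 0 1 0

/-- The Hodge operator on one-forms, in the normalization `*dz = i dz`, `*dz̄ = -i dz̄`,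
i.e. `*dx¹ = -dx²`, `*dx² = dx¹`. -/
def star (w : SForm Λ) : SForm Λ := mk 0 w.c2 (-w.c1) 0

/-- Contraction with the vector field `v₀ = ∂/∂σ = -x² ∂₁ + x¹ ∂₂` generating the rotations,
at the point `p = x¹ + i x²`. -/
def iota (p : ℂ) (w : SForm Λ) : SForm Λ :=
  mk ((-p.im : ℂ) • w.c1 + (p.re : ℂ) • w.c2) (-((p.re : ℂ) • w.c12)) ((-p.im : ℂ) • w.c12) 0

variable [GrassmannAlgebra Λ]

/-- Even functions (at a point). -/
def IsEvenFn (w : SForm Λ) : Prop := IsEven w.c0 ∧ w.c1 = 0 ∧ w.c2 = 0 ∧ w.c12 = 0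

/-- Odd functions (at a point). -/
def IsOddFn (w : SForm Λ) : Prop := IsOdd w.c0 ∧ w.c1 = 0 ∧ w.c2 = 0 ∧ w.c12 = 0

/-- One-forms with odd coefficients. -/
def IsOddOneForm (w : SForm Λ) : Prop := w.c0 = 0 ∧ IsOdd w.c1 ∧ IsOdd w.c2 ∧ w.c12 = 0

/-- Two-forms with even coefficients. -/
def IsEvenTwoForm (w : SForm Λ) : Prop := w.c0 = 0 ∧ w.c1 = 0 ∧ w.c2 = 0 ∧ IsEven w.c12

end SForm

/-! ### Calculus on the disk -/

/-- The closed unit disk. -/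
def disk : Set ℂ := Metric.closedBall 0 1

section Disk

variable {Λ : Type*} [NormedRing Λ] [NormedAlgebra ℂ Λ] [GrassmannAlgebra Λ]

/-- The de Rham differential `d = dx¹ ∂₁ + dx² ∂₂` on the closed disk. -/
def deRham (f : ℂ → SForm Λ) (p : ℂ) : SForm Λ :=
  SForm.dx1 * fderivWithin ℝ f disk p 1 + SForm.dx2 * fderivWithin ℝ f disk p Complex.I

/-- The Lie derivative `L = d ι + ι d` along the rotation field `v₀`. -/
def lie (f : ℂ → SForm Λ) (p : ℂ) : SForm Λ :=
  deRham (fun q => SForm.iota q (f q)) p + SForm.iota p (deRham f p)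

end Disk

/-! ### Wirtinger calculus on `ℂⁿ` and functions of Grassmann-valued coordinates -/

section Wirtinger

variable {n : ℕ} {V : Type*} [NormedAddCommGroup V] [NormedSpace ℂ V]

/-- `∂f/∂uⁱ`. -/
def wd (i : Fin n) (f : (Fin n → ℂ) → V) (u : Fin n → ℂ) : V :=
  (1 / 2 : ℂ) • (fderiv ℝ f u (Pi.single i 1) - Complex.I • fderiv ℝ f u (Pi.single i Complex.I))

/-- `∂f/∂ūⁱ`. -/
def wdb (i : Fin n) (f : (Fin n → ℂ) → V) (u : Fin n → ℂ) : V :=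
  (1 / 2 : ℂ) • (fderiv ℝ f u (Pi.single i 1) + Complex.I • fderiv ℝ f u (Pi.single i Complex.I))

variable {Λ : Type*} [NormedRing Λ] [NormedAlgebra ℂ Λ] [GrassmannAlgebra Λ]

/-- The operator `∑ᵢ (sⁱ ∂/∂uⁱ + s̄ⁱ ∂/∂ūⁱ)`. -/
def soulDeriv (s sb : Fin n → SForm Λ) (f : (Fin n → ℂ) → SForm Λ) (u : Fin n → ℂ) : SForm Λ :=
  ∑ i, (s i * wd i f u + sb i * wdb i f u)

/-- The value `f(φ, φ̄)` of a smooth function `f` on `ℂⁿ` at Grassmann-valued coordinates,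
by Taylor expansion around the body of `φ`:
`f(u + s, ū + s̄) = ∑ₖ (1/k!) (s ∂ + s̄ ∂̄)ᵏ f (u)`; the series is finite since `s`, `s̄` are
nilpotent. -/
def eval (f : (Fin n → ℂ) → ℂ) (φ φb : Fin n → SForm Λ) : SForm Λ :=
  let u : Fin n → ℂ := fun i => GrassmannAlgebra.body (φ i).c0
  let s : Fin n → SForm Λ := fun i => φ i - SForm.const (u i)
  let sb : Fin n → SForm Λ := fun i => φb i - SForm.const (starRingEnd ℂ (u i))
  ∑ k ∈ Finset.range (GrassmannAlgebra.order Λ),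
    ((k.factorial : ℂ)⁻¹) • ((soulDeriv s sb)^[k] (fun x => SForm.const (f x))) u

end Wirtinger

/-! ### Kähler metrics -/

/-- Local holomorphic coordinates on `X`. -/
abbrev Coord (n : ℕ) (X : Type*) [TopologicalSpace X] := OpenPartialHomeomorph X (Fin n → ℂ)

section Hermitian

variable {n : ℕ} {X : Type*} [TopologicalSpace X] [ChartedSpace (Fin n → ℂ) X]

/-- The components `g_{i j̄}`, in the coordinates `e`, of a field of sesquilinear forms on the
holomorphic tangent spaces of `X`. -/
def metricCoeff
    (h : ∀ x : X, TangentSpace 𝓘(ℂ, Fin n → ℂ) x →ₗ[ℂ] TangentSpace 𝓘(ℂ, Fin n → ℂ) x →ₗ⋆[ℂ] ℂ)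
    (e : Coord n X) (i j : Fin n) (u : Fin n → ℂ) : ℂ :=
  h (e.symm u)
    (mfderiv 𝓘(ℂ, Fin n → ℂ) 𝓘(ℂ, Fin n → ℂ) e.symm u
      (Pi.single i 1 : Fin n → ℂ))
    (mfderiv 𝓘(ℂ, Fin n → ℂ) 𝓘(ℂ, Fin n → ℂ) e.symm u
      (Pi.single j 1 : Fin n → ℂ))

end Hermitian

/-- Kähler metrics on the complex manifold `X`: smooth positive definite Hermitian metrics with
`∂_k g_{i j̄} = ∂_i g_{k j̄}`, i.e. with closed fundamental two-form. -/
structure KahlerMetric (n : ℕ) (X : Type*) [TopologicalSpace X] [ChartedSpace (Fin n → ℂ) X] where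
  herm : ∀ x : X, TangentSpace 𝓘(ℂ, Fin n → ℂ) x →ₗ[ℂ] TangentSpace 𝓘(ℂ, Fin n → ℂ) x →ₗ⋆[ℂ] ℂ
  symm : ∀ x v w, herm x v w = starRingEnd ℂ (herm x w v)
  pos : ∀ x v, v ≠ 0 → 0 < (herm x v v).re
  smooth : ∀ e ∈ atlas (Fin n → ℂ) X, ∀ i j,
    ContDiffOn ℝ ∞ (metricCoeff herm e i j) e.target
  closed : ∀ e ∈ atlas (Fin n → ℂ) X, ∀ i j k, ∀ u ∈ e.target,
    wd k (metricCoeff herm e i j) u = wd i (metricCoeff herm e k j) u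

namespace KahlerMetric

variable {n : ℕ} {X : Type*} [TopologicalSpace X] [ChartedSpace (Fin n → ℂ) X]

/-- `g_{i j̄}`. -/
def coeff (g : KahlerMetric n X) (e : Coord n X) (i j : Fin n) : (Fin n → ℂ) → ℂ :=
  metricCoeff g.herm e i j

/-- `g^{i j̄}`, defined by `∑ₘ g^{i m̄} g_{k m̄} = δⁱ_k`. -/
def invCoeff (g : KahlerMetric n X) (e : Coord n X) (i j : Fin n) (u : Fin n → ℂ) : ℂ :=
  ((Matrix.of fun k m => g.coeff e k m u)⁻¹ : Matrix (Fin n) (Fin n) ℂ) j i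

/-- `Γⁱ_{jk} = g^{i m̄} ∂_j g_{k m̄}`. -/
def christoffel (g : KahlerMetric n X) (e : Coord n X) (i j k : Fin n) (u : Fin n → ℂ) : ℂ :=
  ∑ m, g.invCoeff e i m u * wd j (g.coeff e k m) u

/-- `Γ^{ī}_{j̄ k̄}`, the complex conjugate of `Γⁱ_{jk}`. -/
def christoffelBar (g : KahlerMetric n X) (e : Coord n X) (i j k : Fin n) (u : Fin n → ℂ) : ℂ :=
  starRingEnd ℂ (g.christoffel e i j k u)

/-- `R_{i j̄ k l̄} = g_{m j̄} ∂_{l̄} Γᵐ_{ik}`. -/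
def curv (g : KahlerMetric n X) (e : Coord n X) (i j k l : Fin n) (u : Fin n → ℂ) : ℂ :=
  ∑ m, g.coeff e m j u * wdb l (g.christoffel e m i k) u

/-- `Rⁱ_{j k l̄} = g^{i m̄} R_{m̄ j k l̄}`, where `R_{m̄ j k l̄} = -R_{j m̄ k l̄}`. -/
def curvUp (g : KahlerMetric n X) (e : Coord n X) (i j k l : Fin n) (u : Fin n → ℂ) : ℂ :=
  ∑ m, g.invCoeff e i m u * -g.curv e j m k l u

end KahlerMetric

/-! ### Fields -/

/-- The components of the fields in one coordinate system of the target; `φb`, `Gb` stand for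
`φ̄`, `Ḡ`, and `η` for `η̄`. -/
structure LocalFields (n : ℕ) (Λ : Type*) where
  φ : ℂ → Fin n → SForm Λ
  φb : ℂ → Fin n → SForm Λ
  η : ℂ → Fin n → SForm Λ
  θ : ℂ → Fin n → SForm Λ
  ρ : ℂ → Fin n → SForm Λ
  G : ℂ → Fin n → SForm Λ
  Gb : ℂ → Fin n → SForm Λ

section Fields

variable {n : ℕ} {X : Type*} [TopologicalSpace X]
  {Λ : Type*} [NormedRing Λ] [NormedAlgebra ℂ Λ] [GrassmannAlgebra Λ]

/-- `f(φ(p), φ̄(p))`. -/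
def LocalFields.at (F : LocalFields n Λ) (f : (Fin n → ℂ) → ℂ) (p : ℂ) : SForm Λ :=
  eval f (F.φ p) (F.φb p)

/-- The fields `F + ε F'`. -/
def LocalFields.shift (ε : Λ) (F F' : LocalFields n Λ) : LocalFields n Λ where
  φ p i := F.φ p i + SForm.of ε * F'.φ p i
  φb p i := F.φb p i + SForm.of ε * F'.φb p i
  η p i := F.η p i + SForm.of ε * F'.η p i
  θ p i := F.θ p i + SForm.of ε * F'.θ p i
  ρ p i := F.ρ p i + SForm.of ε * F'.ρ p i
  G p i := F.G p i + SForm.of ε * F'.G p i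
  Gb p i := F.Gb p i + SForm.of ε * F'.Gb p i

/-- All fields are replaced by `c` times their Lie derivatives along `v₀`. -/
def LocalFields.lie (c : ℂ) (F : LocalFields n Λ) : LocalFields n Λ where
  φ p i := c • TypeBModel.lie (fun q => F.φ q i) p
  φb p i := c • TypeBModel.lie (fun q => F.φb q i) p
  η p i := c • TypeBModel.lie (fun q => F.η q i) p
  θ p i := c • TypeBModel.lie (fun q => F.θ q i) p
  ρ p i := c • TypeBModel.lie (fun q => F.ρ q i) p
  G p i := c • TypeBModel.lie (fun q => F.G q i) p
  Gb p i := c • TypeBModel.lie (fun q => F.Gb q i) p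

/-- The values of two systems of local fields at the point `p` agree. -/
def LocalFields.AgreeAt (F F' : LocalFields n Λ) (p : ℂ) : Prop :=
  F.φ p = F'.φ p ∧ F.φb p = F'.φb p ∧ F.η p = F'.η p ∧ F.θ p = F'.θ p ∧
    F.ρ p = F'.ρ p ∧ F.G p = F'.G p ∧ F.Gb p = F'.Gb p

/-- The part of the disk that `Φ` maps to the domain of the coordinates `e`. -/
def chartDomain (Φ : ℂ → X) (e : Coord n X) : Set ℂ := {p | p ∈ disk ∧ Φ p ∈ e.source}

/-- The fields in the coordinates `e` are smooth on the part of the disk where they are defined,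
and have there the required form degree and parity; the body of `φ` is the coordinate expression of
the underlying map `Φ`, and the body of `φ̄` is its complex conjugate. -/
structure IsLocalField (Φ : ℂ → X) (e : Coord n X) (F : LocalFields n Λ) : Prop where
  smooth_φ : ContDiffOn ℝ ∞ F.φ (chartDomain Φ e)
  smooth_φb : ContDiffOn ℝ ∞ F.φb (chartDomain Φ e)
  smooth_η : ContDiffOn ℝ ∞ F.η (chartDomain Φ e)
  smooth_θ : ContDiffOn ℝ ∞ F.θ (chartDomain Φ e)
  smooth_ρ : ContDiffOn ℝ ∞ F.ρ (chartDomain Φ e)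
  smooth_G : ContDiffOn ℝ ∞ F.G (chartDomain Φ e)
  smooth_Gb : ContDiffOn ℝ ∞ F.Gb (chartDomain Φ e)
  type_φ : ∀ p ∈ chartDomain Φ e, ∀ i, (F.φ p i).IsEvenFn
  type_φb : ∀ p ∈ chartDomain Φ e, ∀ i, (F.φb p i).IsEvenFn
  type_η : ∀ p ∈ chartDomain Φ e, ∀ i, (F.η p i).IsOddFn
  type_θ : ∀ p ∈ chartDomain Φ e, ∀ i, (F.θ p i).IsOddFn
  type_ρ : ∀ p ∈ chartDomain Φ e, ∀ i, (F.ρ p i).IsOddOneForm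
  type_G : ∀ p ∈ chartDomain Φ e, ∀ i, (F.G p i).IsEvenTwoForm
  type_Gb : ∀ p ∈ chartDomain Φ e, ∀ i, (F.Gb p i).IsEvenFn
  body_φ : ∀ p ∈ chartDomain Φ e, ∀ i, GrassmannAlgebra.body (F.φ p i).c0 = e (Φ p) i
  body_φb : ∀ p ∈ chartDomain Φ e, ∀ i,
    GrassmannAlgebra.body (F.φb p i).c0 = starRingEnd ℂ (e (Φ p) i)

/-- The components of the change of coordinates from `e` to `e'`. -/
def transition (e e' : Coord n X) (i : Fin n) (u : Fin n → ℂ) : ℂ := e' (e.symm u) i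

/-- The complex conjugates of the components of the change of coordinates from `e` to `e'`. -/
def transitionBar (e e' : Coord n X) (i : Fin n) (u : Fin n → ℂ) : ℂ :=
  starRingEnd ℂ (transition e e' i u)

/-- `F'` (in the coordinates `e'`) and `F` (in the coordinates `e`) are the components of the same
fields at `p`: `φ`, `φ̄` transform as coordinates, `ρ`, `G` as vectors of type `(1,0)`, and
`η̄`, `θ`, `Ḡ` as vectors of type `(0,1)`. -/
structure Compatible (e e' : Coord n X) (F F' : LocalFields n Λ) (p : ℂ) : Prop where
  φ : ∀ i, F'.φ p i = F.at (transition e e' i) p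
  φb : ∀ i, F'.φb p i = F.at (transitionBar e e' i) p
  η : ∀ i, F'.η p i = ∑ j, F.at (wdb j (transitionBar e e' i)) p * F.η p j
  θ : ∀ i, F'.θ p i = ∑ j, F.at (wdb j (transitionBar e e' i)) p * F.θ p j
  ρ : ∀ i, F'.ρ p i = ∑ j, F.at (wd j (transition e e' i)) p * F.ρ p j
  G : ∀ i, F'.G p i = ∑ j, F.at (wd j (transition e e' i)) p * F.G p j
  Gb : ∀ i, F'.Gb p i = ∑ j, F.at (wdb j (transitionBar e e' i)) p * F.Gb p j

/-- A (Grassmann-valued) field configuration on the disk with target `X`: a map `Φ` with, for every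
chart of `X`, local components of the fields which agree on overlaps. -/
structure IsFieldConfiguration [ChartedSpace (Fin n → ℂ) X] (Φ : ℂ → X)
    (F : Coord n X → LocalFields n Λ) : Prop where
  continuousOn : ContinuousOn Φ disk
  isLocalField : ∀ e ∈ atlas (Fin n → ℂ) X, IsLocalField Φ e (F e)
  compatible : ∀ e ∈ atlas (Fin n → ℂ) X, ∀ e' ∈ atlas (Fin n → ℂ) X,
    ∀ p ∈ chartDomain Φ e ∩ chartDomain Φ e', Compatible e e' (F e) (F e') p

end Fields

/-! ### The equivariant BRST differential and the action -/

section Action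

variable {ι : Type*} {n : ℕ} {X : Type*} [TopologicalSpace X] [ChartedSpace (Fin n → ℂ) X]
  {Λ : Type*} [NormedRing Λ] [NormedAlgebra ℂ Λ] [GrassmannAlgebra Λ]

/-- `Dρⁱ = dρⁱ + Γⁱ_{jk} dφʲ ∧ ρᵏ`. -/
def covRho (g : KahlerMetric n X) (e : Coord n X) (F : LocalFields n Λ) (p : ℂ) (i : Fin n) :
    SForm Λ :=
  deRham (fun q => F.ρ q i) p
    + ∑ j, ∑ k, F.at (g.christoffel e i j k) p * deRham (fun q => F.φ q j) p * F.ρ p k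

/-- `Dη̄ⁱ = dη̄ⁱ + Γ^{ī}_{j̄ k̄} dφ̄ʲ η̄ᵏ`. -/
def covEta (g : KahlerMetric n X) (e : Coord n X) (F : LocalFields n Λ) (p : ℂ) (i : Fin n) :
    SForm Λ :=
  deRham (fun q => F.η q i) p
    + ∑ j, ∑ k, F.at (g.christoffelBar e i j k) p * deRham (fun q => F.φb q j) p * F.η p k

/-- `Dθⁱ = dθⁱ + Γ^{ī}_{j̄ k̄} dφ̄ʲ θᵏ`. -/
def covTheta (g : KahlerMetric n X) (e : Coord n X) (F : LocalFields n Λ) (p : ℂ) (i : Fin n) :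
    SForm Λ :=
  deRham (fun q => F.θ q i) p
    + ∑ j, ∑ k, F.at (g.christoffelBar e i j k) p * deRham (fun q => F.φb q j) p * F.θ p k

/-- The `S¹`-equivariant BRST transformation, in the coordinates `e`: the values of
`δφ`, `δφ̄`, `δη̄`, `δθ`, `δρ`, `δG`, `δḠ`. -/
def brst (ħ : ℂ) (g : KahlerMetric n X) (e : Coord n X) (F : LocalFields n Λ) :
    LocalFields n Λ where
  φ p i := ħ • SForm.iota p (F.ρ p i)
  φb p i := F.η p i
  η p i := ħ • SForm.iota p (deRham (fun q => F.φb q i) p)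
  θ p i := F.Gb p i - ∑ j, ∑ k, F.at (g.christoffelBar e i j k) p * F.η p j * F.θ p k
  ρ p i := -deRham (fun q => F.φ q i) p - ħ • SForm.iota p (F.G p i)
    - ħ • ∑ j, ∑ k, F.at (g.christoffel e i j k) p * SForm.iota p (F.ρ p j) * F.ρ p k
  G p i := deRham (fun q => F.ρ q i) p
    + ∑ j, ∑ k, F.at (g.christoffel e i j k) p * deRham (fun q => F.φ q j) p * F.ρ p k
    + (1 / 2 : ℂ) • ∑ j, ∑ k, ∑ l, F.at (g.curvUp e i j k l) p * F.η p l * F.ρ p j * F.ρ p k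
    + ħ • ∑ j, ∑ k, F.at (g.christoffel e i j k) p * SForm.iota p (F.G p j) * F.ρ p k
  Gb p i := -∑ j, ∑ k, F.at (g.christoffelBar e i j k) p * F.η p j * F.Gb p k
    + ħ • SForm.iota p (covTheta g e F p i)
    + ħ • ∑ l, ∑ j, ∑ k, F.at (wd l (g.christoffelBar e i j k)) p * SForm.iota p (F.ρ p l)
        * F.η p j * F.θ p k

/-- The superpotential in the coordinates `e`. -/
def localW (W : X → ℂ) (e : Coord n X) (u : Fin n → ℂ) : ℂ := W (e.symm u)

/-- The complex conjugate of the superpotential in the coordinates `e`. -/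
def localWBar (W : X → ℂ) (e : Coord n X) (u : Fin n → ℂ) : ℂ := starRingEnd ℂ (W (e.symm u))

/-- `D_i ∂_j W = ∂_i ∂_j W - Γᵏ_{ij} ∂_k W`. -/
def hessW (g : KahlerMetric n X) (W : X → ℂ) (e : Coord n X) (i j : Fin n) (u : Fin n → ℂ) : ℂ :=
  wd i (wd j (localW W e)) u - ∑ k, g.christoffel e k i j u * wd k (localW W e) u

/-- `D_{ī} ∂_{j̄} W̄ = ∂_{ī} ∂_{j̄} W̄ - Γ^{k̄}_{ī j̄} ∂_{k̄} W̄`. -/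
def hessWBar (g : KahlerMetric n X) (W : X → ℂ) (e : Coord n X) (i j : Fin n) (u : Fin n → ℂ) :
    ℂ :=
  wdb i (wdb j (localWBar W e)) u - ∑ k, g.christoffelBar e k i j u * wdb k (localWBar W e) u

/-- The kinetic Lagrangian (a two-form):
`g_{i j̄} (dφⁱ + ħ ι Gⁱ) ∧ *dφ̄ʲ + g_{i j̄} ρⁱ ∧ *Dη̄ʲ - g_{i j̄} θʲ Dρⁱ + g_{i j̄} Gⁱ Ḡʲ
  - ½ R_{i l̄ k j̄} η̄ˡ θʲ ρⁱ ∧ ρᵏ`. -/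
def lagrangianKin (ħ : ℂ) (g : KahlerMetric n X) (e : Coord n X) (F : LocalFields n Λ) (p : ℂ) :
    SForm Λ :=
  (∑ i, ∑ j, F.at (g.coeff e i j) p
      * (deRham (fun q => F.φ q i) p + ħ • SForm.iota p (F.G p i))
      * SForm.star (deRham (fun q => F.φb q j) p))
    + (∑ i, ∑ j, F.at (g.coeff e i j) p * F.ρ p i * SForm.star (covEta g e F p j))
    - (∑ i, ∑ j, F.at (g.coeff e i j) p * F.θ p j * covRho g e F p i)
    + (∑ i, ∑ j, F.at (g.coeff e i j) p * F.G p i * F.Gb p j)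
    - (1 / 2 : ℂ) • ∑ i, ∑ l, ∑ k, ∑ j,
        F.at (g.curv e i l k j) p * F.η p l * F.θ p j * F.ρ p i * F.ρ p k

/-- The Lagrangian of `W̄` (a function, to be integrated against the area measure):
`D_{ī} ∂_{j̄} W̄ η̄ⁱ θʲ + ∂_{ī} W̄ Ḡⁱ`. -/
def lagrangianWBar (g : KahlerMetric n X) (W : X → ℂ) (e : Coord n X) (F : LocalFields n Λ)
    (p : ℂ) : SForm Λ :=
  (∑ i, ∑ j, F.at (hessWBar g W e i j) p * F.η p i * F.θ p j)
    + ∑ i, F.at (wdb i (localWBar W e)) p * F.Gb p i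

/-- The Lagrangian of `W` (a two-form): `- ½ D_i ∂_j W ρⁱ ∧ ρʲ + ∂_i W Gⁱ`. -/
def lagrangianW (g : KahlerMetric n X) (W : X → ℂ) (e : Coord n X) (F : LocalFields n Λ)
    (p : ℂ) : SForm Λ :=
  -((1 / 2 : ℂ) • ∑ i, ∑ j, F.at (hessW g W e i j) p * F.ρ p i * F.ρ p j)
    + ∑ i, F.at (wd i (localW W e)) p * F.G p i

/-- A locally finite way to patch together expressions in local coordinates of the target: charts
of `X` with a subordinate partition of unity. -/
structure Patching (ι : Type*) (n : ℕ) (X : Type*) [TopologicalSpace X]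
    [ChartedSpace (Fin n → ℂ) X] where
  chart : ι → Coord n X
  chart_mem : ∀ a, chart a ∈ atlas (Fin n → ℂ) X
  weight : PartitionOfUnity ι X
  subordinate : weight.IsSubordinate fun a => (chart a).source

/-- The function on the disk given by the coordinate expressions `f e`: if these agree wherever two
charts overlap, then the result is `f e p` for every chart `e` of `X` at `Φ p`. -/
def Patching.glue (P : Patching ι n X) (Φ : ℂ → X) (f : Coord n X → ℂ → Λ) (p : ℂ) : Λ :=
  ∑ᶠ a, ((P.weight a (Φ p) : ℝ) : ℂ) • f (P.chart a) p

/-- The bulk action, i.e. the sum of the integrals over the disk. -/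
def bulkAction (ħ : ℂ) (g : KahlerMetric n X) (W : X → ℂ) (P : Patching ι n X)
    (Φ : ℂ → X) (F : Coord n X → LocalFields n Λ) : Λ :=
  (∫ p in disk, P.glue Φ (fun e q => (lagrangianKin ħ g e (F e) q).c12) p)
    + (∫ p in disk, P.glue Φ (fun e q => (lagrangianWBar g W e (F e) q).c0) p)
    + ∫ p in disk, P.glue Φ (fun e q => (lagrangianW g W e (F e) q).c12) p

/-- The boundary term `-(1/ħ) ∮ W(φ) dσ`. -/
def boundaryAction (ħ : ℂ) (W : X → ℂ) (P : Patching ι n X)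
    (Φ : ℂ → X) (F : Coord n X → LocalFields n Λ) : Λ :=
  -((1 / ħ) • ∫ σ in (0 : ℝ)..(2 * Real.pi),
    P.glue Φ (fun e q => ((F e).at (localW W e) q).c0) (Complex.exp (σ * Complex.I)))

/-- The total action. -/
def action (ħ : ℂ) (g : KahlerMetric n X) (W : X → ℂ) (P : Patching ι n X)
    (Φ : ℂ → X) (F : Coord n X → LocalFields n Λ) : Λ :=
  bulkAction ħ g W P Φ F + boundaryAction ħ W P Φ F

/-- The boundary integral `∫_{∂D} ρⁱ ∂_i W(φ)`; the coefficient of `dσ` is the contraction with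
`v₀ = ∂/∂σ`. -/
def boundaryRhoDW (W : X → ℂ) (P : Patching ι n X) (Φ : ℂ → X) (F : Coord n X → LocalFields n Λ) :
    Λ :=
  ∫ σ in (0 : ℝ)..(2 * Real.pi),
    P.glue Φ (fun e q =>
      (SForm.iota q (∑ i, (F e).ρ q i * (F e).at (wd i (localW W e)) q)).c0)
      (Complex.exp (σ * Complex.I))

end Action

end TypeBModel

end

noncomputable section

set_option linter.unusedSectionVars false

namespace TypeBModel

/-! ### Graded commutativity -/

section Algebra

variable {Λ : Type*} [NormedRing Λ] [NormedAlgebra ℂ Λ] [GrassmannAlgebra Λ]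

open GrassmannAlgebra

/-! Write δ for the equivariant differential, ι for contraction with v₀ and L for the Lie derivative
along v₀. Apart from the superpotential term, the bulk Lagrangian is δ of a globally defined
expression, so its own variation is δ² of that expression. The theorem is therefore the identity δ²
= ħL followed by Stokes.

The calculus is carried by `Variation`, which records at once that δx = x₁ and δ²x = ħLx. The
property passes to sums, products, d, ι and the Hodge operator, because L is an even derivation
commuting with d, ι and the Hodge operator. It passes to functions of the coordinate fields
(`Variation.at`) because second derivatives are symmetric while δφ and δφ̄ are odd. Hence δ² only
has to be computed on the seven fields. On φ, φ̄, η̄ it is Cartan's formula for functions, together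
with ι² = 0 and the symmetry of Γ. On ρ and θ it reduces to the identities ι δG = ι dρ + δ(Γ ιρ ρ)
(`iota_brst_G`) and δḠ = ħ ι dθ + δ(Γ̄ η̄ θ) (`brst_Gb`). Both hold because the (2,0) and (0,2)
parts of the Chern curvature of a Kähler metric vanish. Applying δ once more to the same identities
settles G and Ḡ. For G this gives the contracted equation only, which determines a two-form away
from the centre of the disk; continuity gives the value at the centre.

For the action, the kinetic Lagrangian is δ(-g ρ ∧ *dφ̄ + g θ G) (`lagrangianKin_eq`) and the term
with W̄ is δ(∂W̄ θ) (`lagrangianWBar_eq`). Their variations are ħL of a two-form and of a function.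
These integrate to zero over the disk because v₀ is divergence free and tangent to the boundary
(`integral_pd_rotation`), and this is why no boundary condition is needed. For the term with W put α
= ∂ᵢW ρⁱ. Then δα = -dW - ħ ι ℒ_W, where ℒ_W is the Lagrangian of W, and δW = ħ ι α. Comparing δ²α =
ħLα with Cartan's formula leaves ι δℒ_W = ι dα, so δℒ_W = dα, and Green's theorem
(`integral_disk_curl`) turns the bulk variation into ∮ α. The boundary term -(1/ħ) ∮ W varies by -∮
ι α, which cancels it.

Two layers support this. Taylor evaluation at Grassmann-valued points must be a ring homomorphism
compatible with differentiation and composition (`tay_mul`, `tay_comp`, `hasFDerivWithinAt_tay`).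
The first and last of these turn tensor identities on the target into identities between fields, and
composition gives the change of charts. The homomorphism properties are obtained by moving from the
body to the point along a segment, where the defect solves a linear differential system with
nilpotent coefficients. The second layer is gluing. The weights depend only on the body map Φ, which
δ does not change, so the glued integrands vary by the common local increment. It is thus enough
that the primitives -g ρ ∧ *dφ̄ + g θ G, ∂W̄ θ and ∂W ρ agree on overlaps of charts; the covariance
of the Lagrangians themselves never enters. -/

theorem IsOdd.mul_eq {a : Λ} (ha : IsOdd a) (b : Λ) : a * b = parity b * a := by
  -- Here b + parity b and b - parity b are twice the even and the odd part of b. The two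
  -- commutation rules apply to them separately, and the factor 2 is divided out over ℂ.
  have h1 : parity (b + parity b) = b + parity b := by
    rw [map_add, parity_parity, add_comm]
  have h2 : parity (b - parity b) = -(b - parity b) := by
    rw [map_sub, parity_parity, neg_sub]
  have e1 := even_comm _ a h1
  have e2 := odd_anticomm _ _ ha h2
  have h3 : (2 : ℂ) • (a * b) = (2 : ℂ) • (parity b * a) := by
    have : a * (b + parity b) + a * (b - parity b) =
        (b + parity b) * a + -((b - parity b) * a) := by rw [e1, e2]
    simp only [two_smul]
    have l : a * (b + parity b) + a * (b - parity b) = a * b + a * b := by noncomm_ring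
    have r : (b + parity b) * a + -((b - parity b) * a) = parity b * a + parity b * a := by
      noncomm_ring
    rw [← l, ← r, this]
  exact smul_right_injective Λ (two_ne_zero' ℂ) h3

theorem IsEven.mul_eq {a : Λ} (ha : IsEven a) (b : Λ) : a * b = b * a := even_comm a b ha

theorem IsOdd.mul_self {a : Λ} (ha : IsOdd a) : a * a = 0 := by
  have h := odd_anticomm a a ha ha
  have h2 : (2 : ℂ) • (a * a) = (2 : ℂ) • (0 : Λ) := by
    rw [two_smul, smul_zero]
    nth_rewrite 1 [h]
    exact neg_add_cancel _
  exact smul_right_injective Λ (two_ne_zero' ℂ) h2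

/-- An odd element squares to zero and ℂ has no nilpotents. In particular multiples of ε change no
body, so varied fields keep the underlying map Φ. -/
theorem IsOdd.body_eq_zero {a : Λ} (ha : IsOdd a) : body a = 0 := by
  have h : body (a * a) = 0 := by rw [ha.mul_self, map_zero]
  rw [map_mul] at h
  exact mul_self_eq_zero.mp h

theorem isEven_algebraMap (z : ℂ) : IsEven (algebraMap ℂ Λ z) := parity.commutes z

theorem IsEven.add {a b : Λ} (ha : IsEven a) (hb : IsEven b) : IsEven (a + b) := by
  change parity (a + b) = a + b
  rw [map_add, ha, hb]

theorem IsEven.sub {a b : Λ} (ha : IsEven a) (hb : IsEven b) : IsEven (a - b) := by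
  change parity (a - b) = a - b
  rw [map_sub, ha, hb]

theorem IsEven.mul {a b : Λ} (ha : IsEven a) (hb : IsEven b) : IsEven (a * b) := by
  change parity (a * b) = a * b
  rw [map_mul, ha, hb]

theorem IsOdd.mul {a b : Λ} (ha : IsOdd a) (hb : IsOdd b) : IsEven (a * b) := by
  change parity (a * b) = a * b
  rw [map_mul, ha, hb, neg_mul_neg]

theorem IsEven.smul {a : Λ} (c : ℂ) (ha : IsEven a) : IsEven (c • a) := by
  change parity (c • a) = c • a
  rw [map_smul, ha]

theorem IsEven.sum {κ : Type*} {s : Finset κ} {f : κ → Λ} (h : ∀ i ∈ s, IsEven (f i)) :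
    IsEven (∑ i ∈ s, f i) := by
  change parity (∑ i ∈ s, f i) = ∑ i ∈ s, f i
  rw [map_sum]
  exact Finset.sum_congr rfl h

end Algebra

/-! ### The algebra of forms at a point -/

namespace SForm

variable {Λ : Type*} [NormedRing Λ] [NormedAlgebra ℂ Λ]

@[ext]
theorem ext' {v w : SForm Λ} (h0 : v.c0 = w.c0) (h1 : v.c1 = w.c1) (h2 : v.c2 = w.c2)
    (h12 : v.c12 = w.c12) : v = w :=
  Prod.ext h0 (Prod.ext h1 (Prod.ext h2 h12))

section Components

variable (a b c e : Λ) (v w : SForm Λ) (z : ℂ)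

@[simp] theorem c0_mk : (mk a b c e).c0 = a := rfl
@[simp] theorem c1_mk : (mk a b c e).c1 = b := rfl
@[simp] theorem c2_mk : (mk a b c e).c2 = c := rfl
@[simp] theorem c12_mk : (mk a b c e).c12 = e := rfl
@[simp] theorem c0_add : (v + w).c0 = v.c0 + w.c0 := rfl
@[simp] theorem c1_add : (v + w).c1 = v.c1 + w.c1 := rfl
@[simp] theorem c2_add : (v + w).c2 = v.c2 + w.c2 := rfl
@[simp] theorem c12_add : (v + w).c12 = v.c12 + w.c12 := rfl
@[simp] theorem c0_neg : (-v).c0 = -v.c0 := rfl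
@[simp] theorem c1_neg : (-v).c1 = -v.c1 := rfl
@[simp] theorem c2_neg : (-v).c2 = -v.c2 := rfl
@[simp] theorem c12_neg : (-v).c12 = -v.c12 := rfl
@[simp] theorem c0_sub : (v - w).c0 = v.c0 - w.c0 := rfl
@[simp] theorem c1_sub : (v - w).c1 = v.c1 - w.c1 := rfl
@[simp] theorem c2_sub : (v - w).c2 = v.c2 - w.c2 := rfl
@[simp] theorem c12_sub : (v - w).c12 = v.c12 - w.c12 := rfl
@[simp] theorem c0_smul : (z • v).c0 = z • v.c0 := rfl
@[simp] theorem c1_smul : (z • v).c1 = z • v.c1 := rfl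
@[simp] theorem c2_smul : (z • v).c2 = z • v.c2 := rfl
@[simp] theorem c12_smul : (z • v).c12 = z • v.c12 := rfl
@[simp] theorem c0_zero : (0 : SForm Λ).c0 = 0 := rfl
@[simp] theorem c1_zero : (0 : SForm Λ).c1 = 0 := rfl
@[simp] theorem c2_zero : (0 : SForm Λ).c2 = 0 := rfl
@[simp] theorem c12_zero : (0 : SForm Λ).c12 = 0 := rfl
@[simp] theorem c0_of : (of a).c0 = a := rfl
@[simp] theorem c1_of : (of a).c1 = 0 := rfl
@[simp] theorem c2_of : (of a).c2 = 0 := rfl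
@[simp] theorem c12_of : (of a).c12 = 0 := rfl

end Components

variable [GrassmannAlgebra Λ]

open GrassmannAlgebra

section MulComponents

variable (v w : SForm Λ)

@[simp] theorem c0_mul : (v * w).c0 = v.c0 * w.c0 := rfl
@[simp] theorem c1_mul : (v * w).c1 = parity v.c0 * w.c1 + v.c1 * w.c0 := rfl
@[simp] theorem c2_mul : (v * w).c2 = parity v.c0 * w.c2 + v.c2 * w.c0 := rfl
@[simp] theorem c12_mul : (v * w).c12 = v.c0 * w.c12 + parity v.c1 * w.c2
      - parity v.c2 * w.c1 + v.c12 * w.c0 := rfl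

end MulComponents

instance : One (SForm Λ) := ⟨of 1⟩

@[simp] theorem c0_one : (1 : SForm Λ).c0 = 1 := rfl
@[simp] theorem c1_one : (1 : SForm Λ).c1 = 0 := rfl
@[simp] theorem c2_one : (1 : SForm Λ).c2 = 0 := rfl
@[simp] theorem c12_one : (1 : SForm Λ).c12 = 0 := rfl

/-- Associativity of the signed product rests on parity being a multiplicative involution. -/
instance : Ring (SForm Λ) :=
  { (inferInstance : AddCommGroup (SForm Λ)), (inferInstance : Mul (SForm Λ)),
    (inferInstance : One (SForm Λ)) with
    left_distrib := fun a b c => by ext <;> simp <;> noncomm_ring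
    right_distrib := fun a b c => by ext <;> simp <;> noncomm_ring
    zero_mul := fun a => by ext <;> simp
    mul_zero := fun a => by ext <;> simp
    mul_assoc := fun a b c => by ext <;> simp [parity_parity] <;> noncomm_ring
    one_mul := fun a => by ext <;> simp
    mul_one := fun a => by ext <;> simp }

instance : Algebra ℂ (SForm Λ) :=
  Algebra.ofModule (fun r x y => by ext <;> simp [smul_add, smul_sub])
    (fun r x y => by ext <;> simp [smul_add, smul_sub])

/-- The automorphism of the algebra of forms given by the total parity. -/
def totalParity : SForm Λ →ₐ[ℂ] SForm Λ where
  toFun w := mk (parity w.c0) (-parity w.c1) (-parity w.c2) (parity w.c12)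
  map_one' := by ext <;> simp
  map_zero' := by ext <;> simp
  map_mul' v w := by ext <;> simp [-Complex.coe_smul] <;> abel
  map_add' v w := by ext <;> simp <;> abel
  commutes' z := by
    rw [Algebra.algebraMap_eq_smul_one]; ext <;> simp

@[simp] theorem c0_totalParity (w : SForm Λ) : (totalParity w).c0 = parity w.c0 := rfl
@[simp] theorem c1_totalParity (w : SForm Λ) : (totalParity w).c1 = -parity w.c1 := rfl
@[simp] theorem c2_totalParity (w : SForm Λ) : (totalParity w).c2 = -parity w.c2 := rfl
@[simp] theorem c12_totalParity (w : SForm Λ) : (totalParity w).c12 = parity w.c12 := rfl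

/-- Forms of even total parity. -/
def Even (w : SForm Λ) : Prop := totalParity w = w

/-- Forms of odd total parity. -/
def Odd (w : SForm Λ) : Prop := totalParity w = -w

theorem totalParity_totalParity (w : SForm Λ) : totalParity (totalParity w) = w := by
  ext <;> simp [parity_parity]

theorem Even.mul_eq {v : SForm Λ} (hv : v.Even) (w : SForm Λ) : v * w = w * v := by
  have h0 : IsEven v.c0 := congrArg c0 hv
  have h1 : IsOdd v.c1 := neg_eq_iff_eq_neg.mp (congrArg c1 hv)
  have h2 : IsOdd v.c2 := neg_eq_iff_eq_neg.mp (congrArg c2 hv)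
  have h3 : IsEven v.c12 := congrArg c12 hv
  ext
  · simp [h0.mul_eq]
  · simp only [c1_mul, h1.mul_eq, show parity v.c0 = v.c0 from h0, h0.mul_eq]; abel
  · simp only [c2_mul, h2.mul_eq, show parity v.c0 = v.c0 from h0, h0.mul_eq]; abel
  · simp only [c12_mul, h3.mul_eq, h0.mul_eq, show parity v.c1 = -v.c1 from h1,
      show parity v.c2 = -v.c2 from h2, neg_mul, h1.mul_eq, h2.mul_eq]
    abel

/-- Graded commutativity for the total grading, with w not assumed homogeneous: the sign becomes the
automorphism `totalParity`. Componentwise it comes from the rules in Λ, since a totally odd form has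
odd coefficients in degrees 0 and 2 and even ones in degree 1. -/
theorem Odd.mul_eq {v : SForm Λ} (hv : v.Odd) (w : SForm Λ) : v * w = totalParity w * v := by
  have h0 : IsOdd v.c0 := congrArg c0 hv
  have h1 : IsEven v.c1 := neg_inj.mp (congrArg c1 hv)
  have h2 : IsEven v.c2 := neg_inj.mp (congrArg c2 hv)
  have h3 : IsOdd v.c12 := congrArg c12 hv
  ext
  · simp [h0.mul_eq]
  · simp only [c1_mul, c0_totalParity, c1_totalParity, parity_parity,
      show parity v.c0 = -v.c0 from h0, neg_mul, h0.mul_eq]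
    rw [h1.mul_eq]; abel
  · simp only [c2_mul, c0_totalParity, c2_totalParity, parity_parity,
      show parity v.c0 = -v.c0 from h0, neg_mul, h0.mul_eq]
    rw [h2.mul_eq]; abel
  · simp only [c12_mul, c0_totalParity, c1_totalParity, c2_totalParity, c12_totalParity,
      parity_parity, map_neg, show parity v.c1 = v.c1 from h1, show parity v.c2 = v.c2 from h2,
      neg_mul]
    rw [h0.mul_eq, h3.mul_eq, h1.mul_eq, h2.mul_eq]; abel

theorem Odd.anticomm {v w : SForm Λ} (hv : v.Odd) (hw : w.Odd) : v * w = -(w * v) := by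
  rw [hv.mul_eq, show totalParity w = -w from hw, neg_mul]

theorem Odd.mul_self {v : SForm Λ} (hv : v.Odd) : v * v = 0 := by
  have h := hv.anticomm hv
  have h2 : (2 : ℂ) • (v * v) = (2 : ℂ) • (0 : SForm Λ) := by
    rw [two_smul, smul_zero]
    nth_rewrite 1 [h]
    exact neg_add_cancel _
  exact smul_right_injective _ (two_ne_zero' ℂ) h2

theorem odd_dx1 : (dx1 : SForm Λ).Odd := by
  ext <;> simp [dx1]
theorem odd_dx2 : (dx2 : SForm Λ).Odd := by
  ext <;> simp [dx2]
theorem odd_of {a : Λ} (ha : IsOdd a) : (of a).Odd := by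
  ext <;> simp; exact ha
theorem even_of {a : Λ} (ha : IsEven a) : (of a).Even := by
  ext <;> simp; exact ha

theorem IsEvenFn.even {w : SForm Λ} (h : w.IsEvenFn) : w.Even := by
  obtain ⟨h0, h1, h2, h3⟩ := h
  ext <;> simp [h1, h2, h3]; exact h0
theorem IsOddFn.odd {w : SForm Λ} (h : w.IsOddFn) : w.Odd := by
  obtain ⟨h0, h1, h2, h3⟩ := h
  ext <;> simp [h1, h2, h3]; exact h0
theorem IsOddOneForm.even {w : SForm Λ} (h : w.IsOddOneForm) : w.Even := by
  obtain ⟨h0, h1, h2, h3⟩ := h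
  ext <;> simp [h0, h3, neg_eq_iff_eq_neg]
  · exact h1
  · exact h2
theorem IsEvenTwoForm.even {w : SForm Λ} (h : w.IsEvenTwoForm) : w.Even := by
  obtain ⟨h0, h1, h2, h3⟩ := h
  ext <;> simp [h0, h1, h2]; exact h3

theorem IsEvenFn.eq_of {w : SForm Λ} (h : w.IsEvenFn) : w = of w.c0 := by
  obtain ⟨h0, h1, h2, h3⟩ := h
  ext <;> simp [h1, h2, h3]

/-! ### Contraction and the Hodge operator -/

/-- Contraction with `v₀` as a linear map. -/
def iotaL (p : ℂ) : SForm Λ →ₗ[ℂ] SForm Λ where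
  toFun := iota p
  map_add' v w := by ext <;> simp [-Complex.coe_smul, iota, smul_add] <;> abel
  map_smul' z v := by ext <;> simp [-Complex.coe_smul, iota, smul_smul, mul_comm z, smul_add]

theorem iota_add (p : ℂ) (v w : SForm Λ) : iota p (v + w) = iota p v + iota p w :=
  map_add (iotaL p) v w
theorem iota_sub (p : ℂ) (v w : SForm Λ) : iota p (v - w) = iota p v - iota p w :=
  map_sub (iotaL p) v w
theorem iota_neg (p : ℂ) (v : SForm Λ) : iota p (-v) = -iota p v := map_neg (iotaL p) v
theorem iota_zero (p : ℂ) : iota p (0 : SForm Λ) = 0 := map_zero (iotaL p)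
theorem iota_smul (p : ℂ) (z : ℂ) (v : SForm Λ) : iota p (z • v) = z • iota p v :=
  map_smul (iotaL p) z v
theorem iota_sum {κ : Type*} (s : Finset κ) (p : ℂ) (f : κ → SForm Λ) :
    iota p (∑ i ∈ s, f i) = ∑ i ∈ s, iota p (f i) := map_sum (iotaL p) f s

/-- Contraction is an odd derivation of the total grading, so it sees the Grassmann parity as well
as the form degree. -/
theorem iota_mul (p : ℂ) (v w : SForm Λ) :
    iota p (v * w) = iota p v * w + totalParity v * iota p w := by
  ext <;> simp [-Complex.coe_smul, iota, parity_parity, smul_add, smul_sub, mul_add, add_mul] <;> abel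

theorem iota_iota (p : ℂ) (v : SForm Λ) : iota p (iota p v) = 0 := by
  ext <;> simp [-Complex.coe_smul, iota, smul_smul]
  rw [mul_comm, add_neg_cancel]

theorem totalParity_iota (p : ℂ) (v : SForm Λ) : 
    totalParity (iota p v) = -iota p (totalParity v) := by
  ext <;> simp [-Complex.coe_smul, iota]; abel

theorem iota_of (p : ℂ) (a : Λ) : iota p (of a) = 0 := by
  ext <;> simp [iota]

/-- The Hodge operator as a linear map. -/
def starL : SForm Λ →ₗ[ℂ] SForm Λ where
  toFun := star
  map_add' v w := by ext <;> simp [star]; abel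
  map_smul' z v := by ext <;> simp [star]

theorem star_add (v w : SForm Λ) : star (v + w) = star v + star w := map_add starL v w
theorem star_neg (v : SForm Λ) : star (-v) = -star v := map_neg starL v
theorem star_smul (z : ℂ) (v : SForm Λ) : star (z • v) = z • star v := map_smul starL z v
theorem star_sum {κ : Type*} (s : Finset κ) (f : κ → SForm Λ) :
    star (∑ i ∈ s, f i) = ∑ i ∈ s, star (f i) := map_sum starL f s

theorem star_of_mul (a : Λ) (w : SForm Λ) : star (of a * w) = of a * star w := by
  ext <;> simp [star]

theorem star_mul_of (a : Λ) (w : SForm Λ) : star (w * of a) = star w * of a := by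
  ext <;> simp [star]

theorem totalParity_star (v : SForm Λ) : totalParity (star v) = star (totalParity v) := by
  ext <;> simp [star]

theorem Odd.star {v : SForm Λ} (hv : v.Odd) : (SForm.star v).Odd := by
  rw [Odd, totalParity_star, hv, star_neg]

theorem of_add (a b : Λ) : of (a + b) = of a + of b := by ext <;> simp
theorem of_mul (a b : Λ) : of (a * b) = of a * of b := by ext <;> simp
theorem of_smul (z : ℂ) (a : Λ) : of (z • a) = z • of a := by ext <;> simp

/-- The inclusion of `Λ` as the forms of degree zero. -/
def ofHom : Λ →ₐ[ℂ] SForm Λ where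
  toFun := of
  map_one' := rfl
  map_mul' := of_mul
  map_zero' := rfl
  map_add' := of_add
  commutes' z := by
    rw [Algebra.algebraMap_eq_smul_one, of_smul, Algebra.algebraMap_eq_smul_one]; rfl

theorem of_sum {κ : Type*} (s : Finset κ) (f : κ → Λ) :
    of (∑ i ∈ s, f i) = ∑ i ∈ s, of (f i) := map_sum (ofHom (Λ := Λ)) f s

end SForm

open Filter Topology

/-! ### Wirtinger derivatives -/

section WirtingerLemmas

variable {n : ℕ} {V : Type*} [NormedAddCommGroup V] [NormedSpace ℂ V]

/-- The Wirtinger derivatives `∂/∂uⁱ` (left summand) and `∂/∂ūⁱ` (right summand). -/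
def wdir (a : Fin n ⊕ Fin n) (f : (Fin n → ℂ) → V) : (Fin n → ℂ) → V :=
  Sum.elim (fun i => wd i f) (fun i => wdb i f) a

/-- The coordinates `uⁱ` (left summand) and `ūⁱ` (right summand). -/
def zcoord (a : Fin n ⊕ Fin n) (u : Fin n → ℂ) : ℂ :=
  Sum.elim (fun i => u i) (fun i => starRingEnd ℂ (u i)) a

/-- The value on a real differential of the (anti)holomorphic coordinate vector fields. -/
def wdirL (a : Fin n ⊕ Fin n) : ((Fin n → ℂ) →L[ℝ] V) →ₗ[ℝ] V where
  toFun L := Sum.elim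
    (fun i => (1 / 2 : ℂ) • (L (Pi.single i 1) - Complex.I • L (Pi.single i Complex.I)))
    (fun i => (1 / 2 : ℂ) • (L (Pi.single i 1) + Complex.I • L (Pi.single i Complex.I))) a
  map_add' L M := by
    rcases a with i | i <;> simp only [Sum.elim_inl, Sum.elim_inr, add_apply] <;>
      module
  map_smul' c L := by
    rcases a with i | i <;>
      simp only [Sum.elim_inl, Sum.elim_inr, smul_apply, RingHom.id_apply] <;>
      rw [smul_comm Complex.I c, smul_comm c (1 / 2 : ℂ)] <;>
      simp only [smul_add, smul_sub]

theorem wdir_apply (a : Fin n ⊕ Fin n) (f : (Fin n → ℂ) → V) (u : Fin n → ℂ) :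
    wdir a f u = wdirL a (fderiv ℝ f u) := by
  rcases a with i | i <;> rfl

/-- In each coordinate this is dx ∂ₓ + dy ∂ᵧ = dz ∂ + dz̄ ∂̄. Everything later treats the
holomorphic and antiholomorphic directions as one index set `Fin n ⊕ Fin n`. -/
theorem clm_apply_eq_sum_wdirL (L : (Fin n → ℂ) →L[ℝ] V) (v : Fin n → ℂ) :
    L v = ∑ a, zcoord a v • wdirL a L := by
  have hv : v = ∑ i, ((v i).re • (Pi.single i 1 : Fin n → ℂ)
      + (v i).im • (Pi.single i Complex.I : Fin n → ℂ)) := by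
    funext j
    rw [Finset.sum_apply, Finset.sum_eq_single j]
    · simp
    · intro b _ hb
      simp [Pi.single_eq_of_ne (Ne.symm hb)]
    · simp
  conv_lhs => rw [hv]
  rw [map_sum, Fintype.sum_sum_type, ← Finset.sum_add_distrib]
  refine Finset.sum_congr rfl fun i _ => ?_
  rw [map_add, map_smul, map_smul]
  simp only [zcoord, wdirL, Sum.elim_inl, Sum.elim_inr, LinearMap.coe_mk, AddHom.coe_mk]
  generalize L (Pi.single i 1) = x
  generalize L (Pi.single i Complex.I) = y
  have h1 : (v i).re • x = ((v i).re : ℂ) • x := (Complex.coe_smul _ _).symm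
  have h2 : (v i).im • y = ((v i).im : ℂ) • y := (Complex.coe_smul _ _).symm
  rw [h1, h2, Complex.re_eq_add_conj, Complex.im_eq_sub_conj]
  have : (2 * Complex.I)⁻¹ = - Complex.I / 2 := by
    rw [mul_inv, Complex.inv_I]; ring
  rw [div_eq_mul_inv _ (2 * Complex.I), this]
  match_scalars <;> ring

theorem fderiv_apply_eq_sum_wdir (f : (Fin n → ℂ) → V) (u v : Fin n → ℂ) :
    fderiv ℝ f u v = ∑ a, zcoord a v • wdir a f u := by
  simp only [wdir_apply]
  exact clm_apply_eq_sum_wdirL _ _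

theorem wdir_congr {f g : (Fin n → ℂ) → V} {u : Fin n → ℂ} (h : f =ᶠ[𝓝 u] g)
    (a : Fin n ⊕ Fin n) : wdir a f =ᶠ[𝓝 u] wdir a g := by
  filter_upwards [h.fderiv (𝕜 := ℝ)] with x hx
  rw [wdir_apply, wdir_apply, hx]

theorem wdir_clm_comp {V' : Type*} [NormedAddCommGroup V'] [NormedSpace ℂ V'] (L : V →L[ℂ] V')
    {f : (Fin n → ℂ) → V} {u : Fin n → ℂ} (hf : DifferentiableAt ℝ f u) (a : Fin n ⊕ Fin n) :
    wdir a (fun x => L (f x)) u = L (wdir a f u) := by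
  have h : HasFDerivAt (fun x => L (f x)) ((L.restrictScalars ℝ).comp (fderiv ℝ f u)) u :=
    (L.restrictScalars ℝ).hasFDerivAt.comp u hf.hasFDerivAt
  rw [wdir_apply, wdir_apply, h.fderiv]
  rcases a with i | i <;> simp [wdirL]

theorem wdir_add {f g : (Fin n → ℂ) → V} {u : Fin n → ℂ} (hf : DifferentiableAt ℝ f u)
    (hg : DifferentiableAt ℝ g u) (a : Fin n ⊕ Fin n) :
    wdir a (fun x => f x + g x) u = wdir a f u + wdir a g u := by
  rw [wdir_apply, wdir_apply, wdir_apply, fderiv_fun_add hf hg, map_add]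

theorem wdir_sum {κ : Type*} {s : Finset κ} {f : κ → (Fin n → ℂ) → V} {u : Fin n → ℂ}
    (hf : ∀ i ∈ s, DifferentiableAt ℝ (f i) u) (a : Fin n ⊕ Fin n) :
    wdir a (fun x => ∑ i ∈ s, f i x) u = ∑ i ∈ s, wdir a (f i) u := by
  simp only [wdir_apply, fderiv_fun_sum hf, map_sum]

theorem wdir_mul {f g : (Fin n → ℂ) → ℂ} {u : Fin n → ℂ} (hf : DifferentiableAt ℝ f u)
    (hg : DifferentiableAt ℝ g u) (a : Fin n ⊕ Fin n) :
    wdir a (fun x => f x * g x) u = wdir a f u * g u + f u * wdir a g u := by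
  rw [wdir_apply, wdir_apply, wdir_apply, fderiv_fun_mul hf hg]
  rcases a with i | i <;> simp [wdirL] <;> ring

/-- Smoothness in a neighbourhood of a point. -/
def SmoothNear (f : (Fin n → ℂ) → V) (u : Fin n → ℂ) : Prop := ∀ᶠ x in 𝓝 u, ContDiffAt ℝ ∞ f x

theorem SmoothNear.contDiffAt {f : (Fin n → ℂ) → V} {u : Fin n → ℂ} (h : SmoothNear f u) :
    ContDiffAt ℝ ∞ f u := h.self_of_nhds

theorem SmoothNear.differentiableAt {f : (Fin n → ℂ) → V} {u : Fin n → ℂ} (h : SmoothNear f u) :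
    DifferentiableAt ℝ f u := h.contDiffAt.differentiableAt (by simp)

theorem SmoothNear.eventually {f : (Fin n → ℂ) → V} {u : Fin n → ℂ} (h : SmoothNear f u) :
    ∀ᶠ x in 𝓝 u, SmoothNear f x := eventually_eventually_nhds.mpr h

theorem SmoothNear.congr {f g : (Fin n → ℂ) → V} {u : Fin n → ℂ} (h : SmoothNear f u)
    (hfg : f =ᶠ[𝓝 u] g) : SmoothNear g u := by
  filter_upwards [h, hfg.eventually_nhds] with x hx hx'
  exact hx.congr_of_eventuallyEq (EventuallyEq.symm hx')

theorem contDiffAt_wdir {f : (Fin n → ℂ) → V} {u : Fin n → ℂ} (h : ContDiffAt ℝ ∞ f u)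
    (a : Fin n ⊕ Fin n) : ContDiffAt ℝ ∞ (wdir a f) u := by
  have h1 : ∀ v : Fin n → ℂ, ContDiffAt ℝ ∞ (fun x => fderiv ℝ f x v) u := fun v =>
    (h.fderiv_right (m := ∞) (by simp)).clm_apply contDiffAt_const
  rcases a with i | i
  · exact contDiffAt_const.smul ((h1 _).sub (contDiffAt_const.smul (h1 _)))
  · exact contDiffAt_const.smul ((h1 _).add (contDiffAt_const.smul (h1 _)))

theorem SmoothNear.wdir {f : (Fin n → ℂ) → V} {u : Fin n → ℂ} (h : SmoothNear f u)
    (a : Fin n ⊕ Fin n) : SmoothNear (wdir a f) u := by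
  filter_upwards [h] with x hx using contDiffAt_wdir hx a

theorem SmoothNear.add {f g : (Fin n → ℂ) → V} {u : Fin n → ℂ} (hf : SmoothNear f u)
    (hg : SmoothNear g u) : SmoothNear (fun x => f x + g x) u := by
  filter_upwards [hf, hg] with x h1 h2 using h1.add h2

theorem SmoothNear.sub {f g : (Fin n → ℂ) → V} {u : Fin n → ℂ} (hf : SmoothNear f u)
    (hg : SmoothNear g u) : SmoothNear (fun x => f x - g x) u := by
  filter_upwards [hf, hg] with x h1 h2 using h1.sub h2

theorem SmoothNear.neg {f : (Fin n → ℂ) → V} {u : Fin n → ℂ} (hf : SmoothNear f u) :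
    SmoothNear (fun x => -f x) u := by
  filter_upwards [hf] with x h1 using h1.neg

theorem SmoothNear.mul {f g : (Fin n → ℂ) → ℂ} {u : Fin n → ℂ} (hf : SmoothNear f u)
    (hg : SmoothNear g u) : SmoothNear (fun x => f x * g x) u := by
  filter_upwards [hf, hg] with x h1 h2 using h1.mul h2

theorem SmoothNear.sum {κ : Type*} {s : Finset κ} {f : κ → (Fin n → ℂ) → V} {u : Fin n → ℂ}
    (hf : ∀ i ∈ s, SmoothNear (f i) u) : SmoothNear (fun x => ∑ i ∈ s, f i x) u := by
  filter_upwards [(Filter.eventually_all_finset s).mpr hf] with x h1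
  exact ContDiffAt.sum h1

theorem SmoothNear.conj {f : (Fin n → ℂ) → ℂ} {u : Fin n → ℂ} (hf : SmoothNear f u) :
    SmoothNear (fun x => starRingEnd ℂ (f x)) u := by
  filter_upwards [hf] with x h1
  exact Complex.conjCLE.contDiff.contDiffAt.comp x h1

theorem SmoothNear.const_mul {f : (Fin n → ℂ) → ℂ} {u : Fin n → ℂ} (c : ℂ)
    (hf : SmoothNear f u) : SmoothNear (fun x => c * f x) u := by
  filter_upwards [hf] with x h1 using contDiffAt_const.mul h1

/-- Both sides expand into the same complex combination of values of the second real differential,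
once its symmetry is used. -/
theorem wdir_comm {f : (Fin n → ℂ) → V} {u : Fin n → ℂ} (h : ContDiffAt ℝ ∞ f u)
    (a b : Fin n ⊕ Fin n) : wdir a (wdir b f) u = wdir b (wdir a f) u := by
  have hd : DifferentiableAt ℝ (fderiv ℝ f) u :=
    (h.fderiv_right (m := ∞) (by simp)).differentiableAt (by simp)
  have hs : IsSymmSndFDerivAt ℝ f u := h.isSymmSndFDerivAt (by simpa using ENat.LEInfty.out)
  have h1 : ∀ v : Fin n → ℂ, DifferentiableAt ℝ (fun x => fderiv ℝ f x v) u := fun v =>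
    hd.clm_apply (differentiableAt_const _)
  have h2 : ∀ v w : Fin n → ℂ, fderiv ℝ (fun x => fderiv ℝ f x v) u w =
      fderiv ℝ (fderiv ℝ f) u w v := by
    intro v w
    rw [fderiv_clm_apply hd (differentiableAt_const _)]
    simp
  have h3 : ∀ (b : Fin n ⊕ Fin n) (w : Fin n → ℂ), fderiv ℝ (wdir b f) u w =
      wdirL b (fderiv ℝ (fderiv ℝ f) u w) := by
    intro b w
    rcases b with i | i
    · have h4 := ((h1 (Pi.single i 1)).hasFDerivAt.sub
        ((h1 (Pi.single i Complex.I)).hasFDerivAt.const_smul Complex.I)).const_smul (1 / 2 : ℂ)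
      refine (congrFun (congrArg DFunLike.coe h4.fderiv) w).trans ?_
      simp [wdirL, h2]
    · have h4 := ((h1 (Pi.single i 1)).hasFDerivAt.add
        ((h1 (Pi.single i Complex.I)).hasFDerivAt.const_smul Complex.I)).const_smul (1 / 2 : ℂ)
      refine (congrFun (congrArg DFunLike.coe h4.fderiv) w).trans ?_
      simp [wdirL, h2]
  have hs' : ∀ v w, fderiv ℝ (fderiv ℝ f) u v w = fderiv ℝ (fderiv ℝ f) u w v := hs
  rw [wdir_apply a, wdir_apply b]
  rcases a with i | i <;> rcases b with j | j <;>
    simp only [wdirL, LinearMap.coe_mk, AddHom.coe_mk, Sum.elim_inl, Sum.elim_inr, h3] <;>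
    rw [hs' (Pi.single j 1) (Pi.single i 1), hs' (Pi.single j 1) (Pi.single i Complex.I),
      hs' (Pi.single j Complex.I) (Pi.single i 1),
      hs' (Pi.single j Complex.I) (Pi.single i Complex.I)] <;>
    module

theorem wdir_conj {f : (Fin n → ℂ) → ℂ} {u : Fin n → ℂ} (hf : DifferentiableAt ℝ f u)
    (a : Fin n ⊕ Fin n) :
    wdir a (fun x => starRingEnd ℂ (f x)) u = starRingEnd ℂ (wdir a.swap f u) := by
  have h : HasFDerivAt (fun x => starRingEnd ℂ (f x))
      ((Complex.conjCLE : ℂ →L[ℝ] ℂ).comp (fderiv ℝ f u)) u :=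
    (Complex.conjCLE : ℂ →L[ℝ] ℂ).hasFDerivAt.comp u hf.hasFDerivAt
  rw [wdir_apply, wdir_apply, h.fderiv]
  rcases a with i | i <;> simp [wdirL, Complex.conj_ofNat] <;> ring

/-- The chain rule for Wirtinger derivatives. -/
theorem wdir_comp {f : (Fin n → ℂ) → ℂ} {τ : (Fin n → ℂ) → (Fin n → ℂ)} {u : Fin n → ℂ}
    (hf : DifferentiableAt ℝ f (τ u)) (hτ : DifferentiableAt ℝ τ u) (a : Fin n ⊕ Fin n) :
    wdir a (fun x => f (τ x)) u =
      ∑ b, wdir b f (τ u) * wdir a (fun x => zcoord b (τ x)) u := by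
  have h := (hf.hasFDerivAt.comp u hτ.hasFDerivAt).fderiv
  have hz : ∀ b : Fin n ⊕ Fin n, ∃ L : (Fin n → ℂ) →L[ℝ] ℂ, (∀ v, L v = zcoord b v) := by
    rintro (i | i)
    · exact ⟨ContinuousLinearMap.proj i, fun v => rfl⟩
    · exact ⟨(Complex.conjCLE : ℂ →L[ℝ] ℂ).comp (ContinuousLinearMap.proj i), fun v => rfl⟩
  choose Z hZ using hz
  have hz' : ∀ b, fderiv ℝ (fun x => zcoord b (τ x)) u = (Z b).comp (fderiv ℝ τ u) := by
    intro b
    have : (fun x => zcoord b (τ x)) = fun x => Z b (τ x) := by funext x; rw [hZ]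
    rw [this]
    exact ((Z b).hasFDerivAt.comp u hτ.hasFDerivAt).fderiv
  rw [wdir_apply, show (fun x => f (τ x)) = f ∘ τ from rfl, h]
  have key : (fderiv ℝ f (τ u)).comp (fderiv ℝ τ u) =
      ∑ b, (ContinuousLinearMap.mul ℝ ℂ (wdir b f (τ u))).comp
        (fderiv ℝ (fun x => zcoord b (τ x)) u) := by
    ext v
    rw [ContinuousLinearMap.comp_apply, fderiv_apply_eq_sum_wdir]
    simp [hz', hZ, mul_comm]
  rw [key, map_sum]
  refine Finset.sum_congr rfl fun b _ => ?_
  rw [wdir_apply a]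
  rcases a with i | i <;> simp [wdirL] <;> ring

end WirtingerLemmas

/-! ### Taylor evaluation at Grassmann-valued points -/

section Taylor

open GrassmannAlgebra

variable {n : ℕ} {Λ : Type*} [NormedRing Λ] [NormedAlgebra ℂ Λ] [GrassmannAlgebra Λ]

/-- The derivative `(∑ₐ sᵃ ∂ₐ)ᵏ f`. -/
def taylorTerm (s : Fin n ⊕ Fin n → Λ) : ℕ → ((Fin n → ℂ) → ℂ) → (Fin n → ℂ) → Λ
  | 0, f, u => algebraMap ℂ Λ (f u)
  | k + 1, f, u => ∑ a, s a * taylorTerm s k (wdir a f) u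

/-- The body of a Grassmann-valued point. -/
def bodyPt (φ : Fin n ⊕ Fin n → Λ) : Fin n → ℂ := fun i => body (φ (.inl i))

/-- The soul of a Grassmann-valued point. -/
def soulPt (φ : Fin n ⊕ Fin n → Λ) : Fin n ⊕ Fin n → Λ :=
  fun a => φ a - algebraMap ℂ Λ (zcoord a (bodyPt φ))

/-- The value of `f` at a Grassmann-valued point, by Taylor expansion around the body. -/
def tay (f : (Fin n → ℂ) → ℂ) (φ : Fin n ⊕ Fin n → Λ) : Λ :=
  ∑ k ∈ Finset.range (order Λ), ((k.factorial : ℂ)⁻¹) • taylorTerm (soulPt φ) k f (bodyPt φ)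

/-- Grassmann-valued points: systems of even coordinates whose bodies are complex conjugate. -/
structure IsPt (φ : Fin n ⊕ Fin n → Λ) : Prop where
  even : ∀ a, IsEven (φ a)
  body_eq : ∀ a, body (φ a) = zcoord a (bodyPt φ)

theorem IsPt.even_soul {φ : Fin n ⊕ Fin n → Λ} (h : IsPt φ) (a : Fin n ⊕ Fin n) :
    IsEven (soulPt φ a) := (h.even a).sub (isEven_algebraMap _)

theorem body_algebraMap (z : ℂ) : body (algebraMap ℂ Λ z) = z := body.commutes z

theorem IsPt.body_soul {φ : Fin n ⊕ Fin n → Λ} (h : IsPt φ) (a : Fin n ⊕ Fin n) :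
    body (soulPt φ a) = 0 := by
  rw [soulPt, map_sub, h.body_eq, body_algebraMap, sub_self]

theorem order_pos : 0 < order Λ := by
  by_contra h
  have h0 : (1 : Λ) = 0 := by
    simpa using nilpotent ([] : List Λ) (by simp) (by simpa using Nat.le_of_not_lt h)
  have : (1 : ℂ) = 0 := by rw [← map_one (body (Λ := Λ)), h0, map_zero]
  exact one_ne_zero this

section Terms

variable {s : Fin n ⊕ Fin n → Λ} {f g : (Fin n → ℂ) → ℂ} {u : Fin n → ℂ}

theorem taylorTerm_congr (k : ℕ) (h : f =ᶠ[𝓝 u] g) : taylorTerm s k f u = taylorTerm s k g u := by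
  induction k generalizing f g with
  | zero => simp only [taylorTerm, h.self_of_nhds]
  | succ k ih => exact Finset.sum_congr rfl fun a _ => by rw [ih (wdir_congr h a)]

theorem contDiffAt_algebraMap (z : ℂ) : ContDiffAt ℝ ∞ (algebraMap ℂ Λ) z :=
  ((algebraMapCLM ℂ Λ).restrictScalars ℝ).contDiff.contDiffAt

theorem contDiffAt_taylorTerm (k : ℕ) (h : ContDiffAt ℝ ∞ f u) :
    ContDiffAt ℝ ∞ (taylorTerm s k f) u := by
  induction k generalizing f with
  | zero => exact (contDiffAt_algebraMap _).comp u h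
  | succ k ih =>
    exact ContDiffAt.sum fun a _ => contDiffAt_const.mul (ih (contDiffAt_wdir h a))

/-- The soul components do not depend on u, so they pass through the derivative, and the Wirtinger
derivatives commute. This reconciles the two orders of differentiation met in `eval` and
`taylorTerm`. -/
theorem wdir_taylorTerm (k : ℕ) (h : SmoothNear f u) (b : Fin n ⊕ Fin n) :
    wdir b (taylorTerm s k f) u = taylorTerm s k (wdir b f) u := by
  induction k generalizing f with
  | zero => exact wdir_clm_comp (algebraMapCLM ℂ Λ) h.differentiableAt b
  | succ k ih =>
    have hd : ∀ a, DifferentiableAt ℝ (taylorTerm s k (wdir a f)) u := fun a =>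
      (contDiffAt_taylorTerm k (h.wdir a).contDiffAt).differentiableAt (by simp)
    change wdir b (fun u => ∑ a, s a * taylorTerm s k (wdir a f) u) u = _
    rw [wdir_sum fun a _ => (hd a).const_mul _]
    refine Finset.sum_congr rfl fun a _ => ?_
    refine (wdir_clm_comp (ContinuousLinearMap.mul ℂ Λ (s a)) (hd a) b).trans ?_
    rw [ContinuousLinearMap.mul_apply', ih (h.wdir a)]
    congr 1
    refine taylorTerm_congr k ?_
    filter_upwards [h] with x hx using wdir_comm hx b a

theorem taylorTerm_add (k : ℕ) (hf : SmoothNear f u) (hg : SmoothNear g u) :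
    taylorTerm s k (fun x => f x + g x) u = taylorTerm s k f u + taylorTerm s k g u := by
  induction k generalizing f g with
  | zero => simp [taylorTerm]
  | succ k ih =>
    simp only [taylorTerm]
    rw [← Finset.sum_add_distrib]
    refine Finset.sum_congr rfl fun a _ => ?_
    rw [← mul_add, ← ih (hf.wdir a) (hg.wdir a)]
    congr 1
    refine taylorTerm_congr k ?_
    filter_upwards [hf.eventually, hg.eventually] with x h1 h2
      using wdir_add h1.differentiableAt h2.differentiableAt a

theorem taylorTerm_const_mul (k : ℕ) (c : ℂ) (hf : SmoothNear f u) :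
    taylorTerm s k (fun x => c * f x) u = c • taylorTerm s k f u := by
  induction k generalizing f with
  | zero => simp [taylorTerm, Algebra.smul_def]
  | succ k ih =>
    simp only [taylorTerm, Finset.smul_sum]
    refine Finset.sum_congr rfl fun a _ => ?_
    rw [← mul_smul_comm, ← ih (hf.wdir a)]
    congr 1
    refine taylorTerm_congr k ?_
    filter_upwards [hf.eventually] with x h1
    exact wdir_clm_comp (ContinuousLinearMap.mul ℂ ℂ c) h1.differentiableAt a

theorem isEven_taylorTerm (hs : ∀ a, IsEven (s a)) (k : ℕ) : IsEven (taylorTerm s k f u) := by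
  induction k generalizing f with
  | zero => exact isEven_algebraMap _
  | succ k ih => exact IsEven.sum fun a _ => (hs a).mul ih

theorem body_taylorTerm_succ (hs : ∀ a, body (s a) = 0) (k : ℕ) :
    body (taylorTerm s (k + 1) f u) = 0 := by
  simp only [taylorTerm, map_sum, map_mul, hs, zero_mul, Finset.sum_const_zero]

/-- A Taylor term of order k is a combination of products of k souls. Together with the factors of l
there are at least `order Λ` of them. -/
theorem prod_mul_taylorTerm (hs : ∀ a, body (s a) = 0) (k : ℕ) (l : List Λ)
    (hl : ∀ x ∈ l, body x = 0) (h : order Λ ≤ l.length + k) :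
    l.prod * taylorTerm s k f u = 0 := by
  induction k generalizing f l with
  | zero => rw [nilpotent l hl h, zero_mul]
  | succ k ih =>
    simp only [taylorTerm, Finset.mul_sum, ← mul_assoc]
    refine Finset.sum_eq_zero fun a _ => ?_
    have := ih (f := wdir a f) (l ++ [s a]) (by
      intro x hx
      rcases List.mem_append.mp hx with hx | hx
      · exact hl x hx
      · rw [List.mem_singleton.mp hx, hs]) (by simp; omega)
    simpa using this

end Terms

section TayBasic

variable {φ : Fin n ⊕ Fin n → Λ} {f g : (Fin n → ℂ) → ℂ}

theorem tay_congr (h : f =ᶠ[𝓝 (bodyPt φ)] g) : tay f φ = tay g φ :=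
  Finset.sum_congr rfl fun k _ => by rw [taylorTerm_congr k h]

theorem tay_add (hf : SmoothNear f (bodyPt φ)) (hg : SmoothNear g (bodyPt φ)) :
    tay (fun x => f x + g x) φ = tay f φ + tay g φ := by
  simp only [tay, taylorTerm_add _ hf hg, smul_add, Finset.sum_add_distrib]

theorem tay_const_mul (c : ℂ) (hf : SmoothNear f (bodyPt φ)) :
    tay (fun x => c * f x) φ = c • tay f φ := by
  simp only [tay, taylorTerm_const_mul _ _ hf, Finset.smul_sum]
  exact Finset.sum_congr rfl fun k _ => smul_comm _ _ _

theorem isEven_tay (h : IsPt φ) : IsEven (tay f φ) :=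
  IsEven.sum fun k _ => (isEven_taylorTerm h.even_soul k).smul _

theorem body_tay (h : IsPt φ) : body (tay f φ) = f (bodyPt φ) := by
  obtain ⟨m, hm⟩ := Nat.exists_eq_add_of_lt (order_pos (Λ := Λ))
  rw [zero_add] at hm
  simp only [tay, hm, map_sum, map_smul]
  rw [Finset.sum_range_succ']
  simp only [body_taylorTerm_succ h.body_soul, smul_zero, Finset.sum_const_zero, zero_add]
  simp [taylorTerm]

theorem tay_of_soul_eq_zero (h : soulPt φ = 0) : tay f φ = algebraMap ℂ Λ (f (bodyPt φ)) := by
  obtain ⟨m, hm⟩ := Nat.exists_eq_add_of_lt (order_pos (Λ := Λ))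
  rw [zero_add] at hm
  simp only [tay, hm]
  rw [Finset.sum_range_succ']
  simp [taylorTerm, h]

end TayBasic

/-! ### Derivatives of Taylor evaluations -/

section TayDeriv

variable [FiniteDimensional ℂ Λ]

/-- The body as a continuous real-linear map. -/
def bodyCLM : Λ →L[ℝ] ℂ :=
  ((body (Λ := Λ)).toLinearMap.toContinuousLinearMap).restrictScalars ℝ

@[simp] theorem bodyCLM_apply (a : Λ) : bodyCLM a = body a := rfl

variable {E : Type*} [NormedAddCommGroup E] [NormedSpace ℝ E]

/-- Product rule for (s∂)ᵏf(u) with s and u both moving. The motion of u differentiates f, and the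
motion of s replaces one of k interchangeable even factors. For k = 0 the truncated index k - 1 is
harmless because of the factor k. -/
theorem hasFDerivWithinAt_taylorTerm {f : (Fin n → ℂ) → ℂ} {s : E → Fin n ⊕ Fin n → Λ}
    {u : E → Fin n → ℂ} {s' : Fin n ⊕ Fin n → E →L[ℝ] Λ} {u' : E →L[ℝ] (Fin n → ℂ)} {S : Set E}
    {x : E} (hs : ∀ a, HasFDerivWithinAt (fun y => s y a) (s' a) S x)
    (hu : HasFDerivWithinAt u u' S x) (he : ∀ a, IsEven (s x a)) (k : ℕ)
    (hf : SmoothNear f (u x)) :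
    ∃ L : E →L[ℝ] Λ, HasFDerivWithinAt (fun y => taylorTerm (s y) k f (u y)) L S x ∧
      ∀ v, L v = ∑ a, algebraMap ℂ Λ (zcoord a (u' v)) * taylorTerm (s x) k (wdir a f) (u x)
        + (k : ℂ) • ∑ a, s' a v * taylorTerm (s x) (k - 1) (wdir a f) (u x) := by
  induction k generalizing f with
  | zero =>
    refine ⟨((algebraMapCLM ℂ Λ).restrictScalars ℝ).comp ((fderiv ℝ f (u x)).comp u'), ?_, ?_⟩
    · exact ((algebraMapCLM ℂ Λ).restrictScalars ℝ).hasFDerivAt.comp_hasFDerivWithinAt x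
        (hf.differentiableAt.hasFDerivAt.comp_hasFDerivWithinAt x hu)
    · intro v
      simp [fderiv_apply_eq_sum_wdir, taylorTerm]
  | succ k ih =>
    choose L hL hL' using fun a => ih (f := wdir a f) (hf.wdir a)
    have h1 := HasFDerivWithinAt.fun_sum (u := Finset.univ) fun a _ => (hs a).mul' (hL a)
    refine ⟨_, h1, fun v => ?_⟩
    simp only [sum_apply, add_apply, smul_apply, smul_eq_mul,
      op_smul_eq_mul, hL']
    have hc : ∀ a b, taylorTerm (s x) k (wdir b (wdir a f)) (u x) =
        taylorTerm (s x) k (wdir a (wdir b f)) (u x) := fun a b =>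
      taylorTerm_congr k (by filter_upwards [hf] with y hy using wdir_comm hy b a)
    have hc' : ∀ a b, taylorTerm (s x) (k - 1) (wdir b (wdir a f)) (u x) =
        taylorTerm (s x) (k - 1) (wdir a (wdir b f)) (u x) := fun a b =>
      taylorTerm_congr _ (by filter_upwards [hf] with y hy using wdir_comm hy b a)
    simp only [Finset.sum_add_distrib, mul_add, Finset.mul_sum]
    have e1 : ∑ a, ∑ b, s x a * (algebraMap ℂ Λ (zcoord b (u' v)) *
          taylorTerm (s x) k (wdir b (wdir a f)) (u x)) =
        ∑ b, algebraMap ℂ Λ (zcoord b (u' v)) * taylorTerm (s x) (k + 1) (wdir b f) (u x) := by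
      rw [Finset.sum_comm]
      refine Finset.sum_congr rfl fun b _ => ?_
      simp only [taylorTerm, Finset.mul_sum]
      refine Finset.sum_congr rfl fun a _ => ?_
      rw [hc, ← mul_assoc, ← mul_assoc, Algebra.commutes]
    have e2 : ∑ a, s x a * ((k : ℂ) • ∑ b, s' b v *
          taylorTerm (s x) (k - 1) (wdir b (wdir a f)) (u x)) =
        (k : ℂ) • ∑ b, s' b v * taylorTerm (s x) k (wdir b f) (u x) := by
      rcases k with _ | k
      · simp
      · simp only [Finset.smul_sum, Finset.mul_sum]
        rw [Finset.sum_comm]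
        refine Finset.sum_congr rfl fun b _ => ?_
        simp only [taylorTerm, Finset.mul_sum, Finset.smul_sum]
        refine Finset.sum_congr rfl fun a _ => ?_
        rw [hc', mul_smul_comm, ← mul_assoc, ← mul_assoc, (he a).mul_eq]
        rfl
    rw [e1, e2, add_assoc]
    congr 1
    rw [Nat.add_sub_cancel, Nat.cast_add, Nat.cast_one, add_smul, one_smul]

/-- After the factorials are shifted, the velocities of body and soul multiply the same truncated
series of the first derivatives of f, so they recombine to the full velocity. -/
theorem hasFDerivWithinAt_tay {f : (Fin n → ℂ) → ℂ} {φ : E → Fin n ⊕ Fin n → Λ}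
    {φ' : Fin n ⊕ Fin n → E →L[ℝ] Λ} {S : Set E} {x : E} (hx : x ∈ S)
    (hφ : ∀ a, HasFDerivWithinAt (fun y => φ y a) (φ' a) S x)
    (hp : ∀ᶠ y in 𝓝[S] x, IsPt (φ y)) (hU : UniqueDiffWithinAt ℝ S x)
    (hf : SmoothNear f (bodyPt (φ x))) :
    ∃ L : E →L[ℝ] Λ, HasFDerivWithinAt (fun y => tay f (φ y)) L S x ∧
      ∀ v, L v = ∑ a, φ' a v * tay (wdir a f) (φ x) := by
  have hpx : IsPt (φ x) := hp.self_of_nhdsWithin hx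
  have hu : HasFDerivWithinAt (fun y => bodyPt (φ y))
      (ContinuousLinearMap.pi fun i => bodyCLM.comp (φ' (.inl i))) S x :=
    hasFDerivWithinAt_pi.mpr fun i => bodyCLM.hasFDerivAt.comp_hasFDerivWithinAt x (hφ _)
  have hz : ∀ a, HasFDerivWithinAt (fun y => zcoord a (bodyPt (φ y))) (bodyCLM.comp (φ' a)) S x := by
    intro a
    refine (bodyCLM.hasFDerivAt.comp_hasFDerivWithinAt x (hφ a)).congr_of_eventuallyEq ?_
      (hpx.body_eq a).symm
    filter_upwards [hp] with y hy using (hy.body_eq a).symm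
  -- The bodies of φ and φ̄ are conjugate along the whole family. Uniqueness of the derivative
  -- within S makes the bodies of their velocities conjugate too.
  have hzu : ∀ a v, zcoord a ((ContinuousLinearMap.pi fun i => bodyCLM.comp (φ' (.inl i))) v) =
      body (φ' a v) := by
    rintro (i | i) v
    · rfl
    · have h1 := (Complex.conjCLE : ℂ →L[ℝ] ℂ).hasFDerivAt.comp_hasFDerivWithinAt x (hz (.inl i))
      exact congrArg (fun L : E →L[ℝ] ℂ => L v) (hU.eq h1 (hz (.inr i)))
  have hs : ∀ a, HasFDerivWithinAt (fun y => soulPt (φ y) a)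
      (φ' a - ((algebraMapCLM ℂ Λ).restrictScalars ℝ).comp (bodyCLM.comp (φ' a))) S x := fun a =>
    (hφ a).sub (((algebraMapCLM ℂ Λ).restrictScalars ℝ).hasFDerivAt.comp_hasFDerivWithinAt x (hz a))
  choose L hL hL' using fun k => hasFDerivWithinAt_taylorTerm hs hu hpx.even_soul k hf
  have h1 := HasFDerivWithinAt.fun_sum (u := Finset.range (order Λ)) fun k _ =>
    (hL k).const_smul ((k.factorial : ℂ)⁻¹)
  refine ⟨_, h1, fun v => ?_⟩
  simp only [sum_apply, smul_apply, hL', hzu]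
  have hr : ∀ a, (φ' a - ((algebraMapCLM ℂ Λ).restrictScalars ℝ).comp (bodyCLM.comp (φ' a))) v =
      φ' a v - algebraMap ℂ Λ (body (φ' a v)) := fun a => rfl
  simp only [hr]
  obtain ⟨m, hm⟩ := Nat.exists_eq_add_of_lt (order_pos (Λ := Λ))
  rw [zero_add] at hm
  set A : ℕ → Λ := fun k => ∑ a, algebraMap ℂ Λ (body (φ' a v)) *
    taylorTerm (soulPt (φ x)) k (wdir a f) (bodyPt (φ x)) with hA
  set B : ℕ → Λ := fun k => ∑ a, (φ' a v - algebraMap ℂ Λ (body (φ' a v))) *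
    taylorTerm (soulPt (φ x)) k (wdir a f) (bodyPt (φ x)) with hB
  -- The truncation at `order Λ` = m + 1 terms loses nothing: a velocity minus its body is again a
  -- soul, so this last term contains m + 1 soul factors.
  have hBm : B m = 0 := by
    refine Finset.sum_eq_zero fun a _ => ?_
    have := prod_mul_taylorTerm (f := wdir a f) (u := bodyPt (φ x)) hpx.body_soul m
      [φ' a v - algebraMap ℂ Λ (body (φ' a v))] (by
        intro y hy
        rw [List.mem_singleton.mp hy, map_sub, body_algebraMap, sub_self]) (by simp; omega)
    simpa using this
  have lhs : ∑ k ∈ Finset.range (order Λ), ((k.factorial : ℂ)⁻¹) • (A k + (k : ℂ) • B (k - 1)) =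
      ∑ k ∈ Finset.range (order Λ), ((k.factorial : ℂ)⁻¹) • (A k + B k) := by
    simp only [smul_add, Finset.sum_add_distrib, hm]
    congr 1
    rw [Finset.sum_range_succ', Finset.sum_range_succ, hBm]
    simp only [Nat.cast_zero, zero_smul, smul_zero, add_zero]
    refine Finset.sum_congr rfl fun k _ => ?_
    rw [Nat.add_sub_cancel, smul_smul, Nat.factorial_succ]
    congr 1
    have : ((k : ℂ) + 1) ≠ 0 := Nat.cast_add_one_ne_zero k
    push_cast
    field_simp
  refine lhs.trans ?_
  simp only [tay, Finset.mul_sum]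
  rw [Finset.sum_comm]
  refine Finset.sum_congr rfl fun k _ => ?_
  rw [hA, hB, ← Finset.sum_add_distrib, Finset.smul_sum]
  refine Finset.sum_congr rfl fun a _ => ?_
  rw [← add_mul, add_sub_cancel, mul_smul_comm]

end TayDeriv

end Taylor

/-! ### Taylor evaluation is multiplicative and compatible with composition -/

section TaylorHom

open GrassmannAlgebra

variable {n : ℕ} {Λ : Type*} [NormedRing Λ] [NormedAlgebra ℂ Λ] [GrassmannAlgebra Λ]
  [FiniteDimensional ℂ Λ]

/-- A linear system of differential equations with nilpotent coefficients and vanishing initial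
values has only the zero solution, even if it is infinite. -/
theorem eq_zero_of_soul_ode {I J : Type*} [Fintype J] {D : I → ℝ → Λ} {c : I → J → ℝ → Λ}
    {σ : I → J → I} (hc : ∀ i j t, body (c i j t) = 0) (h0 : ∀ i, D i 0 = 0)
    (hD : ∀ i t, HasDerivAt (D i) (∑ j, c i j t * D (σ i j) t) t) (i : I) (t : ℝ) :
    D i t = 0 := by
  -- Induction on the number m of factors missing from a vanishing product of souls. Differentiating
  -- l.prod * D i produces one more soul, so the derivative vanishes by induction and the product
  -- keeps its initial value 0. The empty product with m = `order Λ` is the claim.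
  have key : ∀ m : ℕ, ∀ l : List Λ, (∀ x ∈ l, body x = 0) → order Λ ≤ l.length + m →
      ∀ i t, l.prod * D i t = 0 := by
    intro m
    induction m with
    | zero => intro l hl h i t; rw [nilpotent l hl h, zero_mul]
    | succ m ih =>
      intro l hl h i t
      have hd : ∀ t, HasDerivAt (fun t => l.prod * D i t) 0 t := by
        intro t
        convert (hD i t).const_mul l.prod using 1
        rw [Finset.mul_sum]
        refine (Finset.sum_eq_zero fun j _ => ?_).symm
        have := ih (l ++ [c i j t]) (by
          intro x hx
          rcases List.mem_append.mp hx with hx | hx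
          · exact hl x hx
          · rw [List.mem_singleton.mp hx, hc]) (by simp; omega) (σ i j) t
        simpa [mul_assoc] using this
      have := is_const_of_deriv_eq_zero (fun t => (hd t).differentiableAt)
        (fun t => (hd t).deriv) t 0
      simpa [h0] using this
  simpa using key (order Λ) [] (by simp) (by simp) i t

theorem hasDerivAt_tay {f : (Fin n → ℂ) → ℂ} {φ : ℝ → Fin n ⊕ Fin n → Λ}
    {φ' : Fin n ⊕ Fin n → Λ} {t : ℝ} (hφ : ∀ a, HasDerivAt (fun y => φ y a) (φ' a) t)
    (hp : ∀ y, IsPt (φ y)) (hf : SmoothNear f (bodyPt (φ t))) :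
    HasDerivAt (fun y => tay f (φ y)) (∑ a, φ' a * tay (wdir a f) (φ t)) t := by
  obtain ⟨L, hL, hL'⟩ := hasFDerivWithinAt_tay (S := Set.univ) (Set.mem_univ t)
    (fun a => (hφ a).hasFDerivAt.hasFDerivWithinAt) (Eventually.of_forall hp)
    uniqueDiffWithinAt_univ hf
  have := (hasFDerivWithinAt_univ.mp hL).hasDerivAt
  rw [hL'] at this
  simpa using this

theorem tay_sum {κ : Type*} {s : Finset κ} {f : κ → (Fin n → ℂ) → ℂ} {φ : Fin n ⊕ Fin n → Λ}
    (hf : ∀ i ∈ s, SmoothNear (f i) (bodyPt φ)) :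
    tay (fun x => ∑ i ∈ s, f i x) φ = ∑ i ∈ s, tay (f i) φ := by
  classical
  induction s using Finset.induction_on with
  | empty =>
    have h : SmoothNear (fun _ : Fin n → ℂ => (0 : ℂ)) (bodyPt φ) :=
      Eventually.of_forall fun x => contDiffAt_const
    have := tay_const_mul (0 : ℂ) h
    simpa using this
  | insert i s hi ih =>
    simp only [Finset.sum_insert hi]
    rw [tay_add (hf i (Finset.mem_insert_self _ _))
      (SmoothNear.sum fun j hj => hf j (Finset.mem_insert_of_mem hj)),
      ih fun j hj => hf j (Finset.mem_insert_of_mem hj)]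

/-- The segment from the body of a Grassmann-valued point to the point. -/
def radial (φ : Fin n ⊕ Fin n → Λ) (t : ℝ) : Fin n ⊕ Fin n → Λ :=
  fun a => algebraMap ℂ Λ (zcoord a (bodyPt φ)) + t • soulPt φ a

theorem body_real_smul (t : ℝ) (a : Λ) : body (t • a) = t • body a :=
  (bodyCLM (Λ := Λ)).map_smul t a

theorem isEven_real_smul (t : ℝ) {a : Λ} (ha : IsEven a) : IsEven (t • a) := by
  rw [← Complex.coe_smul]; exact ha.smul _

/-! ### Homomorphism properties, by transport along the radial segment. -/

section Radial

variable {φ : Fin n ⊕ Fin n → Λ}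

theorem body_radial (h : IsPt φ) (t : ℝ) (a : Fin n ⊕ Fin n) :
    body (radial φ t a) = zcoord a (bodyPt φ) := by
  rw [radial, map_add, body_algebraMap, body_real_smul, h.body_soul, smul_zero, add_zero]

theorem bodyPt_radial (h : IsPt φ) (t : ℝ) : bodyPt (radial φ t) = bodyPt φ :=
  funext fun i => body_radial h t (.inl i)

theorem isPt_radial (h : IsPt φ) (t : ℝ) : IsPt (radial φ t) where
  even a := (isEven_algebraMap _).add (isEven_real_smul t (h.even_soul a))
  body_eq a := by rw [body_radial h, bodyPt_radial h]

theorem soulPt_radial_zero (h : IsPt φ) : soulPt (radial φ 0) = 0 := by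
  funext a
  rw [soulPt, bodyPt_radial h]
  simp [radial]

theorem radial_one : radial φ 1 = φ := by
  funext a
  simp [radial, soulPt]

theorem hasDerivAt_tay_radial {f : (Fin n → ℂ) → ℂ} (h : IsPt φ) (hf : SmoothNear f (bodyPt φ))
    (t : ℝ) : HasDerivAt (fun t => tay f (radial φ t))
      (∑ a, soulPt φ a * tay (wdir a f) (radial φ t)) t := by
  refine hasDerivAt_tay (fun a => ?_) (isPt_radial h) (by rwa [bodyPt_radial h])
  have := ((hasDerivAt_id t).smul_const (soulPt φ a)).const_add
    (algebraMap ℂ Λ (zcoord a (bodyPt φ)))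
  simpa [radial] using this

/-- Along the radial segment the defect of a pair (f, g) has as its derivative a sum of souls times
the defects of (∂ₐf, g) and (f, ∂ₐg). At t = 0 the evaluation is at a pure body, where the defect is
zero. The resulting infinite system is handled by `eq_zero_of_soul_ode`, and the Boolean index says
which of the two functions is differentiated. -/
theorem tay_mul {f g : (Fin n → ℂ) → ℂ} (h : IsPt φ) (hf : SmoothNear f (bodyPt φ))
    (hg : SmoothNear g (bodyPt φ)) : tay (fun x => f x * g x) φ = tay f φ * tay g φ := by
  let I := {p : ((Fin n → ℂ) → ℂ) × ((Fin n → ℂ) → ℂ) //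
    SmoothNear p.1 (bodyPt φ) ∧ SmoothNear p.2 (bodyPt φ)}
  let D : I → ℝ → Λ := fun p t => tay (fun x => p.1.1 x * p.1.2 x) (radial φ t) -
    tay p.1.1 (radial φ t) * tay p.1.2 (radial φ t)
  let σ : I → (Fin n ⊕ Fin n) × Bool → I := fun p j => if j.2 then
      ⟨(wdir j.1 p.1.1, p.1.2), p.2.1.wdir _, p.2.2⟩ else
      ⟨(p.1.1, wdir j.1 p.1.2), p.2.1, p.2.2.wdir _⟩
  have := eq_zero_of_soul_ode (D := D) (σ := σ) (c := fun _ j _ => soulPt φ j.1)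
    (fun _ j _ => h.body_soul _) ?_ ?_ ⟨(f, g), hf, hg⟩ 1
  · simp only [D, radial_one] at this
    exact sub_eq_zero.mp this
  · intro p
    simp only [D, tay_of_soul_eq_zero (soulPt_radial_zero h), map_mul, sub_self]
  · rintro ⟨⟨f, g⟩, hf, hg⟩ t
    have h1 := (hasDerivAt_tay_radial h (hf.mul hg) t).sub
      ((hasDerivAt_tay_radial h hf t).mul (hasDerivAt_tay_radial h hg t))
    refine h1.congr_deriv ?_
    rw [Fintype.sum_prod_type, Finset.sum_mul, Finset.mul_sum, ← Finset.sum_add_distrib,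
      ← Finset.sum_sub_distrib]
    refine Finset.sum_congr rfl fun a _ => ?_
    rw [Fintype.sum_bool]
    simp only [D, σ, if_true, Bool.false_eq_true, if_false]
    have e : tay (wdir a fun x => f x * g x) (radial φ t) =
        tay (fun x => wdir a f x * g x) (radial φ t) +
          tay (fun x => f x * wdir a g x) (radial φ t) := by
      rw [← tay_add (by rw [bodyPt_radial h]; exact (hf.wdir a).mul hg)
        (by rw [bodyPt_radial h]; exact hf.mul (hg.wdir a))]
      refine tay_congr ?_
      rw [bodyPt_radial h]
      filter_upwards [hf.eventually, hg.eventually] with x h1 h2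
        using wdir_mul h1.differentiableAt h2.differentiableAt a
    rw [e, ← mul_assoc (tay f _), ← (h.even_soul a).mul_eq (tay f _)]
    noncomm_ring

theorem isPt_tay {τ : (Fin n → ℂ) → (Fin n → ℂ)} (h : IsPt φ) :
    IsPt (fun a => tay (fun x => zcoord a (τ x)) φ) ∧
      bodyPt (fun a => tay (fun x => zcoord a (τ x)) φ) = τ (bodyPt φ) := by
  have hb : bodyPt (fun a => tay (fun x => zcoord a (τ x)) φ) = τ (bodyPt φ) :=
    funext fun i => body_tay h
  refine ⟨⟨fun a => isEven_tay h, fun a => ?_⟩, hb⟩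
  rw [hb]
  exact body_tay h

theorem SmoothNear.zcoord_comp {τ : (Fin n → ℂ) → (Fin n → ℂ)} {u : Fin n → ℂ}
    (hτ : SmoothNear τ u) (a : Fin n ⊕ Fin n) : SmoothNear (fun x => zcoord a (τ x)) u := by
  have h : ∀ i, SmoothNear (fun x => τ x i) u := fun i => by
    filter_upwards [hτ] with x hx using (contDiffAt_pi.mp hx) i
  rcases a with i | i
  · exact h i
  · exact (h i).conj

theorem SmoothNear.comp {V : Type*} [NormedAddCommGroup V] [NormedSpace ℂ V]
    {f : (Fin n → ℂ) → V} {τ : (Fin n → ℂ) → (Fin n → ℂ)}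
    {u : Fin n → ℂ} (hf : SmoothNear f (τ u)) (hτ : SmoothNear τ u) :
    SmoothNear (fun x => f (τ x)) u := by
  filter_upwards [hτ.contDiffAt.continuousAt.eventually hf, hτ] with x h1 h2 using h1.comp x h2

/-- The same argument as for products. By the chain rule and multiplicativity, the defect of f has
as its derivative a combination of the defects of the ∂ᵦf, with coefficients linear in the souls. -/
theorem tay_comp {f : (Fin n → ℂ) → ℂ} {τ : (Fin n → ℂ) → (Fin n → ℂ)} (h : IsPt φ)
    (hτ : SmoothNear τ (bodyPt φ)) (hf : SmoothNear f (τ (bodyPt φ))) :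
    tay (fun x => f (τ x)) φ = tay f (fun a => tay (fun x => zcoord a (τ x)) φ) := by
  let I := {f : (Fin n → ℂ) → ℂ // SmoothNear f (τ (bodyPt φ))}
  let ψ : ℝ → Fin n ⊕ Fin n → Λ := fun t a => tay (fun x => zcoord a (τ x)) (radial φ t)
  have hψb : ∀ t, bodyPt (ψ t) = τ (bodyPt φ) := fun t => by
    rw [← bodyPt_radial h t]; exact (isPt_tay (isPt_radial h t)).2
  let D : I → ℝ → Λ := fun f t => tay (fun x => f.1 (τ x)) (radial φ t) - tay f.1 (ψ t)
  have hz := hτ.zcoord_comp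
  have := eq_zero_of_soul_ode (D := D) (J := Fin n ⊕ Fin n)
    (σ := fun f a => ⟨wdir a f.1, f.2.wdir a⟩)
    (c := fun _ b t => ∑ a, soulPt φ a * tay (wdir a fun x => zcoord b (τ x)) (radial φ t))
    ?_ ?_ ?_ ⟨f, hf⟩ 1
  · simp only [D, ψ, radial_one] at this
    exact sub_eq_zero.mp this
  · intro _ b t
    simp [map_sum, h.body_soul]
  · intro f
    simp only [D]
    have h0 : soulPt (ψ 0) = 0 := by
      funext a
      rw [soulPt, hψb]
      simp [ψ, tay_of_soul_eq_zero (soulPt_radial_zero h), bodyPt_radial h]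
    rw [tay_of_soul_eq_zero (soulPt_radial_zero h), tay_of_soul_eq_zero h0, hψb, bodyPt_radial h,
      sub_self]
  · rintro ⟨f, hf⟩ t
    have h1 := (hasDerivAt_tay_radial h (hf.comp hτ) t).sub
      (hasDerivAt_tay (φ := ψ) (fun b => hasDerivAt_tay_radial h (hz b) t)
        (fun y => (isPt_tay (isPt_radial h y)).1) (by rwa [hψb]))
    refine h1.congr_deriv ?_
    have e : ∀ a, tay (wdir a fun x => f (τ x)) (radial φ t) =
        ∑ b, tay (fun x => wdir b f (τ x)) (radial φ t) *
          tay (wdir a fun x => zcoord b (τ x)) (radial φ t) := by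
      intro a
      have hb : ∀ b, SmoothNear (fun x => wdir b f (τ x)) (bodyPt (radial φ t)) := fun b => by
        rw [bodyPt_radial h]; exact (hf.wdir b).comp hτ
      have hb' : ∀ b, SmoothNear (wdir a fun x => zcoord b (τ x)) (bodyPt (radial φ t)) :=
        fun b => by rw [bodyPt_radial h]; exact (hz b).wdir a
      simp only [← tay_mul (isPt_radial h t) (hb _) (hb' _)]
      rw [← tay_sum fun b _ => (hb b).mul (hb' b)]
      refine tay_congr ?_
      rw [bodyPt_radial h]
      filter_upwards [hτ, hτ.contDiffAt.continuousAt.eventually hf] with x h1 h2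
      exact wdir_comp (h2.differentiableAt (by simp)) (h1.differentiableAt (by simp)) a
    simp only [e, D, mul_sub, Finset.sum_sub_distrib]
    congr 1
    simp only [Finset.mul_sum, Finset.sum_mul]
    rw [Finset.sum_comm]
    refine Finset.sum_congr rfl fun b _ => Finset.sum_congr rfl fun a _ => ?_
    rw [(isEven_tay (isPt_radial h t)).mul_eq, mul_assoc]

/-- The Taylor expansion to first order in even elements with vanishing products. -/
theorem tay_add_nilpotent {f : (Fin n → ℂ) → ℂ} {ψ : Fin n ⊕ Fin n → Λ} (h : IsPt φ)
    (he : ∀ a, IsEven (ψ a)) (hb : ∀ a, body (ψ a) = 0) (hn : ∀ a b, ψ a * ψ b = 0)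
    (hf : SmoothNear f (bodyPt φ)) :
    tay f (fun a => φ a + ψ a) = tay f φ + ∑ a, ψ a * tay (wdir a f) φ := by
  let χ : ℝ → Fin n ⊕ Fin n → Λ := fun t a => φ a + t • ψ a
  have hχb : ∀ t, bodyPt (χ t) = bodyPt φ := fun t => funext fun i => by
    simp [bodyPt, χ, body_real_smul, hb]
  have hχ : ∀ t, IsPt (χ t) := fun t =>
    ⟨fun a => (h.even a).add (isEven_real_smul t (he a)), fun a => by
      rw [hχb, ← h.body_eq]; simp [χ, body_real_smul, hb]⟩
  have hd : ∀ {g : (Fin n → ℂ) → ℂ}, SmoothNear g (bodyPt φ) → ∀ t,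
      HasDerivAt (fun t => tay g (χ t)) (∑ a, ψ a * tay (wdir a g) (χ t)) t := by
    intro g hg t
    refine hasDerivAt_tay (fun a => ?_) hχ (by rwa [hχb])
    have := ((hasDerivAt_id t).smul_const (ψ a)).const_add (φ a)
    simpa [χ] using this
  have hχ0 : χ 0 = φ := funext fun a => by simp [χ]
  have hχ1 : χ 1 = fun a => φ a + ψ a := funext fun a => by simp [χ]
  -- Multiplication by ψₐ removes all dependence on t, since each further derivative brings a factor
  -- ψ. Hence the derivative of the evaluation itself is constant along the line, and there are no
  -- terms of second order.
  have hc : ∀ {g : (Fin n → ℂ) → ℂ}, SmoothNear g (bodyPt φ) → ∀ a t,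
      ψ a * tay g (χ t) = ψ a * tay g φ := by
    intro g hg a t
    have hd' : ∀ t, HasDerivAt (fun t => ψ a * tay g (χ t)) 0 t := by
      intro t
      refine ((hd hg t).const_mul (ψ a)).congr_deriv ?_
      simp only [Finset.mul_sum, ← mul_assoc, hn, zero_mul, Finset.sum_const_zero]
    have := is_const_of_deriv_eq_zero (fun t => (hd' t).differentiableAt)
      (fun t => (hd' t).deriv) t 0
    simpa only [hχ0] using this
  have hd' : ∀ t, HasDerivAt (fun t => tay f (χ t) - t • ∑ a, ψ a * tay (wdir a f) φ) 0 t := by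
    intro t
    refine ((hd hf t).sub ((hasDerivAt_id t).smul_const _)).congr_deriv ?_
    simp [hc (hf.wdir _)]
  have := is_const_of_deriv_eq_zero (fun t => (hd' t).differentiableAt)
    (fun t => (hd' t).deriv) 1 0
  simp only [hχ1, hχ0, one_smul, zero_smul, sub_zero] at this
  exact sub_eq_iff_eq_add.mp this

end Radial

/-! ### Smoothness of Taylor evaluations. -/

section Smooth

variable {E : Type*} [NormedAddCommGroup E] [NormedSpace ℝ E]

theorem contDiffWithinAt_tay {f : (Fin n → ℂ) → ℂ} {φ : E → Fin n ⊕ Fin n → Λ} {S : Set E} {x : E}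
    (hφ : ∀ a, ContDiffWithinAt ℝ ∞ (fun y => φ y a) S x) (hf : SmoothNear f (bodyPt (φ x))) :
    ContDiffWithinAt ℝ ∞ (fun y => tay f (φ y)) S x := by
  have hu : ContDiffWithinAt ℝ ∞ (fun y => bodyPt (φ y)) S x :=
    contDiffWithinAt_pi.mpr fun i => (bodyCLM (Λ := Λ)).contDiff.contDiffAt.comp_contDiffWithinAt x (hφ (.inl i))
  have hz : ∀ a, ContDiffWithinAt ℝ ∞ (fun y => zcoord a (bodyPt (φ y))) S x := by
    have h1 : ∀ i, ContDiffWithinAt ℝ ∞ (fun y => bodyPt (φ y) i) S x :=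
      contDiffWithinAt_pi.mp hu
    rintro (i | i)
    · exact h1 i
    · exact Complex.conjCLE.contDiff.contDiffAt.comp_contDiffWithinAt x (h1 i)
  have hs : ∀ a, ContDiffWithinAt ℝ ∞ (fun y => soulPt (φ y) a) S x := fun a =>
    (hφ a).sub ((contDiffAt_algebraMap _).comp_contDiffWithinAt x (hz a))
  have ht : ∀ k, ∀ {g : (Fin n → ℂ) → ℂ}, SmoothNear g (bodyPt (φ x)) →
      ContDiffWithinAt ℝ ∞ (fun y => taylorTerm (soulPt (φ y)) k g (bodyPt (φ y))) S x := by
    intro k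
    induction k with
    | zero =>
      intro g hg
      exact (contDiffAt_algebraMap _).comp_contDiffWithinAt x
        (hg.contDiffAt.comp_contDiffWithinAt x hu)
    | succ k ih =>
      intro g hg
      exact ContDiffWithinAt.sum fun a _ => (hs a).mul (ih (hg.wdir a))
  refine ContDiffWithinAt.sum fun k _ => ?_
  have h2 := ((((k.factorial : ℂ)⁻¹) • ContinuousLinearMap.id ℂ Λ).restrictScalars ℝ).contDiff
    (n := ∞)
  exact h2.contDiffAt.comp_contDiffWithinAt x (ht k hf)

end Smooth

/-- The coordinates of a Grassmann-valued point of the target. -/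
def pt (φ φb : Fin n → SForm Λ) : Fin n ⊕ Fin n → Λ :=
  Sum.elim (fun i => (φ i).c0) (fun i => (φb i).c0)

/-- The inclusion of `Λ` as the forms of degree zero, as a continuous linear map. -/
def ofCLM : Λ →L[ℂ] SForm Λ := (SForm.ofHom (Λ := Λ)).toLinearMap.toContinuousLinearMap

/-- The definition of `eval` differentiates the whole iterated expression at each step, whereas
`taylorTerm` puts the new derivative on f inside. They agree because the souls are constant in u. -/
theorem eval_eq_of_tay {f : (Fin n → ℂ) → ℂ} {φ φb : Fin n → SForm Λ}
    (hφ : ∀ i, (φ i).IsEvenFn) (hφb : ∀ i, (φb i).IsEvenFn)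
    (hf : SmoothNear f (bodyPt (pt φ φb))) : eval f φ φb = SForm.of (tay f (pt φ φb)) := by
  set u := bodyPt (pt φ φb) with hu
  set s := soulPt (pt φ φb) with hs
  have hs1 : ∀ i, φ i - SForm.const (u i) = SForm.of (s (.inl i)) := fun i => by
    rw [(hφ i).eq_of]
    ext <;> simp [SForm.const, hs, soulPt, pt, zcoord, hu]
  have hs2 : ∀ i, φb i - SForm.const (starRingEnd ℂ (u i)) = SForm.of (s (.inr i)) := fun i => by
    rw [(hφb i).eq_of]
    ext <;> simp [SForm.const, hs, soulPt, pt, zcoord, hu]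
  -- Equality is needed on a neighbourhood, since the next iteration differentiates it.
  have key : ∀ k, ∀ {u}, SmoothNear f u →
      (soulDeriv (fun i => SForm.of (s (.inl i))) (fun i => SForm.of (s (.inr i))))^[k]
        (fun x => SForm.const (f x)) =ᶠ[𝓝 u] fun x => SForm.of (taylorTerm s k f x) := by
    intro k
    induction k with
    | zero => intro u _; exact Eventually.of_forall fun x => rfl
    | succ k ih =>
      intro u hf
      filter_upwards [hf.eventually] with x hx
      rw [Function.iterate_succ_apply']
      have h1 : ∀ a, wdir a ((soulDeriv (fun i => SForm.of (s (.inl i)))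
          (fun i => SForm.of (s (.inr i))))^[k] (fun x => SForm.const (f x))) x =
          SForm.of (taylorTerm s k (wdir a f) x) := by
        intro a
        rw [(wdir_congr (ih hx) a).self_of_nhds, ← wdir_taylorTerm k hx]
        exact wdir_clm_comp (ofCLM (Λ := Λ))
          ((contDiffAt_taylorTerm k hx.contDiffAt).differentiableAt (by simp)) a
      simp only [soulDeriv, taylorTerm]
      rw [SForm.of_sum, Fintype.sum_sum_type, Finset.sum_add_distrib]
      congr 1 <;> refine Finset.sum_congr rfl fun i _ => ?_
      · rw [SForm.of_mul, ← h1 (.inl i)]; rfl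
      · rw [SForm.of_mul, ← h1 (.inr i)]; rfl
  have h2 : eval f φ φb = ∑ k ∈ Finset.range (order Λ), ((k.factorial : ℂ)⁻¹) •
      ((soulDeriv (fun i => φ i - SForm.const (u i))
        (fun i => φb i - SForm.const (starRingEnd ℂ (u i))))^[k] (fun x => SForm.const (f x))) u :=
    rfl
  rw [h2]
  simp only [hs1, hs2]
  rw [tay, SForm.of_sum]
  refine Finset.sum_congr rfl fun k _ => ?_
  rw [(key k hf).self_of_nhds, SForm.of_smul]

end TaylorHom

/-! ### Calculus of forms on the disk -/

section DiskCalculus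

theorem convex_disk : Convex ℝ disk := convex_closedBall _ _

theorem interior_disk : interior disk = Metric.ball (0 : ℂ) 1 :=
  interior_closedBall _ one_ne_zero

theorem uniqueDiffOn_disk : UniqueDiffOn ℝ disk :=
  uniqueDiffOn_convex convex_disk ⟨0, by rw [interior_disk]; simp⟩

theorem disk_subset_closure_interior : disk ⊆ closure (interior disk) := by
  rw [interior_disk, closure_ball _ one_ne_zero]; rfl

/-- Relatively open subsets of the closed disk. -/
structure IsDiskOpen (D : Set ℂ) : Prop where
  subset : D ⊆ disk
  mem_nhdsWithin : ∀ p ∈ D, D ∈ 𝓝[disk] p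

/-- Smoothness (up to the boundary) on a subset of the closed disk. -/
def DiskSmoothOn {V : Type*} [NormedAddCommGroup V] [NormedSpace ℂ V] (D : Set ℂ) (f : ℂ → V) :
    Prop := ∀ p ∈ D, ContDiffWithinAt ℝ ∞ f disk p

/-- The derivative on the closed disk in the direction `v`. -/
def pd {V : Type*} [NormedAddCommGroup V] [NormedSpace ℂ V] (v : ℂ) (f : ℂ → V) (p : ℂ) : V :=
  fderivWithin ℝ f disk p v

section General

variable {V V' : Type*} [NormedAddCommGroup V] [NormedSpace ℂ V]
  [NormedAddCommGroup V'] [NormedSpace ℂ V'] {D : Set ℂ} {f g : ℂ → V} {p : ℂ}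

theorem DiskSmoothOn.differentiableWithinAt (hf : DiskSmoothOn D f) (hp : p ∈ D) :
    DifferentiableWithinAt ℝ f disk p := (hf p hp).differentiableWithinAt (by simp)

theorem DiskSmoothOn.continuousOn (hD : IsDiskOpen D) (hf : DiskSmoothOn D f) :
    ContinuousOn f D := fun p hp => (hf p hp).continuousWithinAt.mono hD.subset

theorem DiskSmoothOn.congr (hD : IsDiskOpen D) (hf : DiskSmoothOn D f) (h : Set.EqOn g f D) :
    DiskSmoothOn D g := fun p hp =>
  (hf p hp).congr_of_eventuallyEq (by filter_upwards [hD.mem_nhdsWithin p hp] with x hx using h hx)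
    (h hp)

theorem DiskSmoothOn.add (hf : DiskSmoothOn D f) (hg : DiskSmoothOn D g) :
    DiskSmoothOn D (fun p => f p + g p) := fun p hp => (hf p hp).add (hg p hp)

theorem DiskSmoothOn.sub (hf : DiskSmoothOn D f) (hg : DiskSmoothOn D g) :
    DiskSmoothOn D (fun p => f p - g p) := fun p hp => (hf p hp).sub (hg p hp)

theorem DiskSmoothOn.neg (hf : DiskSmoothOn D f) : DiskSmoothOn D (fun p => -f p) :=
  fun p hp => (hf p hp).neg

theorem DiskSmoothOn.sum {κ : Type*} {s : Finset κ} {f : κ → ℂ → V}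
    (hf : ∀ i ∈ s, DiskSmoothOn D (f i)) : DiskSmoothOn D (fun p => ∑ i ∈ s, f i p) :=
  fun p hp => ContDiffWithinAt.sum fun i hi => hf i hi p hp

theorem DiskSmoothOn.clm_comp (L : V →L[ℂ] V') (hf : DiskSmoothOn D f) :
    DiskSmoothOn D (fun p => L (f p)) :=
  fun p hp => (L.restrictScalars ℝ).contDiff.contDiffAt.comp_contDiffWithinAt p (hf p hp)

theorem DiskSmoothOn.smul (c : ℂ) (hf : DiskSmoothOn D f) : DiskSmoothOn D (fun p => c • f p) :=
  hf.clm_comp (c • ContinuousLinearMap.id ℂ V)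

theorem DiskSmoothOn.real_smul {r : ℂ → ℝ} (hr : ContDiff ℝ ∞ r) (hf : DiskSmoothOn D f) :
    DiskSmoothOn D (fun p => r p • f p) :=
  fun p hp => hr.contDiffWithinAt.smul (hf p hp)

theorem DiskSmoothOn.lm_comp [FiniteDimensional ℂ V] (L : V →ₗ[ℂ] V') (hf : DiskSmoothOn D f) :
    DiskSmoothOn D (fun p => L (f p)) :=
  hf.clm_comp L.toContinuousLinearMap

theorem DiskSmoothOn.pd (hD : IsDiskOpen D) (hf : DiskSmoothOn D f) (v : ℂ) :
    DiskSmoothOn D (pd v f) := fun p hp =>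
  ((hf p hp).fderivWithin_right uniqueDiffOn_disk (m := ∞) (by simp)
    (hD.subset hp)).clm_apply contDiffWithinAt_const

theorem pd_congr (hD : IsDiskOpen D) (h : Set.EqOn f g D) (hp : p ∈ D) (v : ℂ) :
    pd v f p = pd v g p := by
  unfold pd
  rw [EventuallyEq.fderivWithin_eq ?_ (h hp)]
  filter_upwards [hD.mem_nhdsWithin p hp] with x hx using h hx

theorem pd_clm_comp (hD : IsDiskOpen D) (L : V →L[ℂ] V') (hf : DiskSmoothOn D f) (hp : p ∈ D)
    (v : ℂ) : pd v (fun q => L (f q)) p = L (pd v f p) := by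
  have h := (L.restrictScalars ℝ).hasFDerivAt.comp_hasFDerivWithinAt p
    (hf.differentiableWithinAt hp).hasFDerivWithinAt
  exact congrArg (fun M : ℂ →L[ℝ] V' => M v)
    (h.fderivWithin (uniqueDiffOn_disk p (hD.subset hp)))

theorem pd_lm_comp [FiniteDimensional ℂ V] (hD : IsDiskOpen D) (L : V →ₗ[ℂ] V')
    (hf : DiskSmoothOn D f) (hp : p ∈ D) (v : ℂ) :
    pd v (fun q => L (f q)) p = L (pd v f p) :=
  pd_clm_comp hD L.toContinuousLinearMap hf hp v

theorem pd_add (hD : IsDiskOpen D) (hf : DiskSmoothOn D f) (hg : DiskSmoothOn D g) (hp : p ∈ D)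
    (v : ℂ) : pd v (fun q => f q + g q) p = pd v f p + pd v g p := by
  unfold pd
  rw [fderivWithin_fun_add (uniqueDiffOn_disk p (hD.subset hp)) (hf.differentiableWithinAt hp)
    (hg.differentiableWithinAt hp)]
  rfl

/-- Symmetry of the second derivative persists at boundary points because the disk is contained in
the closure of its interior. -/
theorem pd_comm (hD : IsDiskOpen D) (hf : DiskSmoothOn D f) (hp : p ∈ D) (v w : ℂ) :
    pd v (pd w f) p = pd w (pd v f) p := by
  have hs : IsSymmSndFDerivWithinAt ℝ f disk p :=
    (hf p hp).isSymmSndFDerivWithinAt (by simpa using ENat.LEInfty.out) uniqueDiffOn_disk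
      (disk_subset_closure_interior (hD.subset hp)) (hD.subset hp)
  have hd : DifferentiableWithinAt ℝ (fderivWithin ℝ f disk) disk p :=
    ((hf p hp).fderivWithin_right uniqueDiffOn_disk (m := ∞) (by simp)
      (hD.subset hp)).differentiableWithinAt (by simp)
  have h2 : ∀ v w, pd v (pd w f) p = fderivWithin ℝ (fderivWithin ℝ f disk) disk p v w := by
    intro v w
    unfold pd
    rw [fderivWithin_clm_apply (uniqueDiffOn_disk p (hD.subset hp)) hd
      (differentiableWithinAt_const _)]
    simp
  rw [h2, h2]
  exact hs v w

end General

variable {Λ : Type*} [NormedRing Λ] [NormedAlgebra ℂ Λ] [FiniteDimensional ℂ Λ]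

instance : FiniteDimensional ℂ (SForm Λ) :=
  inferInstanceAs (FiniteDimensional ℂ (Λ × Λ × Λ × Λ))

variable [GrassmannAlgebra Λ]

/-- The product of forms as a continuous bilinear map. -/
def mulCLM : SForm Λ →L[ℂ] SForm Λ →L[ℂ] SForm Λ :=
  (LinearMap.toContinuousLinearMap.toLinearMap ∘ₗ
    LinearMap.mul ℂ (SForm Λ)).toContinuousLinearMap

variable {D : Set ℂ} {f g : ℂ → SForm Λ} {p : ℂ}

/-- The product of forms as a continuous real-bilinear map. -/
def mulCLMReal : SForm Λ →L[ℝ] SForm Λ →L[ℝ] SForm Λ :=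
  (ContinuousLinearMap.restrictScalarsL ℂ (SForm Λ) (SForm Λ) ℝ ℝ).comp
    (mulCLM.restrictScalars ℝ)

theorem DiskSmoothOn.mul (hf : DiskSmoothOn D f) (hg : DiskSmoothOn D g) :
    DiskSmoothOn D (fun p => f p * g p) := fun p hp =>
  (mulCLMReal (Λ := Λ)).isBoundedBilinearMap.contDiff.contDiffAt.comp_contDiffWithinAt p
    ((hf p hp).prodMk (hg p hp))

theorem diskSmoothOn_const (w : SForm Λ) : DiskSmoothOn D (fun _ => w) :=
  fun _ _ => contDiffWithinAt_const

theorem pd_mul (hD : IsDiskOpen D) (hf : DiskSmoothOn D f) (hg : DiskSmoothOn D g) (hp : p ∈ D)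
    (v : ℂ) : pd v (fun q => f q * g q) p = pd v f p * g p + f p * pd v g p := by
  have h := ((mulCLMReal (Λ := Λ)).isBoundedBilinearMap.hasFDerivAt
    (f p, g p)).comp_hasFDerivWithinAt p
    ((hf.differentiableWithinAt hp).hasFDerivWithinAt.prodMk
      (hg.differentiableWithinAt hp).hasFDerivWithinAt)
  refine (congrArg (fun M : ℂ →L[ℝ] SForm Λ => M v)
    (h.fderivWithin (uniqueDiffOn_disk p (hD.subset hp)))).trans ?_
  exact add_comm (f p * pd v g p) (pd v f p * g p)

namespace SForm

theorem iota_eq (p : ℂ) (w : SForm Λ) : iota p w = p.re • iota 1 w + p.im • iota Complex.I w := by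
  rw [← Complex.coe_smul, ← Complex.coe_smul]
  ext <;> simp [-Complex.coe_smul, iota]
  abel

end SForm

open SForm

theorem DiskSmoothOn.iota (hf : DiskSmoothOn D f) :
    DiskSmoothOn D (fun p => SForm.iota p (f p)) := by
  have h : ∀ q : ℂ, DiskSmoothOn D (fun p => SForm.iota q (f p)) := fun q =>
    hf.lm_comp (iotaL q)
  intro p hp
  have := ((h 1).real_smul Complex.reCLM.contDiff).add
    ((h Complex.I).real_smul Complex.imCLM.contDiff) p hp
  refine this.congr (fun q _ => SForm.iota_eq q _) (SForm.iota_eq p _)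

/-- The contraction is real-linear in the base point, so its derivative in the direction v is
contraction with the value of the rotation field at v. -/
theorem pd_iota (hD : IsDiskOpen D) (hf : DiskSmoothOn D f) (hp : p ∈ D) (v : ℂ) :
    pd v (fun q => SForm.iota q (f q)) p = SForm.iota v (f p) + SForm.iota p (pd v f p) := by
  have hd := (hf.differentiableWithinAt hp).hasFDerivWithinAt
  have h1 : ∀ w : ℂ, HasFDerivWithinAt (fun q => SForm.iota w (f q))
      (((iotaL w).toContinuousLinearMap.restrictScalars ℝ).comp (fderivWithin ℝ f disk p))
      disk p := fun w =>
    ((iotaL w).toContinuousLinearMap.restrictScalars ℝ).hasFDerivAt.comp_hasFDerivWithinAt p hd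
  have h2 := (Complex.reCLM.hasFDerivWithinAt.smul (h1 1)).add
    (Complex.imCLM.hasFDerivWithinAt.smul (h1 Complex.I))
  have h3 : HasFDerivWithinAt (fun q => SForm.iota q (f q)) _ disk p :=
    h2.congr (fun q _ => SForm.iota_eq q _) (SForm.iota_eq p _)
  refine (congrArg (fun M : ℂ →L[ℝ] SForm Λ => M v)
    (h3.fderivWithin (uniqueDiffOn_disk p (hD.subset hp)))).trans ?_
  rw [SForm.iota_eq v, SForm.iota_eq p]
  change (p.re • SForm.iota 1 (pd v f p) + v.re • SForm.iota 1 (f p)) +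
    (p.im • SForm.iota Complex.I (pd v f p) + v.im • SForm.iota Complex.I (f p)) = _
  abel

theorem deRham_apply (f : ℂ → SForm Λ) (p : ℂ) :
    deRham f p = dx1 * pd 1 f p + dx2 * pd Complex.I f p := rfl

theorem DiskSmoothOn.deRham (hD : IsDiskOpen D) (hf : DiskSmoothOn D f) :
    DiskSmoothOn D (deRham f) :=
  ((diskSmoothOn_const dx1).mul (hf.pd hD 1)).add
    ((diskSmoothOn_const dx2).mul (hf.pd hD Complex.I))

theorem DiskSmoothOn.star (hf : DiskSmoothOn D f) :
    DiskSmoothOn D (fun p => SForm.star (f p)) := hf.lm_comp starL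

theorem DiskSmoothOn.totalParity (hf : DiskSmoothOn D f) :
    DiskSmoothOn D (fun p => totalParity (f p)) := hf.lm_comp (SForm.totalParity (Λ := Λ)).toLinearMap

theorem DiskSmoothOn.lie (hD : IsDiskOpen D) (hf : DiskSmoothOn D f) : DiskSmoothOn D (lie f) :=
  (hf.iota.deRham hD).add (hf.deRham hD).iota

theorem deRham_congr (hD : IsDiskOpen D) (h : Set.EqOn f g D) (hp : p ∈ D) :
    deRham f p = deRham g p := by
  simp only [deRham_apply, pd_congr hD h hp]

theorem lie_congr (hD : IsDiskOpen D) (h : Set.EqOn f g D) (hp : p ∈ D) :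
    lie f p = lie g p := by
  have h' : Set.EqOn (fun q => SForm.iota q (f q)) (fun q => SForm.iota q (g q)) D :=
    fun q hq => by simp only [h hq]
  simp only [lie, deRham_congr hD h' hp, deRham_congr hD h hp]

theorem deRham_add (hD : IsDiskOpen D) (hf : DiskSmoothOn D f) (hg : DiskSmoothOn D g)
    (hp : p ∈ D) : deRham (fun q => f q + g q) p = deRham f p + deRham g p := by
  simp only [deRham_apply, pd_add hD hf hg hp, mul_add]; abel

theorem pd_zero (v : ℂ) : pd v (fun _ => (0 : SForm Λ)) p = 0 := by simp [pd]

theorem pd_const (w : SForm Λ) (v : ℂ) : pd v (fun _ => w) p = 0 := by simp [pd]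

theorem deRham_zero : deRham (fun _ => (0 : SForm Λ)) p = 0 := by
  simp only [deRham_apply, pd_zero, mul_zero, add_zero]

theorem deRham_neg (hD : IsDiskOpen D) (hf : DiskSmoothOn D f) (hp : p ∈ D) :
    deRham (fun q => -f q) p = -deRham f p := by
  have h : ∀ v, pd v (fun q => -f q) p = -pd v f p := fun v =>
    pd_lm_comp hD (-LinearMap.id) hf hp v
  simp only [deRham_apply, h, mul_neg]; abel

theorem deRham_smul (hD : IsDiskOpen D) (c : ℂ) (hf : DiskSmoothOn D f) (hp : p ∈ D) :
    deRham (fun q => c • f q) p = c • deRham f p := by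
  have h : ∀ v, pd v (fun q => c • f q) p = c • pd v f p := fun v =>
    pd_lm_comp hD (c • LinearMap.id) hf hp v
  simp only [deRham_apply, h, mul_smul_comm, smul_add]

theorem deRham_mul (hD : IsDiskOpen D) (hf : DiskSmoothOn D f) (hg : DiskSmoothOn D g)
    (hp : p ∈ D) :
    deRham (fun q => f q * g q) p = deRham f p * g p + totalParity (f p) * deRham g p := by
  simp only [deRham_apply, pd_mul hD hf hg hp, mul_add, add_mul, ← mul_assoc,
    odd_dx1.mul_eq (f p), odd_dx2.mul_eq (f p)]
  abel

theorem deRham_odd_const_mul (hD : IsDiskOpen D) {w : SForm Λ} (hw : w.Odd)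
    (hf : DiskSmoothOn D f) (hp : p ∈ D) :
    deRham (fun q => w * f q) p = -(w * deRham f p) := by
  rw [deRham_mul hD (diskSmoothOn_const w) hf hp, deRham_apply (fun _ => w), pd_const, pd_const,
    show SForm.totalParity w = -w from hw]
  simp

theorem deRham_deRham (hD : IsDiskOpen D) (hf : DiskSmoothOn D f) (hp : p ∈ D) :
    deRham (deRham f) p = 0 := by
  have h : ∀ v, pd v (deRham f) p = dx1 * pd v (pd 1 f) p + dx2 * pd v (pd Complex.I f) p := by
    intro v
    have e : deRham f = fun q => dx1 * pd 1 f q + dx2 * pd Complex.I f q := rfl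
    rw [e, pd_add hD ((diskSmoothOn_const dx1).mul (hf.pd hD 1))
      ((diskSmoothOn_const dx2).mul (hf.pd hD Complex.I)) hp,
      pd_mul hD (diskSmoothOn_const dx1) (hf.pd hD 1) hp,
      pd_mul hD (diskSmoothOn_const dx2) (hf.pd hD Complex.I) hp, pd_const, pd_const]
    simp
  rw [deRham_apply, h, h, pd_comm hD hf hp Complex.I 1]
  simp only [mul_add, ← mul_assoc, odd_dx1.mul_self, odd_dx2.mul_self,
    (odd_dx1 (Λ := Λ)).anticomm odd_dx2]
  simp

theorem totalParity_deRham (hD : IsDiskOpen D) (hf : DiskSmoothOn D f) (hp : p ∈ D) :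
    totalParity (deRham f p) = -deRham (fun q => totalParity (f q)) p := by
  have h : ∀ v, pd v (fun q => SForm.totalParity (f q)) p = SForm.totalParity (pd v f p) :=
    fun v => pd_lm_comp hD SForm.totalParity.toLinearMap hf hp v
  simp only [deRham_apply, h, map_add, map_mul, show SForm.totalParity (dx1 : SForm Λ) = -dx1 from
    odd_dx1, show SForm.totalParity (dx2 : SForm Λ) = -dx2 from odd_dx2]
  noncomm_ring

/-- The Lie derivative of the coordinate one-forms, extended to a derivation. -/
def lieFrame (w : SForm Λ) : SForm Λ := dx1 * SForm.iota 1 w + dx2 * SForm.iota Complex.I w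

/-- In Cartan's formula the terms dxᵏ ∧ ι ∂ₖf cancel. What survives is the derivative of the
coefficients along the velocity i·p of the rotation, and the algebraic rotation of the coframe. From
this form it is plain that L is an even derivation. -/
theorem lie_eq (hD : IsDiskOpen D) (hf : DiskSmoothOn D f) (hp : p ∈ D) :
    lie f p = pd (Complex.I * p) f p + lieFrame (f p) := by
  have h1 : SForm.iota p (dx1 : SForm Λ) = of (algebraMap ℂ Λ (-p.im)) := by
    ext <;> simp [-Complex.coe_smul, SForm.iota, dx1, Algebra.algebraMap_eq_smul_one]
  have h2 : SForm.iota p (dx2 : SForm Λ) = of (algebraMap ℂ Λ p.re) := by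
    ext <;> simp [-Complex.coe_smul, SForm.iota, dx2, Algebra.algebraMap_eq_smul_one]
  have h3 : ∀ (z : ℂ) (w : SForm Λ), of (algebraMap ℂ Λ z) * w = z • w := fun z w => by
    rw [show (of (algebraMap ℂ Λ z) : SForm Λ) = algebraMap ℂ (SForm Λ) z from
      (SForm.ofHom (Λ := Λ)).commutes z, ← Algebra.smul_def]
  have h4 : pd (Complex.I * p) f p = (-p.im : ℂ) • pd 1 f p + (p.re : ℂ) • pd Complex.I f p := by
    have : Complex.I * p = (-p.im) • (1 : ℂ) + p.re • Complex.I := by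
      apply Complex.ext <;> simp
    unfold pd
    rw [this, map_add, map_smul, map_smul, ← Complex.coe_smul, ← Complex.coe_smul]
    push_cast
    rfl
  simp only [lie, deRham_apply, pd_iota hD hf hp, SForm.iota_add, SForm.iota_mul, h1, h2, h3, h4,
    lieFrame, show SForm.totalParity (dx1 : SForm Λ) = -dx1 from odd_dx1,
    show SForm.totalParity (dx2 : SForm Λ) = -dx2 from odd_dx2]
  noncomm_ring

theorem lieFrame_mul (v w : SForm Λ) : lieFrame (v * w) = lieFrame v * w + v * lieFrame w := by
  have h1 : dx1 * SForm.totalParity v = v * dx1 := by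
    rw [odd_dx1.mul_eq, totalParity_totalParity]
  have h2 : dx2 * SForm.totalParity v = v * dx2 := by
    rw [odd_dx2.mul_eq, totalParity_totalParity]
  simp only [lieFrame, SForm.iota_mul, mul_add, add_mul, ← mul_assoc, h1, h2]
  abel

theorem lie_mul (hD : IsDiskOpen D) (hf : DiskSmoothOn D f) (hg : DiskSmoothOn D g)
    (hp : p ∈ D) : lie (fun q => f q * g q) p = lie f p * g p + f p * lie g p := by
  rw [lie_eq hD (hf.mul hg) hp, lie_eq hD hf hp, lie_eq hD hg hp, pd_mul hD hf hg hp,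
    lieFrame_mul]
  noncomm_ring

theorem lie_add (hD : IsDiskOpen D) (hf : DiskSmoothOn D f) (hg : DiskSmoothOn D g)
    (hp : p ∈ D) : lie (fun q => f q + g q) p = lie f p + lie g p := by
  simp only [lie, SForm.iota_add]
  rw [deRham_add hD hf.iota hg.iota hp, deRham_add hD hf hg hp, SForm.iota_add]
  abel

theorem lie_smul (hD : IsDiskOpen D) (c : ℂ) (hf : DiskSmoothOn D f) (hp : p ∈ D) :
    lie (fun q => c • f q) p = c • lie f p := by
  simp only [lie, SForm.iota_smul]
  rw [deRham_smul hD c hf.iota hp, deRham_smul hD c hf hp, SForm.iota_smul, smul_add]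

theorem lie_zero : lie (fun _ => (0 : SForm Λ)) p = 0 := by
  simp only [lie, SForm.iota_zero, deRham_zero, add_zero]

theorem lie_deRham (hD : IsDiskOpen D) (hf : DiskSmoothOn D f) (hp : p ∈ D) :
    lie (deRham f) p = deRham (lie f) p := by
  have h1 : lie f = fun q => deRham (fun q => SForm.iota q (f q)) q + SForm.iota q (deRham f q) :=
    rfl
  rw [h1, deRham_add hD (hf.iota.deRham hD) (hf.deRham hD).iota hp, deRham_deRham hD hf.iota hp,
    lie, deRham_deRham hD hf hp, SForm.iota_zero, add_zero, zero_add]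

theorem lie_iota (f : ℂ → SForm Λ) (p : ℂ) :
    lie (fun q => SForm.iota q (f q)) p = SForm.iota p (lie f p) := by
  simp only [lie, SForm.iota_iota, SForm.iota_add, deRham_zero, zero_add, add_zero]

/-- Rotations are orientation-preserving isometries of the flat metric: the infinitesimal rotation
of the coframe commutes with the Hodge operator, whose coefficients are constant. -/
theorem lie_star (hD : IsDiskOpen D) (hf : DiskSmoothOn D f) (hp : p ∈ D) :
    lie (fun q => SForm.star (f q)) p = SForm.star (lie f p) := by
  have h : pd (Complex.I * p) (fun q => SForm.star (f q)) p =
      SForm.star (pd (Complex.I * p) f p) := pd_lm_comp hD starL hf hp _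
  rw [lie_eq hD hf.star hp, lie_eq hD hf hp, SForm.star_add, h]
  congr 1
  ext <;> simp [lieFrame, SForm.star, SForm.iota, dx1, dx2]

end DiskCalculus

/-! ### Green's theorem on the disk -/

section Green

open MeasureTheory Set

variable {V : Type*} [NormedAddCommGroup V] [NormedSpace ℂ V]

/-- Polar coordinates. -/
def polarMap (x : ℝ × ℝ) : ℂ := x.1 * Complex.exp (x.2 * Complex.I)

theorem norm_polarMap (x : ℝ × ℝ) : ‖polarMap x‖ = |x.1| := by
  rw [polarMap, norm_mul, Complex.norm_exp_ofReal_mul_I, mul_one, Complex.norm_real,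
    Real.norm_eq_abs]

theorem continuous_polarMap : Continuous polarMap := by
  unfold polarMap; fun_prop

theorem polarMap_mem_disk {x : ℝ × ℝ} (h0 : 0 ≤ x.1) (h1 : x.1 ≤ 1) : polarMap x ∈ disk := by
  rw [disk, mem_closedBall_zero_iff, norm_polarMap, abs_of_nonneg h0]; exact h1

theorem hasFDerivAt_polarMap (x : ℝ × ℝ) : ∃ L : ℝ × ℝ →L[ℝ] ℂ, HasFDerivAt polarMap L x ∧
    ∀ v, L v = v.1 * Complex.exp (x.2 * Complex.I) +
      v.2 * (x.1 * (Complex.I * Complex.exp (x.2 * Complex.I))) := by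
  have h1 : HasFDerivAt (fun y : ℝ × ℝ => (y.1 : ℂ))
      (Complex.ofRealCLM.comp (ContinuousLinearMap.fst ℝ ℝ ℝ)) x :=
    (Complex.ofRealCLM.comp (ContinuousLinearMap.fst ℝ ℝ ℝ)).hasFDerivAt
  have h2 : HasFDerivAt (fun y : ℝ × ℝ => (y.2 : ℂ))
      (Complex.ofRealCLM.comp (ContinuousLinearMap.snd ℝ ℝ ℝ)) x :=
    (Complex.ofRealCLM.comp (ContinuousLinearMap.snd ℝ ℝ ℝ)).hasFDerivAt
  refine ⟨_, h1.mul ((h2.mul_const Complex.I).cexp), fun v => ?_⟩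
  simp
  ring

theorem integral_disk_eq_polar (h : ℂ → V) :
    ∫ p in disk, h p = ∫ x in Icc ((0, -Real.pi) : ℝ × ℝ) (1, Real.pi), x.1 • h (polarMap x) := by
  have hm : MeasurableSet disk := Metric.isClosed_closedBall.measurableSet
  rw [← integral_indicator hm, ← Complex.integral_comp_polarCoord_symm]
  have e : ∀ x : ℝ × ℝ, Complex.polarCoord.symm x = polarMap x := by
    intro x
    rw [Complex.polarCoord_symm_apply, polarMap, Complex.exp_mul_I, Complex.ofReal_cos,
      Complex.ofReal_sin]
  have h1 : ∫ x in polarCoord.target, x.1 • disk.indicator h (Complex.polarCoord.symm x) =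
      ∫ x in polarCoord.target, (Iic (1 : ℝ) ×ˢ (univ : Set ℝ)).indicator
        (fun x => x.1 • h (polarMap x)) x := by
    refine setIntegral_congr_fun polarCoord.open_target.measurableSet fun x hx => ?_
    have hx0 : 0 < x.1 := hx.1
    simp only [e]
    by_cases hx1 : x.1 ≤ 1
    · rw [indicator_of_mem (polarMap_mem_disk hx0.le hx1), indicator_of_mem (by simpa using hx1)]
    · rw [indicator_of_notMem, indicator_of_notMem (by simpa using hx1), smul_zero]
      rw [disk, mem_closedBall_zero_iff, norm_polarMap, abs_of_pos hx0]
      exact hx1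
  rw [h1, setIntegral_indicator (measurableSet_Iic.prod MeasurableSet.univ)]
  refine setIntegral_congr_set ?_
  rw [← Icc_prod_Icc]
  have h2 : polarCoord.target ∩ Iic (1 : ℝ) ×ˢ (univ : Set ℝ) =
      Ioc (0 : ℝ) 1 ×ˢ Ioo (-Real.pi) Real.pi := by
    ext x
    simp only [polarCoord_target, mem_inter_iff, mem_prod, mem_Ioi, mem_Ioo, mem_Iic, mem_univ,
      mem_Ioc]
    tauto
  rw [h2]
  exact Measure.set_prod_ae_eq Ioc_ae_eq_Icc Ioo_ae_eq_Icc

/-- In polar coordinates r(∂₁c - ∂₂b) is the divergence ∂_r f + ∂_σ g for the fields f and g chosen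
below, so the divergence theorem on the rectangle [0,1] × [-π,π] applies. The edge r = 0 contributes
nothing because f has a factor r, the edges σ = ±π cancel by periodicity, and r = 1 gives the
boundary integral. -/
theorem integral_disk_curl [CompleteSpace V] {b c : ℂ → V} (hb : DiskSmoothOn disk b)
    (hc : DiskSmoothOn disk c) :
    ∫ p in disk, (pd 1 c p - pd Complex.I b p) = ∫ σ in (0 : ℝ)..(2 * Real.pi),
      ((-Real.sin σ) • b (Complex.exp (σ * Complex.I)) +
        Real.cos σ • c (Complex.exp (σ * Complex.I))) := by
  have hD : IsDiskOpen disk := ⟨subset_rfl, fun p _ => self_mem_nhdsWithin⟩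
  set h : ℂ → V := fun p => pd 1 c p - pd Complex.I b p with hh
  set f : ℝ × ℝ → V := fun x => x.1 • ((-Real.sin x.2) • b (polarMap x) +
    Real.cos x.2 • c (polarMap x)) with hf
  set g : ℝ × ℝ → V := fun x => -(Real.cos x.2 • b (polarMap x) +
    Real.sin x.2 • c (polarMap x)) with hg
  have key : ∀ x : ℝ × ℝ, ∃ f' g' : ℝ × ℝ →L[ℝ] V,
      (x ∈ Ioo (0 : ℝ) 1 ×ˢ Ioo (-Real.pi) Real.pi → HasFDerivAt f f' x ∧ HasFDerivAt g g' x) ∧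
      f' (1, 0) + g' (0, 1) = x.1 • h (polarMap x) := by
    intro x
    by_cases hx : x ∈ Ioo (0 : ℝ) 1 ×ˢ Ioo (-Real.pi) Real.pi
    · obtain ⟨L, hL, hL'⟩ := hasFDerivAt_polarMap x
      have hd : polarMap x ∈ disk := polarMap_mem_disk hx.1.1.le hx.1.2.le
      have hn : disk ∈ 𝓝 (polarMap x) := by
        rw [← mem_interior_iff_mem_nhds, interior_disk, mem_ball_zero_iff, norm_polarMap,
          abs_of_pos hx.1.1]
        exact hx.1.2
      have hcomp : ∀ {k : ℂ → V}, DiskSmoothOn disk k →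
          HasFDerivAt (fun y => k (polarMap y)) ((fderivWithin ℝ k disk (polarMap x)).comp L) x :=
        fun hk => ((hk.differentiableWithinAt hd).hasFDerivWithinAt.hasFDerivAt hn).comp x hL
      have hs : HasFDerivAt (fun y : ℝ × ℝ => Real.sin y.2)
          (Real.cos x.2 • ContinuousLinearMap.snd ℝ ℝ ℝ) x := (hasFDerivAt_snd (p := x)).sin
      have hc' : HasFDerivAt (fun y : ℝ × ℝ => Real.cos y.2)
          (-Real.sin x.2 • ContinuousLinearMap.snd ℝ ℝ ℝ) x := (hasFDerivAt_snd (p := x)).cos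
      have hr : HasFDerivAt (fun y : ℝ × ℝ => y.1) (ContinuousLinearMap.fst ℝ ℝ ℝ) x :=
        hasFDerivAt_fst
      have hf1 : HasFDerivAt f _ x := hr.fun_smul ((hs.fun_neg.fun_smul (hcomp hb)).fun_add
        (hc'.fun_smul (hcomp hc)))
      have hg1 : HasFDerivAt g _ x :=
        ((hc'.fun_smul (hcomp hb)).fun_add (hs.fun_smul (hcomp hc))).fun_neg
      refine ⟨_, _, fun _ => ⟨hf1, hg1⟩, ?_⟩
      have e1 : L (1, 0) = Real.cos x.2 • (1 : ℂ) + Real.sin x.2 • Complex.I := by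
        rw [hL']; simp [Complex.exp_mul_I]
      have e2 : L (0, 1) = x.1 • ((-Real.sin x.2) • (1 : ℂ) + Real.cos x.2 • Complex.I) := by
        rw [hL']
        simp [Complex.exp_mul_I, mul_add]
        ring_nf
        simp
        ring
      simp only [hh, pd, add_apply, smul_apply, neg_apply, ContinuousLinearMap.comp_apply,
        ContinuousLinearMap.smulRight_apply, ContinuousLinearMap.coe_fst',
        ContinuousLinearMap.coe_snd', e1, e2, map_add, map_smul]
      generalize fderivWithin ℝ b disk (polarMap x) 1 = b1
      generalize fderivWithin ℝ b disk (polarMap x) Complex.I = b2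
      generalize fderivWithin ℝ c disk (polarMap x) 1 = c1
      generalize fderivWithin ℝ c disk (polarMap x) Complex.I = c2
      have hsc := Real.sin_sq_add_cos_sq x.2
      simp only [smul_eq_mul, mul_zero, mul_one, zero_smul, add_zero, one_smul]
      match_scalars <;> first | ring1 | linear_combination x.1 * hsc | linear_combination -x.1 * hsc
    -- Off the open rectangle no derivative is claimed. The values are chosen so that the divergence
    -- is r·h everywhere, which lets the integrand be rewritten without a case distinction.
    · exact ⟨(ContinuousLinearMap.fst ℝ ℝ ℝ).smulRight (x.1 • h (polarMap x)), 0,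
        fun hx' => absurd hx' hx, by simp⟩
  choose f' g' hfg hfg' using key
  have hmaps : MapsTo polarMap (Icc ((0, -Real.pi) : ℝ × ℝ) (1, Real.pi)) disk := by
    intro x hx
    exact polarMap_mem_disk hx.1.1 hx.2.1
  have hcont : ∀ {k : ℂ → V}, DiskSmoothOn disk k →
      ContinuousOn (fun x => k (polarMap x)) (Icc ((0, -Real.pi) : ℝ × ℝ) (1, Real.pi)) :=
    fun hk => (hk.continuousOn hD).comp continuous_polarMap.continuousOn hmaps
  have hcs : Continuous fun x : ℝ × ℝ => Real.sin x.2 := Real.continuous_sin.comp continuous_snd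
  have hcc : Continuous fun x : ℝ × ℝ => Real.cos x.2 := Real.continuous_cos.comp continuous_snd
  have hdiv := integral_divergence_prod_Icc_of_hasFDerivAt_of_le f g f' g' (0, -Real.pi)
    (1, Real.pi) ⟨zero_le_one, by simpa using Real.pi_pos.le⟩
    (continuous_fst.continuousOn.smul ((hcs.neg.continuousOn.smul (hcont hb)).add
      (hcc.continuousOn.smul (hcont hc))))
    ((hcc.continuousOn.smul (hcont hb)).add (hcs.continuousOn.smul (hcont hc))).neg
    (fun x hx => (hfg x hx).1) (fun x hx => (hfg x hx).2) (by
      simp only [hfg']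
      exact (continuous_fst.continuousOn.smul
        (hcont ((hc.pd hD 1).sub (hb.pd hD Complex.I)))).integrableOn_compact isCompact_Icc)
  simp only [hfg'] at hdiv
  rw [integral_disk_eq_polar, hdiv]
  have hp : ∀ r : ℝ, g (r, Real.pi) = g (r, -Real.pi) := by
    intro r
    have : polarMap (r, -Real.pi) = polarMap (r, Real.pi) := by
      simp [polarMap, Complex.exp_neg]
    simp [hg, this]
  simp only [hp, sub_self, zero_add]
  have hf0 : ∀ y, f (0, y) = 0 := fun y => by simp [hf]
  simp only [hf0, intervalIntegral.integral_zero, sub_zero]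
  have hf1 : ∀ σ, f (1, σ) = (-Real.sin σ) • b (Complex.exp (σ * Complex.I)) +
      Real.cos σ • c (Complex.exp (σ * Complex.I)) := fun σ => by simp [hf, polarMap]
  simp only [hf1]
  have hper : Function.Periodic (fun σ : ℝ => (-Real.sin σ) • b (Complex.exp (σ * Complex.I)) +
      Real.cos σ • c (Complex.exp (σ * Complex.I))) (2 * Real.pi) := by
    intro σ
    have : Complex.exp ((σ + 2 * Real.pi : ℝ) * Complex.I) = Complex.exp (σ * Complex.I) := by
      push_cast
      rw [add_mul, Complex.exp_add, Complex.exp_two_pi_mul_I, mul_one]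
    simp only [this, Real.sin_add_two_pi, Real.cos_add_two_pi]
  have := hper.intervalIntegral_add_eq (-Real.pi) 0
  rw [show -Real.pi + 2 * Real.pi = Real.pi by ring, zero_add] at this
  exact this

end Green

/-! ### Variations -/

section Variation

open SForm

variable {Λ : Type*} [NormedRing Λ] [NormedAlgebra ℂ Λ] [FiniteDimensional ℂ Λ]
  [GrassmannAlgebra Λ]

theorem mul_of_odd {ε : Λ} (hε : IsOdd ε) (w : SForm Λ) :
    w * of ε = of ε * totalParity w := by
  rw [(odd_of hε).mul_eq, totalParity_totalParity]

/-- Moving the second ε to the left costs only a parity, and ε² = 0. All variations are therefore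
exactly linear in ε. -/
theorem of_mul_mul_of_mul {ε : Λ} (hε : IsOdd ε) (v w : SForm Λ) :
    of ε * v * (of ε * w) = 0 := by
  rw [mul_assoc, ← mul_assoc v, mul_of_odd hε, ← mul_assoc, ← mul_assoc, (odd_of hε).mul_self,
    zero_mul, zero_mul]

theorem iota_of_mul {ε : Λ} (hε : IsOdd ε) (p : ℂ) (w : SForm Λ) :
    SForm.iota p (of ε * w) = -(of ε * SForm.iota p w) := by
  rw [SForm.iota_mul, iota_of, zero_mul, zero_add, show totalParity (of ε) = -of ε from odd_of hε,
    neg_mul]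

theorem totalParity_of_mul {ε : Λ} (hε : IsOdd ε) (w : SForm Λ) :
    totalParity (of ε * w) = -(of ε * totalParity w) := by
  rw [map_mul, show totalParity (of ε) = -of ε from odd_of hε, neg_mul]

/-- The function `x` on `D` varies with the first variation `x₁`: its varied value is
`y = x + ε x₁`, and the varied value of `x₁` is `y₁ = x₁ + ε c L x`. -/
structure Variation (c : ℂ) (ε : Λ) (D : Set ℂ) (x x₁ y y₁ : ℂ → SForm Λ) : Prop where
  smooth : DiskSmoothOn D x
  smooth₁ : DiskSmoothOn D x₁
  eq : ∀ p ∈ D, y p = x p + of ε * x₁ p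
  eq₁ : ∀ p ∈ D, y₁ p = x₁ p + of ε * (c • lie x p)

namespace Variation

variable {c : ℂ} {ε : Λ} {D : Set ℂ} {x x₁ y y₁ z z₁ w w₁ : ℂ → SForm Λ}

theorem congr (hD : IsDiskOpen D) (h : Variation c ε D x x₁ y y₁) (e : Set.EqOn z x D)
    (e₁ : Set.EqOn z₁ x₁ D) (e' : Set.EqOn w y D) (e₁' : Set.EqOn w₁ y₁ D) :
    Variation c ε D z z₁ w w₁ where
  smooth := h.smooth.congr hD e
  smooth₁ := h.smooth₁.congr hD e₁
  eq p hp := by rw [e' hp, e hp, e₁ hp, h.eq p hp]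
  eq₁ p hp := by rw [e₁' hp, e₁ hp, h.eq₁ p hp, lie_congr hD e hp]

theorem add (hD : IsDiskOpen D) (h : Variation c ε D x x₁ y y₁) (h' : Variation c ε D z z₁ w w₁) :
    Variation c ε D (fun p => x p + z p) (fun p => x₁ p + z₁ p) (fun p => y p + w p)
      (fun p => y₁ p + w₁ p) where
  smooth := h.smooth.add h'.smooth
  smooth₁ := h.smooth₁.add h'.smooth₁
  eq p hp := by rw [h.eq p hp, h'.eq p hp, mul_add]; abel
  eq₁ p hp := by
    rw [h.eq₁ p hp, h'.eq₁ p hp, lie_add hD h.smooth h'.smooth hp, smul_add, mul_add]; abel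

theorem smul (hD : IsDiskOpen D) (k : ℂ) (h : Variation c ε D x x₁ y y₁) :
    Variation c ε D (fun p => k • x p) (fun p => k • x₁ p) (fun p => k • y p)
      (fun p => k • y₁ p) where
  smooth := h.smooth.smul k
  smooth₁ := h.smooth₁.smul k
  eq p hp := by rw [h.eq p hp, smul_add, mul_smul_comm]
  eq₁ p hp := by
    rw [h.eq₁ p hp, lie_smul hD k h.smooth hp, smul_add, ← mul_smul_comm, smul_comm]

theorem neg (hD : IsDiskOpen D) (h : Variation c ε D x x₁ y y₁) :
    Variation c ε D (fun p => -x p) (fun p => -x₁ p) (fun p => -y p) (fun p => -y₁ p) := by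
  simpa only [neg_smul, one_smul] using h.smul hD (-1)

theorem zero : Variation c ε D (fun _ => 0) (fun _ => 0) (fun _ => 0) (fun _ => 0) where
  smooth := diskSmoothOn_const 0
  smooth₁ := diskSmoothOn_const 0
  eq p _ := by rw [mul_zero, add_zero]
  eq₁ p _ := by rw [lie_zero, smul_zero, mul_zero, add_zero]

theorem sum (hD : IsDiskOpen D) {κ : Type*} {s : Finset κ} {x x₁ y y₁ : κ → ℂ → SForm Λ}
    (h : ∀ i ∈ s, Variation c ε D (x i) (x₁ i) (y i) (y₁ i)) :
    Variation c ε D (fun p => ∑ i ∈ s, x i p) (fun p => ∑ i ∈ s, x₁ i p)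
      (fun p => ∑ i ∈ s, y i p) (fun p => ∑ i ∈ s, y₁ i p) := by
  classical
  induction s using Finset.induction_on with
  | empty => simpa using zero
  | insert i s hi ih =>
    simp only [Finset.sum_insert hi]
    exact (h i (Finset.mem_insert_self _ _)).add hD
      (ih fun j hj => h j (Finset.mem_insert_of_mem hj))

/-- δ is an odd derivation. In the second variation the mixed term δx δz occurs twice with opposite
signs, which leaves the Leibniz rule for L. -/
theorem mul (hD : IsDiskOpen D) (hε : IsOdd ε) (h : Variation c ε D x x₁ y y₁)
    (h' : Variation c ε D z z₁ w w₁) :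
    Variation c ε D (fun p => x p * z p) (fun p => x₁ p * z p + totalParity (x p) * z₁ p)
      (fun p => y p * w p) (fun p => y₁ p * w p + totalParity (y p) * w₁ p) where
  smooth := h.smooth.mul h'.smooth
  smooth₁ := (h.smooth₁.mul h'.smooth).add (h.smooth.totalParity.mul h'.smooth₁)
  eq p hp := by
    rw [h.eq p hp, h'.eq p hp, add_mul, mul_add, mul_add, of_mul_mul_of_mul hε, ← mul_assoc (x p),
      mul_of_odd hε, mul_add, mul_assoc, mul_assoc]
    abel
  eq₁ p hp := by
    have e1 : of ε * x₁ p * (of ε * z₁ p) = 0 := of_mul_mul_of_mul hε _ _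
    rw [h.eq₁ p hp, h'.eq₁ p hp, h.eq p hp, h'.eq p hp, lie_mul hD h.smooth h'.smooth hp,
      map_add, totalParity_of_mul hε]
    simp only [add_mul, mul_add, neg_mul, of_mul_mul_of_mul hε, smul_add, mul_smul_comm,
      smul_mul_assoc, smul_zero]
    rw [← mul_assoc (x₁ p), mul_of_odd hε, ← mul_assoc (totalParity (x p)), mul_of_odd hε,
      totalParity_totalParity]
    simp only [mul_assoc, neg_zero, smul_zero, add_zero]
    abel

/-- The odd constant ε anticommutes with d, hence the sign in the first variation. In the second the
two signs cancel and L commutes with d. -/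
theorem deRham (hD : IsDiskOpen D) (hε : IsOdd ε) (h : Variation c ε D x x₁ y y₁) :
    Variation c ε D (deRham x) (fun p => -deRham x₁ p) (TypeBModel.deRham y)
      (fun p => -TypeBModel.deRham y₁ p) where
  smooth := h.smooth.deRham hD
  smooth₁ := (h.smooth₁.deRham hD).neg
  eq p hp := by
    rw [deRham_congr hD h.eq hp,
      deRham_add hD h.smooth ((diskSmoothOn_const _).mul h.smooth₁) hp,
      deRham_odd_const_mul hD (odd_of hε) h.smooth₁ hp, mul_neg]
  eq₁ p hp := by
    have hl := (h.smooth.lie hD).smul c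
    rw [deRham_congr hD h.eq₁ hp,
      deRham_add hD h.smooth₁ ((diskSmoothOn_const _).mul hl) hp,
      deRham_odd_const_mul hD (odd_of hε) hl hp, deRham_smul hD c (h.smooth.lie hD) hp,
      lie_deRham hD h.smooth hp]
    abel

theorem iota (hε : IsOdd ε) (h : Variation c ε D x x₁ y y₁) :
    Variation c ε D (fun p => SForm.iota p (x p)) (fun p => -SForm.iota p (x₁ p))
      (fun p => SForm.iota p (y p)) (fun p => -SForm.iota p (y₁ p)) where
  smooth := h.smooth.iota
  smooth₁ := h.smooth₁.iota.neg
  eq p hp := by rw [h.eq p hp, SForm.iota_add, iota_of_mul hε, mul_neg]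
  eq₁ p hp := by
    rw [h.eq₁ p hp, SForm.iota_add, iota_of_mul hε, SForm.iota_smul, lie_iota]
    abel

theorem star (hD : IsDiskOpen D) (h : Variation c ε D x x₁ y y₁) :
    Variation c ε D (fun p => SForm.star (x p)) (fun p => SForm.star (x₁ p))
      (fun p => SForm.star (y p)) (fun p => SForm.star (y₁ p)) where
  smooth := h.smooth.star
  smooth₁ := h.smooth₁.star
  eq p hp := by rw [h.eq p hp, SForm.star_add, SForm.star_of_mul]
  eq₁ p hp := by
    rw [h.eq₁ p hp, SForm.star_add, SForm.star_of_mul, SForm.star_smul, lie_star hD h.smooth hp]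

end Variation

end Variation

/-! ### Functions of the coordinate fields -/

section CoordinateFields

open SForm

variable {n : ℕ} {X : Type*} [TopologicalSpace X]
  {Λ : Type*} [NormedRing Λ] [NormedAlgebra ℂ Λ] [FiniteDimensional ℂ Λ] [GrassmannAlgebra Λ]

/-- Smoothness near every point of the domain of definition of the coordinates `e`. -/
def SmoothTarget (e : Coord n X) (f : (Fin n → ℂ) → ℂ) : Prop := ∀ u ∈ e.target, SmoothNear f u

theorem SmoothTarget.wdir {e : Coord n X} {f : (Fin n → ℂ) → ℂ} (h : SmoothTarget e f)
    (a : Fin n ⊕ Fin n) : SmoothTarget e (wdir a f) := fun u hu => (h u hu).wdir a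

/-- The coordinate fields `φ`, `φ̄`. -/
def LocalFields.coord (F : LocalFields n Λ) (a : Fin n ⊕ Fin n) (p : ℂ) : SForm Λ :=
  Sum.elim (fun i => F.φ p i) (fun i => F.φb p i) a

/-- The Grassmann-valued point of the target given by the coordinate fields. -/
def LocalFields.point (F : LocalFields n Λ) (p : ℂ) : Fin n ⊕ Fin n → Λ := pt (F.φ p) (F.φb p)

variable {Φ : ℂ → X} {e : Coord n X} {F F' : LocalFields n Λ} {f g : (Fin n → ℂ) → ℂ} {p : ℂ}

namespace IsLocalField

theorem target (hp : p ∈ chartDomain Φ e) : e (Φ p) ∈ e.target := e.map_source hp.2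

theorem bodyPt_point (h : IsLocalField Φ e F) (hp : p ∈ chartDomain Φ e) :
    bodyPt (F.point p) = e (Φ p) := funext fun i => h.body_φ p hp i

theorem isPt_point (h : IsLocalField Φ e F) (hp : p ∈ chartDomain Φ e) : IsPt (F.point p) where
  even := by
    rintro (i | i)
    · exact (h.type_φ p hp i).1
    · exact (h.type_φb p hp i).1
  body_eq a := by
    rw [h.bodyPt_point hp]
    rcases a with i | i
    · exact h.body_φ p hp i
    · exact h.body_φb p hp i

theorem at_eq (h : IsLocalField Φ e F) (hp : p ∈ chartDomain Φ e) (hf : SmoothTarget e f) :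
    F.at f p = of (tay f (F.point p)) :=
  eval_eq_of_tay (h.type_φ p hp) (h.type_φb p hp) (by
    have := hf _ (target hp)
    rwa [← h.bodyPt_point hp] at this)

theorem coord_eq (h : IsLocalField Φ e F) (hp : p ∈ chartDomain Φ e) (a : Fin n ⊕ Fin n) :
    F.coord a p = of (F.point p a) := by
  rcases a with i | i
  · exact (h.type_φ p hp i).eq_of
  · exact (h.type_φb p hp i).eq_of

theorem smoothNear (h : IsLocalField Φ e F) (hp : p ∈ chartDomain Φ e) (hf : SmoothTarget e f) :
    SmoothNear f (bodyPt (F.point p)) := by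
  rw [h.bodyPt_point hp]; exact hf _ (target hp)

theorem at_even (h : IsLocalField Φ e F) (hp : p ∈ chartDomain Φ e) (hf : SmoothTarget e f) :
    (F.at f p).Even := by
  rw [h.at_eq hp hf]; exact even_of (isEven_tay (h.isPt_point hp))

theorem at_add (h : IsLocalField Φ e F) (hp : p ∈ chartDomain Φ e) (hf : SmoothTarget e f)
    (hg : SmoothTarget e g) : F.at (fun u => f u + g u) p = F.at f p + F.at g p := by
  rw [h.at_eq hp hf, h.at_eq hp hg, h.at_eq hp (fun u hu => (hf u hu).add (hg u hu)),
    tay_add (h.smoothNear hp hf) (h.smoothNear hp hg), of_add]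

theorem at_mul (h : IsLocalField Φ e F) (hp : p ∈ chartDomain Φ e) (hf : SmoothTarget e f)
    (hg : SmoothTarget e g) : F.at (fun u => f u * g u) p = F.at f p * F.at g p := by
  rw [h.at_eq hp hf, h.at_eq hp hg, h.at_eq hp (fun u hu => (hf u hu).mul (hg u hu)),
    tay_mul (h.isPt_point hp) (h.smoothNear hp hf) (h.smoothNear hp hg), of_mul]

theorem at_sum (h : IsLocalField Φ e F) (hp : p ∈ chartDomain Φ e) {κ : Type*} {s : Finset κ}
    {f : κ → (Fin n → ℂ) → ℂ} (hf : ∀ i ∈ s, SmoothTarget e (f i)) :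
    F.at (fun u => ∑ i ∈ s, f i u) p = ∑ i ∈ s, F.at (f i) p := by
  rw [h.at_eq hp (fun u hu => SmoothNear.sum fun i hi => hf i hi u hu),
    tay_sum fun i hi => h.smoothNear hp (hf i hi), of_sum]
  exact Finset.sum_congr rfl fun i hi => (h.at_eq hp (hf i hi)).symm

theorem at_const_mul (h : IsLocalField Φ e F) (hp : p ∈ chartDomain Φ e) (c : ℂ)
    (hf : SmoothTarget e f) : F.at (fun u => c * f u) p = c • F.at f p := by
  rw [h.at_eq hp hf, h.at_eq hp (fun u hu => (hf u hu).const_mul c),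
    tay_const_mul c (h.smoothNear hp hf), of_smul]

/-- Taylor evaluation sees only the germ at the body, and the body lies in the open set `e.target`.
This is how tensor identities become identities between fields. -/
theorem at_congr (h : IsLocalField Φ e F) (hp : p ∈ chartDomain Φ e) (hf : SmoothTarget e f)
    (hfg : ∀ u ∈ e.target, f u = g u) : F.at f p = F.at g p := by
  have he : ∀ u ∈ e.target, f =ᶠ[𝓝 u] g := fun u hu => by
    filter_upwards [e.open_target.mem_nhds hu] with x hx using hfg x hx
  rw [h.at_eq hp hf, h.at_eq hp (fun u hu => (hf u hu).congr (he u hu)),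
    tay_congr (f := f) (g := g) (by rw [h.bodyPt_point hp]; exact he _ (target hp))]

section Smooth

variable (hD : IsDiskOpen (chartDomain Φ e))
include hD

theorem diskSmoothOn {f : ℂ → Fin n → SForm Λ} (hf : ContDiffOn ℝ ∞ f (chartDomain Φ e))
    (i : Fin n) : DiskSmoothOn (chartDomain Φ e) (fun p => f p i) := fun p hp =>
  contDiffWithinAt_pi.mp ((hf p hp).mono_of_mem_nhdsWithin (hD.mem_nhdsWithin p hp)) i

theorem smooth_coord (h : IsLocalField Φ e F) (a : Fin n ⊕ Fin n) :
    DiskSmoothOn (chartDomain Φ e) (F.coord a) := by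
  rcases a with i | i
  · exact diskSmoothOn hD h.smooth_φ i
  · exact diskSmoothOn hD h.smooth_φb i

/-- The component of degree zero as a linear map. -/
def _root_.TypeBModel.SForm.c0L : SForm Λ →ₗ[ℂ] Λ where
  toFun := SForm.c0
  map_add' _ _ := rfl
  map_smul' _ _ := rfl

theorem smooth_point (h : IsLocalField Φ e F) (a : Fin n ⊕ Fin n) :
    DiskSmoothOn (chartDomain Φ e) (fun p => F.point p a) := by
  rcases a with i | i
  · exact (smooth_coord hD h (.inl i)).lm_comp SForm.c0L
  · exact (smooth_coord hD h (.inr i)).lm_comp SForm.c0L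

theorem smooth_at (h : IsLocalField Φ e F) (hf : SmoothTarget e f) :
    DiskSmoothOn (chartDomain Φ e) (F.at f) := by
  have : DiskSmoothOn (chartDomain Φ e) (fun p => of (tay f (F.point p))) := by
    refine DiskSmoothOn.clm_comp (ofCLM (Λ := Λ)) fun p hp => ?_
    exact contDiffWithinAt_tay (fun a => smooth_point hD h a p hp) (h.smoothNear hp hf)
  exact this.congr hD fun p hp => h.at_eq hp hf

theorem pd_at (h : IsLocalField Φ e F) (hp : p ∈ chartDomain Φ e) (hf : SmoothTarget e f) (v : ℂ) :
    pd v (F.at f) p = ∑ a, F.at (wdir a f) p * pd v (F.coord a) p := by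
  have hs := smooth_point hD h
  have h0 : ∀ a, pd v (F.coord a) p = of (pd v (fun q => F.point q a) p) := fun a => by
    rw [pd_congr hD (fun q hq => h.coord_eq hq a) hp]
    exact pd_clm_comp hD (ofCLM (Λ := Λ)) (hs a) hp v
  have h2 : DiskSmoothOn (chartDomain Φ e) (fun p => tay f (F.point p)) := fun p hp =>
    contDiffWithinAt_tay (fun a => hs a p hp) (h.smoothNear hp hf)
  have h1 : pd v (F.at f) p = of (pd v (fun q => tay f (F.point q)) p) := by
    rw [pd_congr hD (fun q hq => h.at_eq hq hf) hp]
    exact pd_clm_comp hD (ofCLM (Λ := Λ)) h2 hp v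
  obtain ⟨L, hL, hL'⟩ := hasFDerivWithinAt_tay (S := disk) (hD.subset hp)
    (fun a => ((hs a).differentiableWithinAt hp).hasFDerivWithinAt)
    (by filter_upwards [hD.mem_nhdsWithin p hp] with q hq using h.isPt_point hq)
    (uniqueDiffOn_disk p (hD.subset hp)) (h.smoothNear hp hf)
  rw [h1, pd, hL.fderivWithin (uniqueDiffOn_disk p (hD.subset hp)), hL', of_sum]
  refine Finset.sum_congr rfl fun a _ => ?_
  rw [h0, h.at_eq hp (hf.wdir a), of_mul, (even_of (isEven_tay (h.isPt_point hp))).mul_eq]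
  rfl

theorem deRham_at (h : IsLocalField Φ e F) (hp : p ∈ chartDomain Φ e) (hf : SmoothTarget e f) :
    deRham (F.at f) p = ∑ a, F.at (wdir a f) p * deRham (F.coord a) p := by
  simp only [deRham_apply, h.pd_at hD hp hf, Finset.mul_sum, mul_add, Finset.sum_add_distrib]
  congr 1 <;> refine Finset.sum_congr rfl fun a _ => ?_ <;>
  rw [← mul_assoc, ← mul_assoc, (h.at_even hp (hf.wdir a)).mul_eq]

/-- On forms of degree zero L is a plain directional derivative, so the chain rule of `pd_at`
carries over. -/
theorem lie_at (h : IsLocalField Φ e F) (hp : p ∈ chartDomain Φ e) (hf : SmoothTarget e f) :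
    lie (F.at f) p = ∑ a, F.at (wdir a f) p * lie (F.coord a) p := by
  have h0 : ∀ (a : Λ), lieFrame (of a) = 0 := fun a => by simp [lieFrame, iota_of]
  rw [lie_eq hD (smooth_at hD h hf) hp, h.pd_at hD hp hf, h.at_eq hp hf, h0, add_zero]
  refine Finset.sum_congr rfl fun a _ => ?_
  rw [lie_eq hD (smooth_coord hD h a) hp, h.coord_eq hp, h0, add_zero]

end Smooth

end IsLocalField

theorem isDiskOpen_chartDomain (hΦ : ContinuousOn Φ disk) (e : Coord n X) :
    IsDiskOpen (chartDomain Φ e) where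
  subset _ hp := hp.1
  mem_nhdsWithin p hp := by
    have h1 := hΦ p hp.1 (e.open_source.mem_nhds hp.2)
    filter_upwards [h1, self_mem_nhdsWithin] with q hq hq' using ⟨hq', hq⟩

/-- The variation of functions of the coordinate fields. -/
theorem Variation.at {c : ℂ} {ε : Λ} (hD : IsDiskOpen (chartDomain Φ e)) (hε : IsOdd ε)
    (h : IsLocalField Φ e F) (h' : IsLocalField Φ e F') {B B' : Fin n ⊕ Fin n → ℂ → SForm Λ}
    (hv : ∀ a, Variation c ε (chartDomain Φ e) (F.coord a) (B a) (F'.coord a) (B' a))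
    (hB : ∀ a, ∀ p ∈ chartDomain Φ e, ∃ b, IsOdd b ∧ B a p = of b)
    (hf : SmoothTarget e f) :
    Variation c ε (chartDomain Φ e) (F.at f) (fun p => ∑ a, F.at (wdir a f) p * B a p)
      (F'.at f) (fun p => ∑ a, F'.at (wdir a f) p * B' a p) := by
  have hBo : ∀ a, ∀ p ∈ chartDomain Φ e, (B a p).Odd := fun a p hp => by
    obtain ⟨b, hb, hb'⟩ := hB a p hp
    rw [hb']; exact odd_of hb
  have key : ∀ {f : (Fin n → ℂ) → ℂ}, SmoothTarget e f → ∀ p ∈ chartDomain Φ e,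
      F'.at f p = F.at f p + of ε * ∑ a, F.at (wdir a f) p * B a p := by
    intro f hf p hp
    choose b hb hb' using fun a => hB a p hp
    have e1 : F'.point p = fun a => F.point p a + ε * b a := by
      funext a
      have := (hv a).eq p hp
      rw [h'.coord_eq hp, h.coord_eq hp, hb', ← of_mul, ← of_add] at this
      exact congrArg SForm.c0 this
    have e2 : ∀ a c : Fin n ⊕ Fin n, ε * b a * (ε * b c) = 0 := fun a c => by
      have : b a * ε = -(ε * b a) := by rw [(hb a).mul_eq, hε, neg_mul]
      rw [mul_assoc, ← mul_assoc (b a), this, neg_mul, mul_neg, ← mul_assoc, ← mul_assoc,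
        hε.mul_self, zero_mul, zero_mul, neg_zero]
    rw [h'.at_eq hp hf, e1, tay_add_nilpotent (h.isPt_point hp) (fun a => hε.mul (hb a))
      (fun a => by rw [map_mul, hε.body_eq_zero, zero_mul]) e2 (h.smoothNear hp hf), of_add,
      h.at_eq hp hf, of_sum, Finset.mul_sum]
    congr 1
    refine Finset.sum_congr rfl fun a _ => ?_
    rw [h.at_eq hp (hf.wdir a), hb', of_mul, of_mul, mul_assoc,
      (even_of (isEven_tay (h.isPt_point hp))).mul_eq]
  refine ⟨h.smooth_at hD hf, DiskSmoothOn.sum fun a _ =>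
    (h.smooth_at hD (hf.wdir a)).mul (hv a).smooth₁, key hf, fun p hp => ?_⟩
  -- The quadratic term of the second variation pairs a symmetric Hessian with anticommuting
  -- factors.
  have hc : ∑ a, ∑ b, F.at (wdir b (wdir a f)) p * B b p * B a p = 0 := by
    set T := ∑ a, ∑ b, F.at (wdir b (wdir a f)) p * B b p * B a p with hT
    have : T = -T := by
      conv_lhs => rw [hT, Finset.sum_comm]
      rw [hT, ← Finset.sum_neg_distrib]
      refine Finset.sum_congr rfl fun a _ => ?_
      rw [← Finset.sum_neg_distrib]
      refine Finset.sum_congr rfl fun b _ => ?_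
      rw [mul_assoc, mul_assoc, (hBo a p hp).anticomm (hBo b p hp), mul_neg]
      congr 2
      refine h.at_congr hp ((hf.wdir b).wdir a) fun u hu => ?_
      exact wdir_comm (hf u hu).contDiffAt a b
    have h2 : (2 : ℂ) • T = (2 : ℂ) • (0 : SForm Λ) := by
      rw [two_smul, smul_zero]
      nth_rewrite 1 [this]
      exact neg_add_cancel _
    exact smul_right_injective _ (two_ne_zero' ℂ) h2
  have e3 : ∀ a, F'.at (wdir a f) p * B' a p = F.at (wdir a f) p * B a p +
      of ε * (∑ b, F.at (wdir b (wdir a f)) p * B b p * B a p) +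
      of ε * (c • (F.at (wdir a f) p * lie (F.coord a) p)) := by
    intro a
    rw [key (hf.wdir a) p hp, (hv a).eq₁ p hp, add_mul, mul_add, mul_add, of_mul_mul_of_mul hε,
      add_zero, ← mul_assoc (F.at (wdir a f) p), (h.at_even hp (hf.wdir a)).mul_eq (of ε),
      mul_assoc (of ε), mul_assoc (of ε), Finset.sum_mul, mul_smul_comm]
    abel
  simp only [e3, Finset.sum_add_distrib, ← Finset.mul_sum, ← Finset.smul_sum]
  rw [hc, mul_zero, add_zero, h.lie_at hD hp hf]

end CoordinateFields

/-! ### Kähler geometry in local coordinates -/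

section Kahler

variable {n : ℕ} {X : Type*} [TopologicalSpace X]

/-! ### Smooth functions on the range of a chart. -/

section SmoothTarget

variable {e : Coord n X} {f g : (Fin n → ℂ) → ℂ}

theorem SmoothTarget.add (hf : SmoothTarget e f) (hg : SmoothTarget e g) :
    SmoothTarget e (fun u => f u + g u) := fun u hu => (hf u hu).add (hg u hu)

theorem SmoothTarget.sub (hf : SmoothTarget e f) (hg : SmoothTarget e g) :
    SmoothTarget e (fun u => f u - g u) := fun u hu => (hf u hu).sub (hg u hu)

theorem SmoothTarget.neg (hf : SmoothTarget e f) : SmoothTarget e (fun u => -f u) :=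
  fun u hu => (hf u hu).neg

theorem SmoothTarget.mul (hf : SmoothTarget e f) (hg : SmoothTarget e g) :
    SmoothTarget e (fun u => f u * g u) := fun u hu => (hf u hu).mul (hg u hu)

theorem SmoothTarget.conj (hf : SmoothTarget e f) :
    SmoothTarget e (fun u => starRingEnd ℂ (f u)) := fun u hu => (hf u hu).conj

theorem SmoothTarget.sum {κ : Type*} {s : Finset κ} {f : κ → (Fin n → ℂ) → ℂ}
    (hf : ∀ i ∈ s, SmoothTarget e (f i)) : SmoothTarget e (fun u => ∑ i ∈ s, f i u) :=
  fun u hu => SmoothNear.sum fun i hi => hf i hi u hu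

theorem SmoothTarget.wd (hf : SmoothTarget e f) (i : Fin n) : SmoothTarget e (wd i f) :=
  hf.wdir (.inl i)

theorem SmoothTarget.wdb (hf : SmoothTarget e f) (i : Fin n) : SmoothTarget e (wdb i f) :=
  hf.wdir (.inr i)

theorem SmoothTarget.of_contDiffOn (hf : ContDiffOn ℝ ∞ f e.target) : SmoothTarget e f :=
  fun u hu => by
    filter_upwards [e.open_target.mem_nhds hu] with x hx
      using hf.contDiffAt (e.open_target.mem_nhds hx)

theorem SmoothTarget.differentiableAt (hf : SmoothTarget e f) {u : Fin n → ℂ} (hu : u ∈ e.target) :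
    DifferentiableAt ℝ f u := (hf u hu).differentiableAt

theorem SmoothTarget.wdir_congr (h : ∀ u ∈ e.target, f u = g u) (a : Fin n ⊕ Fin n)
    {u : Fin n → ℂ} (hu : u ∈ e.target) : TypeBModel.wdir a f u = TypeBModel.wdir a g u := by
  refine (TypeBModel.wdir_congr (?_ : f =ᶠ[𝓝 u] g) a).self_of_nhds
  filter_upwards [e.open_target.mem_nhds hu] with x hx using h x hx

theorem smoothTarget_det {m : Type*} [Fintype m] [DecidableEq m] {A : (Fin n → ℂ) → Matrix m m ℂ}
    (hA : ∀ i j, SmoothTarget e fun u => A u i j) : SmoothTarget e fun u => (A u).det := by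
  intro u hu
  have h : ∀ᶠ x in 𝓝 u, ∀ i j, ContDiffAt ℝ ∞ (fun u => A u i j) x :=
    eventually_all.mpr fun i => eventually_all.mpr fun j => hA i j u hu
  filter_upwards [h] with x hx
  simp only [Matrix.det_apply]
  exact ContDiffAt.sum fun σ _ => (contDiffAt_prod fun i _ => hx _ _).const_smul _

/-- By Cramer's rule the entries are polynomials in smooth entries divided by a nonvanishing
determinant. -/
theorem smoothTarget_inv {m : Type*} [Fintype m] [DecidableEq m] {A : (Fin n → ℂ) → Matrix m m ℂ}
    (hA : ∀ i j, SmoothTarget e fun u => A u i j) (h0 : ∀ u ∈ e.target, (A u).det ≠ 0) (i j : m) :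
    SmoothTarget e fun u => (A u)⁻¹ i j := by
  have h1 : SmoothTarget e fun u => (A u).adjugate i j := by
    simp only [Matrix.adjugate_apply]
    refine smoothTarget_det fun k l => ?_
    by_cases hk : k = j
    · subst hk
      simp only [Matrix.updateRow_self]
      exact fun u _ => Eventually.of_forall fun x => contDiffAt_const
    · simp only [Matrix.updateRow_ne hk]
      exact hA k l
  intro u hu
  filter_upwards [h1 u hu, smoothTarget_det hA u hu, e.open_target.mem_nhds hu] with x h2 h3 h4
  have h5 : (fun u => (A u)⁻¹ i j) = fun u => (A u).det⁻¹ * (A u).adjugate i j := by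
    funext u
    rw [Matrix.inv_def, Ring.inverse_eq_inv', Matrix.smul_apply, smul_eq_mul]
  rw [h5]
  exact (h3.inv (h0 x h4)).mul h2

end SmoothTarget

variable [ChartedSpace (Fin n → ℂ) X] [IsManifold 𝓘(ℂ, Fin n → ℂ) ω X]

/-- The derivative of the inverse of a chart. -/
def frame (e : Coord n X) (u : Fin n → ℂ) :
    (Fin n → ℂ) →L[ℂ] TangentSpace 𝓘(ℂ, Fin n → ℂ) (e.symm u) :=
  mfderiv 𝓘(ℂ, Fin n → ℂ) 𝓘(ℂ, Fin n → ℂ) e.symm u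

theorem frame_injective {e : Coord n X} (he : e ∈ atlas (Fin n → ℂ) X) {u : Fin n → ℂ}
    (hu : u ∈ e.target) : Function.Injective (frame e u) := by
  have h := (mdifferentiable_of_mem_atlas (I := 𝓘(ℂ, Fin n → ℂ)) he).comp_symm_deriv hu
  exact Function.LeftInverse.injective (g := mfderiv 𝓘(ℂ, Fin n → ℂ) 𝓘(ℂ, Fin n → ℂ) e (e.symm u))
    fun v => congrArg (fun L : (Fin n → ℂ) →L[ℂ] (Fin n → ℂ) => L v) h

namespace KahlerMetric

variable (g : KahlerMetric n X) {e : Coord n X} (he : e ∈ atlas (Fin n → ℂ) X)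
include he

theorem coeff_eq (e : Coord n X) (i j : Fin n) (u : Fin n → ℂ) :
    g.coeff e i j u =
      g.herm (e.symm u) (frame e u (Pi.single i 1)) (frame e u (Pi.single j 1)) := rfl

theorem conj_coeff (e : Coord n X) (i j : Fin n) (u : Fin n → ℂ) :
    starRingEnd ℂ (g.coeff e i j u) = g.coeff e j i u := (g.symm _ _ _).symm

/-- A null vector of the matrix of coefficients would give a nonzero tangent vector of length zero,
since the coordinate frame is injective. -/
theorem det_coeff_ne_zero {u : Fin n → ℂ} (hu : u ∈ e.target) :
    (Matrix.of fun k m => g.coeff e k m u).det ≠ 0 := by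
  intro h0
  obtain ⟨v, hv, hv'⟩ := Matrix.exists_mulVec_eq_zero_iff.mpr h0
  -- The conjugate appears because the metric is conjugate-linear in its second argument, the one
  -- that v contracts.
  set w : Fin n → ℂ := fun i => starRingEnd ℂ (v i) with hw
  have hw0 : w ≠ 0 := by
    intro h
    apply hv
    funext i
    have := congrFun h i
    simpa [hw] using this
  have hfr : frame e u w = ∑ i, w i • frame e u (Pi.single i 1) := by
    have : w = ∑ i, w i • (Pi.single i 1 : Fin n → ℂ) := by
      funext j; simp [Finset.sum_apply, Pi.single_apply]
    conv_lhs => rw [this]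
    rw [map_sum]
    exact Finset.sum_congr rfl fun i _ => map_smul _ _ _
  have hne : frame e u w ≠ 0 := fun h =>
    hw0 (frame_injective he hu (h.trans (map_zero _).symm))
  have hpos := g.pos _ _ hne
  have : g.herm (e.symm u) (frame e u w) (frame e u w) = 0 := by
    rw [hfr]
    simp only [map_sum, map_smul, LinearMap.sum_apply, LinearMap.smul_apply, map_smulₛₗ]
    simp only [Finset.smul_sum]
    rw [Finset.sum_comm]
    refine Finset.sum_eq_zero fun k _ => ?_
    have hk := congrFun hv' k
    simp only [Matrix.mulVec, dotProduct, Matrix.of_apply, Pi.zero_apply] at hk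
    have : ∑ m, starRingEnd ℂ (w m) • w k • g.coeff e k m u =
        w k * ∑ m, g.coeff e k m u * v m := by
      rw [Finset.mul_sum]
      refine Finset.sum_congr rfl fun m _ => ?_
      simp only [hw, Complex.conj_conj, smul_eq_mul]
      ring
    rw [hk, mul_zero] at this
    exact this
  rw [this] at hpos
  simp at hpos

theorem smooth_coeff (i j : Fin n) : SmoothTarget e (g.coeff e i j) :=
  SmoothTarget.of_contDiffOn (g.smooth e he i j)

theorem smooth_invCoeff (i j : Fin n) : SmoothTarget e (g.invCoeff e i j) :=
  smoothTarget_inv (fun k m => g.smooth_coeff he k m) (fun _ hu => g.det_coeff_ne_zero he hu) j i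

theorem smooth_christoffel (i j k : Fin n) : SmoothTarget e (g.christoffel e i j k) :=
  SmoothTarget.sum fun m _ => (g.smooth_invCoeff he i m).mul ((g.smooth_coeff he k m).wd j)

theorem smooth_christoffelBar (i j k : Fin n) : SmoothTarget e (g.christoffelBar e i j k) :=
  (g.smooth_christoffel he i j k).conj

theorem smooth_curv (i j k l : Fin n) : SmoothTarget e (g.curv e i j k l) :=
  SmoothTarget.sum fun m _ => (g.smooth_coeff he m j).mul ((g.smooth_christoffel he m i k).wdb l)

theorem smooth_curvUp (i j k l : Fin n) : SmoothTarget e (g.curvUp e i j k l) :=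
  SmoothTarget.sum fun m _ => (g.smooth_invCoeff he i m).mul (g.smooth_curv he j m k l).neg

variable {u : Fin n → ℂ} (hu : u ∈ e.target)
include hu

theorem sum_invCoeff_mul (m m' : Fin n) :
    ∑ i, g.invCoeff e i m' u * g.coeff e i m u = if m' = m then 1 else 0 := by
  have h := Matrix.nonsing_inv_mul (Matrix.of fun k m => g.coeff e k m u)
    (isUnit_iff_ne_zero.mpr (g.det_coeff_ne_zero he hu))
  exact congrFun (congrFun h m') m

theorem sum_invCoeff_mul' (i k : Fin n) :
    ∑ m, g.invCoeff e i m u * g.coeff e k m u = if k = i then 1 else 0 := by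
  have h := Matrix.mul_nonsing_inv (Matrix.of fun k m => g.coeff e k m u)
    (isUnit_iff_ne_zero.mpr (g.det_coeff_ne_zero he hu))
  have h' := congrFun (congrFun h k) i
  rw [Matrix.mul_apply, Matrix.one_apply] at h'
  rw [← h']
  exact Finset.sum_congr rfl fun m _ => mul_comm _ _

theorem eq_of_sum_mul_coeff_eq {x y : Fin n → ℂ}
    (h : ∀ m, ∑ a, x a * g.coeff e a m u = ∑ a, y a * g.coeff e a m u) : x = y := by
  have key : ∀ (x : Fin n → ℂ) b,
      ∑ m, (∑ a, x a * g.coeff e a m u) * g.invCoeff e b m u = x b := by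
    intro x b
    simp only [Finset.sum_mul]
    rw [Finset.sum_comm]
    have : ∀ a, ∑ m, x a * g.coeff e a m u * g.invCoeff e b m u =
        x a * if a = b then 1 else 0 := by
      intro a
      rw [← g.sum_invCoeff_mul' he hu b a, Finset.mul_sum]
      exact Finset.sum_congr rfl fun m _ => by ring
    simp [this]
  funext b
  rw [← key x b, ← key y b]
  simp only [h]

/-- Metric compatibility of the Chern connection. In this form, with the inverse metric eliminated,
Γ cancels the derivatives of g in the Lagrangians. -/
theorem wd_coeff (j k m : Fin n) :
    wd j (g.coeff e k m) u = ∑ i, g.christoffel e i j k u * g.coeff e i m u := by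
  simp only [christoffel, Finset.sum_mul]
  rw [Finset.sum_comm]
  have : ∀ m', ∑ i, g.invCoeff e i m' u * wd j (g.coeff e k m') u * g.coeff e i m u =
      wd j (g.coeff e k m') u * if m' = m then 1 else 0 := by
    intro m'
    rw [← g.sum_invCoeff_mul he hu m m', Finset.mul_sum]
    exact Finset.sum_congr rfl fun i _ => by ring
  simp [this]

theorem wdb_coeff_eq_conj (l i j : Fin n) :
    wdb l (g.coeff e i j) u = starRingEnd ℂ (wd l (g.coeff e j i) u) := by
  have h := wdir_conj ((g.smooth_coeff he j i).differentiableAt hu) (.inr l)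
  have e1 : (fun x => starRingEnd ℂ (g.coeff e j i x)) = g.coeff e i j :=
    funext fun x => g.conj_coeff he e j i x
  rw [e1] at h
  exact h

theorem wdb_coeff (l i j : Fin n) :
    wdb l (g.coeff e i j) u = ∑ m, g.christoffelBar e m l j u * g.coeff e i m u := by
  rw [g.wdb_coeff_eq_conj he hu, g.wd_coeff he hu, map_sum]
  refine Finset.sum_congr rfl fun m _ => ?_
  rw [map_mul, g.conj_coeff he]
  rfl

theorem christoffel_symm (i j k : Fin n) :
    g.christoffel e i j k u = g.christoffel e i k j u := by
  refine Finset.sum_congr rfl fun m _ => ?_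
  congr 1
  exact g.closed e he k m j u hu

/-- Differentiating metric compatibility once more puts the (2,0) curvature expression, with lowered
index, equal to a second derivative of g. That derivative is symmetric in l and j, which is the
source of `christoffel_flat`. -/
theorem wd_wd_coeff (l j k m : Fin n) : wd l (wd j (g.coeff e k m)) u =
    ∑ a, (wd l (g.christoffel e a j k) u +
      ∑ i, g.christoffel e i j k u * g.christoffel e a l i u) * g.coeff e a m u := by
  have h1 := SmoothTarget.wdir_congr (fun u hu => g.wd_coeff he hu j k m) (.inl l) hu
  refine h1.trans ?_
  rw [wdir_sum fun i _ => ((g.smooth_christoffel he i j k).differentiableAt hu).fun_mul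
    ((g.smooth_coeff he i m).differentiableAt hu)]
  have h2 : ∀ i, wdir (.inl l) (fun u => g.christoffel e i j k u * g.coeff e i m u) u =
      wd l (g.christoffel e i j k) u * g.coeff e i m u +
        ∑ a, g.christoffel e i j k u * g.christoffel e a l i u * g.coeff e a m u := by
    intro i
    rw [wdir_mul ((g.smooth_christoffel he i j k).differentiableAt hu)
      ((g.smooth_coeff he i m).differentiableAt hu)]
    congr 1
    change _ * wd l (g.coeff e i m) u = _
    rw [g.wd_coeff he hu, Finset.mul_sum]
    exact Finset.sum_congr rfl fun a _ => by ring
  rw [Finset.sum_congr rfl fun i _ => h2 i, Finset.sum_add_distrib, Finset.sum_comm]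
  simp only [add_mul, Finset.sum_add_distrib, Finset.sum_mul]

/-- The part of type `(2,0)` of the curvature vanishes. -/
theorem christoffel_flat (a l j k : Fin n) :
    wd l (g.christoffel e a j k) u + ∑ i, g.christoffel e i j k u * g.christoffel e a l i u =
    wd j (g.christoffel e a l k) u + ∑ i, g.christoffel e i l k u * g.christoffel e a j i u := by
  refine congrFun (g.eq_of_sum_mul_coeff_eq he hu (x := fun a => wd l (g.christoffel e a j k) u +
    ∑ i, g.christoffel e i j k u * g.christoffel e a l i u) (y := fun a =>
    wd j (g.christoffel e a l k) u + ∑ i, g.christoffel e i l k u * g.christoffel e a j i u)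
    fun m => ?_) a
  rw [← g.wd_wd_coeff he hu, ← g.wd_wd_coeff he hu]
  exact wdir_comm (g.smooth_coeff he k m u hu).contDiffAt (.inl l) (.inl j)

theorem wdb_christoffelBar (a l j k : Fin n) :
    wdb l (g.christoffelBar e a j k) u = starRingEnd ℂ (wd l (g.christoffel e a j k) u) :=
  wdir_conj ((g.smooth_christoffel he a j k).differentiableAt hu) (.inr l)

theorem christoffelBar_symm (i j k : Fin n) :
    g.christoffelBar e i j k u = g.christoffelBar e i k j u :=
  congrArg (starRingEnd ℂ) (g.christoffel_symm he hu i j k)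

/-- The part of type `(0,2)` of the curvature vanishes. -/
theorem christoffelBar_flat (a l j k : Fin n) :
    wdb l (g.christoffelBar e a j k) u +
      ∑ i, g.christoffelBar e i j k u * g.christoffelBar e a l i u =
    wdb j (g.christoffelBar e a l k) u +
      ∑ i, g.christoffelBar e i l k u * g.christoffelBar e a j i u := by
  have h := congrArg (starRingEnd ℂ) (g.christoffel_flat he hu a l j k)
  simp only [map_add, map_sum, map_mul] at h
  rw [g.wdb_christoffelBar he hu, g.wdb_christoffelBar he hu]
  exact h

theorem curvUp_eq (i j k l : Fin n) :
    g.curvUp e i j k l u = -wdb l (g.christoffel e i j k) u := by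
  simp only [curvUp, curv, mul_neg, Finset.sum_neg_distrib, Finset.mul_sum]
  rw [Finset.sum_comm]
  have : ∀ m', ∑ m, g.invCoeff e i m u * (g.coeff e m' m u * wdb l (g.christoffel e m' j k) u) =
      wdb l (g.christoffel e m' j k) u * if m' = i then 1 else 0 := by
    intro m'
    rw [← g.sum_invCoeff_mul' he hu i m', Finset.mul_sum]
    exact Finset.sum_congr rfl fun m _ => by ring
  simp [this]

theorem curv_eq (i l k j : Fin n) : g.curv e i l k j u =
    wdb j (wd i (g.coeff e k l)) u - ∑ m, g.christoffel e m i k u * wdb j (g.coeff e m l) u := by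
  have h1 := SmoothTarget.wdir_congr (fun u hu => g.wd_coeff he hu i k l) (.inr j) hu
  have h2 : wdb j (wd i (g.coeff e k l)) u = ∑ m, (wdb j (g.christoffel e m i k) u *
      g.coeff e m l u + g.christoffel e m i k u * wdb j (g.coeff e m l) u) := by
    refine h1.trans ?_
    rw [wdir_sum fun m _ => ((g.smooth_christoffel he m i k).differentiableAt hu).fun_mul
      ((g.smooth_coeff he m l).differentiableAt hu)]
    exact Finset.sum_congr rfl fun m _ => wdir_mul
      ((g.smooth_christoffel he m i k).differentiableAt hu)
      ((g.smooth_coeff he m l).differentiableAt hu) _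
  rw [h2, Finset.sum_add_distrib, add_sub_cancel_right]
  exact Finset.sum_congr rfl fun m _ => mul_comm _ _

theorem wdb_coeff_symm (j m l : Fin n) :
    wdb j (g.coeff e m l) u = wdb l (g.coeff e m j) u := by
  rw [g.wdb_coeff_eq_conj he hu, g.wdb_coeff_eq_conj he hu]
  exact congrArg (starRingEnd ℂ) (g.closed e he l m j u hu)

/-- The curvature depends on g only through ∂̄g and ∂∂̄g. By the conjugate of the closedness
condition, its two barred indices can be exchanged. The exchange is needed because δG contains the
curvature with its upper index contracted, and the Lagrangian the fully lowered one. -/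
theorem curv_symm (i l k j : Fin n) : g.curv e i l k j u = g.curv e i j k l u := by
  rw [g.curv_eq he hu, g.curv_eq he hu]
  have h1 : wdb j (wd i (g.coeff e k l)) u = wdb l (wd i (g.coeff e k j)) u := by
    have e1 := wdir_comm (g.smooth_coeff he k l u hu).contDiffAt (.inr j) (.inl i)
    have e2 := wdir_comm (g.smooth_coeff he k j u hu).contDiffAt (.inr l) (.inl i)
    refine e1.trans (Eq.trans ?_ e2.symm)
    exact SmoothTarget.wdir_congr (fun u hu => g.wdb_coeff_symm he hu j k l) (.inl i) hu
  rw [h1]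
  congr 1
  exact Finset.sum_congr rfl fun m _ => by rw [g.wdb_coeff_symm he hu]

end KahlerMetric

end Kahler

/-! ### Form degree -/

section Degree

variable {Λ : Type*} [NormedRing Λ] [NormedAlgebra ℂ Λ]

namespace SForm

/-- Forms of degree `k`. -/
def deg (k : ℕ) : Submodule ℂ (SForm Λ) where
  carrier := {w | (k ≠ 0 → w.c0 = 0) ∧ (k ≠ 1 → w.c1 = 0) ∧ (k ≠ 1 → w.c2 = 0) ∧
    (k ≠ 2 → w.c12 = 0)}
  add_mem' := by
    rintro v w ⟨h0, h1, h2, h3⟩ ⟨k0, k1, k2, k3⟩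
    exact ⟨fun h => by rw [c0_add, h0 h, k0 h, add_zero],
      fun h => by rw [c1_add, h1 h, k1 h, add_zero],
      fun h => by rw [c2_add, h2 h, k2 h, add_zero],
      fun h => by rw [c12_add, h3 h, k3 h, add_zero]⟩
  zero_mem' := ⟨fun _ => rfl, fun _ => rfl, fun _ => rfl, fun _ => rfl⟩
  smul_mem' := by
    rintro c v ⟨h0, h1, h2, h3⟩
    exact ⟨fun h => by rw [c0_smul, h0 h, smul_zero],
      fun h => by rw [c1_smul, h1 h, smul_zero],
      fun h => by rw [c2_smul, h2 h, smul_zero],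
      fun h => by rw [c12_smul, h3 h, smul_zero]⟩

theorem of_mem_deg (a : Λ) : of a ∈ deg (Λ := Λ) 0 :=
  ⟨fun h => absurd rfl h, fun _ => rfl, fun _ => rfl, fun _ => rfl⟩

theorem eq_of_of_mem_deg {w : SForm Λ} (h : w ∈ deg (Λ := Λ) 0) : w = of w.c0 :=
  ext' rfl (h.2.1 zero_ne_one) (h.2.2.1 zero_ne_one) (h.2.2.2 two_ne_zero.symm)

theorem iota_mem_deg {k : ℕ} {w : SForm Λ} (p : ℂ) (h : w ∈ deg (Λ := Λ) (k + 1)) :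
    iota p w ∈ deg (Λ := Λ) k := by
  obtain ⟨-, h1, h2, h3⟩ := h
  refine ⟨fun hk => ?_, fun hk => ?_, fun hk => ?_, fun _ => rfl⟩
  · simp [-Complex.coe_smul, iota, h1 (by omega), h2 (by omega)]
  · simp [-Complex.coe_smul, iota, h3 (by omega)]
  · simp [-Complex.coe_smul, iota, h3 (by omega)]

theorem star_mem_deg {w : SForm Λ} : star w ∈ deg (Λ := Λ) 1 :=
  ⟨fun _ => rfl, fun h => absurd rfl h, fun h => absurd rfl h, fun _ => rfl⟩

/-- Contraction with the rotation field is injective on two-forms away from the origin. -/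
theorem eq_of_iota_eq {p : ℂ} (hp : p ≠ 0) {v w : SForm Λ} (hv : v ∈ deg (Λ := Λ) 2)
    (hw : w ∈ deg (Λ := Λ) 2) (h : iota p v = iota p w) : v = w := by
  obtain ⟨v0, v1, v2, -⟩ := hv
  obtain ⟨w0, w1, w2, -⟩ := hw
  refine ext' ((v0 two_ne_zero).trans (w0 two_ne_zero).symm)
    ((v1 (by decide)).trans (w1 (by decide)).symm) ((v2 (by decide)).trans (w2 (by decide)).symm) ?_
  have h1 : -((p.re : ℂ) • v.c12) = -((p.re : ℂ) • w.c12) := congrArg c1 h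
  have h2 : (-p.im : ℂ) • v.c12 = (-p.im : ℂ) • w.c12 := congrArg c2 h
  by_cases hr : p.re = 0
  · have hi : p.im ≠ 0 := fun hi => hp (Complex.ext hr hi)
    exact smul_right_injective Λ (neg_ne_zero.mpr (Complex.ofReal_ne_zero.mpr hi)) h2
  · exact smul_right_injective Λ (Complex.ofReal_ne_zero.mpr hr) (neg_injective h1)

variable [GrassmannAlgebra Λ]

theorem mul_mem_deg {j k : ℕ} {v w : SForm Λ} (hv : v ∈ deg (Λ := Λ) j)
    (hw : w ∈ deg (Λ := Λ) k) : v * w ∈ deg (Λ := Λ) (j + k) := by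
  obtain ⟨v0, v1, v2, v3⟩ := hv
  obtain ⟨w0, w1, w2, w3⟩ := hw
  refine ⟨fun h => ?_, fun h => ?_, fun h => ?_, fun h => ?_⟩
  · by_cases hj : j = 0
    · rw [c0_mul, w0 (by omega), mul_zero]
    · rw [c0_mul, v0 hj, zero_mul]
  · by_cases hj : j = 0
    · rw [c1_mul, w1 (by omega), v1 (by omega), mul_zero, zero_mul, add_zero]
    · rw [c1_mul, v0 hj, map_zero, zero_mul, zero_add]
      by_cases hj1 : j = 1
      · rw [w0 (by omega), mul_zero]
      · rw [v1 hj1, zero_mul]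
  · by_cases hj : j = 0
    · rw [c2_mul, w2 (by omega), v2 (by omega), mul_zero, zero_mul, add_zero]
    · rw [c2_mul, v0 hj, map_zero, zero_mul, zero_add]
      by_cases hj1 : j = 1
      · rw [w0 (by omega), mul_zero]
      · rw [v2 hj1, zero_mul]
  · rcases (by omega : j = 0 ∨ j = 1 ∨ j = 2 ∨ 3 ≤ j) with hj | hj | hj | hj
    · rw [c12_mul, w3 (by omega), v1 (by omega), v2 (by omega), v3 (by omega)]; simp
    · rw [c12_mul, v0 (by omega), w1 (by omega), w2 (by omega), v3 (by omega)]; simp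
    · rw [c12_mul, v0 (by omega), v1 (by omega), v2 (by omega), w0 (by omega)]; simp
    · rw [c12_mul, v0 (by omega), v1 (by omega), v2 (by omega), v3 (by omega)]; simp

theorem dx1_mem_deg : (dx1 : SForm Λ) ∈ deg (Λ := Λ) 1 :=
  ⟨fun _ => rfl, fun h => absurd rfl h, fun h => absurd rfl h, fun _ => rfl⟩

theorem dx2_mem_deg : (dx2 : SForm Λ) ∈ deg (Λ := Λ) 1 :=
  ⟨fun _ => rfl, fun h => absurd rfl h, fun h => absurd rfl h, fun _ => rfl⟩

/-- The coefficient of `dx¹` as a linear map. -/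
def c1L : SForm Λ →ₗ[ℂ] Λ where
  toFun := c1
  map_add' _ _ := rfl
  map_smul' _ _ := rfl

/-- The coefficient of `dx²` as a linear map. -/
def c2L : SForm Λ →ₗ[ℂ] Λ where
  toFun := c2
  map_add' _ _ := rfl
  map_smul' _ _ := rfl

/-- The coefficient of `dx¹ dx²` as a linear map. -/
def c12L : SForm Λ →ₗ[ℂ] Λ where
  toFun := c12
  map_add' _ _ := rfl
  map_smul' _ _ := rfl

end SForm

open SForm

variable [FiniteDimensional ℂ Λ] [GrassmannAlgebra Λ]

/-- The missing components vanish on a relatively open subset of the disk, hence so do their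
derivatives. -/
theorem pd_mem_deg {D : Set ℂ} (hD : IsDiskOpen D) {f : ℂ → SForm Λ} (hf : DiskSmoothOn D f)
    {k : ℕ} (h : ∀ p ∈ D, f p ∈ deg (Λ := Λ) k) {p : ℂ} (hp : p ∈ D) (v : ℂ) :
    pd v f p ∈ deg (Λ := Λ) k := by
  have key : ∀ L : SForm Λ →ₗ[ℂ] Λ, (∀ p ∈ D, L (f p) = 0) → L (pd v f p) = 0 := by
    intro L hL
    rw [← pd_lm_comp hD L hf hp, pd_congr hD (g := fun _ => (0 : Λ)) hL hp]
    simp [pd]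
  exact ⟨fun hk => key c0L fun p hp => (h p hp).1 hk, fun hk => key c1L fun p hp => (h p hp).2.1 hk,
    fun hk => key c2L fun p hp => (h p hp).2.2.1 hk, fun hk => key c12L fun p hp => (h p hp).2.2.2 hk⟩

/-- Smooth differential forms on `D` of degree `k` and total parity `s = ±1`. -/
structure IsForm (D : Set ℂ) (k : ℕ) (s : ℂ) (f : ℂ → SForm Λ) : Prop where
  smooth : DiskSmoothOn D f
  mem_deg : ∀ p ∈ D, f p ∈ deg (Λ := Λ) k
  parity_eq : ∀ p ∈ D, totalParity (f p) = s • f p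

namespace IsForm

variable {D : Set ℂ} {k l : ℕ} {s t : ℂ} {f g : ℂ → SForm Λ}

theorem even (h : IsForm D k 1 f) {p : ℂ} (hp : p ∈ D) : (f p).Even :=
  (h.parity_eq p hp).trans (one_smul _ _)

theorem odd (h : IsForm D k (-1) f) {p : ℂ} (hp : p ∈ D) : (f p).Odd :=
  (h.parity_eq p hp).trans (by rw [neg_smul, one_smul])

/-- Products and contractions yield unsimplified degrees and signs such as 0 + 1 and 1 * -1. The
default arguments normalize them. -/
theorem cast (h : IsForm D k s f) (hk : k = l := by rfl) (hs : s = t := by norm_num) :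
    IsForm D l t f := hk ▸ hs ▸ h

theorem add (hf : IsForm D k s f) (hg : IsForm D k s g) : IsForm D k s (fun p => f p + g p) where
  smooth := hf.smooth.add hg.smooth
  mem_deg p hp := add_mem (hf.mem_deg p hp) (hg.mem_deg p hp)
  parity_eq p hp := by rw [map_add, hf.parity_eq p hp, hg.parity_eq p hp, smul_add]

theorem smul (c : ℂ) (hf : IsForm D k s f) : IsForm D k s (fun p => c • f p) where
  smooth := hf.smooth.smul c
  mem_deg p hp := Submodule.smul_mem _ c (hf.mem_deg p hp)
  parity_eq p hp := by rw [map_smul, hf.parity_eq p hp, smul_comm]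

theorem neg (hf : IsForm D k s f) : IsForm D k s (fun p => -f p) := by
  simpa only [neg_smul, one_smul] using hf.smul (-1)

theorem sub (hf : IsForm D k s f) (hg : IsForm D k s g) : IsForm D k s (fun p => f p - g p) := by
  simpa only [sub_eq_add_neg] using hf.add hg.neg

theorem sum {κ : Type*} {I : Finset κ} {f : κ → ℂ → SForm Λ} (h : ∀ i ∈ I, IsForm D k s (f i)) :
    IsForm D k s (fun p => ∑ i ∈ I, f i p) where
  smooth := DiskSmoothOn.sum fun i hi => (h i hi).smooth
  mem_deg p hp := sum_mem fun i hi => (h i hi).mem_deg p hp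
  parity_eq p hp := by
    rw [map_sum, Finset.smul_sum]
    exact Finset.sum_congr rfl fun i hi => (h i hi).parity_eq p hp

theorem mul (hf : IsForm D k s f) (hg : IsForm D l t g) :
    IsForm D (k + l) (s * t) (fun p => f p * g p) where
  smooth := hf.smooth.mul hg.smooth
  mem_deg p hp := mul_mem_deg (hf.mem_deg p hp) (hg.mem_deg p hp)
  parity_eq p hp := by
    rw [map_mul, hf.parity_eq p hp, hg.parity_eq p hp, smul_mul_smul_comm]

theorem iota (hf : IsForm D (k + 1) s f) : IsForm D k (-s) (fun p => SForm.iota p (f p)) where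
  smooth := hf.smooth.iota
  mem_deg p hp := iota_mem_deg p (hf.mem_deg p hp)
  parity_eq p hp := by
    rw [totalParity_iota, hf.parity_eq p hp, iota_smul, neg_smul]

theorem star (hf : IsForm D k s f) : IsForm D 1 s (fun p => SForm.star (f p)) where
  smooth := hf.smooth.star
  mem_deg p _ := star_mem_deg
  parity_eq p hp := by rw [totalParity_star, hf.parity_eq p hp, SForm.star_smul]

theorem deRham (hD : IsDiskOpen D) (hf : IsForm D k s f) : IsForm D (k + 1) (-s) (deRham f) where
  smooth := hf.smooth.deRham hD
  mem_deg p hp := by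
    rw [deRham_apply, add_comm k]
    exact add_mem (mul_mem_deg dx1_mem_deg (pd_mem_deg hD hf.smooth hf.mem_deg hp _))
      (mul_mem_deg dx2_mem_deg (pd_mem_deg hD hf.smooth hf.mem_deg hp _))
  parity_eq p hp := by
    rw [totalParity_deRham hD hf.smooth hp, deRham_congr hD hf.parity_eq hp,
      deRham_smul hD s hf.smooth hp, neg_smul]

theorem iota_eq_zero (hf : IsForm D 0 s f) {p : ℂ} (hp : p ∈ D) : SForm.iota p (f p) = 0 := by
  rw [eq_of_of_mem_deg (hf.mem_deg p hp), iota_of]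

theorem lie_eq (hD : IsDiskOpen D) (hf : IsForm D 0 s f) {p : ℂ} (hp : p ∈ D) :
    TypeBModel.lie f p = SForm.iota p (TypeBModel.deRham f p) := by
  rw [TypeBModel.lie, deRham_congr hD (g := fun _ => 0) (fun q hq => hf.iota_eq_zero hq) hp,
    deRham_zero, zero_add]

theorem lie (hD : IsDiskOpen D) (hf : IsForm D k s f) : IsForm D k s (lie f) := by
  have h2 : IsForm D k s (fun p => SForm.iota p (TypeBModel.deRham f p)) :=
    (hf.deRham hD).iota.cast rfl (neg_neg s)
  rcases k with _ | k
  · exact ⟨hf.smooth.lie hD, fun p hp => by rw [hf.lie_eq hD hp]; exact h2.mem_deg p hp,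
      fun p hp => by rw [hf.lie_eq hD hp]; exact h2.parity_eq p hp⟩
  · exact ((hf.iota.deRham hD).cast rfl (neg_neg s)).add h2

theorem const_mul {ε : Λ} (hε : IsOdd ε) (hf : IsForm D k s f) :
    IsForm D k (-s) (fun p => of ε * f p) where
  smooth := (diskSmoothOn_const _).mul hf.smooth
  mem_deg p hp := by
    have := mul_mem_deg (of_mem_deg ε) (hf.mem_deg p hp)
    rwa [zero_add] at this
  parity_eq p hp := by
    rw [totalParity_of_mul hε, hf.parity_eq p hp, mul_smul_comm, neg_smul]

theorem exists_odd (hf : IsForm D 0 (-1) f) {p : ℂ} (hp : p ∈ D) : ∃ b, IsOdd b ∧ f p = of b :=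
  ⟨(f p).c0, congrArg c0 (hf.odd hp), eq_of_of_mem_deg (hf.mem_deg p hp)⟩

theorem isEvenFn (hf : IsForm D 0 1 f) {p : ℂ} (hp : p ∈ D) : (f p).IsEvenFn := by
  obtain ⟨-, h1, h2, h3⟩ := hf.mem_deg p hp
  exact ⟨congrArg c0 (hf.even hp), h1 (by decide), h2 (by decide), h3 (by decide)⟩

theorem isOddFn (hf : IsForm D 0 (-1) f) {p : ℂ} (hp : p ∈ D) : (f p).IsOddFn := by
  obtain ⟨-, h1, h2, h3⟩ := hf.mem_deg p hp
  exact ⟨congrArg c0 (hf.odd hp), h1 (by decide), h2 (by decide), h3 (by decide)⟩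

theorem isOddOneForm (hf : IsForm D 1 1 f) {p : ℂ} (hp : p ∈ D) : (f p).IsOddOneForm := by
  obtain ⟨h0, -, -, h3⟩ := hf.mem_deg p hp
  exact ⟨h0 (by decide), neg_eq_iff_eq_neg.mp (congrArg c1 (hf.even hp)),
    neg_eq_iff_eq_neg.mp (congrArg c2 (hf.even hp)), h3 (by decide)⟩

theorem isEvenTwoForm (hf : IsForm D 2 1 f) {p : ℂ} (hp : p ∈ D) : (f p).IsEvenTwoForm := by
  obtain ⟨h0, h1, h2, -⟩ := hf.mem_deg p hp
  exact ⟨h0 (by decide), h1 (by decide), h2 (by decide), congrArg c12 (hf.even hp)⟩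

end IsForm

end Degree

/-! ### The fields as forms -/

section FieldForms

open SForm

variable {n : ℕ} {X : Type*} [TopologicalSpace X]
  {Λ : Type*} [NormedRing Λ] [NormedAlgebra ℂ Λ] [FiniteDimensional ℂ Λ] [GrassmannAlgebra Λ]
  {Φ : ℂ → X} {e : Coord n X} {F : LocalFields n Λ}

/-- The infinitesimal variation `B` of the fields has the form degrees of the fields and the
opposite parities. -/
structure IsLocalVariation (D : Set ℂ) (B : LocalFields n Λ) : Prop where
  φ : ∀ i, IsForm D 0 (-1) (fun p => B.φ p i)
  φb : ∀ i, IsForm D 0 (-1) (fun p => B.φb p i)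
  η : ∀ i, IsForm D 0 1 (fun p => B.η p i)
  θ : ∀ i, IsForm D 0 1 (fun p => B.θ p i)
  ρ : ∀ i, IsForm D 1 (-1) (fun p => B.ρ p i)
  G : ∀ i, IsForm D 2 (-1) (fun p => B.G p i)
  Gb : ∀ i, IsForm D 0 (-1) (fun p => B.Gb p i)

namespace IsLocalField

variable (hD : IsDiskOpen (chartDomain Φ e)) (h : IsLocalField Φ e F)
include hD h

theorem form_φ (i : Fin n) : IsForm (chartDomain Φ e) 0 1 (fun p => F.φ p i) :=
  ⟨diskSmoothOn hD h.smooth_φ i, fun p hp => by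
    rw [(h.type_φ p hp i).eq_of]; exact of_mem_deg _,
    fun p hp => by rw [one_smul]; exact (h.type_φ p hp i).even⟩

theorem form_φb (i : Fin n) : IsForm (chartDomain Φ e) 0 1 (fun p => F.φb p i) :=
  ⟨diskSmoothOn hD h.smooth_φb i, fun p hp => by
    rw [(h.type_φb p hp i).eq_of]; exact of_mem_deg _,
    fun p hp => by rw [one_smul]; exact (h.type_φb p hp i).even⟩

theorem form_η (i : Fin n) : IsForm (chartDomain Φ e) 0 (-1) (fun p => F.η p i) :=
  ⟨diskSmoothOn hD h.smooth_η i, fun p hp => by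
    obtain ⟨-, h1, h2, h3⟩ := h.type_η p hp i
    exact ⟨fun hk => absurd rfl hk, fun _ => h1, fun _ => h2, fun _ => h3⟩,
    fun p hp => by rw [neg_smul, one_smul]; exact (h.type_η p hp i).odd⟩

theorem form_θ (i : Fin n) : IsForm (chartDomain Φ e) 0 (-1) (fun p => F.θ p i) :=
  ⟨diskSmoothOn hD h.smooth_θ i, fun p hp => by
    obtain ⟨-, h1, h2, h3⟩ := h.type_θ p hp i
    exact ⟨fun hk => absurd rfl hk, fun _ => h1, fun _ => h2, fun _ => h3⟩,
    fun p hp => by rw [neg_smul, one_smul]; exact (h.type_θ p hp i).odd⟩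

theorem form_ρ (i : Fin n) : IsForm (chartDomain Φ e) 1 1 (fun p => F.ρ p i) :=
  ⟨diskSmoothOn hD h.smooth_ρ i, fun p hp => by
    obtain ⟨h0, -, -, h3⟩ := h.type_ρ p hp i
    exact ⟨fun _ => h0, fun hk => absurd rfl hk, fun hk => absurd rfl hk, fun _ => h3⟩,
    fun p hp => by rw [one_smul]; exact (h.type_ρ p hp i).even⟩

theorem form_G (i : Fin n) : IsForm (chartDomain Φ e) 2 1 (fun p => F.G p i) :=
  ⟨diskSmoothOn hD h.smooth_G i, fun p hp => by
    obtain ⟨h0, h1, h2, -⟩ := h.type_G p hp i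
    exact ⟨fun _ => h0, fun _ => h1, fun _ => h2, fun hk => absurd rfl hk⟩,
    fun p hp => by rw [one_smul]; exact (h.type_G p hp i).even⟩

theorem form_Gb (i : Fin n) : IsForm (chartDomain Φ e) 0 1 (fun p => F.Gb p i) :=
  ⟨diskSmoothOn hD h.smooth_Gb i, fun p hp => by
    rw [(h.type_Gb p hp i).eq_of]; exact of_mem_deg _,
    fun p hp => by rw [one_smul]; exact (h.type_Gb p hp i).even⟩

theorem form_at {f : (Fin n → ℂ) → ℂ} (hf : SmoothTarget e f) :
    IsForm (chartDomain Φ e) 0 1 (F.at f) :=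
  ⟨h.smooth_at hD hf, fun p hp => by rw [h.at_eq hp hf]; exact of_mem_deg _,
    fun p hp => by rw [one_smul]; exact h.at_even hp hf⟩

/-- Fields varied by an odd constant times fields of opposite parity. -/
theorem shift {B : LocalFields n Λ} (hB : IsLocalVariation (chartDomain Φ e) B) {ε : Λ}
    (hε : IsOdd ε) : IsLocalField Φ e (F.shift ε B) := by
  have hs : ∀ {f : ℂ → Fin n → SForm Λ}, (∀ i, DiskSmoothOn (chartDomain Φ e) (fun p => f p i)) →
      ContDiffOn ℝ ∞ f (chartDomain Φ e) := fun hf p hp =>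
    (contDiffWithinAt_pi.mpr fun i => hf i p hp).mono hD.subset
  have h0 : ∀ i, IsForm (chartDomain Φ e) 0 1 (fun p => (F.shift ε B).φ p i) := fun i =>
    (h.form_φ hD i).add (((hB.φ i).const_mul hε).cast rfl (neg_neg 1))
  have h1 : ∀ i, IsForm (chartDomain Φ e) 0 1 (fun p => (F.shift ε B).φb p i) := fun i =>
    (h.form_φb hD i).add (((hB.φb i).const_mul hε).cast rfl (neg_neg 1))
  have h2 : ∀ i, IsForm (chartDomain Φ e) 0 (-1) (fun p => (F.shift ε B).η p i) := fun i =>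
    (h.form_η hD i).add ((hB.η i).const_mul hε)
  have h3 : ∀ i, IsForm (chartDomain Φ e) 0 (-1) (fun p => (F.shift ε B).θ p i) := fun i =>
    (h.form_θ hD i).add ((hB.θ i).const_mul hε)
  have h4 : ∀ i, IsForm (chartDomain Φ e) 1 1 (fun p => (F.shift ε B).ρ p i) := fun i =>
    (h.form_ρ hD i).add (((hB.ρ i).const_mul hε).cast rfl (neg_neg 1))
  have h5 : ∀ i, IsForm (chartDomain Φ e) 2 1 (fun p => (F.shift ε B).G p i) := fun i =>
    (h.form_G hD i).add (((hB.G i).const_mul hε).cast rfl (neg_neg 1))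
  have h6 : ∀ i, IsForm (chartDomain Φ e) 0 1 (fun p => (F.shift ε B).Gb p i) := fun i =>
    (h.form_Gb hD i).add (((hB.Gb i).const_mul hε).cast rfl (neg_neg 1))
  have hb : ∀ v w : SForm Λ, GrassmannAlgebra.body (v + of ε * w).c0 =
      GrassmannAlgebra.body v.c0 := fun v w => by
    rw [c0_add, c0_mul, c0_of, map_add, map_mul, hε.body_eq_zero, zero_mul, add_zero]
  exact {
    smooth_φ := hs fun i => (h0 i).smooth
    smooth_φb := hs fun i => (h1 i).smooth
    smooth_η := hs fun i => (h2 i).smooth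
    smooth_θ := hs fun i => (h3 i).smooth
    smooth_ρ := hs fun i => (h4 i).smooth
    smooth_G := hs fun i => (h5 i).smooth
    smooth_Gb := hs fun i => (h6 i).smooth
    type_φ := fun p hp i => (h0 i).isEvenFn hp
    type_φb := fun p hp i => (h1 i).isEvenFn hp
    type_η := fun p hp i => (h2 i).isOddFn hp
    type_θ := fun p hp i => (h3 i).isOddFn hp
    type_ρ := fun p hp i => (h4 i).isOddOneForm hp
    type_G := fun p hp i => (h5 i).isEvenTwoForm hp
    type_Gb := fun p hp i => (h6 i).isEvenFn hp
    body_φ := fun p hp i => (hb _ _).trans (h.body_φ p hp i)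
    body_φb := fun p hp i => (hb _ _).trans (h.body_φb p hp i) }

end IsLocalField

namespace IsLocalField

variable [ChartedSpace (Fin n → ℂ) X] [IsManifold 𝓘(ℂ, Fin n → ℂ) ω X]
  (g : KahlerMetric n X) (he : e ∈ atlas (Fin n → ℂ) X)
  (hD : IsDiskOpen (chartDomain Φ e)) (h : IsLocalField Φ e F)
include he hD h

theorem form_covTheta (i : Fin n) : IsForm (chartDomain Φ e) 1 1 (fun p => covTheta g e F p i) := by
  refine (((h.form_θ hD i).deRham hD).cast rfl (neg_neg 1)).add
    (.sum fun j _ => .sum fun k _ => ?_)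
  exact (((h.form_at hD (g.smooth_christoffelBar he i j k)).mul ((h.form_φb hD j).deRham hD)).mul
    (h.form_θ hD k)).cast

theorem form_covRho (i : Fin n) : IsForm (chartDomain Φ e) 2 (-1) (fun p => covRho g e F p i) := by
  refine ((h.form_ρ hD i).deRham hD).add (.sum fun j _ => .sum fun k _ => ?_)
  exact (((h.form_at hD (g.smooth_christoffel he i j k)).mul ((h.form_φ hD j).deRham hD)).mul
    (h.form_ρ hD k)).cast

/-- Counting degrees and signs shows that δ is odd and preserves form degree. By `shift` the varied
fields are then fields again, so every pointwise identity can be applied to them as well. -/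
theorem brst (ħ : ℂ) : IsLocalVariation (chartDomain Φ e) (brst ħ g e F) where
  φ i := (h.form_ρ hD i).iota.smul ħ
  φb i := h.form_η hD i
  η i := (((h.form_φb hD i).deRham hD).iota.smul ħ).cast
  θ i := (h.form_Gb hD i).sub (.sum fun j _ => .sum fun k _ =>
    (((h.form_at hD (g.smooth_christoffelBar he i j k)).mul (h.form_η hD j)).mul
      (h.form_θ hD k)).cast)
  ρ i := ((((h.form_φ hD i).deRham hD).neg).sub ((h.form_G hD i).iota.smul ħ)).sub
    (.smul ħ (.sum fun j _ => .sum fun k _ =>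
      (((h.form_at hD (g.smooth_christoffel he i j k)).mul (h.form_ρ hD j).iota).mul
        (h.form_ρ hD k)).cast))
  G i := (((h.form_covRho g he hD i).add (.smul _ (.sum fun j _ => .sum fun k _ => .sum fun l _ =>
      ((((h.form_at hD (g.smooth_curvUp he i j k l)).mul (h.form_η hD l)).mul
        (h.form_ρ hD j)).mul (h.form_ρ hD k)).cast)))).add
    (.smul ħ (.sum fun j _ => .sum fun k _ =>
      (((h.form_at hD (g.smooth_christoffel he i j k)).mul (h.form_G hD j).iota).mul
        (h.form_ρ hD k)).cast))
  Gb i := (IsForm.neg (.sum fun j _ => .sum fun k _ =>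
      (((h.form_at hD (g.smooth_christoffelBar he i j k)).mul (h.form_η hD j)).mul
        (h.form_Gb hD k)).cast)).add ((h.form_covTheta g he hD i).iota.smul ħ) |>.add
    (.smul ħ (.sum fun l _ => .sum fun j _ => .sum fun k _ =>
      ((((h.form_at hD ((g.smooth_christoffelBar he i j k).wd l)).mul (h.form_ρ hD l).iota).mul
        (h.form_η hD j)).mul (h.form_θ hD k)).cast))

end IsLocalField

end FieldForms

/-! ### The square of the BRST differential -/

section SymmetricSums

variable {R : Type*} [Ring R] {κ : Type*} [Fintype κ]

theorem sum_mul_anticomm {A : κ → κ → R} (hA : ∀ j k, A j k = A k j) {x y : κ → R}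
    (h : ∀ j k, x j * y k = -(y k * x j)) :
    ∑ j, ∑ k, A j k * (x j * y k) = -∑ j, ∑ k, A j k * (y j * x k) := by
  rw [Finset.sum_comm, ← Finset.sum_neg_distrib]
  refine Finset.sum_congr rfl fun j _ => ?_
  rw [← Finset.sum_neg_distrib]
  exact Finset.sum_congr rfl fun k _ => by rw [hA k j, h, mul_neg]

theorem sum_mul_comm {A : κ → κ → R} (hA : ∀ j k, A j k = A k j) {x y : κ → R}
    (h : ∀ j k, x j * y k = y k * x j) :
    ∑ j, ∑ k, A j k * (x j * y k) = ∑ j, ∑ k, A j k * (y j * x k) := by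
  rw [Finset.sum_comm]
  exact Finset.sum_congr rfl fun j _ => Finset.sum_congr rfl fun k _ => by rw [hA k j, h]

theorem sum_mul_anticomm_self [Module ℂ R] {A : κ → κ → R} (hA : ∀ j k, A j k = A k j) {x : κ → R}
    (h : ∀ j k, x j * x k = -(x k * x j)) : ∑ j, ∑ k, A j k * (x j * x k) = 0 := by
  have h1 := sum_mul_anticomm hA h
  have h2 : (2 : ℂ) • (∑ j, ∑ k, A j k * (x j * x k)) = (2 : ℂ) • (0 : R) := by
    rw [two_smul, smul_zero]
    nth_rewrite 1 [h1]
    exact neg_add_cancel _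
  exact smul_right_injective _ (two_ne_zero' ℂ) h2

/-- The cancellation behind the flatness of the `(2,0)` part of the connection. -/
theorem sum_flat_cancel [Module ℂ R] {A : κ → κ → R} {A₁ B : κ → κ → κ → R} {x r : κ → R}
    (hx : ∀ j k, x j * x k = -(x k * x j)) (hB : ∀ j k l m, B k l m * x j = x j * B k l m)
    (hflat : ∀ l j m, A₁ l j m + ∑ k, A l k * B k j m = A₁ j l m + ∑ k, A j k * B k l m) :
    (∑ j, ∑ k, ∑ l, A₁ l j k * (x l * (x j * r k))) +
      ∑ j, ∑ k, A j k * (x j * ∑ l, ∑ m, B k l m * x l * r m) = 0 := by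
  have h0 : ∀ m, (∑ l, ∑ j, (A₁ l j m + ∑ k, A l k * B k j m) * (x l * x j)) * r m = 0 :=
    fun m => by rw [sum_mul_anticomm_self (fun l j => hflat l j m) hx, zero_mul]
  have h1 : ∀ m, (∑ l, ∑ j, (A₁ l j m + ∑ k, A l k * B k j m) * (x l * x j)) * r m =
      (∑ j, ∑ l, A₁ l j m * (x l * (x j * r m))) +
      ∑ l, ∑ j, ∑ k, A l k * (x l * (B k j m * x j * r m)) := by
    intro m
    rw [Finset.sum_comm (f := fun j l => A₁ l j m * (x l * (x j * r m))), ← Finset.sum_add_distrib,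
      Finset.sum_mul]
    refine Finset.sum_congr rfl fun l _ => ?_
    rw [← Finset.sum_add_distrib, Finset.sum_mul]
    refine Finset.sum_congr rfl fun j _ => ?_
    rw [add_mul, add_mul, mul_assoc, mul_assoc, Finset.sum_mul, Finset.sum_mul]
    congr 1
    refine Finset.sum_congr rfl fun k _ => ?_
    rw [mul_assoc (A l k), ← mul_assoc (B k j m), hB, mul_assoc, mul_assoc, mul_assoc, mul_assoc]
  have h2 := Finset.sum_congr rfl fun m (_ : m ∈ Finset.univ) => (h1 m).symm.trans (h0 m)
  rw [Finset.sum_add_distrib, Finset.sum_const_zero, Finset.sum_comm] at h2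
  refine Eq.trans ?_ h2
  congr 1
  symm
  refine Finset.sum_comm.trans (Finset.sum_congr rfl fun l _ => ?_)
  simp only [Finset.mul_sum]
  refine (Finset.sum_congr rfl fun m _ => Finset.sum_comm).trans
    (Finset.sum_comm.trans (Finset.sum_congr rfl fun k _ => Finset.sum_comm))

end SymmetricSums

/-! ### The square on φ, φ̄ and η̄. -/

section Square

open SForm

variable {n : ℕ} {X : Type*} [TopologicalSpace X]
  {Λ : Type*} [NormedRing Λ] [NormedAlgebra ℂ Λ] [FiniteDimensional ℂ Λ] [GrassmannAlgebra Λ]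

/-- The second variation is filled in by decree. This serves when only δ of a composite expression
is wanted, before δ² is known on its constituents. -/
theorem Variation.of_smooth {c : ℂ} {ε : Λ} {D : Set ℂ} {x x₁ y : ℂ → SForm Λ}
    (hx : DiskSmoothOn D x) (hx₁ : DiskSmoothOn D x₁) (h : ∀ p ∈ D, y p = x p + of ε * x₁ p) :
    Variation c ε D x x₁ y (fun p => x₁ p + of ε * (c • lie x p)) :=
  ⟨hx, hx₁, h, fun _ _ => rfl⟩

/-- The rotation field vanishes at the centre, so contracted identities say nothing there;
continuity closes the gap. -/
theorem eqOn_of_eqOn_ne_zero {D : Set ℂ} (hD : IsDiskOpen D) {V : Type*} [NormedAddCommGroup V]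
    {f g : ℂ → V} (hf : ContinuousOn f D) (hg : ContinuousOn g D)
    (h : ∀ p ∈ D, p ≠ 0 → f p = g p) : Set.EqOn f g D := by
  intro p hp
  by_cases h0 : p = 0
  · subst h0
    have hN : D ∈ 𝓝 (0 : ℂ) := by
      have := hD.mem_nhdsWithin 0 hp
      rwa [disk, nhdsWithin_eq_nhds.mpr (Metric.closedBall_mem_nhds 0 one_pos)] at this
    have hf0 : Tendsto f (𝓝[≠] 0) (𝓝 (f 0)) := ((hf 0 hp).continuousAt hN).mono_left nhdsWithin_le_nhds
    have hg0 : Tendsto g (𝓝[≠] 0) (𝓝 (g 0)) := ((hg 0 hp).continuousAt hN).mono_left nhdsWithin_le_nhds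
    refine tendsto_nhds_unique_of_eventuallyEq hf0 hg0 ?_
    filter_upwards [self_mem_nhdsWithin, mem_nhdsWithin_of_mem_nhds hN] with q hq hq'
      using h q hq' hq
  · exact h p hp h0

variable {Φ : ℂ → X} {e : Coord n X} {F : LocalFields n Λ}

/-- The varied fields `F + ε δF`. -/
abbrev brstShift [ChartedSpace (Fin n → ℂ) X] (ħ : ℂ) (g : KahlerMetric n X) (e : Coord n X)
    (ε : Λ) (F : LocalFields n Λ) : LocalFields n Λ := F.shift ε (brst ħ g e F)

variable [ChartedSpace (Fin n → ℂ) X] [IsManifold 𝓘(ℂ, Fin n → ℂ) ω X]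

namespace IsLocalField

variable (ħ : ℂ) (g : KahlerMetric n X) (he : e ∈ atlas (Fin n → ℂ) X)
  (hD : IsDiskOpen (chartDomain Φ e)) (h : IsLocalField Φ e F) {p : ℂ} (hp : p ∈ chartDomain Φ e)
include he hD h

theorem brstShift {ε : Λ} (hε : IsOdd ε) : IsLocalField Φ e (brstShift ħ g e ε F) :=
  h.shift hD (h.brst g he hD ħ) hε

section Pointwise

include hp

theorem at_christoffel_symm (i j k : Fin n) :
    F.at (g.christoffel e i j k) p = F.at (g.christoffel e i k j) p :=
  h.at_congr hp (g.smooth_christoffel he i j k) fun _ hu => g.christoffel_symm he hu i j k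

theorem at_christoffelBar_symm (i j k : Fin n) :
    F.at (g.christoffelBar e i j k) p = F.at (g.christoffelBar e i k j) p :=
  h.at_congr hp (g.smooth_christoffelBar he i j k) fun _ hu => g.christoffelBar_symm he hu i j k

theorem sum_christoffel_iota_iota (i : Fin n) :
    ∑ j, ∑ k, F.at (g.christoffel e i j k) p *
      (SForm.iota p (F.ρ p j) * SForm.iota p (F.ρ p k)) = 0 :=
  sum_mul_anticomm_self (h.at_christoffel_symm g he hD hp i) fun j k =>
    ((h.form_ρ hD j).iota.odd hp).anticomm ((h.form_ρ hD k).iota.odd hp)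

theorem iota_christoffel_mul (i j k : Fin n) (w : SForm Λ) :
    SForm.iota p (F.at (g.christoffel e i j k) p * w) =
      F.at (g.christoffel e i j k) p * SForm.iota p w := by
  rw [SForm.iota_mul, (h.form_at hD (g.smooth_christoffel he i j k)).iota_eq_zero hp, zero_mul,
    zero_add, (h.at_even hp (g.smooth_christoffel he i j k) : totalParity _ = _)]

theorem iota_sum_christoffel (i : Fin n) : SForm.iota p (∑ j, ∑ k, F.at (g.christoffel e i j k) p *
    SForm.iota p (F.ρ p j) * F.ρ p k) = 0 := by
  have h1 : ∀ j k, SForm.iota p (F.at (g.christoffel e i j k) p * SForm.iota p (F.ρ p j) * F.ρ p k)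
      = -(F.at (g.christoffel e i j k) p * (SForm.iota p (F.ρ p j) * SForm.iota p (F.ρ p k))) := by
    intro j k
    rw [mul_assoc, h.iota_christoffel_mul g he hD hp, SForm.iota_mul, SForm.iota_iota, zero_mul,
      zero_add, ((h.form_ρ hD j).iota.odd hp : totalParity _ = _), neg_mul, mul_neg]
  simp only [SForm.iota_sum, h1, Finset.sum_neg_distrib]
  rw [h.sum_christoffel_iota_iota g he hD hp, neg_zero]

/-- The term with G dies by ι² = 0, and the quadratic one because Γ is symmetric while the ιρʲ
anticommute. With Cartan's formula for functions this gives δ²φ = ħLφ. -/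
theorem iota_brst_ρ (i : Fin n) : SForm.iota p ((TypeBModel.brst ħ g e F).ρ p i) =
    -SForm.iota p (deRham (fun q => F.φ q i) p) := by
  simp only [TypeBModel.brst]
  rw [SForm.iota_sub, SForm.iota_sub, SForm.iota_smul, SForm.iota_smul, SForm.iota_iota,
    h.iota_sum_christoffel g he hD hp, SForm.iota_neg]
  simp

end Pointwise

variable {ε : Λ} (hε : IsOdd ε)
include hε

theorem variation_φ (i : Fin n) : Variation ħ ε (chartDomain Φ e) (fun p => F.φ p i)
    (fun p => (TypeBModel.brst ħ g e F).φ p i) (fun p => (TypeBModel.brstShift ħ g e ε F).φ p i)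
    (fun p => (TypeBModel.brst ħ g e (TypeBModel.brstShift ħ g e ε F)).φ p i) where
  smooth := (h.form_φ hD i).smooth
  smooth₁ := ((h.brst g he hD ħ).φ i).smooth
  eq p _ := rfl
  eq₁ p hp := by
    change ħ • SForm.iota p (F.ρ p i + of ε * (TypeBModel.brst ħ g e F).ρ p i) =
      ħ • SForm.iota p (F.ρ p i) + _
    rw [SForm.iota_add, iota_of_mul hε, h.iota_brst_ρ ħ g he hD hp, (h.form_φ hD i).lie_eq hD hp,
      smul_add, mul_neg, neg_neg, mul_smul_comm]

theorem variation_φb (i : Fin n) : Variation ħ ε (chartDomain Φ e) (fun p => F.φb p i)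
    (fun p => (TypeBModel.brst ħ g e F).φb p i) (fun p => (TypeBModel.brstShift ħ g e ε F).φb p i)
    (fun p => (TypeBModel.brst ħ g e (TypeBModel.brstShift ħ g e ε F)).φb p i) where
  smooth := (h.form_φb hD i).smooth
  smooth₁ := ((h.brst g he hD ħ).φb i).smooth
  eq p _ := rfl
  eq₁ p hp := by
    rw [(h.form_φb hD i).lie_eq hD hp]; rfl

theorem variation_coord (a : Fin n ⊕ Fin n) : Variation ħ ε (chartDomain Φ e) (F.coord a)
    ((TypeBModel.brst ħ g e F).coord a) ((TypeBModel.brstShift ħ g e ε F).coord a)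
    ((TypeBModel.brst ħ g e (TypeBModel.brstShift ħ g e ε F)).coord a) := by
  rcases a with i | i
  · exact h.variation_φ ħ g he hD hε i
  · exact h.variation_φb ħ g he hD hε i

omit hε in
theorem form_brst_coord (a : Fin n ⊕ Fin n) : IsForm (chartDomain Φ e) 0 (-1)
    ((TypeBModel.brst ħ g e F).coord a) := by
  rcases a with i | i
  · exact (h.brst g he hD ħ).φ i
  · exact (h.brst g he hD ħ).φb i

theorem variation_at {f : (Fin n → ℂ) → ℂ} (hf : SmoothTarget e f) :
    Variation ħ ε (chartDomain Φ e) (F.at f)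
      (fun p => ∑ a, F.at (wdir a f) p * (TypeBModel.brst ħ g e F).coord a p)
      ((TypeBModel.brstShift ħ g e ε F).at f)
      (fun p => ∑ a, (TypeBModel.brstShift ħ g e ε F).at (wdir a f) p *
        (TypeBModel.brst ħ g e (TypeBModel.brstShift ħ g e ε F)).coord a p) :=
  Variation.at hD hε h (h.brstShift ħ g he hD hε) (h.variation_coord ħ g he hD hε)
    (fun a _ hp => (h.form_brst_coord ħ g he hD a).exists_odd hp) hf

theorem variation_η (i : Fin n) : Variation ħ ε (chartDomain Φ e) (fun p => F.η p i)
    (fun p => (TypeBModel.brst ħ g e F).η p i) (fun p => (TypeBModel.brstShift ħ g e ε F).η p i)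
    (fun p => (TypeBModel.brst ħ g e (TypeBModel.brstShift ħ g e ε F)).η p i) where
  smooth := (h.form_η hD i).smooth
  smooth₁ := ((h.brst g he hD ħ).η i).smooth
  eq p _ := rfl
  eq₁ p hp := by
    refine ((((h.variation_φb ħ g he hD hε i).deRham hD hε).iota hε).smul hD ħ).eq p hp |>.trans ?_
    rw [SForm.iota_neg, neg_neg, (h.form_η hD i).lie_eq hD hp]
    rfl

end IsLocalField

end Square

/-! ### The contracted form of δG. -/

section SquareRho

open SForm

variable {n : ℕ} {X : Type*} [TopologicalSpace X]
  {Λ : Type*} [NormedRing Λ] [NormedAlgebra ℂ Λ] [FiniteDimensional ℂ Λ] [GrassmannAlgebra Λ]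
  {Φ : ℂ → X} {e : Coord n X} {F : LocalFields n Λ}
  [ChartedSpace (Fin n → ℂ) X] [IsManifold 𝓘(ℂ, Fin n → ℂ) ω X]

/-- `Γⁱ_{jk} (ι ρʲ) ρᵏ`. -/
def quadRho (g : KahlerMetric n X) (e : Coord n X) (F : LocalFields n Λ) (i : Fin n) (p : ℂ) :
    SForm Λ :=
  ∑ j, ∑ k, F.at (g.christoffel e i j k) p * SForm.iota p (F.ρ p j) * F.ρ p k

/-- The variation of `Γⁱ_{jk} (ι ρʲ) ρᵏ`. -/
def quadRhoVar (ħ : ℂ) (g : KahlerMetric n X) (e : Coord n X) (F : LocalFields n Λ) (i : Fin n)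
    (p : ℂ) : SForm Λ :=
  ∑ j, ∑ k, (((∑ a, F.at (wdir a (g.christoffel e i j k)) p * (brst ħ g e F).coord a p) *
      SForm.iota p (F.ρ p j) + totalParity (F.at (g.christoffel e i j k) p) *
        -SForm.iota p ((brst ħ g e F).ρ p j)) * F.ρ p k +
    totalParity (F.at (g.christoffel e i j k) p * SForm.iota p (F.ρ p j)) * (brst ħ g e F).ρ p k)

namespace IsLocalField

variable (ħ : ℂ) (g : KahlerMetric n X) (he : e ∈ atlas (Fin n → ℂ) X)
  (hD : IsDiskOpen (chartDomain Φ e)) (h : IsLocalField Φ e F) {p : ℂ} (hp : p ∈ chartDomain Φ e)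
include he hD h

section Pointwise

include hp

theorem at_flat (i l j m : Fin n) :
    F.at (wd l (g.christoffel e i j m)) p +
      ∑ k, F.at (g.christoffel e i l k) p * F.at (g.christoffel e k j m) p =
    F.at (wd j (g.christoffel e i l m)) p +
      ∑ k, F.at (g.christoffel e i j k) p * F.at (g.christoffel e k l m) p := by
  have h1 : ∀ l j, SmoothTarget e (fun u => wd l (g.christoffel e i j m) u +
      ∑ k, g.christoffel e k j m u * g.christoffel e i l k u) := fun l j =>
    ((g.smooth_christoffel he i j m).wd l).add (.sum fun k _ =>
      (g.smooth_christoffel he k j m).mul (g.smooth_christoffel he i l k))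
  have h2 : ∀ l j, F.at (fun u => wd l (g.christoffel e i j m) u +
      ∑ k, g.christoffel e k j m u * g.christoffel e i l k u) p =
      F.at (wd l (g.christoffel e i j m)) p +
      ∑ k, F.at (g.christoffel e i l k) p * F.at (g.christoffel e k j m) p := fun l j => by
    rw [h.at_add hp ((g.smooth_christoffel he i j m).wd l) (.sum fun k _ =>
      (g.smooth_christoffel he k j m).mul (g.smooth_christoffel he i l k)),
      h.at_sum hp fun k _ => (g.smooth_christoffel he k j m).mul (g.smooth_christoffel he i l k)]
    congr 1
    refine Finset.sum_congr rfl fun k _ => ?_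
    rw [h.at_mul hp (g.smooth_christoffel he k j m) (g.smooth_christoffel he i l k),
      (h.at_even hp (g.smooth_christoffel he k j m)).mul_eq]
  rw [← h2, ← h2]
  exact h.at_congr hp (h1 l j) fun u hu => g.christoffel_flat he hu i l j m

theorem at_curvUp (i j k l : Fin n) :
    F.at (g.curvUp e i j k l) p = -F.at (wdb l (g.christoffel e i j k)) p := by
  have h1 := (g.smooth_christoffel he i j k).wdb l
  rw [h.at_congr hp (g.smooth_curvUp he i j k l) (g := fun u =>
    (-1) * wdb l (g.christoffel e i j k) u) fun u hu => by rw [g.curvUp_eq he hu]; ring,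
    h.at_const_mul hp (-1) h1, neg_smul, one_smul]

/-- The terms ∂Γ ιρ ιρ ρ, and those where Γ meets the Γ inside δρ, form the (2,0) curvature
contracted with anticommuting factors and cancel. Only ∂̄Γ and the terms linear in Γ remain. -/
theorem quadRhoVar_eq (i : Fin n) : quadRhoVar ħ g e F i p =
    (∑ j, ∑ k, ∑ l, F.at (wdb l (g.christoffel e i j k)) p * (F.η p l *
      (SForm.iota p (F.ρ p j) * F.ρ p k))) +
    (∑ j, ∑ k, F.at (g.christoffel e i j k) p * (SForm.iota p (deRham (fun q => F.φ q j) p) *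
      F.ρ p k)) +
    (∑ j, ∑ k, F.at (g.christoffel e i j k) p * (SForm.iota p (F.ρ p j) *
      deRham (fun q => F.φ q k) p)) +
    ħ • (∑ j, ∑ k, F.at (g.christoffel e i j k) p * (SForm.iota p (F.ρ p j) *
      SForm.iota p (F.G p k))) := by
  have hA : ∀ i j k, (F.at (g.christoffel e i j k) p).Even := fun i j k =>
    h.at_even hp (g.smooth_christoffel he i j k)
  have hx : ∀ j, (SForm.iota p (F.ρ p j)).Odd := fun j => (h.form_ρ hD j).iota.odd hp
  have h0 := sum_flat_cancel (r := F.ρ p) (fun j k => (hx j).anticomm (hx k))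
    (fun j k l m => (hA k l m).mul_eq (SForm.iota p (F.ρ p j))) (h.at_flat g he hD hp i)
  have h4 : ∀ j k, (((∑ a, F.at (wdir a (g.christoffel e i j k)) p *
        (TypeBModel.brst ħ g e F).coord a p) *
      SForm.iota p (F.ρ p j) + totalParity (F.at (g.christoffel e i j k) p) *
        -SForm.iota p ((TypeBModel.brst ħ g e F).ρ p j)) * F.ρ p k +
    totalParity (F.at (g.christoffel e i j k) p * SForm.iota p (F.ρ p j)) *
      (TypeBModel.brst ħ g e F).ρ p k) =
      ħ • (∑ l, F.at (wd l (g.christoffel e i j k)) p * (SForm.iota p (F.ρ p l) *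
        (SForm.iota p (F.ρ p j) * F.ρ p k))) +
      (∑ l, F.at (wdb l (g.christoffel e i j k)) p * (F.η p l *
        (SForm.iota p (F.ρ p j) * F.ρ p k))) +
      F.at (g.christoffel e i j k) p * (SForm.iota p (deRham (fun q => F.φ q j) p) * F.ρ p k) +
      F.at (g.christoffel e i j k) p * (SForm.iota p (F.ρ p j) * deRham (fun q => F.φ q k) p) +
      ħ • (F.at (g.christoffel e i j k) p * (SForm.iota p (F.ρ p j) * SForm.iota p (F.G p k))) +
      ħ • (F.at (g.christoffel e i j k) p * (SForm.iota p (F.ρ p j) *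
        ∑ l, ∑ m, F.at (g.christoffel e k l m) p * SForm.iota p (F.ρ p l) * F.ρ p m)) := by
    intro j k
    rw [map_mul, (hA i j k : totalParity _ = _), (hx j : totalParity _ = _),
      h.iota_brst_ρ ħ g he hD hp, neg_neg, Fintype.sum_sum_type]
    have e1 : (TypeBModel.brst ħ g e F).ρ p k = -deRham (fun q => F.φ q k) p -
      ħ • SForm.iota p (F.G p k) - ħ • ∑ l, ∑ m, F.at (g.christoffel e k l m) p *
        SForm.iota p (F.ρ p l) * F.ρ p m := rfl
    have e2 : ∀ l, (TypeBModel.brst ħ g e F).coord (.inl l) p = ħ • SForm.iota p (F.ρ p l) :=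
      fun l => rfl
    have e3 : ∀ l, (TypeBModel.brst ħ g e F).coord (.inr l) p = F.η p l := fun l => rfl
    have e4 : ∀ l, wdir (.inl l) (g.christoffel e i j k) = wd l (g.christoffel e i j k) :=
      fun _ => rfl
    have e5 : ∀ l, wdir (.inr l) (g.christoffel e i j k) = wdb l (g.christoffel e i j k) :=
      fun _ => rfl
    simp only [e1, e2, e3, e4, e5, add_mul, Finset.sum_mul, mul_sub, mul_neg, neg_mul,
      mul_smul_comm, smul_mul_assoc, mul_assoc, Finset.smul_sum, sub_neg_eq_add, neg_neg]
    simp only [Finset.mul_sum, Finset.smul_sum, mul_smul_comm, smul_neg, sub_neg_eq_add]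
    abel
  rw [quadRhoVar, Finset.sum_congr rfl fun j _ => Finset.sum_congr rfl fun k _ => h4 j k]
  simp only [Finset.sum_add_distrib, ← Finset.smul_sum]
  have h5 := congrArg (fun w => ħ • w) h0
  simp only [smul_add, smul_zero] at h5
  rw [eq_neg_of_add_eq_zero_left h5]
  abel

/-- The transformation law of G is shaped so that δ²ρ closes. Contracting ρʲρᵏ in the curvature term
gives two contributions, equal by the symmetry of Γ, which absorbs the factor 1/2; the sign comes
from R = -∂̄Γ and the passage of ι across η̄. The other terms match those of `quadRhoVar_eq` after
exchanging the lower indices of Γ. -/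
theorem iota_brst_G (i : Fin n) : SForm.iota p ((TypeBModel.brst ħ g e F).G p i) =
    SForm.iota p (deRham (fun q => F.ρ q i) p) + quadRhoVar ħ g e F i p := by
  have hA : ∀ i j k, (F.at (g.christoffel e i j k) p).Even := fun i j k =>
    h.at_even hp (g.smooth_christoffel he i j k)
  have hx : ∀ j, (SForm.iota p (F.ρ p j)).Odd := fun j => (h.form_ρ hD j).iota.odd hp
  have hd : ∀ j, (deRham (fun q => F.φ q j) p).Odd := fun j => ((h.form_φ hD j).deRham hD).odd hp
  have hz : ∀ j, (SForm.iota p (F.G p j)).Odd := fun j => (h.form_G hD j).iota.odd hp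
  have hsym := h.at_christoffel_symm g he hD hp i
  have h1 : ∀ j k, SForm.iota p (F.at (g.christoffel e i j k) p * deRham (fun q => F.φ q j) p *
      F.ρ p k) = F.at (g.christoffel e i j k) p * (SForm.iota p (deRham (fun q => F.φ q j) p) *
      F.ρ p k) - F.at (g.christoffel e i j k) p * (deRham (fun q => F.φ q j) p *
        SForm.iota p (F.ρ p k)) := fun j k => by
    rw [mul_assoc, h.iota_christoffel_mul g he hD hp, SForm.iota_mul,
      (hd j : totalParity _ = _), neg_mul, ← sub_eq_add_neg, mul_sub]
  have h2 : ∀ j k, SForm.iota p (F.at (g.christoffel e i j k) p * SForm.iota p (F.G p j) *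
      F.ρ p k) = -(F.at (g.christoffel e i j k) p * (SForm.iota p (F.G p j) *
        SForm.iota p (F.ρ p k))) := fun j k => by
    rw [mul_assoc, h.iota_christoffel_mul g he hD hp, SForm.iota_mul, SForm.iota_iota, zero_mul,
      zero_add, (hz j : totalParity _ = _), neg_mul, mul_neg]
  have h3 : ∀ j k l, SForm.iota p (F.at (g.curvUp e i j k l) p * F.η p l * F.ρ p j * F.ρ p k) =
      F.at (wdb l (g.christoffel e i j k)) p * (F.η p l * (SForm.iota p (F.ρ p j) * F.ρ p k)) +
      F.at (wdb l (g.christoffel e i j k)) p * (F.η p l *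
        (SForm.iota p (F.ρ p k) * F.ρ p j)) := fun j k l => by
    have hs := (g.smooth_christoffel he i j k).wdb l
    rw [h.at_curvUp g he hD hp, mul_assoc, mul_assoc, neg_mul, SForm.iota_neg, SForm.iota_mul,
      (h.form_at hD hs).iota_eq_zero hp, zero_mul, zero_add,
      (h.at_even hp hs : totalParity _ = _), SForm.iota_mul, (h.form_η hD l).iota_eq_zero hp,
      zero_mul, zero_add, ((h.form_η hD l).odd hp : totalParity _ = _), SForm.iota_mul,
      ((h.form_ρ hD j).even hp : totalParity _ = _), neg_mul, mul_neg, neg_neg,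
      ((h.form_ρ hD j).even hp).mul_eq, mul_add, mul_add]
  have h4 : ∑ j, ∑ k, ∑ l, F.at (wdb l (g.christoffel e i j k)) p * (F.η p l *
        (SForm.iota p (F.ρ p k) * F.ρ p j)) = ∑ j, ∑ k, ∑ l,
      F.at (wdb l (g.christoffel e i j k)) p * (F.η p l * (SForm.iota p (F.ρ p j) * F.ρ p k)) := by
    rw [Finset.sum_comm]
    refine Finset.sum_congr rfl fun k _ => Finset.sum_congr rfl fun j _ =>
      Finset.sum_congr rfl fun l _ => ?_
    congr 1
    exact h.at_congr hp ((g.smooth_christoffel he i j k).wdb l) fun u hu =>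
      SmoothTarget.wdir_congr (fun u hu => g.christoffel_symm he hu i j k) (.inr l) hu
  have h5 : (TypeBModel.brst ħ g e F).G p i = deRham (fun q => F.ρ q i) p
    + ∑ j, ∑ k, F.at (g.christoffel e i j k) p * deRham (fun q => F.φ q j) p * F.ρ p k
    + (1 / 2 : ℂ) • ∑ j, ∑ k, ∑ l, F.at (g.curvUp e i j k l) p * F.η p l * F.ρ p j * F.ρ p k
    + ħ • ∑ j, ∑ k, F.at (g.christoffel e i j k) p * SForm.iota p (F.G p j) * F.ρ p k := rfl
  rw [h5, h.quadRhoVar_eq ħ g he hD hp]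
  simp only [SForm.iota_add, SForm.iota_sum, SForm.iota_smul, h1, h2, h3, Finset.sum_add_distrib,
    Finset.sum_sub_distrib, Finset.sum_neg_distrib, h4]
  rw [sum_mul_anticomm hsym fun j k => (hd j).anticomm (hx k),
    sum_mul_anticomm hsym fun j k => (hz j).anticomm (hx k)]
  module

end Pointwise

end IsLocalField

end SquareRho

/-! ### The square on ρ, θ, Ḡ and G. -/

section SquareAll

open SForm

variable {n : ℕ} {X : Type*} [TopologicalSpace X]
  {Λ : Type*} [NormedRing Λ] [NormedAlgebra ℂ Λ] [FiniteDimensional ℂ Λ] [GrassmannAlgebra Λ]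
  {Φ : ℂ → X} {e : Coord n X} {F : LocalFields n Λ}
  [ChartedSpace (Fin n → ℂ) X] [IsManifold 𝓘(ℂ, Fin n → ℂ) ω X]

/-- `Γ^{ī}_{j̄ k̄} η̄ʲ θᵏ`. -/
def quadTheta (g : KahlerMetric n X) (e : Coord n X) (F : LocalFields n Λ) (i : Fin n) (p : ℂ) :
    SForm Λ :=
  ∑ j, ∑ k, F.at (g.christoffelBar e i j k) p * F.η p j * F.θ p k

/-- The variation of `Γ^{ī}_{j̄ k̄} η̄ʲ θᵏ`. -/
def quadThetaVar (ħ : ℂ) (g : KahlerMetric n X) (e : Coord n X) (F : LocalFields n Λ) (i : Fin n)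
    (p : ℂ) : SForm Λ :=
  ∑ j, ∑ k, (((∑ a, F.at (wdir a (g.christoffelBar e i j k)) p * (brst ħ g e F).coord a p) *
      F.η p j + totalParity (F.at (g.christoffelBar e i j k) p) * (brst ħ g e F).η p j) *
      F.θ p k + totalParity (F.at (g.christoffelBar e i j k) p * F.η p j) * (brst ħ g e F).θ p k)

namespace IsLocalField

variable (ħ : ℂ) (g : KahlerMetric n X) (he : e ∈ atlas (Fin n → ℂ) X)
  (hD : IsDiskOpen (chartDomain Φ e)) (h : IsLocalField Φ e F) {p : ℂ} (hp : p ∈ chartDomain Φ e)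
include he hD h

section Pointwise

include hp

theorem at_flatBar (i l j m : Fin n) :
    F.at (wdb l (g.christoffelBar e i j m)) p +
      ∑ k, F.at (g.christoffelBar e i l k) p * F.at (g.christoffelBar e k j m) p =
    F.at (wdb j (g.christoffelBar e i l m)) p +
      ∑ k, F.at (g.christoffelBar e i j k) p * F.at (g.christoffelBar e k l m) p := by
  have h0 : ∀ l j k, SmoothTarget e fun u => g.christoffelBar e k j m u *
      g.christoffelBar e i l k u := fun l j k =>
    (g.smooth_christoffelBar he k j m).mul (g.smooth_christoffelBar he i l k)
  have h1 : ∀ l j, SmoothTarget e (fun u => wdb l (g.christoffelBar e i j m) u +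
      ∑ k, g.christoffelBar e k j m u * g.christoffelBar e i l k u) := fun l j =>
    ((g.smooth_christoffelBar he i j m).wdb l).add (.sum fun k _ => h0 l j k)
  have h2 : ∀ l j, F.at (fun u => wdb l (g.christoffelBar e i j m) u +
      ∑ k, g.christoffelBar e k j m u * g.christoffelBar e i l k u) p =
      F.at (wdb l (g.christoffelBar e i j m)) p +
      ∑ k, F.at (g.christoffelBar e i l k) p * F.at (g.christoffelBar e k j m) p := fun l j => by
    rw [h.at_add hp ((g.smooth_christoffelBar he i j m).wdb l) (.sum fun k _ => h0 l j k),
      h.at_sum hp fun k _ => h0 l j k]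
    congr 1
    refine Finset.sum_congr rfl fun k _ => ?_
    rw [h.at_mul hp (g.smooth_christoffelBar he k j m) (g.smooth_christoffelBar he i l k),
      (h.at_even hp (g.smooth_christoffelBar he k j m)).mul_eq]
  rw [← h2, ← h2]
  exact h.at_congr hp (h1 l j) fun u hu => g.christoffelBar_flat he hu i l j m

/-- The antiholomorphic counterpart of `iota_brst_G`. The part of δ(Γ̄ η̄ θ) quadratic in η̄ cancels
by (0,2) flatness, and the rest is what the law for Ḡ contains besides ħ ι dθ. -/
theorem brst_Gb (i : Fin n) : (TypeBModel.brst ħ g e F).Gb p i =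
    ħ • SForm.iota p (deRham (fun q => F.θ q i) p) + quadThetaVar ħ g e F i p := by
  have hA : ∀ i j k, (F.at (g.christoffelBar e i j k) p).Even := fun i j k =>
    h.at_even hp (g.smooth_christoffelBar he i j k)
  have hη : ∀ j, (F.η p j).Odd := fun j => (h.form_η hD j).odd hp
  have h0 := sum_flat_cancel (r := F.θ p) (fun j k => (hη j).anticomm (hη k))
    (fun j k l m => (hA k l m).mul_eq (F.η p j)) (h.at_flatBar g he hD hp i)
  have h1 : ∀ j k, SForm.iota p (F.at (g.christoffelBar e i j k) p *
      deRham (fun q => F.φb q j) p * F.θ p k) = F.at (g.christoffelBar e i j k) p *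
      (SForm.iota p (deRham (fun q => F.φb q j) p) * F.θ p k) := fun j k => by
    rw [SForm.iota_mul, (h.form_θ hD k).iota_eq_zero hp, mul_zero, add_zero, SForm.iota_mul,
      (h.form_at hD (g.smooth_christoffelBar he i j k)).iota_eq_zero hp, zero_mul, zero_add,
      (hA i j k : totalParity _ = _), mul_assoc]
  have h4 : ∀ j k, (((∑ a, F.at (wdir a (g.christoffelBar e i j k)) p *
        (TypeBModel.brst ħ g e F).coord a p) *
      F.η p j + totalParity (F.at (g.christoffelBar e i j k) p) *
        (TypeBModel.brst ħ g e F).η p j) * F.θ p k +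
    totalParity (F.at (g.christoffelBar e i j k) p * F.η p j) *
      (TypeBModel.brst ħ g e F).θ p k) =
      ħ • (∑ l, F.at (wd l (g.christoffelBar e i j k)) p * (SForm.iota p (F.ρ p l) *
        (F.η p j * F.θ p k))) +
      (∑ l, F.at (wdb l (g.christoffelBar e i j k)) p * (F.η p l * (F.η p j * F.θ p k))) +
      ħ • (F.at (g.christoffelBar e i j k) p *
        (SForm.iota p (deRham (fun q => F.φb q j) p) * F.θ p k)) -
      F.at (g.christoffelBar e i j k) p * (F.η p j * F.Gb p k) +
      F.at (g.christoffelBar e i j k) p * (F.η p j *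
        ∑ l, ∑ m, F.at (g.christoffelBar e k l m) p * F.η p l * F.θ p m) := by
    intro j k
    rw [map_mul, (hA i j k : totalParity _ = _), (hη j : totalParity _ = _),
      Fintype.sum_sum_type]
    have e1 : (TypeBModel.brst ħ g e F).θ p k = F.Gb p k - ∑ l, ∑ m,
      F.at (g.christoffelBar e k l m) p * F.η p l * F.θ p m := rfl
    have e2 : ∀ l, (TypeBModel.brst ħ g e F).coord (.inl l) p = ħ • SForm.iota p (F.ρ p l) :=
      fun l => rfl
    have e3 : ∀ l, (TypeBModel.brst ħ g e F).coord (.inr l) p = F.η p l := fun l => rfl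
    have e4 : ∀ l, wdir (.inl l) (g.christoffelBar e i j k) = wd l (g.christoffelBar e i j k) :=
      fun _ => rfl
    have e5 : ∀ l, wdir (.inr l) (g.christoffelBar e i j k) = wdb l (g.christoffelBar e i j k) :=
      fun _ => rfl
    have e6 : (TypeBModel.brst ħ g e F).η p j = ħ • SForm.iota p (deRham (fun q => F.φb q j) p) :=
      rfl
    simp only [e1, e2, e3, e4, e5, e6, add_mul, Finset.sum_mul, mul_sub, mul_neg, neg_mul,
      mul_smul_comm, smul_mul_assoc, mul_assoc, Finset.smul_sum, sub_neg_eq_add]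
    abel
  have h5 : (TypeBModel.brst ħ g e F).Gb p i =
    -∑ j, ∑ k, F.at (g.christoffelBar e i j k) p * F.η p j * F.Gb p k
    + ħ • SForm.iota p (deRham (fun q => F.θ q i) p
    + ∑ j, ∑ k, F.at (g.christoffelBar e i j k) p * deRham (fun q => F.φb q j) p * F.θ p k)
    + ħ • ∑ l, ∑ j, ∑ k, F.at (wd l (g.christoffelBar e i j k)) p * SForm.iota p (F.ρ p l)
        * F.η p j * F.θ p k := rfl
  rw [quadThetaVar, Finset.sum_congr rfl fun j _ => Finset.sum_congr rfl fun k _ => h4 j k, h5]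
  simp only [SForm.iota_add, SForm.iota_sum, h1, Finset.sum_add_distrib, Finset.sum_sub_distrib,
    ← Finset.smul_sum]
  rw [eq_neg_of_add_eq_zero_left h0]
  have h6 : ∑ l, ∑ j, ∑ k, F.at (wd l (g.christoffelBar e i j k)) p * SForm.iota p (F.ρ p l)
        * F.η p j * F.θ p k = ∑ j, ∑ k, ∑ l, F.at (wd l (g.christoffelBar e i j k)) p *
        (SForm.iota p (F.ρ p l) * (F.η p j * F.θ p k)) := by
    rw [Finset.sum_comm]
    refine Finset.sum_congr rfl fun j _ => Finset.sum_comm.trans ?_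
    simp only [mul_assoc]
  rw [h6]
  simp only [smul_add, mul_assoc]
  abel

end Pointwise

variable {ε : Λ} (hε : IsOdd ε)
include hε

/-- The second variation y₁ of ρ is left free. Knowing δ(Γ ιρ ρ) requires no more than δρ, so this
can be used inside the proof of δ²ρ = ħLρ without circularity. -/
theorem variation_quadRho {y₁ : Fin n → ℂ → SForm Λ}
    (v : ∀ i, Variation ħ ε (chartDomain Φ e) (fun p => F.ρ p i)
      (fun p => (TypeBModel.brst ħ g e F).ρ p i) (fun p => (TypeBModel.brstShift ħ g e ε F).ρ p i)
      (y₁ i)) (i : Fin n) :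
    Variation ħ ε (chartDomain Φ e) (quadRho g e F i) (quadRhoVar ħ g e F i)
      (quadRho g e (TypeBModel.brstShift ħ g e ε F) i) (fun p => ∑ j, ∑ k,
        (((∑ a, (TypeBModel.brstShift ħ g e ε F).at (wdir a (g.christoffel e i j k)) p *
          (TypeBModel.brst ħ g e (TypeBModel.brstShift ħ g e ε F)).coord a p) *
          SForm.iota p ((TypeBModel.brstShift ħ g e ε F).ρ p j) +
          totalParity ((TypeBModel.brstShift ħ g e ε F).at (g.christoffel e i j k) p) *
          -SForm.iota p (y₁ j p)) * (TypeBModel.brstShift ħ g e ε F).ρ p k +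
          totalParity ((TypeBModel.brstShift ħ g e ε F).at (g.christoffel e i j k) p *
          SForm.iota p ((TypeBModel.brstShift ħ g e ε F).ρ p j)) * y₁ k p)) :=
  Variation.sum hD fun j _ => Variation.sum hD fun k _ =>
    Variation.mul hD hε (Variation.mul hD hε
      (h.variation_at ħ g he hD hε (g.smooth_christoffel he i j k)) ((v j).iota hε)) (v k)

theorem variation_quadTheta {y₁ : Fin n → ℂ → SForm Λ}
    (v : ∀ i, Variation ħ ε (chartDomain Φ e) (fun p => F.θ p i)
      (fun p => (TypeBModel.brst ħ g e F).θ p i) (fun p => (TypeBModel.brstShift ħ g e ε F).θ p i)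
      (y₁ i)) (i : Fin n) :
    Variation ħ ε (chartDomain Φ e) (quadTheta g e F i) (quadThetaVar ħ g e F i)
      (quadTheta g e (TypeBModel.brstShift ħ g e ε F) i) (fun p => ∑ j, ∑ k,
        (((∑ a, (TypeBModel.brstShift ħ g e ε F).at (wdir a (g.christoffelBar e i j k)) p *
          (TypeBModel.brst ħ g e (TypeBModel.brstShift ħ g e ε F)).coord a p) *
          (TypeBModel.brstShift ħ g e ε F).η p j +
          totalParity ((TypeBModel.brstShift ħ g e ε F).at (g.christoffelBar e i j k) p) *
          (TypeBModel.brst ħ g e (TypeBModel.brstShift ħ g e ε F)).η p j) *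
          (TypeBModel.brstShift ħ g e ε F).θ p k +
          totalParity ((TypeBModel.brstShift ħ g e ε F).at (g.christoffelBar e i j k) p *
          (TypeBModel.brstShift ħ g e ε F).η p j) * y₁ k p)) :=
  Variation.sum hD fun j _ => Variation.sum hD fun k _ =>
    Variation.mul hD hε (Variation.mul hD hε
      (h.variation_at ħ g he hD hε (g.smooth_christoffelBar he i j k))
      (h.variation_η ħ g he hD hε j)) (v k)

/-- Applying δ to -dφ - ħ ιG - ħ Γ ιρ ρ gives ħ d ιρ + ħ ι δG - ħ δ(Γ ιρ ρ). By `iota_brst_G` this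
is ħ(dι + ιd)ρ. -/
theorem variation_ρ (i : Fin n) : Variation ħ ε (chartDomain Φ e) (fun p => F.ρ p i)
    (fun p => (TypeBModel.brst ħ g e F).ρ p i) (fun p => (TypeBModel.brstShift ħ g e ε F).ρ p i)
    (fun p => (TypeBModel.brst ħ g e (TypeBModel.brstShift ħ g e ε F)).ρ p i) where
  smooth := (h.form_ρ hD i).smooth
  smooth₁ := ((h.brst g he hD ħ).ρ i).smooth
  eq p _ := rfl
  eq₁ p hp := by
    have v0 : ∀ i, Variation ħ ε (chartDomain Φ e) (fun p => F.ρ p i)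
      (fun p => (TypeBModel.brst ħ g e F).ρ p i)
      (fun p => (TypeBModel.brstShift ħ g e ε F).ρ p i) _ := fun i =>
      Variation.of_smooth (h.form_ρ hD i).smooth ((h.brst g he hD ħ).ρ i).smooth fun _ _ => rfl
    have h1 := (h.variation_quadRho ħ g he hD hε v0 i).eq p hp
    have h2 := ((h.variation_φ ħ g he hD hε i).deRham hD hε).eq p hp
    have h3 : SForm.iota p ((TypeBModel.brstShift ħ g e ε F).G p i) = SForm.iota p (F.G p i) -
        of ε * SForm.iota p ((TypeBModel.brst ħ g e F).G p i) := by
      change SForm.iota p (F.G p i + of ε * (TypeBModel.brst ħ g e F).G p i) = _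
      rw [SForm.iota_add, iota_of_mul hε, sub_eq_add_neg]
    have h4 : deRham (fun p => (TypeBModel.brst ħ g e F).φ p i) p =
        ħ • deRham (fun p => SForm.iota p (F.ρ p i)) p :=
      deRham_smul hD ħ (h.form_ρ hD i).iota.smooth hp
    have h5 : ∀ F : LocalFields n Λ, (TypeBModel.brst ħ g e F).ρ p i =
      -deRham (fun q => F.φ q i) p - ħ • SForm.iota p (F.G p i) - ħ • quadRho g e F i p :=
      fun _ => rfl
    rw [h5, h5, h1, h2, h3, h4, h.iota_brst_G ħ g he hD hp, lie]
    simp only [mul_add, mul_neg, mul_smul_comm]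
    module

/-- Applying δ to Ḡ - Γ̄ η̄ θ leaves exactly the term ħ ι dθ of `brst_Gb`. -/
theorem variation_θ (i : Fin n) : Variation ħ ε (chartDomain Φ e) (fun p => F.θ p i)
    (fun p => (TypeBModel.brst ħ g e F).θ p i) (fun p => (TypeBModel.brstShift ħ g e ε F).θ p i)
    (fun p => (TypeBModel.brst ħ g e (TypeBModel.brstShift ħ g e ε F)).θ p i) where
  smooth := (h.form_θ hD i).smooth
  smooth₁ := ((h.brst g he hD ħ).θ i).smooth
  eq p _ := rfl
  eq₁ p hp := by
    have v0 : ∀ i, Variation ħ ε (chartDomain Φ e) (fun p => F.θ p i)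
      (fun p => (TypeBModel.brst ħ g e F).θ p i)
      (fun p => (TypeBModel.brstShift ħ g e ε F).θ p i) _ := fun i =>
      Variation.of_smooth (h.form_θ hD i).smooth ((h.brst g he hD ħ).θ i).smooth fun _ _ => rfl
    have h1 := (h.variation_quadTheta ħ g he hD hε v0 i).eq p hp
    have h3 : (TypeBModel.brstShift ħ g e ε F).Gb p i = F.Gb p i +
        of ε * (TypeBModel.brst ħ g e F).Gb p i := rfl
    have h5 : ∀ F : LocalFields n Λ, (TypeBModel.brst ħ g e F).θ p i =
      F.Gb p i - quadTheta g e F i p := fun _ => rfl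
    rw [h5, h5, h1, h3, h.brst_Gb ħ g he hD hp, (h.form_θ hD i).lie_eq hD hp]
    simp only [mul_add, mul_smul_comm]
    module

theorem variation_quadTheta' (i : Fin n) :
    Variation ħ ε (chartDomain Φ e) (quadTheta g e F i) (quadThetaVar ħ g e F i)
      (quadTheta g e (TypeBModel.brstShift ħ g e ε F) i)
      (quadThetaVar ħ g e (TypeBModel.brstShift ħ g e ε F) i) :=
  h.variation_quadTheta ħ g he hD hε (h.variation_θ ħ g he hD hε) i

theorem variation_quadRho' (i : Fin n) :
    Variation ħ ε (chartDomain Φ e) (quadRho g e F i) (quadRhoVar ħ g e F i)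
      (quadRho g e (TypeBModel.brstShift ħ g e ε F) i)
      (quadRhoVar ħ g e (TypeBModel.brstShift ħ g e ε F) i) :=
  h.variation_quadRho ħ g he hD hε (h.variation_ρ ħ g he hD hε) i

/-- Apply δ to δḠ = ħ ι dθ + δ(Γ̄ η̄ θ). The first term gives ħL δθ and the second ħL(Γ̄ η̄ θ), and
Ḡ is the sum of δθ and Γ̄ η̄ θ. -/
theorem variation_Gb (i : Fin n) : Variation ħ ε (chartDomain Φ e) (fun p => F.Gb p i)
    (fun p => (TypeBModel.brst ħ g e F).Gb p i) (fun p => (TypeBModel.brstShift ħ g e ε F).Gb p i)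
    (fun p => (TypeBModel.brst ħ g e (TypeBModel.brstShift ħ g e ε F)).Gb p i) where
  smooth := (h.form_Gb hD i).smooth
  smooth₁ := ((h.brst g he hD ħ).Gb i).smooth
  eq p _ := rfl
  eq₁ p hp := by
    have h' := h.brstShift ħ g he hD hε
    have v := h.variation_quadTheta' ħ g he hD hε i
    have h1 := (((h.variation_θ ħ g he hD hε i).deRham hD hε).iota hε).eq p hp
    have h2 : lie (fun q => F.Gb q i) p =
        lie (fun q => (TypeBModel.brst ħ g e F).θ q i) p + lie (quadTheta g e F i) p := by
      rw [← lie_add hD ((h.brst g he hD ħ).θ i).smooth v.smooth hp]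
      exact lie_congr hD (fun q _ => (sub_add_cancel (F.Gb q i) (quadTheta g e F i q)).symm) hp
    rw [h'.brst_Gb ħ g he hD hp, h.brst_Gb ħ g he hD hp, v.eq₁ p hp, h1, h2,
      ((h.brst g he hD ħ).θ i).lie_eq hD hp, SForm.iota_neg, neg_neg]
    simp only [mul_add, mul_smul_comm]
    module

/-- Apply δ to the contracted identity `iota_brst_G`. The terms ι d(Γ ιρ ρ) cancel because ι
annihilates Γ ιρ ρ, and ι dιG = ι LG. This determines δ²G off the centre, and continuity extends it.
-/
theorem variation_G (i : Fin n) : Variation ħ ε (chartDomain Φ e) (fun p => F.G p i)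
    (fun p => (TypeBModel.brst ħ g e F).G p i) (fun p => (TypeBModel.brstShift ħ g e ε F).G p i)
    (fun p => (TypeBModel.brst ħ g e (TypeBModel.brstShift ħ g e ε F)).G p i) where
  smooth := (h.form_G hD i).smooth
  smooth₁ := ((h.brst g he hD ħ).G i).smooth
  eq p _ := rfl
  eq₁ := by
    have h' := h.brstShift ħ g he hD hε
    have v := h.variation_quadRho' ħ g he hD hε i
    have f1 : IsForm (chartDomain Φ e) 2 (-1) (fun p => (TypeBModel.brst ħ g e F).G p i +
        of ε * (ħ • lie (fun q => F.G q i) p)) :=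
      ((h.brst g he hD ħ).G i).add ((((h.form_G hD i).lie hD).smul ħ).const_mul hε)
    have f2 := (h'.brst g he hD ħ).G i
    refine eqOn_of_eqOn_ne_zero hD (f2.smooth.continuousOn hD) (f1.smooth.continuousOn hD)
      fun p hp h0 => eq_of_iota_eq h0 (f2.mem_deg p hp) (f1.mem_deg p hp) ?_
    have h1 := (((h.variation_ρ ħ g he hD hε i).deRham hD hε).iota hε).eq p hp
    have hG := (h.form_G hD i).iota.smooth
    have h2 : deRham (fun q => (TypeBModel.brst ħ g e F).ρ q i) p =
        -(ħ • deRham (fun q => SForm.iota q (F.G q i)) p) - ħ • deRham (quadRho g e F i) p := by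
      have h5 : (fun q => (TypeBModel.brst ħ g e F).ρ q i) = fun q =>
        -(deRham (fun q => F.φ q i) q) + ((-ħ) • SForm.iota q (F.G q i) +
          (-ħ) • quadRho g e F i q) := by
        funext q
        change -deRham (fun q => F.φ q i) q - ħ • SForm.iota q (F.G q i) -
          ħ • quadRho g e F i q = _
        module
      have hd := (h.form_φ hD i).smooth
      rw [h5, deRham_add hD (hd.deRham hD).neg ((hG.smul _).add (v.smooth.smul _)) hp,
        deRham_add hD (hG.smul _) (v.smooth.smul _) hp, deRham_smul hD _ hG hp,
        deRham_smul hD _ v.smooth hp, deRham_neg hD (hd.deRham hD) hp, deRham_deRham hD hd hp]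
      module
    have h3 : deRham (fun q => SForm.iota q (quadRho g e F i q)) p = 0 :=
      (deRham_congr hD (g := fun _ => 0) (fun q hq => h.iota_sum_christoffel g he hD hq i)
        hp).trans deRham_zero
    rw [h'.iota_brst_G ħ g he hD hp, SForm.iota_add, h.iota_brst_G ħ g he hD hp, v.eq₁ p hp, h1,
      h2, iota_of_mul hε, SForm.iota_smul, lie, lie, SForm.iota_add, SForm.iota_iota, h3,
      SForm.iota_neg, SForm.iota_sub, SForm.iota_neg, SForm.iota_smul, SForm.iota_smul]
    simp only [mul_sub, mul_neg, mul_smul_comm, zero_add, add_zero]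
    module

/-- The square of the BRST differential. -/
theorem brst_brst : ∀ p ∈ chartDomain Φ e,
    (TypeBModel.brst ħ g e (TypeBModel.brstShift ħ g e ε F)).AgreeAt
      ((TypeBModel.brst ħ g e F).shift ε (F.lie ħ)) p := fun p hp =>
  ⟨funext fun i => (h.variation_φ ħ g he hD hε i).eq₁ p hp,
    funext fun i => (h.variation_φb ħ g he hD hε i).eq₁ p hp,
    funext fun i => (h.variation_η ħ g he hD hε i).eq₁ p hp,
    funext fun i => (h.variation_θ ħ g he hD hε i).eq₁ p hp,
    funext fun i => (h.variation_ρ ħ g he hD hε i).eq₁ p hp,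
    funext fun i => (h.variation_G ħ g he hD hε i).eq₁ p hp,
    funext fun i => (h.variation_Gb ħ g he hD hε i).eq₁ p hp⟩

end IsLocalField

end SquareAll

/-! ### The kinetic Lagrangian is a BRST variation -/

section Kinetic

open SForm

/-- Relabelling of dummy indices after ∂g = Γg has been inserted, so that the result can be compared
with Γ terms standing behind a factor g. -/
theorem sum_contract {R : Type*} [Ring R] {κ : Type*} [Fintype κ] {G : κ → κ → R}
    {A c w : κ → κ → κ → R} (hc : ∀ l k j, c l k j = ∑ i, A i l k * G i j)
    (hA : ∀ i l k j, A i l k * G i j = G i j * A i l k) :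
    ∑ k, ∑ j, ∑ l, c l k j * w l k j = ∑ i, ∑ j, G i j * ∑ l, ∑ k, A i l k * w l k j := by
  have h1 : ∀ i j, G i j * ∑ l, ∑ k, A i l k * w l k j =
      ∑ k, ∑ l, A i l k * G i j * w l k j := fun i j => by
    rw [Finset.sum_comm, Finset.mul_sum]
    refine Finset.sum_congr rfl fun k _ => ?_
    rw [Finset.mul_sum]
    exact Finset.sum_congr rfl fun l _ => by rw [hA, mul_assoc]
  simp only [h1, hc, Finset.sum_mul]
  refine Eq.symm (Eq.trans (Finset.sum_congr rfl fun i _ => Finset.sum_comm) ?_)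
  refine Finset.sum_comm.trans (Finset.sum_congr rfl fun k _ => ?_)
  refine Finset.sum_comm.trans (Finset.sum_congr rfl fun j _ => Finset.sum_comm)

theorem sum_contract' {R : Type*} [Ring R] {κ : Type*} [Fintype κ] {G : κ → κ → R}
    {A c w : κ → κ → κ → R} (hc : ∀ l i j, c l i j = ∑ m, A m l j * G i m)
    (hA : ∀ i j k l, A i l k * G j i = G j i * A i l k) :
    ∑ i, ∑ j, ∑ l, c l i j * w l i j = ∑ i, ∑ j, G i j * ∑ l, ∑ k, A j l k * w l i k := by
  have h := sum_contract (G := fun j i => G i j) (A := A) (c := fun l j i => c l i j)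
    (w := fun l j i => w l i j) (fun l j i => hc l i j) fun i l k j => hA i j k l
  rw [Finset.sum_comm, h, Finset.sum_comm]

variable {n : ℕ} {X : Type*} [TopologicalSpace X]
  {Λ : Type*} [NormedRing Λ] [NormedAlgebra ℂ Λ] [FiniteDimensional ℂ Λ] [GrassmannAlgebra Λ]
  {Φ : ℂ → X} {e : Coord n X} {F : LocalFields n Λ}
  [ChartedSpace (Fin n → ℂ) X] [IsManifold 𝓘(ℂ, Fin n → ℂ) ω X]

theorem star_mul_of_mem_deg_zero {Λ : Type*} [NormedRing Λ] [NormedAlgebra ℂ Λ]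
    [GrassmannAlgebra Λ] {v : SForm Λ} (hv : v ∈ deg (Λ := Λ) 0) (w : SForm Λ) :
    SForm.star (v * w) = v * SForm.star w := by
  rw [eq_of_of_mem_deg hv, star_of_mul]

/-- `g_{i j̄} ρⁱ ∧ *dφ̄ʲ`. -/
def pairRho (g : KahlerMetric n X) (e : Coord n X) (F : LocalFields n Λ) (p : ℂ) : SForm Λ :=
  ∑ i, ∑ j, F.at (g.coeff e i j) p * F.ρ p i * SForm.star (deRham (fun q => F.φb q j) p)

/-- The variation of `g_{i j̄} ρⁱ ∧ *dφ̄ʲ`. -/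
def pairRhoVar (ħ : ℂ) (g : KahlerMetric n X) (e : Coord n X) (F : LocalFields n Λ) (p : ℂ) :
    SForm Λ :=
  ∑ i, ∑ j, (((∑ a, F.at (wdir a (g.coeff e i j)) p * (brst ħ g e F).coord a p) * F.ρ p i +
    totalParity (F.at (g.coeff e i j) p) * (brst ħ g e F).ρ p i) *
      SForm.star (deRham (fun q => F.φb q j) p) +
    totalParity (F.at (g.coeff e i j) p * F.ρ p i) *
      SForm.star (-deRham (fun q => (brst ħ g e F).φb q j) p))

/-- `g_{i j̄} θʲ Gⁱ`. -/
def pairTheta (g : KahlerMetric n X) (e : Coord n X) (F : LocalFields n Λ) (p : ℂ) : SForm Λ :=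
  ∑ i, ∑ j, F.at (g.coeff e i j) p * F.θ p j * F.G p i

/-- The variation of `g_{i j̄} θʲ Gⁱ`. -/
def pairThetaVar (ħ : ℂ) (g : KahlerMetric n X) (e : Coord n X) (F : LocalFields n Λ) (p : ℂ) :
    SForm Λ :=
  ∑ i, ∑ j, (((∑ a, F.at (wdir a (g.coeff e i j)) p * (brst ħ g e F).coord a p) * F.θ p j +
    totalParity (F.at (g.coeff e i j) p) * (brst ħ g e F).θ p j) * F.G p i +
    totalParity (F.at (g.coeff e i j) p * F.θ p j) * (brst ħ g e F).G p i)

namespace IsLocalField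

variable (ħ : ℂ) (g : KahlerMetric n X) (he : e ∈ atlas (Fin n → ℂ) X)
  (hD : IsDiskOpen (chartDomain Φ e)) (h : IsLocalField Φ e F) {p : ℂ} (hp : p ∈ chartDomain Φ e)
include he hD h

section Pointwise

include hp

theorem at_wd_coeff (l i j : Fin n) : F.at (wd l (g.coeff e i j)) p =
    ∑ m, F.at (g.christoffel e m l i) p * F.at (g.coeff e m j) p := by
  have h1 : ∀ m, SmoothTarget e fun u => g.christoffel e m l i u * g.coeff e m j u := fun m =>
    (g.smooth_christoffel he m l i).mul (g.smooth_coeff he m j)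
  rw [h.at_congr hp ((g.smooth_coeff he i j).wd l) fun u hu => g.wd_coeff he hu l i j,
    h.at_sum hp fun m _ => h1 m]
  exact Finset.sum_congr rfl fun m _ =>
    h.at_mul hp (g.smooth_christoffel he m l i) (g.smooth_coeff he m j)

theorem at_wdb_coeff (l i j : Fin n) : F.at (wdb l (g.coeff e i j)) p =
    ∑ m, F.at (g.christoffelBar e m l j) p * F.at (g.coeff e i m) p := by
  have h1 : ∀ m, SmoothTarget e fun u => g.christoffelBar e m l j u * g.coeff e i m u := fun m =>
    (g.smooth_christoffelBar he m l j).mul (g.smooth_coeff he i m)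
  rw [h.at_congr hp ((g.smooth_coeff he i j).wdb l) fun u hu => g.wdb_coeff he hu l i j,
    h.at_sum hp fun m _ => h1 m]
  exact Finset.sum_congr rfl fun m _ =>
    h.at_mul hp (g.smooth_christoffelBar he m l j) (g.smooth_coeff he i m)

/-- Lowering the index undoes g⁻¹, and the symmetry in the barred indices brings the curvature into
the order of the Lagrangian. -/
theorem sum_coeff_mul_curvUp (j k l m : Fin n) :
    ∑ i, F.at (g.coeff e i j) p * F.at (g.curvUp e i k l m) p =
      -F.at (g.curv e k m l j) p := by
  have h1 : ∀ i, SmoothTarget e fun u => g.coeff e i j u * g.curvUp e i k l m u := fun i =>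
    (g.smooth_coeff he i j).mul (g.smooth_curvUp he i k l m)
  have h2 : -F.at (g.curv e k m l j) p = F.at (fun u => (-1) * g.curv e k m l j u) p := by
    rw [h.at_const_mul hp (-1) (g.smooth_curv he k m l j), neg_smul, one_smul]
  rw [h2, ← h.at_congr hp (.sum fun i (_ : i ∈ Finset.univ) => h1 i) fun u hu => ?_,
    h.at_sum hp fun i _ => h1 i]
  · exact Finset.sum_congr rfl fun i _ =>
      (h.at_mul hp (g.smooth_coeff he i j) (g.smooth_curvUp he i k l m)).symm
  · rw [g.curv_symm he hu, KahlerMetric.curv, neg_one_mul, ← Finset.sum_neg_distrib]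
    exact Finset.sum_congr rfl fun i _ => by rw [g.curvUp_eq he hu, mul_neg]

/-- The derivative ∂g along δφ cancels the Γ term of δρ. The derivative ∂̄g along δφ̄ = η̄ supplies
the connection term that turns dη̄ into Dη̄. -/
theorem pairRhoVar_eq : pairRhoVar ħ g e F p =
    -((∑ i, ∑ j, F.at (g.coeff e i j) p
      * (deRham (fun q => F.φ q i) p + ħ • SForm.iota p (F.G p i))
      * SForm.star (deRham (fun q => F.φb q j) p))
    + (∑ i, ∑ j, F.at (g.coeff e i j) p * F.ρ p i * SForm.star (covEta g e F p j))) := by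
  have hc : ∀ i j, (F.at (g.coeff e i j) p).Even := fun i j => h.at_even hp (g.smooth_coeff he i j)
  have hρ : ∀ i, (F.ρ p i).Even := fun i => (h.form_ρ hD i).even hp
  have hs : ∀ j, (SForm.star (deRham (fun q => F.φb q j) p)).Odd := fun j =>
    (((h.form_φb hD j).deRham hD).odd hp).star
  have hη : ∀ j, (F.η p j).Odd := fun j => (h.form_η hD j).odd hp
  have h1 : ∀ i j, (((∑ a, F.at (wdir a (g.coeff e i j)) p *
      (TypeBModel.brst ħ g e F).coord a p) * F.ρ p i +
    totalParity (F.at (g.coeff e i j) p) * (TypeBModel.brst ħ g e F).ρ p i) *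
      SForm.star (deRham (fun q => F.φb q j) p) +
    totalParity (F.at (g.coeff e i j) p * F.ρ p i) *
      SForm.star (-deRham (fun q => (TypeBModel.brst ħ g e F).φb q j) p)) =
      ħ • (∑ l, F.at (wd l (g.coeff e i j)) p * (SForm.iota p (F.ρ p l) * (F.ρ p i *
        SForm.star (deRham (fun q => F.φb q j) p)))) +
      (∑ l, F.at (wdb l (g.coeff e i j)) p * (F.η p l * (F.ρ p i *
        SForm.star (deRham (fun q => F.φb q j) p)))) -
      F.at (g.coeff e i j) p * (deRham (fun q => F.φ q i) p + ħ • SForm.iota p (F.G p i))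
        * SForm.star (deRham (fun q => F.φb q j) p) -
      ħ • (F.at (g.coeff e i j) p * ∑ l, ∑ k, F.at (g.christoffel e i l k) p *
        (SForm.iota p (F.ρ p l) * (F.ρ p k * SForm.star (deRham (fun q => F.φb q j) p)))) -
      F.at (g.coeff e i j) p * F.ρ p i * SForm.star (deRham (fun q => F.η q j) p) := by
    intro i j
    rw [map_mul, (hc i j : totalParity _ = _), (hρ i : totalParity _ = _),
      Fintype.sum_sum_type]
    have e1 : (TypeBModel.brst ħ g e F).ρ p i = -deRham (fun q => F.φ q i) p -
      ħ • SForm.iota p (F.G p i) - ħ • ∑ l, ∑ m, F.at (g.christoffel e i l m) p *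
        SForm.iota p (F.ρ p l) * F.ρ p m := rfl
    have e2 : ∀ l, (TypeBModel.brst ħ g e F).coord (.inl l) p = ħ • SForm.iota p (F.ρ p l) :=
      fun l => rfl
    have e3 : ∀ l, (TypeBModel.brst ħ g e F).coord (.inr l) p = F.η p l := fun l => rfl
    have e4 : ∀ l, wdir (.inl l) (g.coeff e i j) = wd l (g.coeff e i j) := fun _ => rfl
    have e5 : ∀ l, wdir (.inr l) (g.coeff e i j) = wdb l (g.coeff e i j) := fun _ => rfl
    have e6 : (fun q => (TypeBModel.brst ħ g e F).φb q j) = fun q => F.η q j := rfl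
    rw [e1, e6, SForm.star_neg]
    simp only [e2, e3, e4, e5, add_mul, Finset.sum_mul, mul_sub, sub_mul, mul_neg, neg_mul,
      mul_smul_comm, smul_mul_assoc, mul_assoc, Finset.smul_sum, mul_add, Finset.mul_sum]
    abel
  have h2 : ∑ i, ∑ j, ∑ l, F.at (wd l (g.coeff e i j)) p * (SForm.iota p (F.ρ p l) * (F.ρ p i *
        SForm.star (deRham (fun q => F.φb q j) p))) = ∑ i, ∑ j, F.at (g.coeff e i j) p *
        ∑ l, ∑ k, F.at (g.christoffel e i l k) p * (SForm.iota p (F.ρ p l) * (F.ρ p k *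
          SForm.star (deRham (fun q => F.φb q j) p))) :=
    sum_contract (c := fun l i j => F.at (wd l (g.coeff e i j)) p)
      (w := fun l i j => SForm.iota p (F.ρ p l) * (F.ρ p i *
        SForm.star (deRham (fun q => F.φb q j) p)))
      (h.at_wd_coeff g he hD hp) fun i l k j => ((hc i j).mul_eq _).symm
  have h3 : ∑ i, ∑ j, ∑ l, F.at (wdb l (g.coeff e i j)) p * (F.η p l * (F.ρ p i *
        SForm.star (deRham (fun q => F.φb q j) p))) = ∑ i, ∑ j, F.at (g.coeff e i j) p *
        ∑ l, ∑ k, F.at (g.christoffelBar e j l k) p * (F.η p l * (F.ρ p i *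
          SForm.star (deRham (fun q => F.φb q k) p))) := by
    exact sum_contract' (c := fun l i j => F.at (wdb l (g.coeff e i j)) p)
      (w := fun l i j => F.η p l * (F.ρ p i * SForm.star (deRham (fun q => F.φb q j) p)))
      (h.at_wdb_coeff g he hD hp) fun i j _ _ => ((hc j i).mul_eq _).symm
  have h4 : ∀ i j, F.at (g.coeff e i j) p * F.ρ p i * SForm.star (covEta g e F p j) =
      F.at (g.coeff e i j) p * F.ρ p i * SForm.star (deRham (fun q => F.η q j) p) -
      F.at (g.coeff e i j) p * ∑ l, ∑ k, F.at (g.christoffelBar e j l k) p * (F.η p l * (F.ρ p i *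
          SForm.star (deRham (fun q => F.φb q k) p))) := by
    intro i j
    have h5 : ∀ k l, F.ρ p i * SForm.star (F.at (g.christoffelBar e j k l) p *
        deRham (fun q => F.φb q k) p * F.η p l) = -(F.at (g.christoffelBar e j l k) p *
        (F.η p l * (F.ρ p i * SForm.star (deRham (fun q => F.φb q k) p)))) := fun k l => by
      have hs' := g.smooth_christoffelBar he j k l
      rw [mul_assoc, star_mul_of_mem_deg_zero ((h.form_at hD hs').mem_deg p hp),
        eq_of_of_mem_deg ((h.form_η hD l).mem_deg p hp), star_mul_of,
        ← eq_of_of_mem_deg ((h.form_η hD l).mem_deg p hp), (hs k).anticomm (hη l), mul_neg, mul_neg,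
        ← mul_assoc, ← (h.at_even hp hs').mul_eq, mul_assoc, ← mul_assoc (F.ρ p i),
        (hρ i).mul_eq (F.η p l), mul_assoc, h.at_christoffelBar_symm g he hD hp]
    rw [covEta, SForm.star_add, SForm.star_sum, mul_add, mul_assoc _ _ (∑ k, _), Finset.mul_sum]
    simp only [SForm.star_sum, Finset.mul_sum, h5]
    rw [sub_eq_add_neg]
    congr 1
    rw [Finset.sum_comm]
    simp only [mul_neg, Finset.sum_neg_distrib]
  rw [pairRhoVar, Finset.sum_congr rfl fun i _ => Finset.sum_congr rfl fun j _ => h1 i j,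
    Finset.sum_congr (g := fun i => ∑ j, _) rfl fun i _ => Finset.sum_congr rfl fun j _ => h4 i j]
  simp only [Finset.sum_add_distrib, Finset.sum_sub_distrib, ← Finset.smul_sum]
  rw [h2, h3]
  abel

/-- ρ ∧ G is a three-form on a surface, hence zero; contract it with v₀. -/
theorem iota_rho_mul_G (i l : Fin n) : SForm.iota p (F.ρ p l) * F.G p i =
    -(SForm.iota p (F.G p i) * F.ρ p l) := by
  have h0 : F.ρ p l * F.G p i = 0 := by
    have h1 := mul_mem_deg ((h.form_ρ hD l).mem_deg p hp) ((h.form_G hD i).mem_deg p hp)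
    exact ext' (h1.1 (by decide)) (h1.2.1 (by decide)) (h1.2.2.1 (by decide))
      (h1.2.2.2 (by decide))
  have h2 := SForm.iota_mul p (F.ρ p l) (F.G p i)
  rw [h0, SForm.iota_zero, ((h.form_ρ hD l).even hp : totalParity _ = _),
    ((h.form_ρ hD l).even hp).mul_eq (SForm.iota p (F.G p i))] at h2
  exact eq_neg_of_add_eq_zero_left h2.symm

theorem sum_coeff_theta_curvUp :
    ∑ i, ∑ j, F.at (g.coeff e i j) p * (F.θ p j * ∑ k, ∑ l, ∑ m,
        F.at (g.curvUp e i k l m) p * F.η p m * F.ρ p k * F.ρ p l) = ∑ i, ∑ l, ∑ k, ∑ j,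
        F.at (g.curv e i l k j) p * F.η p l * F.θ p j * F.ρ p i * F.ρ p k := by
  have hθ : ∀ i, (F.θ p i).Odd := fun i => (h.form_θ hD i).odd hp
  have hη : ∀ j, (F.η p j).Odd := fun j => (h.form_η hD j).odd hp
  have h5 : ∀ i j k l m, F.at (g.coeff e i j) p * (F.θ p j * (F.at (g.curvUp e i k l m) p *
      F.η p m * F.ρ p k * F.ρ p l)) = -(F.at (g.coeff e i j) p * F.at (g.curvUp e i k l m) p *
      (F.η p m * F.θ p j * F.ρ p k * F.ρ p l)) := fun i j k l m => by
    simp only [mul_assoc]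
    rw [← mul_assoc (F.θ p j), ← (h.at_even hp (g.smooth_curvUp he i k l m)).mul_eq,
      mul_assoc, ← mul_assoc (F.θ p j), (hθ j).anticomm (hη m)]
    simp only [neg_mul, mul_neg, mul_assoc]
  simp only [Finset.mul_sum, h5, Finset.sum_neg_distrib]
  have h6 : ∀ j k l m, ∑ i, F.at (g.coeff e i j) p * F.at (g.curvUp e i k l m) p *
      (F.η p m * F.θ p j * F.ρ p k * F.ρ p l) = -(F.at (g.curv e k m l j) p * F.η p m * F.θ p j *
      F.ρ p k * F.ρ p l) := fun j k l m => by
    rw [← Finset.sum_mul, h.sum_coeff_mul_curvUp g he hD hp]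
    simp only [neg_mul, mul_assoc]
  have h7 : ∑ i, ∑ j, ∑ k, ∑ l, ∑ m, F.at (g.coeff e i j) p * F.at (g.curvUp e i k l m) p *
      (F.η p m * F.θ p j * F.ρ p k * F.ρ p l) = ∑ k, ∑ m, ∑ l, ∑ j,
      ∑ i, F.at (g.coeff e i j) p * F.at (g.curvUp e i k l m) p *
      (F.η p m * F.θ p j * F.ρ p k * F.ρ p l) := by
    simp only [← Fintype.sum_prod_type']
    refine Fintype.sum_equiv
      { toFun := fun x => (x.2.2.1, x.2.2.2.2, x.2.2.2.1, x.2.1, x.1)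
        invFun := fun x => (x.2.2.2.2, x.2.2.2.1, x.1, x.2.2.1, x.2.1)
        left_inv := fun _ => rfl
        right_inv := fun _ => rfl } _ _ fun _ => rfl
  rw [h7]
  simp only [h6, Finset.sum_neg_distrib, neg_neg]

theorem pairThetaVar_term (i j : Fin n) :
    (((∑ a, F.at (wdir a (g.coeff e i j)) p *
      (TypeBModel.brst ħ g e F).coord a p) * F.θ p j +
    totalParity (F.at (g.coeff e i j) p) * (TypeBModel.brst ħ g e F).θ p j) * F.G p i +
    totalParity (F.at (g.coeff e i j) p * F.θ p j) * (TypeBModel.brst ħ g e F).G p i) =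
      ħ • (∑ l, F.at (wd l (g.coeff e i j)) p * (SForm.iota p (F.ρ p l) * (F.θ p j * F.G p i))) +
      (∑ l, F.at (wdb l (g.coeff e i j)) p * (F.η p l * (F.θ p j * F.G p i))) +
      F.at (g.coeff e i j) p * F.G p i * F.Gb p j -
      F.at (g.coeff e i j) p * (∑ l, ∑ k, F.at (g.christoffelBar e j l k) p *
        (F.η p l * (F.θ p k * F.G p i))) -
      F.at (g.coeff e i j) p * F.θ p j * covRho g e F p i -
      (1 / 2 : ℂ) • (F.at (g.coeff e i j) p * (F.θ p j * ∑ k, ∑ l, ∑ m,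
        F.at (g.curvUp e i k l m) p * F.η p m * F.ρ p k * F.ρ p l)) -
      ħ • (F.at (g.coeff e i j) p * (∑ k, ∑ l, F.at (g.christoffel e i k l) p *
        (F.θ p j * (SForm.iota p (F.G p k) * F.ρ p l)))) := by
  have hc : ∀ i j, (F.at (g.coeff e i j) p).Even := fun i j => h.at_even hp (g.smooth_coeff he i j)
  have hθ : ∀ i, (F.θ p i).Odd := fun i => (h.form_θ hD i).odd hp
  have hA : ∀ k l (w : SForm Λ), F.θ p j * (F.at (g.christoffel e i k l) p * w) =
      F.at (g.christoffel e i k l) p * (F.θ p j * w) := fun k l w => by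
    rw [← mul_assoc, ← (h.at_even hp (g.smooth_christoffel he i k l)).mul_eq, mul_assoc]
  rw [map_mul, (hc i j : totalParity _ = _), (hθ j : totalParity _ = _),
    Fintype.sum_sum_type]
  have e1 : (TypeBModel.brst ħ g e F).G p i = covRho g e F p i
    + (1 / 2 : ℂ) • ∑ j, ∑ k, ∑ l, F.at (g.curvUp e i j k l) p * F.η p l * F.ρ p j * F.ρ p k
    + ħ • ∑ j, ∑ k, F.at (g.christoffel e i j k) p * SForm.iota p (F.G p j) * F.ρ p k := rfl
  have e2 : ∀ l, (TypeBModel.brst ħ g e F).coord (.inl l) p = ħ • SForm.iota p (F.ρ p l) :=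
    fun l => rfl
  have e3 : ∀ l, (TypeBModel.brst ħ g e F).coord (.inr l) p = F.η p l := fun l => rfl
  have e4 : ∀ l, wdir (.inl l) (g.coeff e i j) = wd l (g.coeff e i j) := fun _ => rfl
  have e5 : ∀ l, wdir (.inr l) (g.coeff e i j) = wdb l (g.coeff e i j) := fun _ => rfl
  have e6 : (TypeBModel.brst ħ g e F).θ p j = F.Gb p j - ∑ l, ∑ m,
    F.at (g.christoffelBar e j l m) p * F.η p l * F.θ p m := rfl
  rw [e1, e6, mul_assoc _ (F.G p i), ((h.form_G hD i).even hp).mul_eq (F.Gb p j)]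
  generalize covRho g e F p i = C
  generalize (∑ j, ∑ k, ∑ l, F.at (g.curvUp e i j k l) p * F.η p l * F.ρ p j * F.ρ p k) = C'
  simp only [e2, e3, e4, e5, add_mul, Finset.sum_mul, mul_sub, sub_mul, mul_neg, neg_mul,
    mul_smul_comm, smul_mul_assoc, mul_assoc, Finset.smul_sum, mul_add, Finset.mul_sum, hA,
    smul_neg, Finset.sum_neg_distrib]
  abel

theorem sum_wd_coeff_theta :
    ∑ i, ∑ j, ∑ l, F.at (wd l (g.coeff e i j)) p * (SForm.iota p (F.ρ p l) * (F.θ p j *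
      F.G p i)) = ∑ i, ∑ j, F.at (g.coeff e i j) p * ∑ k, ∑ l, F.at (g.christoffel e i k l) p *
        (F.θ p j * (SForm.iota p (F.G p k) * F.ρ p l)) := by
  have hc : ∀ i j, (F.at (g.coeff e i j) p).Even := fun i j => h.at_even hp (g.smooth_coeff he i j)
  have hθ : ∀ i, (F.θ p i).Odd := fun i => (h.form_θ hD i).odd hp
  have h3 : ∀ i j l, SForm.iota p (F.ρ p l) * (F.θ p j * F.G p i) =
      F.θ p j * (SForm.iota p (F.G p i) * F.ρ p l) := fun i j l => by
    rw [← mul_assoc, ((h.form_ρ hD l).iota.odd hp).anticomm (hθ j), neg_mul, mul_assoc,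
      h.iota_rho_mul_G he hD hp, mul_neg, neg_neg]
  simp only [h3]
  refine (sum_contract (c := fun l i j => F.at (wd l (g.coeff e i j)) p)
    (w := fun l i j => F.θ p j * (SForm.iota p (F.G p i) * F.ρ p l))
    (h.at_wd_coeff g he hD hp) fun i l k j => ((hc i j).mul_eq _).symm).trans ?_
  refine Finset.sum_congr rfl fun i _ => Finset.sum_congr rfl fun j _ => ?_
  refine congrArg (F.at (g.coeff e i j) p * ·) (Finset.sum_comm.trans ?_)
  exact Finset.sum_congr rfl fun k _ => Finset.sum_congr rfl fun l _ => congrArg (· * _)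
    (h.at_christoffel_symm g he hD hp i l k)

/-- Here ∂̄g along η̄ cancels the Γ̄ term of δθ. The derivative ∂g along ħ ιρ cancels the term ħ Γ
ιG ρ of δG once `iota_rho_mul_G` exchanges the contraction. The curvature term of δG remains, with
lowered index. -/
theorem pairThetaVar_eq : pairThetaVar ħ g e F p =
    -(∑ i, ∑ j, F.at (g.coeff e i j) p * F.θ p j * covRho g e F p i)
    + (∑ i, ∑ j, F.at (g.coeff e i j) p * F.G p i * F.Gb p j)
    - (1 / 2 : ℂ) • ∑ i, ∑ l, ∑ k, ∑ j,
        F.at (g.curv e i l k j) p * F.η p l * F.θ p j * F.ρ p i * F.ρ p k := by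
  have hc : ∀ i j, (F.at (g.coeff e i j) p).Even := fun i j => h.at_even hp (g.smooth_coeff he i j)
  have hθ : ∀ i, (F.θ p i).Odd := fun i => (h.form_θ hD i).odd hp
  have hη : ∀ j, (F.η p j).Odd := fun j => (h.form_η hD j).odd hp
  have h1 := h.pairThetaVar_term ħ g he hD hp
  have h2 := h.sum_wd_coeff_theta g he hD hp
  have h3 : ∑ i, ∑ j, ∑ l, F.at (wdb l (g.coeff e i j)) p * (F.η p l * (F.θ p j * F.G p i)) =
      ∑ i, ∑ j, F.at (g.coeff e i j) p *
        ∑ l, ∑ k, F.at (g.christoffelBar e j l k) p * (F.η p l * (F.θ p k * F.G p i)) := by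
    exact sum_contract' (c := fun l i j => F.at (wdb l (g.coeff e i j)) p)
      (w := fun l i j => F.η p l * (F.θ p j * F.G p i))
      (h.at_wdb_coeff g he hD hp) fun i j _ _ => ((hc j i).mul_eq _).symm
  have h4 := h.sum_coeff_theta_curvUp g he hD hp
  rw [pairThetaVar, Finset.sum_congr rfl fun i _ => Finset.sum_congr rfl fun j _ => h1 i j]
  simp only [Finset.sum_add_distrib, Finset.sum_sub_distrib, ← Finset.smul_sum]
  rw [h2, h3, h4]
  abel

theorem lagrangianKin_eq :
    lagrangianKin ħ g e F p = -pairRhoVar ħ g e F p + pairThetaVar ħ g e F p := by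
  rw [h.pairRhoVar_eq ħ g he hD hp, h.pairThetaVar_eq ħ g he hD hp, lagrangianKin]
  abel

end Pointwise

variable {ε : Λ} (hε : IsOdd ε)
include hε

theorem variation_pair : Variation ħ ε (chartDomain Φ e)
    (fun p => -pairRho g e F p + pairTheta g e F p)
    (fun p => -pairRhoVar ħ g e F p + pairThetaVar ħ g e F p)
    (fun p => -pairRho g e (TypeBModel.brstShift ħ g e ε F) p +
      pairTheta g e (TypeBModel.brstShift ħ g e ε F) p)
    (fun p => -pairRhoVar ħ g e (TypeBModel.brstShift ħ g e ε F) p +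
      pairThetaVar ħ g e (TypeBModel.brstShift ħ g e ε F) p) := by
  refine .add hD (.neg hD (.sum hD fun i _ => .sum hD fun j _ => ?_))
    (.sum hD fun i _ => .sum hD fun j _ => ?_)
  · exact .mul hD hε (.mul hD hε (h.variation_at ħ g he hD hε (g.smooth_coeff he i j))
      (h.variation_ρ ħ g he hD hε i)) (((h.variation_φb ħ g he hD hε j).deRham hD hε).star hD)
  · exact .mul hD hε (.mul hD hε (h.variation_at ħ g he hD hε (g.smooth_coeff he i j))
      (h.variation_θ ħ g he hD hε j)) (h.variation_G ħ g he hD hε i)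

/-- The Lagrangian is itself the first variation of a primitive, so its own variation is read from
the second slot as ħL of that primitive. The explicit formula must hold at the original and at the
varied fields. -/
theorem variation_lagrangianKin : Variation ħ ε (chartDomain Φ e)
    (fun p => -pairRho g e F p + pairTheta g e F p) (lagrangianKin ħ g e F)
    (fun p => -pairRho g e (TypeBModel.brstShift ħ g e ε F) p +
      pairTheta g e (TypeBModel.brstShift ħ g e ε F) p)
    (lagrangianKin ħ g e (TypeBModel.brstShift ħ g e ε F)) :=
  (h.variation_pair ħ g he hD hε).congr hD (fun _ _ => rfl)
    (fun _ hp => h.lagrangianKin_eq ħ g he hD hp) (fun _ _ => rfl)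
    fun _ hp => (h.brstShift ħ g he hD hε).lagrangianKin_eq ħ g he hD hp

omit hε in
theorem form_pair : IsForm (chartDomain Φ e) 2 (-1)
    (fun p => -pairRho g e F p + pairTheta g e F p) := by
  refine .add (.neg (.sum fun i _ => .sum fun j _ => ?_)) (.sum fun i _ => .sum fun j _ => ?_)
  · exact (((h.form_at hD (g.smooth_coeff he i j)).mul (h.form_ρ hD i)).mul
      ((h.form_φb hD j).deRham hD).star).cast
  · exact (((h.form_at hD (g.smooth_coeff he i j)).mul (h.form_θ hD j)).mul
      (h.form_G hD i)).cast

end IsLocalField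

end Kinetic

/-! ### The superpotential terms -/

section Superpotential

open SForm

variable {n : ℕ} {X : Type*} [TopologicalSpace X]
  {Λ : Type*} [NormedRing Λ] [NormedAlgebra ℂ Λ] [FiniteDimensional ℂ Λ] [GrassmannAlgebra Λ]
  {Φ : ℂ → X} {e : Coord n X} {F : LocalFields n Λ}
  [ChartedSpace (Fin n → ℂ) X] [IsManifold 𝓘(ℂ, Fin n → ℂ) ω X] {W : X → ℂ}

/-- The coordinate expression of `W` is smooth and holomorphic. -/
structure IsHolomorphicIn (W : X → ℂ) (e : Coord n X) : Prop where
  smooth : SmoothTarget e (localW W e)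
  wdb_eq_zero : ∀ u ∈ e.target, ∀ i, wdb i (localW W e) u = 0

namespace IsHolomorphicIn

variable (hW : IsHolomorphicIn W e)
include hW

theorem smooth_bar : SmoothTarget e (localWBar W e) := hW.smooth.conj

theorem wd_bar (i : Fin n) {u : Fin n → ℂ} (hu : u ∈ e.target) :
    wd i (localWBar W e) u = 0 := by
  have h := wdir_conj (hW.smooth.differentiableAt hu) (.inl i)
  refine h.trans ?_
  change starRingEnd ℂ (wdb i (localW W e) u) = 0
  rw [hW.wdb_eq_zero u hu, map_zero]

theorem wdb_wd (i j : Fin n) {u : Fin n → ℂ} (hu : u ∈ e.target) :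
    wdb i (wd j (localW W e)) u = 0 := by
  have h := wdir_comm (hW.smooth u hu).contDiffAt (.inr i) (.inl j)
  refine h.trans ((SmoothTarget.wdir_congr (g := fun _ => 0)
    (fun u hu => hW.wdb_eq_zero u hu i) (.inl j) hu).trans ?_)
  simp [wdir_apply]

theorem wd_wdb_bar (i j : Fin n) {u : Fin n → ℂ} (hu : u ∈ e.target) :
    wd i (wdb j (localWBar W e)) u = 0 := by
  have h := wdir_comm (hW.smooth_bar u hu).contDiffAt (.inl i) (.inr j)
  refine h.trans ((SmoothTarget.wdir_congr (g := fun _ => 0)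
    (fun u hu => hW.wd_bar i hu) (.inr j) hu).trans ?_)
  simp [wdir_apply]

theorem smooth_hessW (g : KahlerMetric n X) (he : e ∈ atlas (Fin n → ℂ) X) (i j : Fin n) :
    SmoothTarget e (hessW g W e i j) :=
  ((hW.smooth.wd j).wd i).sub (.sum fun k _ => (g.smooth_christoffel he k i j).mul (hW.smooth.wd k))

theorem hessW_symm (g : KahlerMetric n X) (he : e ∈ atlas (Fin n → ℂ) X) (i j : Fin n)
    {u : Fin n → ℂ} (hu : u ∈ e.target) : hessW g W e i j u = hessW g W e j i u := by
  have h := wdir_comm (hW.smooth u hu).contDiffAt (.inl i) (.inl j)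
  unfold hessW
  rw [show wd i (wd j (localW W e)) u = wd j (wd i (localW W e)) u from h]
  exact congrArg _ (Finset.sum_congr rfl fun k _ => by rw [g.christoffel_symm he hu])

end IsHolomorphicIn

/-- `∂_{ī} W̄ θⁱ`. -/
def pairWBar (W : X → ℂ) (e : Coord n X) (F : LocalFields n Λ) (p : ℂ) : SForm Λ :=
  ∑ i, F.at (wdb i (localWBar W e)) p * F.θ p i

/-- `∂_i W ρⁱ`. -/
def pairW (W : X → ℂ) (e : Coord n X) (F : LocalFields n Λ) (p : ℂ) : SForm Λ :=
  ∑ i, F.at (wd i (localW W e)) p * F.ρ p i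

/-- The variation of `∂_i W ρⁱ`. -/
def pairWVar (ħ : ℂ) (g : KahlerMetric n X) (W : X → ℂ) (e : Coord n X) (F : LocalFields n Λ)
    (p : ℂ) : SForm Λ :=
  ∑ i, ((∑ a, F.at (wdir a (wd i (localW W e))) p * (brst ħ g e F).coord a p) * F.ρ p i +
    totalParity (F.at (wd i (localW W e)) p) * (brst ħ g e F).ρ p i)

namespace IsLocalField

variable (ħ : ℂ) (g : KahlerMetric n X) (he : e ∈ atlas (Fin n → ℂ) X)
  (hD : IsDiskOpen (chartDomain Φ e)) (h : IsLocalField Φ e F) (hW : IsHolomorphicIn W e)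
  {p : ℂ} (hp : p ∈ chartDomain Φ e)
include he hD h hW

omit he hD hW in
theorem at_eq_zero {f : (Fin n → ℂ) → ℂ} (hp : p ∈ chartDomain Φ e) (hf : SmoothTarget e f)
    (h0 : ∀ u ∈ e.target, f u = 0) : F.at f p = 0 := by
  rw [h.at_congr hp hf (g := fun u => 0 * f u) fun u hu => by rw [h0 u hu, zero_mul],
    h.at_const_mul hp 0 hf, zero_smul]

section Pointwise

include hp

/-- Since W̄ is antiholomorphic, only η̄ differentiates ∂W̄. The Γ̄ term of δθ completes the second
derivative to the covariant Hessian. -/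
theorem lagrangianWBar_eq : lagrangianWBar g W e F p =
    ∑ i, ((∑ a, F.at (wdir a (wdb i (localWBar W e))) p * (TypeBModel.brst ħ g e F).coord a p) *
      F.θ p i + totalParity (F.at (wdb i (localWBar W e)) p) * (TypeBModel.brst ħ g e F).θ p i) := by
  have hs : ∀ i, SmoothTarget e (wdb i (localWBar W e)) := fun i => hW.smooth_bar.wdb i
  have h1 : ∀ i, (∑ a, F.at (wdir a (wdb i (localWBar W e))) p *
      (TypeBModel.brst ħ g e F).coord a p) * F.θ p i +
      totalParity (F.at (wdb i (localWBar W e)) p) * (TypeBModel.brst ħ g e F).θ p i =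
      (∑ l, F.at (wdb l (wdb i (localWBar W e))) p * F.η p l * F.θ p i) +
      F.at (wdb i (localWBar W e)) p * F.Gb p i -
      ∑ j, ∑ k, F.at (wdb i (localWBar W e)) p * F.at (g.christoffelBar e i j k) p *
        (F.η p j * F.θ p k) := by
    intro i
    have e1 : ∀ l, F.at (wdir (.inl l) (wdb i (localWBar W e))) p = 0 := fun l =>
      h.at_eq_zero hp ((hs i).wd l) fun u hu => hW.wd_wdb_bar l i hu
    have e3 : ∀ l, (TypeBModel.brst ħ g e F).coord (.inr l) p = F.η p l := fun l => rfl
    have e5 : ∀ l, wdir (.inr l) (wdb i (localWBar W e)) = wdb l (wdb i (localWBar W e)) :=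
      fun _ => rfl
    have e6 : (TypeBModel.brst ħ g e F).θ p i = F.Gb p i - ∑ l, ∑ m,
      F.at (g.christoffelBar e i l m) p * F.η p l * F.θ p m := rfl
    rw [(h.at_even hp (hs i) : totalParity _ = _), Fintype.sum_sum_type, e6]
    simp only [e1, e3, e5, zero_mul, Finset.sum_const_zero, zero_add, mul_sub, Finset.sum_mul,
      Finset.mul_sum, mul_assoc]
    abel
  have h2 : ∀ i j, F.at (hessWBar g W e i j) p = F.at (wdb i (wdb j (localWBar W e))) p -
      ∑ k, F.at (wdb k (localWBar W e)) p * F.at (g.christoffelBar e k i j) p := by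
    intro i j
    have hm : ∀ k, SmoothTarget e fun u => wdb k (localWBar W e) u * g.christoffelBar e k i j u :=
      fun k => (hs k).mul (g.smooth_christoffelBar he k i j)
    have hsum : SmoothTarget e fun u => ∑ k, wdb k (localWBar W e) u *
      g.christoffelBar e k i j u := .sum fun k _ => hm k
    have hn : SmoothTarget e fun u => (-1) * ∑ k, wdb k (localWBar W e) u *
      g.christoffelBar e k i j u := fun u hu => (hsum u hu).const_mul (-1)
    rw [← h.at_congr hp (((hs j).wdb i).add hn) (g := hessWBar g W e i j) fun u _ => ?_,
      h.at_add hp ((hs j).wdb i) hn, h.at_const_mul hp (-1) hsum,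
      h.at_sum hp fun k _ => hm k, neg_smul, one_smul, sub_eq_add_neg]
    · exact congrArg _ (congrArg _ (Finset.sum_congr rfl fun k _ =>
        h.at_mul hp (hs k) (g.smooth_christoffelBar he k i j)))
    · rw [hessWBar, neg_one_mul, sub_eq_add_neg]
      exact congrArg _ (congrArg _ (Finset.sum_congr rfl fun k _ => mul_comm _ _))
  rw [lagrangianWBar, Finset.sum_congr rfl fun i _ => h1 i]
  simp only [h2, sub_mul, Finset.sum_sub_distrib, Finset.sum_add_distrib, Finset.sum_mul]
  rw [Finset.sum_comm (f := fun i j => F.at (wdb i (wdb j (localWBar W e))) p * F.η p i * F.θ p j)]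
  have h3 : ∑ i, ∑ j, ∑ k, F.at (wdb k (localWBar W e)) p * F.at (g.christoffelBar e k i j) p *
      F.η p i * F.θ p j = ∑ i, ∑ j, ∑ k, F.at (wdb i (localWBar W e)) p *
      F.at (g.christoffelBar e i j k) p * (F.η p j * F.θ p k) := by
    refine (Finset.sum_congr rfl fun i _ => Finset.sum_comm).trans
      (Finset.sum_comm.trans ?_)
    simp only [mul_assoc]
  rw [h3]
  abel

theorem deRham_at_localW : deRham (F.at (localW W e)) p =
    ∑ i, F.at (wd i (localW W e)) p * deRham (fun q => F.φ q i) p := by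
  rw [h.deRham_at hD hp hW.smooth, Fintype.sum_sum_type]
  have e1 : ∀ l, F.at (wdir (.inr l) (localW W e)) p = 0 := fun l =>
    h.at_eq_zero hp (hW.smooth.wdb l) fun u hu => hW.wdb_eq_zero u hu l
  simp only [e1, zero_mul, Finset.sum_const_zero, add_zero]
  rfl

theorem sum_wdir_localW : ∑ a, F.at (wdir a (localW W e)) p * (TypeBModel.brst ħ g e F).coord a p =
    ħ • SForm.iota p (pairW W e F p) := by
  rw [Fintype.sum_sum_type]
  have e1 : ∀ l, F.at (wdir (.inr l) (localW W e)) p = 0 := fun l =>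
    h.at_eq_zero hp (hW.smooth.wdb l) fun u hu => hW.wdb_eq_zero u hu l
  simp only [e1, zero_mul, Finset.sum_const_zero, add_zero, pairW, SForm.iota_sum, Finset.smul_sum]
  refine Finset.sum_congr rfl fun l _ => ?_
  have hs := hW.smooth.wd l
  rw [SForm.iota_mul, (h.form_at hD hs).iota_eq_zero hp, zero_mul, zero_add,
    (h.at_even hp hs : totalParity _ = _), ← mul_smul_comm]
  rfl

/-- Holomorphy leaves only the derivative along ħ ιρ. With the Γ term of δρ it gives the covariant
Hessian on ιρ ρ. This is minus the contraction of -½ Hess W ρρ, the factor ½ being absorbed by the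
symmetry of the Hessian. -/
theorem pairWVar_eq : pairWVar ħ g W e F p =
    -deRham (F.at (localW W e)) p - ħ • SForm.iota p (lagrangianW g W e F p) := by
  have hs : ∀ i, SmoothTarget e (wd i (localW W e)) := fun i => hW.smooth.wd i
  have hρ : ∀ i, (F.ρ p i).Even := fun i => (h.form_ρ hD i).even hp
  have h1 : ∀ i, (∑ a, F.at (wdir a (wd i (localW W e))) p *
      (TypeBModel.brst ħ g e F).coord a p) * F.ρ p i +
      totalParity (F.at (wd i (localW W e)) p) * (TypeBModel.brst ħ g e F).ρ p i =
      ħ • (∑ l, F.at (wd l (wd i (localW W e))) p * (SForm.iota p (F.ρ p l) * F.ρ p i)) -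
      F.at (wd i (localW W e)) p * deRham (fun q => F.φ q i) p -
      ħ • (F.at (wd i (localW W e)) p * SForm.iota p (F.G p i)) -
      ħ • ∑ j, ∑ k, F.at (wd i (localW W e)) p * F.at (g.christoffel e i j k) p *
        (SForm.iota p (F.ρ p j) * F.ρ p k) := by
    intro i
    have e1 : ∀ l, F.at (wdir (.inr l) (wd i (localW W e))) p = 0 := fun l =>
      h.at_eq_zero hp ((hs i).wdb l) fun u hu => hW.wdb_wd l i hu
    have e3 : ∀ l, (TypeBModel.brst ħ g e F).coord (.inl l) p = ħ • SForm.iota p (F.ρ p l) :=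
      fun l => rfl
    have e5 : ∀ l, wdir (.inl l) (wd i (localW W e)) = wd l (wd i (localW W e)) := fun _ => rfl
    have e6 : (TypeBModel.brst ħ g e F).ρ p i = -deRham (fun q => F.φ q i) p -
      ħ • SForm.iota p (F.G p i) - ħ • ∑ l, ∑ m, F.at (g.christoffel e i l m) p *
        SForm.iota p (F.ρ p l) * F.ρ p m := rfl
    rw [(h.at_even hp (hs i) : totalParity _ = _), Fintype.sum_sum_type, e6]
    simp only [e1, e3, e5, zero_mul, Finset.sum_const_zero, add_zero, mul_sub, Finset.sum_mul,
      Finset.mul_sum, mul_assoc, mul_neg, mul_smul_comm, smul_mul_assoc, Finset.smul_sum]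
    abel
  have hh : ∀ i j, (F.at (hessW g W e i j) p).Even := fun i j =>
    h.at_even hp (hW.smooth_hessW g he i j)
  have h2 : ∀ i j, F.at (hessW g W e i j) p = F.at (wd i (wd j (localW W e))) p -
      ∑ k, F.at (wd k (localW W e)) p * F.at (g.christoffel e k i j) p := by
    intro i j
    have hm : ∀ k, SmoothTarget e fun u => wd k (localW W e) u * g.christoffel e k i j u :=
      fun k => (hs k).mul (g.smooth_christoffel he k i j)
    have hsum : SmoothTarget e fun u => ∑ k, wd k (localW W e) u *
      g.christoffel e k i j u := .sum fun k _ => hm k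
    have hn : SmoothTarget e fun u => (-1) * ∑ k, wd k (localW W e) u *
      g.christoffel e k i j u := fun u hu => (hsum u hu).const_mul (-1)
    rw [← h.at_congr hp (((hs j).wd i).add hn) (g := hessW g W e i j) fun u _ => ?_,
      h.at_add hp ((hs j).wd i) hn, h.at_const_mul hp (-1) hsum,
      h.at_sum hp fun k _ => hm k, neg_smul, one_smul, sub_eq_add_neg]
    · exact congrArg _ (congrArg _ (Finset.sum_congr rfl fun k _ =>
        h.at_mul hp (hs k) (g.smooth_christoffel he k i j)))
    · rw [hessW, neg_one_mul, sub_eq_add_neg]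
      exact congrArg _ (congrArg _ (Finset.sum_congr rfl fun k _ => mul_comm _ _))
  have h3 : ∀ i j, SForm.iota p (F.at (hessW g W e i j) p * F.ρ p i * F.ρ p j) =
      F.at (hessW g W e i j) p * (SForm.iota p (F.ρ p i) * F.ρ p j) +
      F.at (hessW g W e i j) p * (F.ρ p i * SForm.iota p (F.ρ p j)) := fun i j => by
    rw [mul_assoc, SForm.iota_mul, (h.form_at hD (hW.smooth_hessW g he i j)).iota_eq_zero hp,
      zero_mul, zero_add, (hh i j : totalParity _ = _), SForm.iota_mul,
      (hρ i : totalParity _ = _), mul_add]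
  have h4 : ∀ i, SForm.iota p (F.at (wd i (localW W e)) p * F.G p i) =
      F.at (wd i (localW W e)) p * SForm.iota p (F.G p i) := fun i => by
    rw [SForm.iota_mul, (h.form_at hD (hs i)).iota_eq_zero hp,
      zero_mul, zero_add, (h.at_even hp (hs i) : totalParity _ = _)]
  have h5 := sum_mul_comm (A := fun i j => F.at (hessW g W e i j) p) (x := fun i => F.ρ p i)
    (y := fun i => SForm.iota p (F.ρ p i)) (fun i j => h.at_congr hp (hW.smooth_hessW g he i j)
      fun u hu => hW.hessW_symm g he i j hu) fun j k => (hρ j).mul_eq _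
  have h6 : SForm.iota p (lagrangianW g W e F p) =
      -(∑ i, ∑ j, F.at (hessW g W e i j) p * (SForm.iota p (F.ρ p i) * F.ρ p j)) +
      ∑ i, F.at (wd i (localW W e)) p * SForm.iota p (F.G p i) := by
    rw [lagrangianW]
    simp only [SForm.iota_add, SForm.iota_neg, SForm.iota_smul, SForm.iota_sum, h3, h4,
      Finset.sum_add_distrib]
    rw [h5]
    module
  have h7 : ∑ i, ∑ j, ∑ k, F.at (wd k (localW W e)) p * F.at (g.christoffel e k i j) p *
      (SForm.iota p (F.ρ p i) * F.ρ p j) = ∑ i, ∑ j, ∑ k, F.at (wd i (localW W e)) p *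
      F.at (g.christoffel e i j k) p * (SForm.iota p (F.ρ p j) * F.ρ p k) :=
    (Finset.sum_congr rfl fun i _ => Finset.sum_comm).trans Finset.sum_comm
  rw [pairWVar, Finset.sum_congr rfl fun i _ => h1 i, h6, h.deRham_at_localW he hD hW hp]
  simp only [h2, sub_mul, Finset.sum_sub_distrib, Finset.sum_mul, ← Finset.smul_sum]
  rw [Finset.sum_comm (f := fun i j => F.at (wd i (wd j (localW W e))) p *
    (SForm.iota p (F.ρ p i) * F.ρ p j)), h7]
  module

end Pointwise

omit he in
theorem form_pairWBar : IsForm (chartDomain Φ e) 0 (-1) (pairWBar W e F) :=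
  .sum fun i _ => ((h.form_at hD (hW.smooth_bar.wdb i)).mul (h.form_θ hD i)).cast

omit he in
theorem form_pairW : IsForm (chartDomain Φ e) 1 1 (pairW W e F) :=
  .sum fun i _ => ((h.form_at hD (hW.smooth.wd i)).mul (h.form_ρ hD i)).cast

theorem form_lagrangianW : IsForm (chartDomain Φ e) 2 1 (lagrangianW g W e F) := by
  refine .add (.neg (.smul _ (.sum fun i _ => .sum fun j _ => ?_))) (.sum fun i _ => ?_)
  · exact (((h.form_at hD (hW.smooth_hessW g he i j)).mul (h.form_ρ hD i)).mul
      (h.form_ρ hD j)).cast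
  · exact ((h.form_at hD (hW.smooth.wd i)).mul (h.form_G hD i)).cast

variable {ε : Λ} (hε : IsOdd ε)
include hε

theorem variation_lagrangianWBar : Variation ħ ε (chartDomain Φ e) (pairWBar W e F)
    (lagrangianWBar g W e F) (pairWBar W e (TypeBModel.brstShift ħ g e ε F))
    (lagrangianWBar g W e (TypeBModel.brstShift ħ g e ε F)) := by
  refine (Variation.sum hD fun i _ => Variation.mul hD hε
    (h.variation_at ħ g he hD hε (hW.smooth_bar.wdb i)) (h.variation_θ ħ g he hD hε i)).congr hD
    (fun _ _ => rfl) (fun p hp => h.lagrangianWBar_eq ħ g he hD hW hp) (fun _ _ => rfl)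
    fun p hp => (h.brstShift ħ g he hD hε).lagrangianWBar_eq ħ g he hD hW hp

theorem at_localW_brstShift {p : ℂ} (hp : p ∈ chartDomain Φ e) :
    (TypeBModel.brstShift ħ g e ε F).at (localW W e) p =
      F.at (localW W e) p + of ε * (ħ • SForm.iota p (pairW W e F p)) := by
  rw [(h.variation_at ħ g he hD hε hW.smooth).eq p hp, h.sum_wdir_localW ħ g he hD hW hp]

theorem variation_pairW : Variation ħ ε (chartDomain Φ e) (pairW W e F)
    (pairWVar ħ g W e F) (pairW W e (TypeBModel.brstShift ħ g e ε F))
    (pairWVar ħ g W e (TypeBModel.brstShift ħ g e ε F)) :=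
  Variation.sum hD fun i _ => Variation.mul hD hε
    (h.variation_at ħ g he hD hε (hW.smooth.wd i)) (h.variation_ρ ħ g he hD hε i)

/-- The term with W is not δ-exact. Instead δ is applied to the formula for δ(∂W ρ): the terms ħ d
ι(∂W ρ) on both sides cancel, leaving an equation between contracted two-forms, which is solved off
the centre and extended by continuity. -/
theorem lagrangianW_brstShift (hħ : ħ ≠ 0) {p : ℂ} (hp : p ∈ chartDomain Φ e) :
    lagrangianW g W e (TypeBModel.brstShift ħ g e ε F) p =
      lagrangianW g W e F p + of ε * deRham (pairW W e F) p := by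
  have h' := h.brstShift ħ g he hD hε
  have hα := h.form_pairW hD hW
  have f1 : IsForm (chartDomain Φ e) 2 1 fun p =>
      lagrangianW g W e F p + of ε * deRham (pairW W e F) p :=
    (h.form_lagrangianW g he hD hW).add (((hα.deRham hD).const_mul hε).cast)
  have f2 := h'.form_lagrangianW g he hD hW
  refine eqOn_of_eqOn_ne_zero hD (f2.smooth.continuousOn hD) (f1.smooth.continuousOn hD)
    (fun p hp h0 => eq_of_iota_eq h0 (f2.mem_deg p hp) (f1.mem_deg p hp) ?_) hp
  have h1 := (h.variation_pairW ħ g he hD hW hε).eq₁ p hp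
  have h2 : deRham ((TypeBModel.brstShift ħ g e ε F).at (localW W e)) p =
      deRham (F.at (localW W e)) p -
        of ε * (ħ • deRham (fun q => SForm.iota q (pairW W e F q)) p) := by
    rw [deRham_congr hD (fun q hq => h.at_localW_brstShift ħ g he hD hW hε hq) hp,
      deRham_add hD (h.smooth_at hD hW.smooth)
        ((diskSmoothOn_const _).mul (hα.iota.smooth.smul ħ)) hp,
      deRham_odd_const_mul hD (odd_of hε) (hα.iota.smooth.smul ħ) hp,
      deRham_smul hD ħ hα.iota.smooth hp, sub_eq_add_neg]
  rw [h'.pairWVar_eq ħ g he hD hW hp, h.pairWVar_eq ħ g he hD hW hp, h2, lie] at h1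
  -- The comparison yields the contracted identity times ħ. Cancelling this factor is where ħ ≠ 0
  -- enters the bulk variation.
  refine smul_right_injective _ hħ ?_
  rw [SForm.iota_add, iota_of_mul hε]
  simp only [smul_add, mul_add, mul_smul_comm, smul_neg] at h1 ⊢
  have h3 := congrArg (fun w => -w - (deRham (F.at (localW W e)) p -
    ħ • (of ε * deRham (fun q => SForm.iota q (pairW W e F q)) p))) h1
  refine Eq.trans (Eq.trans ?_ h3) ?_ <;> abel

end IsLocalField

end Superpotential

/-! ### Holomorphic functions of several variables are smooth -/

section Holomorphic

open MeasureTheory Metric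

variable {E : Type*} [NormedAddCommGroup E] [NormedSpace ℂ E] [FiniteDimensional ℂ E]
  {f : E → ℂ} {U : Set E}

/-- Cauchy's estimate on the complex line through x₀ in the direction v, in a disk of radius ρ/‖v‖.
-/
theorem norm_fderiv_le_of_bound {x₀ : E} {ρ M : ℝ} (hρ : 0 < ρ) (hU : IsOpen U)
    (hf : DifferentiableOn ℂ f U) (hs : closedBall x₀ ρ ⊆ U)
    (hM : ∀ y ∈ closedBall x₀ ρ, ‖f y‖ ≤ M) : ‖fderiv ℂ f x₀‖ ≤ M / ρ := by
  have hM0 : 0 ≤ M := (norm_nonneg _).trans (hM x₀ (mem_closedBall_self hρ.le))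
  refine ContinuousLinearMap.opNorm_le_bound _ (by positivity) fun v => ?_
  rcases eq_or_ne v 0 with rfl | hv
  · simp
  have hv' : 0 < ‖v‖ := norm_pos_iff.mpr hv
  have hmem : ∀ t ∈ closedBall (0 : ℂ) (ρ / ‖v‖), x₀ + t • v ∈ closedBall x₀ ρ := fun t ht => by
    rw [mem_closedBall_iff_norm, add_sub_cancel_left, norm_smul]
    rw [mem_closedBall_zero_iff, le_div_iff₀ hv'] at ht
    exact ht
  have hd : ∀ t ∈ closedBall (0 : ℂ) (ρ / ‖v‖), HasDerivAt (fun t : ℂ => f (x₀ + t • v))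
      (fderiv ℂ f (x₀ + t • v) v) t := fun t ht => by
    have h1 : HasDerivAt (fun t : ℂ => x₀ + t • v) v t := by
      simpa using ((hasDerivAt_id t).smul_const v).const_add x₀
    exact ((hf.differentiableAt (hU.mem_nhds (hs (hmem t ht)))).hasFDerivAt).comp_hasDerivAt t h1
  have h0 := hd 0 (mem_closedBall_self (by positivity))
  have h2 := Complex.norm_deriv_le_of_forall_mem_sphere_norm_le (f := fun t : ℂ => f (x₀ + t • v))
    (c := 0) (R := ρ / ‖v‖) (C := M) (by positivity)
    (DifferentiableOn.diffContOnCl fun t ht =>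
      (hd t (closure_ball_subset_closedBall ht)).differentiableAt.differentiableWithinAt)
    fun t ht => hM _ (hmem t (sphere_subset_closedBall ht))
  rw [h0.deriv, zero_smul, add_zero] at h2
  refine h2.trans (le_of_eq ?_)
  field_simp

/-- Cauchy's formula on the line x + tv writes the directional derivative as an integral of values
of f. It can be differentiated in x under the integral sign, the dominating bound coming from
Cauchy's estimate. Iterating this gives smoothness of holomorphic functions in several variables. -/
theorem differentiableOn_fderiv_apply (hU : IsOpen U) (hf : DifferentiableOn ℂ f U) (v : E) :
    DifferentiableOn ℂ (fun x => fderiv ℂ f x v) U := by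
  let : MeasurableSpace E := borel E
  have : BorelSpace E := ⟨rfl⟩
  have : ProperSpace E := FiniteDimensional.proper ℂ E
  intro x₀ hx₀
  obtain ⟨δ, hδ, hδU⟩ := nhds_basis_closedBall.mem_iff.mp (hU.mem_nhds hx₀)
  -- A third each for the displacement of x from x₀, for the shift tv, and for the ball used in
  -- Cauchy's estimate. The 1 added to ‖v‖ in r below allows v = 0.
  set ρ := δ / 3 with hρ
  have hρ0 : 0 < ρ := by positivity
  obtain ⟨M, hM⟩ := (isCompact_closedBall x₀ δ).exists_bound_of_continuousOn
    (hf.continuousOn.mono hδU)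
  set r := ρ / (‖v‖ + 1) with hr
  have hr0 : 0 < r := by positivity
  have hmem : ∀ x ∈ ball x₀ ρ, ∀ t ∈ closedBall (0 : ℂ) r,
      closedBall (x + t • v) ρ ⊆ closedBall x₀ δ := by
    intro x hx t ht y hy
    rw [mem_closedBall_zero_iff] at ht
    have h1 : ‖t • v‖ ≤ ρ := by
      rw [norm_smul]
      calc ‖t‖ * ‖v‖ ≤ r * (‖v‖ + 1) :=
            mul_le_mul ht (by linarith) (norm_nonneg _) hr0.le
        _ = ρ := by rw [hr]; field_simp
    rw [mem_ball_iff_norm] at hx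
    rw [mem_closedBall_iff_norm] at hy ⊢
    calc ‖y - x₀‖ = ‖(y - (x + t • v)) + (x - x₀) + t • v‖ := by congr 1; abel
      _ ≤ ‖y - (x + t • v)‖ + ‖x - x₀‖ + ‖t • v‖ := norm_add₃_le
      _ ≤ δ := by linarith
  have hcm : ∀ θ : ℝ, circleMap 0 r θ ∈ closedBall (0 : ℂ) r := fun θ =>
    sphere_subset_closedBall (circleMap_mem_sphere 0 hr0.le θ)
  have hself : ∀ x ∈ ball x₀ ρ, ∀ t ∈ closedBall (0 : ℂ) r, x + t • v ∈ U := fun x hx t ht =>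
    hδU (hmem x hx t ht (mem_closedBall_self hρ0.le))
  let k : ℝ → ℂ := fun θ => deriv (circleMap 0 r) θ * (1 / (circleMap 0 r θ - 0) ^ 2)
  have hk : Continuous k := by
    have h0 : ∀ θ, (circleMap 0 r θ - 0) ^ 2 ≠ 0 := fun θ => by
      rw [sub_zero]; exact pow_ne_zero _ (circleMap_ne_center hr0.ne')
    simp only [k, deriv_circleMap]
    exact ((continuous_circleMap 0 r).mul continuous_const).mul
      (continuous_const.div (((continuous_circleMap 0 r).sub continuous_const).pow 2) h0)
  have hcont : ∀ x ∈ ball x₀ ρ, Continuous fun θ => f (x + circleMap 0 r θ • v) := fun x hx =>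
    hf.continuousOn.comp_continuous (continuous_const.add
      ((continuous_circleMap 0 r).smul continuous_const)) fun θ => hself x hx _ (hcm θ)
  have hcauchy : ∀ x ∈ ball x₀ ρ, fderiv ℂ f x v = (2 * Real.pi * Complex.I : ℂ)⁻¹ *
      ∫ θ in (0 : ℝ)..2 * Real.pi, k θ * f (x + circleMap 0 r θ • v) := by
    intro x hx
    have hd : ∀ t ∈ closedBall (0 : ℂ) r, HasDerivAt (fun t : ℂ => f (x + t • v))
        (fderiv ℂ f (x + t • v) v) t := fun t ht => by
      have h1 : HasDerivAt (fun t : ℂ => x + t • v) v t := by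
        simpa using ((hasDerivAt_id t).smul_const v).const_add x
      exact ((hf.differentiableAt (hU.mem_nhds (hself x hx t ht))).hasFDerivAt).comp_hasDerivAt t h1
    have h1 := DifferentiableOn.deriv_eq_smul_circleIntegral (f := fun t : ℂ => f (x + t • v))
      (c := 0) hr0 fun t ht => (hd t ht).differentiableAt.differentiableWithinAt
    rw [(hd 0 (mem_closedBall_self hr0.le)).deriv, zero_smul, add_zero, circleIntegral] at h1
    rw [eq_inv_mul_iff_mul_eq₀ Complex.two_pi_I_ne_zero, ← smul_eq_mul, ← h1]
    exact intervalIntegral.integral_congr fun θ _ => by simp only [smul_eq_mul, k]; ring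
  have hF := intervalIntegral.hasFDerivAt_integral_of_dominated_of_fderiv_le (𝕜 := ℂ)
    (μ := volume) (a := 0) (b := 2 * Real.pi) (s := ball x₀ ρ) (x₀ := x₀)
    (F := fun x θ => k θ * f (x + circleMap 0 r θ • v))
    (F' := fun x θ => k θ • fderiv ℂ f (x + circleMap 0 r θ • v))
    (bound := fun θ => ‖k θ‖ * (M / ρ)) (ball_mem_nhds x₀ hρ0)
    (by
      filter_upwards [ball_mem_nhds x₀ hρ0] with x hx
      exact (hk.mul (hcont x hx)).aestronglyMeasurable)
    ((hk.mul (hcont x₀ (mem_ball_self hρ0))).intervalIntegrable _ _)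
    (by
      have h1 : Measurable fun θ => fderiv ℂ f (x₀ + circleMap 0 r θ • v) :=
        (measurable_fderiv ℂ f).comp (continuous_const.add
          ((continuous_circleMap 0 r).smul continuous_const)).measurable
      exact (hk.measurable.smul h1).aestronglyMeasurable)
    (Eventually.of_forall fun θ _ x hx => by
      rw [norm_smul]
      refine mul_le_mul_of_nonneg_left ?_ (norm_nonneg _)
      exact norm_fderiv_le_of_bound hρ0 hU hf ((hmem x hx _ (hcm θ)).trans hδU)
        fun y hy => hM y (hmem x hx _ (hcm θ) hy))
    ((hk.norm.mul continuous_const).intervalIntegrable _ _)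
    (Eventually.of_forall fun θ _ x hx => by
      have h1 := (hf.differentiableAt (hU.mem_nhds (hself x hx _ (hcm θ)))).hasFDerivAt
      have h2 : HasFDerivAt (fun x => x + circleMap 0 r θ • v) (ContinuousLinearMap.id ℂ E) x :=
        (hasFDerivAt_id x).add_const _
      exact (h1.comp x h2).const_mul (k θ))
  have hF' := (hF.const_mul ((2 * Real.pi * Complex.I : ℂ)⁻¹)).differentiableAt
  refine (hF'.congr_of_eventuallyEq ?_).differentiableWithinAt
  filter_upwards [ball_mem_nhds x₀ hρ0] with x hx using hcauchy x hx

theorem contDiffOn_of_differentiableOn (hU : IsOpen U) (hf : DifferentiableOn ℂ f U) :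
    ContDiffOn ℂ ∞ f U := by
  have key : ∀ (k : ℕ) (f : E → ℂ), DifferentiableOn ℂ f U → ContDiffOn ℂ k f U := by
    intro k
    induction k with
    | zero => exact fun f hf => contDiffOn_zero.mpr hf.continuousOn
    | succ k ih =>
      intro f hf
      rw [Nat.cast_succ, contDiffOn_succ_iff_fderiv_of_isOpen hU]
      refine ⟨hf, by simp, ?_⟩
      rw [contDiffOn_clm_apply]
      exact fun v => ih _ (differentiableOn_fderiv_apply hU hf v)
  exact contDiffOn_infty.mpr fun k => key k f hf

variable {n : ℕ} {U : Set (Fin n → ℂ)} {f : (Fin n → ℂ) → ℂ} {u : Fin n → ℂ}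

theorem smoothNear_of_differentiableOn (hU : IsOpen U) (hf : DifferentiableOn ℂ f U) (hu : u ∈ U) :
    SmoothNear f u := by
  filter_upwards [hU.mem_nhds hu] with x hx
  exact (contDiffOn_of_differentiableOn hU hf).contDiffAt (hU.mem_nhds hx) |>.restrict_scalars ℝ

theorem wdb_eq_zero_of_differentiableAt (hf : DifferentiableAt ℂ f u) (i : Fin n) :
    wdb i f u = 0 := by
  have h1 : fderiv ℝ f u = (fderiv ℂ f u).restrictScalars ℝ :=
    (hf.hasFDerivAt.restrictScalars ℝ).fderiv
  have h2 : (Pi.single i Complex.I : Fin n → ℂ) = Complex.I • Pi.single i 1 := by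
    rw [← Pi.single_smul, smul_eq_mul, mul_one]
  rw [wdb, h1, ContinuousLinearMap.coe_restrictScalars', h2, map_smul, smul_smul, Complex.I_mul_I,
    neg_one_smul, add_neg_cancel, smul_zero]

variable {X : Type*} [TopologicalSpace X] [ChartedSpace (Fin n → ℂ) X]
  [IsManifold 𝓘(ℂ, Fin n → ℂ) ω X]

theorem isHolomorphicIn_of_mdifferentiable {W : X → ℂ}
    (hW : MDifferentiable 𝓘(ℂ, Fin n → ℂ) 𝓘(ℂ) W) {e : Coord n X}
    (he : e ∈ atlas (Fin n → ℂ) X) : IsHolomorphicIn W e := by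
  have h1 : DifferentiableOn ℂ (localW W e) e.target := fun u hu => by
    have h2 := (mdifferentiable_of_mem_atlas (I := 𝓘(ℂ, Fin n → ℂ)) he).mdifferentiableAt_symm hu
    exact ((hW _).comp u h2).differentiableAt.differentiableWithinAt
  exact ⟨fun u hu => smoothNear_of_differentiableOn e.open_target h1 hu, fun u hu i =>
    wdb_eq_zero_of_differentiableAt (h1.differentiableAt (e.open_target.mem_nhds hu)) i⟩

end Holomorphic

/-! ### Changes of coordinates -/

section Covariance

open SForm

variable {n : ℕ} {X : Type*} [TopologicalSpace X]
  {Λ : Type*} [NormedRing Λ] [NormedAlgebra ℂ Λ] [FiniteDimensional ℂ Λ] [GrassmannAlgebra Λ]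
  {Φ : ℂ → X} {e e' : Coord n X} {F F' : LocalFields n Λ} {p : ℂ}

/-- The coordinates `e`, restricted to the domain of `e'`. -/
abbrev overlap (e e' : Coord n X) : Coord n X := e.restrOpen e'.source e'.open_source

theorem mem_overlap_target {u : Fin n → ℂ} :
    u ∈ (overlap e e').target ↔ u ∈ e.target ∧ e.symm u ∈ e'.source := Iff.rfl

theorem chartDomain_overlap :
    chartDomain Φ (overlap e e') = chartDomain Φ e ∩ chartDomain Φ e' := by
  ext p
  simp only [chartDomain, OpenPartialHomeomorph.restrOpen_source, Set.mem_ofPred_eq, Set.mem_inter_iff]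
  tauto

theorem chartDomain_overlap_subset : chartDomain Φ (overlap e e') ⊆ chartDomain Φ e :=
  chartDomain_overlap.subset.trans Set.inter_subset_left

theorem IsLocalField.restrict (h : IsLocalField Φ e F) : IsLocalField Φ (overlap e e') F := by
  have hs : chartDomain Φ (overlap e e') ⊆ chartDomain Φ e := chartDomain_overlap_subset
  exact ⟨h.smooth_φ.mono hs, h.smooth_φb.mono hs, h.smooth_η.mono hs, h.smooth_θ.mono hs,
    h.smooth_ρ.mono hs, h.smooth_G.mono hs, h.smooth_Gb.mono hs, fun p hp => h.type_φ p (hs hp),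
    fun p hp => h.type_φb p (hs hp), fun p hp => h.type_η p (hs hp), fun p hp => h.type_θ p (hs hp),
    fun p hp => h.type_ρ p (hs hp), fun p hp => h.type_G p (hs hp), fun p hp => h.type_Gb p (hs hp),
    fun p hp => h.body_φ p (hs hp), fun p hp => h.body_φb p (hs hp)⟩

/-- The change of coordinates from `e` to `e'`. -/
def transitionMap (e e' : Coord n X) (u : Fin n → ℂ) : Fin n → ℂ := e' (e.symm u)

theorem transitionMap_mem {u : Fin n → ℂ} (hu : u ∈ (overlap e e').target) :
    transitionMap e e' u ∈ e'.target := e'.map_source (mem_overlap_target.mp hu).2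

theorem symm_transitionMap {u : Fin n → ℂ} (hu : u ∈ (overlap e e').target) :
    e'.symm (transitionMap e e' u) = e.symm u := e'.left_inv (mem_overlap_target.mp hu).2

/-- On holomorphic functions `∂/∂uⁱ` is the complex partial derivative. -/
theorem wd_eq_fderiv {f : (Fin n → ℂ) → ℂ} {u : Fin n → ℂ} (hf : DifferentiableAt ℂ f u)
    (i : Fin n) : wd i f u = fderiv ℂ f u (Pi.single i 1) := by
  have h1 : fderiv ℝ f u = (fderiv ℂ f u).restrictScalars ℝ :=
    (hf.hasFDerivAt.restrictScalars ℝ).fderiv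
  have h2 : (Pi.single i Complex.I : Fin n → ℂ) = Complex.I • Pi.single i 1 := by
    rw [← Pi.single_smul, smul_eq_mul, mul_one]
  rw [wd, h1, ContinuousLinearMap.coe_restrictScalars', h2, map_smul, smul_smul, Complex.I_mul_I,
    neg_one_smul, sub_neg_eq_add, ← two_smul ℂ, smul_smul]
  norm_num

theorem sesquilinear_sum_sum {V κ : Type*} [Fintype κ] [AddCommGroup V] [Module ℂ V]
    (H : V →ₗ[ℂ] V →ₗ⋆[ℂ] ℂ) (a b : κ → ℂ) (x : κ → V) :
    H (∑ k, a k • x k) (∑ l, b l • x l) =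
      ∑ k, ∑ l, H (x k) (x l) * a k * starRingEnd ℂ (b l) := by
  rw [map_sum H, LinearMap.sum_apply]
  refine Finset.sum_congr rfl fun k _ => ?_
  rw [map_sum]
  refine Finset.sum_congr rfl fun l _ => ?_
  rw [map_smul H, LinearMap.smul_apply, LinearMap.map_smulₛₗ, smul_eq_mul, smul_eq_mul]
  ring

variable [ChartedSpace (Fin n → ℂ) X] [IsManifold 𝓘(ℂ, Fin n → ℂ) ω X]
  (he : e ∈ atlas (Fin n → ℂ) X) (he' : e' ∈ atlas (Fin n → ℂ) X)

/-! ### Holomorphic transition maps and the transformation of the metric. -/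

section Holomorphic

include he he'

theorem differentiableAt_transitionMap {u : Fin n → ℂ} (hu : u ∈ (overlap e e').target) :
    DifferentiableAt ℂ (transitionMap e e') u := by
  have h1 := (mdifferentiable_of_mem_atlas (I := 𝓘(ℂ, Fin n → ℂ)) he).mdifferentiableAt_symm
    (mem_overlap_target.mp hu).1
  have h2 := (mdifferentiable_of_mem_atlas (I := 𝓘(ℂ, Fin n → ℂ)) he').mdifferentiableAt
    (mem_overlap_target.mp hu).2
  exact (h2.comp u h1).differentiableAt

theorem differentiableAt_transition (i : Fin n) {u : Fin n → ℂ} (hu : u ∈ (overlap e e').target) :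
    DifferentiableAt ℂ (transition e e' i) u :=
  differentiableAt_pi.mp (differentiableAt_transitionMap he he' hu) i

theorem smooth_transition (i : Fin n) : SmoothTarget (overlap e e') (transition e e' i) :=
  fun _ hu => smoothNear_of_differentiableOn (overlap e e').open_target
    (fun _ hv => (differentiableAt_transition he he' i hv).differentiableWithinAt) hu

theorem smooth_transitionBar (i : Fin n) : SmoothTarget (overlap e e') (transitionBar e e' i) :=
  (smooth_transition he he' i).conj

theorem wdb_transition (i j : Fin n) {u : Fin n → ℂ} (hu : u ∈ (overlap e e').target) :
    wdb j (transition e e' i) u = 0 :=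
  wdb_eq_zero_of_differentiableAt (differentiableAt_transition he he' i hu) j

theorem wd_transitionBar (i j : Fin n) {u : Fin n → ℂ} (hu : u ∈ (overlap e e').target) :
    wd j (transitionBar e e' i) u = 0 := by
  refine (wdir_conj ((smooth_transition he he' i).differentiableAt hu) (.inl j)).trans ?_
  change starRingEnd ℂ (wdb j (transition e e' i) u) = 0
  rw [wdb_transition he he' i j hu, map_zero]

theorem wdb_transitionBar (i j : Fin n) {u : Fin n → ℂ} (hu : u ∈ (overlap e e').target) :
    wdb j (transitionBar e e' i) u = starRingEnd ℂ (wd j (transition e e' i) u) :=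
  wdir_conj ((smooth_transition he he' i).differentiableAt hu) (.inr j)

theorem smoothNear_transitionMap {u : Fin n → ℂ} (hu : u ∈ (overlap e e').target) :
    SmoothNear (transitionMap e e') u := by
  have h : ∀ᶠ x in 𝓝 u, ∀ i, ContDiffAt ℝ ∞ (transition e e' i) x :=
    eventually_all.mpr fun i => smooth_transition he he' i u hu
  filter_upwards [h] with x hx using contDiffAt_pi.mpr hx

theorem SmoothTarget.comp_transitionMap {f : (Fin n → ℂ) → ℂ} (hf : SmoothTarget e' f) :
    SmoothTarget (overlap e e') fun u => f (transitionMap e e' u) := fun _ hu =>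
  (hf _ (transitionMap_mem hu)).comp (smoothNear_transitionMap he he' hu)

theorem wd_comp_transitionMap {f : (Fin n → ℂ) → ℂ} (hf : SmoothTarget e' f) (i : Fin n)
    {u : Fin n → ℂ} (hu : u ∈ (overlap e e').target) :
    wd i (fun u => f (transitionMap e e' u)) u =
      ∑ k, wd k f (transitionMap e e' u) * wd i (transition e e' k) u := by
  refine (wdir_comp (hf _ (transitionMap_mem hu)).differentiableAt
    (smoothNear_transitionMap he he' hu).differentiableAt (.inl i)).trans ?_
  rw [Fintype.sum_sum_type]
  have h0 : ∀ k, wdir (.inl i) (fun x => zcoord (.inr k) (transitionMap e e' x)) u = 0 :=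
    fun k => wd_transitionBar he he' k i hu
  simp only [h0, mul_zero, Finset.sum_const_zero, add_zero]
  rfl

theorem wdb_comp_transitionMap {f : (Fin n → ℂ) → ℂ} (hf : SmoothTarget e' f) (i : Fin n)
    {u : Fin n → ℂ} (hu : u ∈ (overlap e e').target) :
    wdb i (fun u => f (transitionMap e e' u)) u =
      ∑ k, wdb k f (transitionMap e e' u) * wdb i (transitionBar e e' k) u := by
  refine (wdir_comp (hf _ (transitionMap_mem hu)).differentiableAt
    (smoothNear_transitionMap he he' hu).differentiableAt (.inr i)).trans ?_
  rw [Fintype.sum_sum_type]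
  have h0 : ∀ k, wdir (.inr i) (fun x => zcoord (.inl k) (transitionMap e e' x)) u = 0 :=
    fun k => wdb_transition he he' k i hu
  simp only [h0, mul_zero, Finset.sum_const_zero, zero_add]
  rfl

/-- Near u the inverse of e is the inverse of e' after the transition map, so the chain rule
applies; the transition map being holomorphic, its complex Jacobian suffices. -/
theorem frame_eq {u : Fin n → ℂ} (hu : u ∈ (overlap e e').target) (i : Fin n) :
    (frame e u (Pi.single i 1) : Fin n → ℂ) =
      ∑ k, wd i (transition e e' k) u •
        (frame e' (transitionMap e e' u) (Pi.single k 1) : Fin n → ℂ) := by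
  have h1 := differentiableAt_transitionMap he he' hu
  have h2 := (mdifferentiable_of_mem_atlas (I := 𝓘(ℂ, Fin n → ℂ)) he').mdifferentiableAt_symm
    (transitionMap_mem hu)
  have h3 : e.symm =ᶠ[𝓝 u] e'.symm ∘ transitionMap e e' := by
    filter_upwards [(overlap e e').open_target.mem_nhds hu] with x hx
      using (symm_transitionMap hx).symm
  have h4 := (h2.hasMFDerivAt.comp u h1.mdifferentiableAt.hasMFDerivAt).congr_of_eventuallyEq h3
  have h5 : (frame e u (Pi.single i 1) : Fin n → ℂ) =
      (frame e' (transitionMap e e' u) (fderiv ℂ (transitionMap e e') u (Pi.single i 1)) :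
        Fin n → ℂ) := by
    have h6 := h4.mfderiv
    rw [mfderiv_eq_fderiv] at h6
    exact congrArg (fun L : (Fin n → ℂ) →L[ℂ] (Fin n → ℂ) => L (Pi.single i 1)) h6
  have h7 : fderiv ℂ (transitionMap e e') u (Pi.single i 1) =
      ∑ k, wd i (transition e e' k) u • (Pi.single k 1 : Fin n → ℂ) := by
    funext k
    rw [Finset.sum_apply]
    simp only [Pi.smul_apply, Pi.single_apply, smul_eq_mul, mul_ite, mul_one, mul_zero,
      Finset.sum_ite_eq, Finset.mem_univ, if_true]
    rw [wd_eq_fderiv (differentiableAt_transition he he' k hu)]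
    exact (congrArg (fun L : (Fin n → ℂ) →L[ℂ] ℂ => L (Pi.single i 1))
      (fderiv_apply h1 k)).symm
  rw [h5, h7]
  let L : (Fin n → ℂ) →L[ℂ] (Fin n → ℂ) := frame e' (transitionMap e e' u)
  exact (map_sum L _ _).trans (Finset.sum_congr rfl fun k _ => map_smul L _ _)

theorem KahlerMetric.coeff_transition (g : KahlerMetric n X) (i j : Fin n) {u : Fin n → ℂ}
    (hu : u ∈ (overlap e e').target) : g.coeff e i j u =
      ∑ k, ∑ l, g.coeff e' k l (transitionMap e e' u) * wd i (transition e e' k) u *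
        wdb j (transitionBar e e' l) u := by
  have hx : ∀ x y : X, x = y → ∀ v w : Fin n → ℂ, g.herm x v w = g.herm y v w := by
    rintro x _ rfl v w; rfl
  rw [g.coeff_eq he]
  refine (hx _ _ (symm_transitionMap hu).symm _ _).trans ?_
  let H : (Fin n → ℂ) →ₗ[ℂ] (Fin n → ℂ) →ₗ⋆[ℂ] ℂ := g.herm (e'.symm (transitionMap e e' u))
  let x : Fin n → Fin n → ℂ := fun k => frame e' (transitionMap e e' u) (Pi.single k 1)
  have e1 : frame e u (Pi.single i 1) = ∑ k, wd i (transition e e' k) u • x k :=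
    frame_eq he he' hu i
  have e2 : frame e u (Pi.single j 1) = ∑ k, wd j (transition e e' k) u • x k :=
    frame_eq he he' hu j
  have e3 : ∀ k l, g.coeff e' k l (transitionMap e e' u) = H (x k) (x l) := fun k l => rfl
  have e4 := (congrArg₂ (fun v w => H v w) e1 e2).trans (sesquilinear_sum_sum H _ _ x)
  simp only [e3, wdb_transitionBar he he' _ j hu]
  exact e4

end Holomorphic

/-! ### Covariance of the primitives. -/

section Fields

theorem sum_transform {R κ : Type*} [Ring R] [Fintype κ] {C : κ → R} {a : κ → κ → R} {x : κ → R} :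
    ∑ k, C k * ∑ i, a i k * x i = ∑ i, (∑ k, C k * a i k) * x i := by
  simp only [Finset.mul_sum, Finset.sum_mul, mul_assoc]
  exact Finset.sum_comm

theorem sum_transform₂ {R κ : Type*} [Ring R] [Fintype κ] {C a b : κ → κ → R} {x y : κ → R}
    (hb : ∀ j l i, b j l * x i = x i * b j l) :
    ∑ k, ∑ l, C k l * (∑ i, a i k * x i) * ∑ j, b j l * y j =
      ∑ i, ∑ j, (∑ k, ∑ l, C k l * a i k * b j l) * x i * y j := by
  have e1 : ∀ k l, C k l * (∑ i, a i k * x i) * ∑ j, b j l * y j =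
      ∑ i, ∑ j, C k l * a i k * b j l * x i * y j := fun k l => by
    rw [Finset.mul_sum (f := fun i => a i k * x i), Finset.sum_mul]
    refine Finset.sum_congr rfl fun i _ => ?_
    rw [Finset.mul_sum]
    refine Finset.sum_congr rfl fun j _ => ?_
    rw [mul_assoc (C k l * a i k), hb]
    simp only [mul_assoc]
  simp only [e1, Finset.sum_mul]
  have e2 : ∀ k, ∑ l, ∑ i, ∑ j, C k l * a i k * b j l * x i * y j =
      ∑ i, ∑ j, ∑ l, C k l * a i k * b j l * x i * y j := fun k =>
    Finset.sum_comm.trans (Finset.sum_congr rfl fun i _ => Finset.sum_comm)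
  simp only [e2]
  exact Finset.sum_comm.trans (Finset.sum_congr rfl fun i _ => Finset.sum_comm)

variable (h : IsLocalField Φ e F) (h' : IsLocalField Φ e' F')
  (hp : p ∈ chartDomain Φ (overlap e e'))

include he he' h h' hp

/-- Compatibility says that the coordinates of F' are the Taylor values of the transition functions
at F, so this is `tay_comp`. -/
theorem at_comp_transitionMap (hc : Compatible e e' F F' p) {f : (Fin n → ℂ) → ℂ}
    (hf : SmoothTarget e' f) : F'.at f p = F.at (fun u => f (transitionMap e e' u)) p := by
  have h0 : IsLocalField Φ (overlap e e') F := h.restrict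
  have hp' : p ∈ chartDomain Φ e' := (chartDomain_overlap.subset hp).2
  have hz : F'.point p = fun a => tay (fun x => zcoord a (transitionMap e e' x)) (F.point p) := by
    funext a
    rcases a with i | i
    · exact congrArg c0 ((hc.φ i).trans (h0.at_eq hp (smooth_transition he he' i)))
    · exact congrArg c0 ((hc.φb i).trans (h0.at_eq hp (smooth_transitionBar he he' i)))
  have hu := IsLocalField.target hp
  have hb := h0.bodyPt_point hp
  rw [h'.at_eq hp' hf, h0.at_eq hp (hf.comp_transitionMap he he'), hz, ← tay_comp (h0.isPt_point hp)]
  · rw [hb]; exact smoothNear_transitionMap he he' hu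
  · rw [hb]; exact hf _ (transitionMap_mem hu)

theorem at_sum_mul_transition {κ : Type*} [Fintype κ] {f a : κ → (Fin n → ℂ) → ℂ}
    {k : (Fin n → ℂ) → ℂ} (hc : Compatible e e' F F' p)
    (hf : ∀ i, SmoothTarget e' (f i)) (ha : ∀ i, SmoothTarget (overlap e e') (a i))
    (hk : ∀ u ∈ (overlap e e').target, k u = ∑ i, f i (transitionMap e e' u) * a i u) :
    F.at k p = ∑ i, F'.at (f i) p * F.at (a i) p := by
  have h0 : IsLocalField Φ (overlap e e') F := h.restrict
  have hs : ∀ i, SmoothTarget (overlap e e') fun u => f i (transitionMap e e' u) :=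
    fun i => (hf i).comp_transitionMap he he'
  have hfa : ∀ i, SmoothTarget (overlap e e') fun u => f i (transitionMap e e' u) * a i u :=
    fun i => (hs i).mul (ha i)
  rw [← h0.at_congr hp (.sum fun i _ => hfa i) fun u hu => (hk u hu).symm,
    h0.at_sum hp fun i _ => hfa i]
  exact Finset.sum_congr rfl fun i _ => by
    rw [h0.at_mul hp (hs i) (ha i), at_comp_transitionMap he he' h h' hp hc (hf i)]

theorem pairW_transition {W : X → ℂ} (hc : Compatible e e' F F' p) (hW : IsHolomorphicIn W e') :
    pairW W e' F' p = pairW W e F p := by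
  have h1 : ∀ i, F.at (wd i (localW W e)) p =
      ∑ k, F'.at (wd k (localW W e')) p * F.at (wd i (transition e e' k)) p := fun i =>
    at_sum_mul_transition he he' h h' hp hc (fun k => hW.smooth.wd k)
      (fun k => (smooth_transition he he' k).wd i) fun u hu => by
        rw [← wd_comp_transitionMap he he' hW.smooth i hu]
        exact SmoothTarget.wdir_congr (e := overlap e e')
          (fun v hv => (congrArg W (symm_transitionMap hv)).symm) (.inl i) hu
  simp only [pairW, h1, hc.ρ]
  exact sum_transform

theorem pairWBar_transition {W : X → ℂ} (hc : Compatible e e' F F' p) (hW : IsHolomorphicIn W e') :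
    pairWBar W e' F' p = pairWBar W e F p := by
  have h1 : ∀ i, F.at (wdb i (localWBar W e)) p =
      ∑ k, F'.at (wdb k (localWBar W e')) p * F.at (wdb i (transitionBar e e' k)) p := fun i =>
    at_sum_mul_transition he he' h h' hp hc (fun k => hW.smooth_bar.wdb k)
      (fun k => (smooth_transitionBar he he' k).wdb i) fun u hu => by
        rw [← wdb_comp_transitionMap he he' hW.smooth_bar i hu]
        exact SmoothTarget.wdir_congr (e := overlap e e')
          (fun v hv => congrArg (fun x => starRingEnd ℂ (W x)) (symm_transitionMap hv).symm)
          (.inr i) hu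
  simp only [pairWBar, h1, hc.θ]
  exact sum_transform

theorem at_coeff_transition (g : KahlerMetric n X) (hc : Compatible e e' F F' p) (i j : Fin n) :
    F.at (g.coeff e i j) p = ∑ k, ∑ l, F'.at (g.coeff e' k l) p *
      F.at (wd i (transition e e' k)) p * F.at (wdb j (transitionBar e e' l)) p := by
  have h0 : IsLocalField Φ (overlap e e') F := h.restrict
  have h1 := fun k => (smooth_transition he he' k).wd i
  have h2 := fun l => (smooth_transitionBar he he' l).wdb j
  rw [at_sum_mul_transition he he' h h' hp hc (κ := Fin n × Fin n)
    (f := fun k => g.coeff e' k.1 k.2)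
    (a := fun k u => wd i (transition e e' k.1) u * wdb j (transitionBar e e' k.2) u)
    (fun k => g.smooth_coeff he' k.1 k.2) (fun k => (h1 k.1).mul (h2 k.2)) fun u hu => by
      rw [g.coeff_transition he he' i j hu, Fintype.sum_prod_type]
      exact Finset.sum_congr rfl fun k _ => Finset.sum_congr rfl fun l _ => mul_assoc _ _ _,
    Fintype.sum_prod_type]
  exact Finset.sum_congr rfl fun k _ => Finset.sum_congr rfl fun l _ => by
    rw [h0.at_mul hp (h1 k) (h2 l), mul_assoc]

/-- The Jacobians produced by g, θ and G are inverse to each other in pairs. Their values at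
Grassmann points are even, so they can be moved past the odd fields without signs. -/
theorem pairTheta_transition (g : KahlerMetric n X) (hc : Compatible e e' F F' p) :
    pairTheta g e' F' p = pairTheta g e F p := by
  have h0 : IsLocalField Φ (overlap e e') F := h.restrict
  have h1 : ∀ i k, (F.at (wd i (transition e e' k)) p).Even := fun i k =>
    h0.at_even hp ((smooth_transition he he' k).wd i)
  have h2 := sum_transform₂ (C := fun l k => F'.at (g.coeff e' k l) p)
    (a := fun j l => F.at (wdb j (transitionBar e e' l)) p)
    (b := fun i k => F.at (wd i (transition e e' k)) p) (x := F.θ p) (y := F.G p)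
    fun i k j => (h1 i k).mul_eq _
  simp only [pairTheta, at_coeff_transition he he' h h' hp g hc, hc.θ, hc.G]
  refine (Finset.sum_comm.trans h2).trans (Finset.sum_comm.trans ?_)
  refine Finset.sum_congr rfl fun i _ => Finset.sum_congr rfl fun j _ => ?_
  refine congrArg (fun c => c * F.θ p j * F.G p i) (Finset.sum_comm.trans ?_)
  refine Finset.sum_congr rfl fun k _ => Finset.sum_congr rfl fun l _ => ?_
  rw [mul_assoc, mul_assoc, (h1 i k).mul_eq]

/-- Compatibility is needed on the whole overlap and not only at p, since dφ̄ has to be transformed.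
The conjugate transition functions are antiholomorphic, so dφ̄ transforms with the barred Jacobian
alone. -/
theorem pairRho_transition (g : KahlerMetric n X) (hΦ : ContinuousOn Φ disk)
    (hc : ∀ q ∈ chartDomain Φ (overlap e e'), Compatible e e' F F' q) :
    pairRho g e' F' p = pairRho g e F p := by
  have h0 : IsLocalField Φ (overlap e e') F := h.restrict
  have hD := isDiskOpen_chartDomain hΦ (overlap e e')
  have hs := smooth_transitionBar he he'
  have h1 : ∀ j l, (F.at (wdb j (transitionBar e e' l)) p).Even := fun j l =>
    h0.at_even hp ((hs l).wdb j)
  have h3 : ∀ l, SForm.star (deRham (fun q => F'.φb q l) p) =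
      ∑ j, F.at (wdb j (transitionBar e e' l)) p *
        SForm.star (deRham (fun q => F.φb q j) p) := fun l => by
    have h4 : ∀ k, F.at (wdir (.inl k) (transitionBar e e' l)) p = 0 := fun k =>
      h0.at_eq_zero hp ((hs l).wdir (.inl k)) fun u hu => wd_transitionBar he he' l k hu
    rw [deRham_congr hD (fun q hq => (hc q hq).φb l) hp, h0.deRham_at hD hp (hs l),
      Fintype.sum_sum_type]
    simp only [h4, zero_mul, Finset.sum_const_zero, zero_add, SForm.star_sum]
    refine Finset.sum_congr rfl fun j _ => ?_
    exact star_mul_of_mem_deg_zero ((h0.form_at hD ((hs l).wdb j)).mem_deg p hp) _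
  have h2 := sum_transform₂ (C := fun k l => F'.at (g.coeff e' k l) p)
    (a := fun i k => F.at (wd i (transition e e' k)) p)
    (b := fun j l => F.at (wdb j (transitionBar e e' l)) p) (x := F.ρ p)
    (y := fun j => SForm.star (deRham (fun q => F.φb q j) p)) fun i k j => (h1 i k).mul_eq _
  simp only [pairRho, at_coeff_transition he he' h h' hp g (hc p hp), (hc p hp).ρ, h3]
  exact h2

end Fields

end Covariance

/-! ### Gluing local expressions -/

section Glue

open MeasureTheory

variable {ι : Type*} {n : ℕ} {X : Type*} [TopologicalSpace X] [ChartedSpace (Fin n → ℂ) X]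
  {Λ : Type*} [NormedRing Λ] [NormedAlgebra ℂ Λ]
  {Φ : ℂ → X} {p : ℂ}

theorem isDiskOpen_disk : IsDiskOpen disk := ⟨subset_rfl, fun _ _ => self_mem_nhdsWithin⟩

theorem exp_mem_disk (σ : ℝ) : Complex.exp (σ * Complex.I) ∈ disk := by
  simp [disk, Complex.norm_exp_ofReal_mul_I]

namespace Patching

variable (P : Patching ι n X)

theorem mem_source_of_weight_ne_zero {a : ι} {x : X} (h : P.weight a x ≠ 0) :
    x ∈ (P.chart a).source := P.subordinate a (subset_tsupport _ h)

theorem glue_eq_sum (f : Coord n X → ℂ → Λ) (p : ℂ) : P.glue Φ f p =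
    ∑ a ∈ P.weight.finsupport (Φ p), ((P.weight a (Φ p) : ℝ) : ℂ) • f (P.chart a) p := by
  refine finsum_eq_sum_of_support_subset _ fun a ha => ?_
  rw [P.weight.coe_finsupport]
  intro h0
  refine ha ?_
  simp only [h0, Complex.ofReal_zero, zero_smul]

theorem glue_congr {f f' : Coord n X → ℂ → Λ}
    (h : ∀ a, Φ p ∈ (P.chart a).source → f (P.chart a) p = f' (P.chart a) p) :
    P.glue Φ f p = P.glue Φ f' p := by
  rw [glue_eq_sum, glue_eq_sum]
  refine Finset.sum_congr rfl fun a ha => ?_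
  rw [h a (P.mem_source_of_weight_ne_zero ((P.weight.mem_finsupport _).mp ha))]

theorem glue_const (p : ℂ) (y : Λ) : P.glue Φ (fun _ _ => y) p = y := by
  rw [glue_eq_sum, ← Finset.sum_smul, ← Complex.ofReal_sum,
    P.weight.sum_finsupport (Set.mem_univ _), Complex.ofReal_one, one_smul]

theorem glue_eq {f : Coord n X → ℂ → Λ} {y : Λ}
    (h : ∀ a, Φ p ∈ (P.chart a).source → f (P.chart a) p = y) : P.glue Φ f p = y :=
  (P.glue_congr (f' := fun _ _ => y) h).trans (P.glue_const p y)

theorem glue_add (f f' : Coord n X → ℂ → Λ) (p : ℂ) :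
    P.glue Φ (fun e q => f e q + f' e q) p = P.glue Φ f p + P.glue Φ f' p := by
  simp only [glue_eq_sum, smul_add, Finset.sum_add_distrib]

/-- The weights sum to one. Only the increment has to be independent of the chart, not the
expressions f and f'. -/
theorem glue_eq_add {f f' : Coord n X → ℂ → Λ} {z : Λ}
    (h : ∀ a, Φ p ∈ (P.chart a).source → f' (P.chart a) p = f (P.chart a) p + z) :
    P.glue Φ f' p = P.glue Φ f p + z := by
  rw [P.glue_congr (f' := fun e q => f e q + (fun _ _ => z : Coord n X → ℂ → Λ) e q) h,
    glue_add, glue_const]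

/-- Near a point finitely many weights matter. A chart not containing the point contributes zero
nearby because its weight is supported in its domain, whatever the values of f there. -/
theorem continuousOn_glue (hΦ : ContinuousOn Φ disk) {f : Coord n X → ℂ → Λ}
    (hf : ∀ e ∈ atlas (Fin n → ℂ) X, ContinuousOn (f e) (chartDomain Φ e)) :
    ContinuousOn (P.glue Φ f) disk := by
  intro p hp
  obtain ⟨I, -, hI⟩ := P.weight.exists_finset_nhds' (Φ p)
  have h1 : ∀ᶠ q in 𝓝[disk] p, P.glue Φ f q =
      ∑ a ∈ I, ((P.weight a (Φ q) : ℝ) : ℂ) • f (P.chart a) q := by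
    filter_upwards [(hΦ p hp).eventually hI] with q hq
    refine finsum_eq_sum_of_support_subset _ fun a ha => hq ?_
    intro h0
    refine ha ?_
    simp only [h0, Complex.ofReal_zero, zero_smul]
  refine ContinuousWithinAt.congr_of_eventuallyEq ?_ h1 (h1.self_of_nhdsWithin hp)
  refine tendsto_finsetSum _ fun a _ => ?_
  by_cases ha : Φ p ∈ (P.chart a).source
  · have hD := isDiskOpen_chartDomain hΦ (P.chart a)
    have h2 : ContinuousWithinAt (f (P.chart a)) disk p :=
      (hf _ (P.chart_mem a) p ⟨hp, ha⟩).mono_of_mem_nhdsWithin (hD.mem_nhdsWithin p ⟨hp, ha⟩)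
    exact (Complex.continuous_ofReal.continuousAt.comp_continuousWithinAt
      ((P.weight a).continuous.continuousAt.comp_continuousWithinAt (hΦ p hp))).smul h2
  · have h2 : ∀ᶠ x in 𝓝 (Φ p), x ∉ tsupport (P.weight a) :=
      (isClosed_tsupport _).isOpen_compl.mem_nhds fun h => ha (P.subordinate a h)
    have h3 : ∀ᶠ q in 𝓝[disk] p, ((P.weight a (Φ q) : ℝ) : ℂ) • f (P.chart a) q = 0 := by
      filter_upwards [(hΦ p hp).eventually h2] with q hq
      rw [image_eq_zero_of_notMem_tsupport hq, Complex.ofReal_zero, zero_smul]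
    rw [h3.self_of_nhdsWithin hp]
    exact tendsto_const_nhds.congr' (h3.mono fun q hq => hq.symm)

/-- Local expressions which agree on overlaps. -/
structure Consistent (Φ : ℂ → X) (f : Coord n X → ℂ → Λ) : Prop where
  smooth : ∀ e ∈ atlas (Fin n → ℂ) X, DiskSmoothOn (chartDomain Φ e) (f e)
  eq : ∀ e ∈ atlas (Fin n → ℂ) X, ∀ e' ∈ atlas (Fin n → ℂ) X, ∀ p ∈ chartDomain Φ e,
    p ∈ chartDomain Φ e' → f e' p = f e p

theorem Consistent.glue_eq {f : Coord n X → ℂ → Λ} (h : Consistent Φ f) {e : Coord n X}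
    (he : e ∈ atlas (Fin n → ℂ) X) (hp : p ∈ chartDomain Φ e) : P.glue Φ f p = f e p :=
  P.glue_eq fun a ha => h.eq e he _ (P.chart_mem a) p hp ⟨hp.1, ha⟩

/-- The weights are merely continuous, but for consistent expressions the glued function coincides
with a single local one near each point. -/
theorem Consistent.smooth_glue {f : Coord n X → ℂ → Λ} (h : Consistent Φ f)
    (hΦ : ContinuousOn Φ disk) : DiskSmoothOn disk (P.glue Φ f) := by
  intro p hp
  obtain ⟨a, ha⟩ := P.weight.exists_pos (Set.mem_univ (Φ p))
  have hpa : p ∈ chartDomain Φ (P.chart a) := ⟨hp, P.mem_source_of_weight_ne_zero ha.ne'⟩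
  exact (h.smooth _ (P.chart_mem a)).congr (isDiskOpen_chartDomain hΦ _)
    (fun q hq => h.glue_eq P (P.chart_mem a) hq) p hpa

theorem integral_glue_eq_add [CompleteSpace Λ] (hΦ : ContinuousOn Φ disk)
    {f f' : Coord n X → ℂ → Λ} {z : ℂ → Λ} (ε : Λ)
    (hf : ∀ e ∈ atlas (Fin n → ℂ) X, ContinuousOn (f e) (chartDomain Φ e))
    (hz : ContinuousOn z disk)
    (h : ∀ e ∈ atlas (Fin n → ℂ) X, ∀ p ∈ chartDomain Φ e, f' e p = f e p + ε * z p) :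
    ∫ p in disk, P.glue Φ f' p = (∫ p in disk, P.glue Φ f p) + ε * ∫ p in disk, z p := by
  have hm : MeasurableSet disk := Metric.isClosed_closedBall.measurableSet
  have hc : IsCompact disk := isCompact_closedBall 0 1
  have i1 : IntegrableOn (P.glue Φ f) disk :=
    (P.continuousOn_glue hΦ hf).integrableOn_compact hc
  have i2 : IntegrableOn z disk := hz.integrableOn_compact hc
  have h1 : ∀ p ∈ disk, P.glue Φ f' p = P.glue Φ f p + ε * z p := fun p hp =>
    P.glue_eq_add fun a ha => h _ (P.chart_mem a) p ⟨hp, ha⟩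
  have i3 : IntegrableOn (fun p => ε * z p) disk := i2.const_mul' ε
  rw [setIntegral_congr_fun hm h1, integral_add i1 i3]
  congr 1
  exact (ContinuousLinearMap.mul ℂ Λ ε).integral_comp_comm i2

theorem circle_integral_glue_eq_add [CompleteSpace Λ] (hΦ : ContinuousOn Φ disk)
    {f f' : Coord n X → ℂ → Λ} {z : ℂ → Λ} (ε : Λ)
    (hf : ∀ e ∈ atlas (Fin n → ℂ) X, ContinuousOn (f e) (chartDomain Φ e))
    (hz : ContinuousOn z disk)
    (h : ∀ e ∈ atlas (Fin n → ℂ) X, ∀ p ∈ chartDomain Φ e, f' e p = f e p + ε * z p) :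
    ∫ σ in (0 : ℝ)..(2 * Real.pi), P.glue Φ f' (Complex.exp (σ * Complex.I)) =
      (∫ σ in (0 : ℝ)..(2 * Real.pi), P.glue Φ f (Complex.exp (σ * Complex.I))) +
        ε * ∫ σ in (0 : ℝ)..(2 * Real.pi), z (Complex.exp (σ * Complex.I)) := by
  have hexp : Continuous fun σ : ℝ => Complex.exp (σ * Complex.I) := by fun_prop
  have i1 : Continuous fun σ : ℝ => P.glue Φ f (Complex.exp (σ * Complex.I)) :=
    (P.continuousOn_glue hΦ hf).comp_continuous hexp exp_mem_disk
  have i2 : Continuous fun σ : ℝ => z (Complex.exp (σ * Complex.I)) :=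
    hz.comp_continuous hexp exp_mem_disk
  have h1 : ∀ p ∈ disk, P.glue Φ f' p = P.glue Φ f p + ε * z p := fun p hp =>
    P.glue_eq_add fun a ha => h _ (P.chart_mem a) p ⟨hp, ha⟩
  have i3 : Continuous fun σ : ℝ => ε * z (Complex.exp (σ * Complex.I)) := continuous_const.mul i2
  rw [intervalIntegral.integral_congr fun σ _ => h1 _ (exp_mem_disk σ),
    intervalIntegral.integral_add (i1.intervalIntegrable _ _) (i3.intervalIntegrable _ _)]
  congr 1
  exact (ContinuousLinearMap.mul ℂ Λ ε).intervalIntegral_comp_comm (i2.intervalIntegrable _ _)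

end Patching

/-- The integral over the disk of the derivative along the rotation field vanishes. -/
theorem integral_pd_rotation [CompleteSpace Λ] {y : ℂ → Λ} (hy : DiskSmoothOn disk y) :
    ∫ p in disk, pd (Complex.I * p) y p = 0 := by
  have hr : ∀ {r : ℂ →L[ℝ] ℝ}, DiskSmoothOn disk fun p => r p • y p := fun {r} =>
    hy.real_smul r.contDiff
  have hpd : ∀ (r : ℂ →L[ℝ] ℝ) (v : ℂ), ∀ p ∈ disk,
      pd v (fun p => r p • y p) p = r v • y p + r p • pd v y p := fun r v p hp => by
    have h1 := r.hasFDerivWithinAt (s := disk) (x := p) |>.smul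
      (hy.differentiableWithinAt hp).hasFDerivWithinAt
    refine (congrArg (fun M : ℂ →L[ℝ] Λ => M v)
      (h1.fderivWithin (uniqueDiffOn_disk p hp))).trans ?_
    simp [pd, add_comm]
  -- With b = -x¹y and c = -x²y the curl is -x²∂₁y + x¹∂₂y, the derivative along v₀. The boundary
  -- integrand is a multiple of sin σ cos σ - cos σ sin σ = 0, since v₀ is tangent to the circle.
  have h := integral_disk_curl (hr (r := -Complex.reCLM)) (hr (r := -Complex.imCLM))
  have h1 : ∀ p ∈ disk, pd (Complex.I * p) y p =
      pd 1 (fun p => (-Complex.imCLM) p • y p) p -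
        pd Complex.I (fun p => (-Complex.reCLM) p • y p) p := fun p hp => by
    rw [hpd _ _ p hp, hpd _ _ p hp]
    have e1 : Complex.I * p = (-p.im) • (1 : ℂ) + p.re • Complex.I := by
      apply Complex.ext <;> simp
    unfold pd
    rw [e1, map_add, map_smul, map_smul]
    simp
  have hm : MeasurableSet disk := Metric.isClosed_closedBall.measurableSet
  rw [setIntegral_congr_fun hm h1, h]
  refine (intervalIntegral.integral_congr (g := fun _ => 0) fun σ _ => ?_).trans (by simp)
  simp only [neg_apply, Complex.reCLM_apply, Complex.imCLM_apply,
    Complex.exp_ofReal_mul_I_re, Complex.exp_ofReal_mul_I_im, smul_smul, ← add_smul]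
  rw [show -Real.sin σ * -Real.cos σ + Real.cos σ * -Real.sin σ = 0 by ring, zero_smul]

end Glue

/-! ### The variation of the action -/

section Action

open SForm MeasureTheory

theorem deg_zero_c0_lie {Λ : Type*} [NormedRing Λ] [NormedAlgebra ℂ Λ] [FiniteDimensional ℂ Λ]
    [GrassmannAlgebra Λ] {D : Set ℂ} (hD : IsDiskOpen D) {f : ℂ → SForm Λ} {s : ℂ} {p : ℂ}
    (hf : IsForm D 0 s f) (hp : p ∈ D) :
    (lie f p).c0 = pd (Complex.I * p) (fun q => (f q).c0) p := by
  have h1 : pd (Complex.I * p) (fun q => (f q).c0) p = (pd (Complex.I * p) f p).c0 :=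
    pd_lm_comp hD c0L hf.smooth hp _
  rw [TypeBModel.lie_eq hD hf.smooth hp, h1, c0_add]
  simp [lieFrame, dx1, dx2]

/-- The area form is invariant under rotations, so the coframe contributes nothing and L acts on the
coefficient as a directional derivative. -/
theorem deg_two_c12_lie {Λ : Type*} [NormedRing Λ] [NormedAlgebra ℂ Λ] [FiniteDimensional ℂ Λ]
    [GrassmannAlgebra Λ] {D : Set ℂ} (hD : IsDiskOpen D) {f : ℂ → SForm Λ} {s : ℂ} {p : ℂ}
    (hf : IsForm D 2 s f) (hp : p ∈ D) :
    (lie f p).c12 = pd (Complex.I * p) (fun q => (f q).c12) p := by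
  have h1 : pd (Complex.I * p) (fun q => (f q).c12) p = (pd (Complex.I * p) f p).c12 :=
    pd_lm_comp hD c12L hf.smooth hp _
  rw [TypeBModel.lie_eq hD hf.smooth hp, h1, c12_add]
  simp [lieFrame, dx1, dx2, SForm.iota]

theorem c12_deRham {Λ : Type*} [NormedRing Λ] [NormedAlgebra ℂ Λ] [FiniteDimensional ℂ Λ]
    [GrassmannAlgebra Λ] {D : Set ℂ} (hD : IsDiskOpen D) {f : ℂ → SForm Λ} {p : ℂ}
    (hf : DiskSmoothOn D f) (hp : p ∈ D) :
    (deRham f p).c12 = pd 1 (fun q => (f q).c2) p - pd Complex.I (fun q => (f q).c1) p := by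
  have h1 : pd 1 (fun q => (f q).c2) p = (pd 1 f p).c2 := pd_lm_comp hD c2L hf hp _
  have h2 : pd Complex.I (fun q => (f q).c1) p = (pd Complex.I f p).c1 := pd_lm_comp hD c1L hf hp _
  rw [h1, h2, deRham_apply]
  simp [dx1, dx2, sub_eq_add_neg]

variable {ι : Type*} {n : ℕ} {X : Type*} [TopologicalSpace X] [ChartedSpace (Fin n → ℂ) X]
  [IsManifold 𝓘(ℂ, Fin n → ℂ) ω X]
  {Λ : Type*} [NormedRing Λ] [NormedAlgebra ℂ Λ] [FiniteDimensional ℂ Λ] [GrassmannAlgebra Λ]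
  {Φ : ℂ → X} {F : Coord n X → LocalFields n Λ}

namespace IsFieldConfiguration

variable (hF : IsFieldConfiguration Φ F)
include hF

theorem isDiskOpen (e : Coord n X) : IsDiskOpen (chartDomain Φ e) :=
  isDiskOpen_chartDomain hF.continuousOn e

theorem consistent {f : Coord n X → ℂ → SForm Λ} (L : SForm Λ →ₗ[ℂ] Λ)
    (hs : ∀ e ∈ atlas (Fin n → ℂ) X, DiskSmoothOn (chartDomain Φ e) (f e))
    (h : ∀ e ∈ atlas (Fin n → ℂ) X, ∀ e' ∈ atlas (Fin n → ℂ) X,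
      ∀ p ∈ chartDomain Φ (overlap e e'), f e' p = f e p) :
    Patching.Consistent Φ fun e p => L (f e p) where
  smooth e he := (hs e he).lm_comp L
  eq e he e' he' p hp hp' :=
    congrArg L (h e he e' he' p (chartDomain_overlap.superset ⟨hp, hp'⟩))

theorem compatible_overlap {e e' : Coord n X} (he : e ∈ atlas (Fin n → ℂ) X)
    (he' : e' ∈ atlas (Fin n → ℂ) X) :
    ∀ p ∈ chartDomain Φ (overlap e e'), Compatible e e' (F e) (F e') p := fun p hp =>
  hF.compatible e he e' he' p (chartDomain_overlap.subset hp)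

theorem consistent_pair (g : KahlerMetric n X) : Patching.Consistent Φ fun e p =>
    (-pairRho g e (F e) p + pairTheta g e (F e) p).c12 :=
  hF.consistent c12L (fun e he => ((hF.isLocalField e he).form_pair g he (hF.isDiskOpen e)).smooth)
    fun e he e' he' p hp => by
      have hc := hF.compatible_overlap he he'
      rw [pairRho_transition he he' (hF.isLocalField e he) (hF.isLocalField e' he') hp g
        hF.continuousOn hc, pairTheta_transition he he' (hF.isLocalField e he)
        (hF.isLocalField e' he') hp g (hc p hp)]

variable (ħ : ℂ) (g : KahlerMetric n X) {W : X → ℂ}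
  (hW : MDifferentiable 𝓘(ℂ, Fin n → ℂ) 𝓘(ℂ) W) {ε : Λ} (hε : IsOdd ε) (P : Patching ι n X)

theorem consistent_pairWBar (hW : MDifferentiable 𝓘(ℂ, Fin n → ℂ) 𝓘(ℂ) W) :
    Patching.Consistent Φ fun e p => (pairWBar W e (F e) p).c0 :=
  hF.consistent c0L (fun e he => ((hF.isLocalField e he).form_pairWBar (hF.isDiskOpen e)
      (isHolomorphicIn_of_mdifferentiable hW he)).smooth)
    fun e he e' he' p hp => pairWBar_transition he he' (hF.isLocalField e he)
      (hF.isLocalField e' he') hp (hF.compatible_overlap he he' p hp)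
      (isHolomorphicIn_of_mdifferentiable hW he')

theorem consistent_pairW (hW : MDifferentiable 𝓘(ℂ, Fin n → ℂ) 𝓘(ℂ) W) (L : SForm Λ →ₗ[ℂ] Λ) :
    Patching.Consistent Φ fun e p => L (pairW W e (F e) p) :=
  hF.consistent L (fun e he => ((hF.isLocalField e he).form_pairW (hF.isDiskOpen e)
      (isHolomorphicIn_of_mdifferentiable hW he)).smooth)
    fun e he e' he' p hp => pairW_transition he he' (hF.isLocalField e he)
      (hF.isLocalField e' he') hp (hF.compatible_overlap he he' p hp)
      (isHolomorphicIn_of_mdifferentiable hW he')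

/-- Expressions which vary by a Lie derivative have an invariant integral. -/
theorem integral_glue_eq_of_rotation {f f' y : Coord n X → ℂ → Λ} (ε : Λ)
    (hf : ∀ e ∈ atlas (Fin n → ℂ) X, ContinuousOn (f e) (chartDomain Φ e))
    (hy : Patching.Consistent Φ y)
    (h : ∀ e ∈ atlas (Fin n → ℂ) X, ∀ p ∈ chartDomain Φ e,
      f' e p = f e p + ε * (ħ • pd (Complex.I * p) (y e) p)) :
    ∫ p in disk, P.glue Φ f' p = ∫ p in disk, P.glue Φ f p := by
  have : CompleteSpace Λ := FiniteDimensional.complete ℂ Λ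
  have hs := hy.smooth_glue P hF.continuousOn
  have hz : ContinuousOn (fun p => ħ • pd (Complex.I * p) (P.glue Φ y) p) disk := by
    have h1 : ∀ p : ℂ, pd (Complex.I * p) (P.glue Φ y) p =
        (-p.im) • pd 1 (P.glue Φ y) p + p.re • pd Complex.I (P.glue Φ y) p := fun p => by
      have e1 : Complex.I * p = (-p.im) • (1 : ℂ) + p.re • Complex.I := by
        apply Complex.ext <;> simp
      unfold pd
      rw [e1, map_add, map_smul, map_smul]
    simp only [h1]
    have h2 : ∀ v, ContinuousOn (pd v (P.glue Φ y)) disk := fun v =>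
      (hs.pd isDiskOpen_disk v).continuousOn isDiskOpen_disk
    exact ((Complex.continuous_im.neg.continuousOn.smul (h2 1)).add
      (Complex.continuous_re.continuousOn.smul (h2 Complex.I))).const_smul ħ
  rw [P.integral_glue_eq_add hF.continuousOn ε hf hz fun e he p hp => ?_, integral_smul,
    integral_pd_rotation hs, smul_zero, mul_zero, add_zero]
  rw [h e he p hp, pd_congr (hF.isDiskOpen e) (fun q hq => hy.glue_eq P he hq) hp]

/-! ### The variation of each integral. -/

section Variation

include hε

theorem integral_lagrangianKin :
    ∫ p in disk, P.glue Φ (fun e q => (lagrangianKin ħ g e (brstShift ħ g e ε (F e)) q).c12) p =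
      ∫ p in disk, P.glue Φ (fun e q => (lagrangianKin ħ g e (F e) q).c12) p := by
  have hv := fun e he => (hF.isLocalField e he).variation_lagrangianKin ħ g he (hF.isDiskOpen e) hε
  refine hF.integral_glue_eq_of_rotation ħ P ε
    (fun e he => ((hv e he).smooth₁.lm_comp c12L).continuousOn (hF.isDiskOpen e))
    (hF.consistent_pair g) fun e he p hp => ?_
  rw [(hv e he).eq₁ p hp, ← deg_two_c12_lie (hF.isDiskOpen e)
    ((hF.isLocalField e he).form_pair g he (hF.isDiskOpen e)) hp]
  simp

include hW

theorem integral_lagrangianWBar :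
    ∫ p in disk, P.glue Φ (fun e q => (lagrangianWBar g W e (brstShift ħ g e ε (F e)) q).c0) p =
      ∫ p in disk, P.glue Φ (fun e q => (lagrangianWBar g W e (F e) q).c0) p := by
  have hv := fun e he => (hF.isLocalField e he).variation_lagrangianWBar ħ g he (hF.isDiskOpen e)
    (isHolomorphicIn_of_mdifferentiable hW he) hε
  refine hF.integral_glue_eq_of_rotation ħ P ε
    (fun e he => ((hv e he).smooth₁.lm_comp c0L).continuousOn (hF.isDiskOpen e))
    (hF.consistent_pairWBar hW) fun e he p hp => ?_
  rw [(hv e he).eq₁ p hp, ← deg_zero_c0_lie (hF.isDiskOpen e)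
    ((hF.isLocalField e he).form_pairWBar (hF.isDiskOpen e)
      (isHolomorphicIn_of_mdifferentiable hW he)) hp]
  simp

omit hε in
-- At exp(iσ) the rotation field has components (-sin σ, cos σ). This brings the boundary integral
-- into the shape produced by `integral_disk_curl`.
theorem boundaryRhoDW_eq : boundaryRhoDW W P Φ F = ∫ σ in (0 : ℝ)..(2 * Real.pi),
    ((-Real.sin σ) • P.glue Φ (fun e q => (pairW W e (F e) q).c1) (Complex.exp (σ * Complex.I)) +
      Real.cos σ • P.glue Φ (fun e q => (pairW W e (F e) q).c2) (Complex.exp (σ * Complex.I))) := by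
  refine intervalIntegral.integral_congr fun σ _ => P.glue_eq fun a ha => ?_
  set p := Complex.exp (σ * Complex.I) with hp
  have he := P.chart_mem a
  have hpa : p ∈ chartDomain Φ (P.chart a) := ⟨exp_mem_disk σ, ha⟩
  have h := hF.isLocalField _ he
  have hw := isHolomorphicIn_of_mdifferentiable hW he
  have e0 : ∑ i, (F (P.chart a)).ρ p i * (F (P.chart a)).at (wd i (localW W (P.chart a))) p =
      pairW W (P.chart a) (F (P.chart a)) p := Finset.sum_congr rfl fun i _ =>
    ((h.at_even hpa (hw.smooth.wd i)).mul_eq _).symm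
  have e1 := (hF.consistent_pairW hW c1L).glue_eq P he hpa
  have e2 := (hF.consistent_pairW hW c2L).glue_eq P he hpa
  change _ = (-Real.sin σ) • P.glue Φ (fun e q => c1L (pairW W e (F e) q)) p +
    Real.cos σ • P.glue Φ (fun e q => c2L (pairW W e (F e) q)) p
  rw [e0, e1, e2]
  have r1 : p.re = Real.cos σ := Complex.exp_ofReal_mul_I_re σ
  have r2 : p.im = Real.sin σ := Complex.exp_ofReal_mul_I_im σ
  simp only [SForm.iota, c0_mk, r1, r2, ← Complex.ofReal_neg, Complex.coe_smul]
  rfl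

theorem integral_lagrangianW (hħ : ħ ≠ 0) :
    ∫ p in disk, P.glue Φ (fun e q => (lagrangianW g W e (brstShift ħ g e ε (F e)) q).c12) p =
      (∫ p in disk, P.glue Φ (fun e q => (lagrangianW g W e (F e) q).c12) p) +
        ε * boundaryRhoDW W P Φ F := by
  have : CompleteSpace Λ := FiniteDimensional.complete ℂ Λ
  have hw := fun e (he : e ∈ atlas (Fin n → ℂ) X) => isHolomorphicIn_of_mdifferentiable hW he
  have k1 := hF.consistent_pairW hW c1L
  have k2 := hF.consistent_pairW hW c2L
  have s1 := k1.smooth_glue P hF.continuousOn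
  have s2 := k2.smooth_glue P hF.continuousOn
  have hz := (((s2.pd isDiskOpen_disk 1).sub (s1.pd isDiskOpen_disk Complex.I)).continuousOn
    isDiskOpen_disk)
  rw [hF.boundaryRhoDW_eq hW P]
  refine (P.integral_glue_eq_add hF.continuousOn ε (fun e he => ?_) hz fun e he p hp => ?_).trans
    (congrArg (fun x => _ + ε * x) (integral_disk_curl s1 s2))
  · exact (((hF.isLocalField e he).form_lagrangianW g he (hF.isDiskOpen e)
      (hw e he)).smooth.lm_comp c12L).continuousOn (hF.isDiskOpen e)
  · rw [(hF.isLocalField e he).lagrangianW_brstShift ħ g he (hF.isDiskOpen e) (hw e he) hε hħ hp,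
      pd_congr (hF.isDiskOpen e) (fun q hq => k1.glue_eq P he hq) hp,
      pd_congr (hF.isDiskOpen e) (fun q hq => k2.glue_eq P he hq) hp]
    have h1 := c12_deRham (hF.isDiskOpen e)
      ((hF.isLocalField e he).form_pairW (hF.isDiskOpen e) (hw e he)).smooth hp
    have h2 : (of ε * deRham (pairW W e (F e)) p).c12 =
      ε * (deRham (pairW W e (F e)) p).c12 := by simp
    rw [c12_add, h2, h1]
    rfl

theorem bulkAction_brstShift (hħ : ħ ≠ 0) :
    bulkAction ħ g W P Φ (fun e => brstShift ħ g e ε (F e)) =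
      bulkAction ħ g W P Φ F + ε * boundaryRhoDW W P Φ F := by
  rw [bulkAction, hF.integral_lagrangianKin ħ g hε P, hF.integral_lagrangianWBar ħ g hW hε P,
    hF.integral_lagrangianW ħ g hW hε P hħ, bulkAction, add_assoc, add_assoc, add_assoc]

/-- On functions δW = ħ ι(∂W ρ), so the prefactor 1/ħ cancels and the bulk boundary term reappears
with the opposite sign. -/
theorem boundaryAction_brstShift (hħ : ħ ≠ 0) :
    boundaryAction ħ W P Φ (fun e => brstShift ħ g e ε (F e)) =
      boundaryAction ħ W P Φ F - ε * boundaryRhoDW W P Φ F := by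
  have : CompleteSpace Λ := FiniteDimensional.complete ℂ Λ
  have hw := fun e (he : e ∈ atlas (Fin n → ℂ) X) => isHolomorphicIn_of_mdifferentiable hW he
  have k1 := hF.consistent_pairW hW c1L
  have k2 := hF.consistent_pairW hW c2L
  have s1 := k1.smooth_glue P hF.continuousOn
  have s2 := k2.smooth_glue P hF.continuousOn
  have hz : ContinuousOn (fun p : ℂ => ħ • ((-p.im) • P.glue Φ (fun e q => c1L (pairW W e (F e) q)) p +
      p.re • P.glue Φ (fun e q => c2L (pairW W e (F e) q)) p)) disk :=
    ((Complex.continuous_im.neg.continuousOn.smul (s1.continuousOn isDiskOpen_disk)).add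
      (Complex.continuous_re.continuousOn.smul (s2.continuousOn isDiskOpen_disk))).const_smul ħ
  have key := P.circle_integral_glue_eq_add hF.continuousOn ε
    (f := fun e q => ((F e).at (localW W e) q).c0)
    (f' := fun e q => ((brstShift ħ g e ε (F e)).at (localW W e) q).c0)
    (fun e he => (((hF.isLocalField e he).smooth_at (hF.isDiskOpen e)
      (hw e he).smooth).lm_comp c0L).continuousOn (hF.isDiskOpen e)) hz fun e he p hp => by
    rw [(hF.isLocalField e he).at_localW_brstShift ħ g he (hF.isDiskOpen e) (hw e he) hε hp,
      k1.glue_eq P he hp, k2.glue_eq P he hp]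
    simp only [c0_add, c0_mul, c0_of, c0_smul, SForm.iota, c0_mk, ← Complex.ofReal_neg,
      Complex.coe_smul]
    rfl
  rw [boundaryAction, key, boundaryAction, intervalIntegral.integral_smul, mul_smul_comm, smul_add,
    smul_smul, one_div_mul_cancel hħ, one_smul, neg_add, ← sub_eq_add_neg,
    hF.boundaryRhoDW_eq hW P]
  simp only [Complex.exp_ofReal_mul_I_re, Complex.exp_ofReal_mul_I_im]
  rfl

end Variation

end IsFieldConfiguration

end Action

end TypeBModel

end

/-- The square of δ is expressed with the same odd parameter as the variations: δ evaluated at the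
varied fields is δ at the original ones plus ε times δ². -/
theorem mainTheorem3 (n : ℕ) (X : Type*) [TopologicalSpace X] [ChartedSpace (Fin n → ℂ) X]
    [IsManifold 𝓘(ℂ, Fin n → ℂ) ω X]
    (g : TypeBModel.KahlerMetric n X)
    (W : X → ℂ) (hW : MDifferentiable 𝓘(ℂ, Fin n → ℂ) 𝓘(ℂ) W)
    (ħ : ℂ) (hħ : ħ ≠ 0)
    (Λ : Type*) [NormedRing Λ] [NormedAlgebra ℂ Λ] [FiniteDimensional ℂ Λ]
    [TypeBModel.GrassmannAlgebra Λ]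
    (Φ : ℂ → X) (F : TypeBModel.Coord n X → TypeBModel.LocalFields n Λ)
    (hF : TypeBModel.IsFieldConfiguration Φ F)
    (ε : Λ) (hε : TypeBModel.IsOdd ε)
    (ι : Type*) (P : TypeBModel.Patching ι n X) :
    let F' : TypeBModel.Coord n X → TypeBModel.LocalFields n Λ :=
      fun e => (F e).shift ε (TypeBModel.brst ħ g e (F e))
    (∀ e ∈ atlas (Fin n → ℂ) X, ∀ p ∈ TypeBModel.chartDomain Φ e,
      (TypeBModel.brst ħ g e (F' e)).AgreeAt
        ((TypeBModel.brst ħ g e (F e)).shift ε ((F e).lie ħ)) p) ∧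
    TypeBModel.bulkAction ħ g W P Φ F' =
      TypeBModel.bulkAction ħ g W P Φ F + ε * TypeBModel.boundaryRhoDW W P Φ F ∧
    TypeBModel.boundaryAction ħ W P Φ F' =
      TypeBModel.boundaryAction ħ W P Φ F - ε * TypeBModel.boundaryRhoDW W P Φ F ∧
    TypeBModel.action ħ g W P Φ F' = TypeBModel.action ħ g W P Φ F := by
  intro F'
  have h2 := hF.bulkAction_brstShift ħ g hW hε P hħ
  have h3 := hF.boundaryAction_brstShift ħ g hW hε P hħ
  refine ⟨fun e he p hp =>
    (hF.isLocalField e he).brst_brst ħ g he (hF.isDiskOpen e) hε p hp, h2, h3, ?_⟩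
  exact (congrArg₂ (· + ·) h2 h3).trans (add_add_sub_cancel _ _ _)
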